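/- Let $m,N\ge 0$, $n\ge 1$ and $\ell>1$ be integers. Let $\Lambda_N$ be the real Grassmann algebra with $N$ generators, $\Lambda_N^{(ev)}$, $\Lambda_N^{(odd)}$ its even and odd parts and $\Lambda_N^+$ the ideal of elements with zero body. Let $\mathcal C_{m,2n}$ be the real algebra generated by $e_1,\dots,e_m,\grave e_1,\dots,\grave e_{2n}$ subject to $$e_je_k+e_ke_j=-2\delta_{jk},\qquad e_j\grave e_k+\grave e_ke_j=0,\qquad \grave e_j\grave e_k-\grave e_k\grave e_j=g_{jk},$$ where $g_{2j-1,2k}=-g_{2k,2j-1}=\delta_{jk}$ and the other $g$'s vanish, i.e. $(g_{jk})=\Omega_{2n}=\mathrm{diag}\left(\begin{smallmatrix}0&1\\-1&0\end{smallmatrix}\right)$. Extended superbivectors are the elements of $\Lambda_N\otimes\mathcal C_{m,2n}$ of the form $$B=\sum_{j<k}b_{jk}e_je_k+\sum_{j,k}\grave b_{jk}e_j\grave e_k+\sum_{j\le k}B_{jk}\tfrac12(\grave e_j\grave e_k+\grave e_k\grave e_j),\qquad b_{jk},B_{jk}\in\Lambda_N^{(ev)},\ \grave b_{jk}\in\Lambda_N^{(odd)}.$$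 Let $\mathrm{Mat}(m|2n)(\Lambda_N)$ be the set of supermatrices $M=\left(\begin{smallmatrix}A&\grave B\\ \grave C&D\end{smallmatrix}\right)$ ($A,D$ with even entries and $\grave B,\grave C$ with odd entries), $M^{ST}=\left(\begin{smallmatrix}A^T&\grave C^T\\-\grave B^T&D^T\end{smallmatrix}\right)$, $\mathbf Q=\left(\begin{smallmatrix}I_m&0\\0&-\frac12\Omega_{2n}\end{smallmatrix}\right)$, $\mathrm{SO}_0=\{M: M^{ST}\mathbf QM=\mathbf Q,\ \mathrm{sdet}\,M=1\}$ and $\mathfrak{so}_0=\{X: X^{ST}\mathbf Q+\mathbf QX=0\}$, where $\mathrm{sdet}$ is the Berezinian. Consider $\ell$ supervector variables $\mathbf x=\sum_j x_je_j+\sum_j\grave x_j\grave e_j$, the $x_j$ being commuting variables and the $\grave x_j$ variables anticommuting with each other and with the generators of $\Lambda_N$; all of these commute with $\mathcal C_{m,2n}$. Supermatrices act on the coordinates of $\mathbf x$ from the left. For an extended superbivector $B$ let $\phi(B)$ be the supermatrix with $\phi(B)\mathbf x=[B,\mathbf x]$ for all $\mathbf x$, and put $$\Xi_1=\phi^{-1}\big(\mathfrak{so}(m)\times[\mathfrak{sp}_\Omega(2n)\cap\mathfrak{so}(2n)]\big),\quad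 \Xi_2=\phi^{-1}\big(\{0_m\}\times[\mathfrak{sp}_\Omega(2n)\cap\mathrm{Sym}(2n)]\big),\quad \Xi_3=\phi^{-1}\big(\mathfrak{so}_0\cap\mathrm{Mat}(m|2n)(\Lambda_N^+)\big),$$ where $\mathfrak{so}(m)$, $\mathfrak{so}(2n)$ and $\mathrm{Sym}(2n)$ consist of real antisymmetric, respectively symmetric, matrices and $\mathfrak{sp}_\Omega(2n)=\{D\in\mathbb R^{2n\times 2n}:D^T\Omega_{2n}+\Omega_{2n}D=0\}$. Exponentials are taken in the completed Clifford–Weyl algebra $\Lambda_N\otimes\widehat{\mathcal C}_{m,2n}$ defined as follows. Let $\mathrm{Cl}_{0,m}$ be the real Clifford algebra with generators $\epsilon_j$, $\epsilon_j\epsilon_k+\epsilon_k\epsilon_j=-2\delta_{jk}$, let $\mathcal S(\mathbb R^n)$ be the space of complex-valued Schwartz functions of $a_1,\dots,a_n$, and $\widehat{\mathcal C}_{m,2n}=\mathrm{Cl}_{0,m}\otimes_{\mathbb R}\mathrm{End}_{\mathbb C}(\mathcal S(\mathbb R^n))$. The algebra $\mathcal C_{m,2n}$ is mapped into $\widehat{\mathcal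 C}_{m,2n}$ by the oscillator representation $\grave e_{2j-1}\mapsto 1\otimes e^{\pi i/4}\partial_{a_j}$, $\grave e_{2j}\mapsto 1\otimes e^{-\pi i/4}a_j$, $e_j\mapsto \epsilon_j\otimes P$ with $(Pf)(a)=f(-a)$. The exponential $e^B=\exp(B)$ is $U(1)$, where $U:\mathbb R\to\Lambda_N\otimes\widehat{\mathcal C}_{m,2n}$ solves $U'(t)=BU(t)$, $U(0)=1$; the derivative is taken strongly, i.e. componentwise (with respect to the finite-dimensional factor $\Lambda_N\otimes\mathrm{Cl}_{0,m}$) on each Schwartz function, in the topology of $\mathcal S(\mathbb R^n)$. The Spin group is the set of all finite products $e^{B_1}\cdots e^{B_k}$ with extended superbivectors $B_i$, and $$\Xi=\exp(\Xi_1)\exp(\Xi_2)\exp(\Xi_3).$$ **Theorem.** The exponential is well defined (it exists and is unique) on $\Xi_1\cup\Xi_2\cup\Xi_3$, and $\Xi$ is a subset of the Spin group. The set $\Xi$ is a double covering of $\mathrm{SO}_0$ under $h$: every $s\in\Xi$ is invertible and there is exactly one matrix $h(s)=M$ over $\Lambda_N$ with $s\,\mathbf x\,s^{-1}=M\mathbf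 x$ for all supervector variables $\mathbf x$; this $M$ lies in $\mathrm{SO}_0$; and for each $M\in\mathrm{SO}_0$ the fibre $\{s\in\Xi:h(s)=M\}$ consists of exactly two elements, $s$ and $-s$. Moreover $\exp\big(\pi(\grave e_{2j-1}^{\,2}+\grave e_{2j}^{\,2})\big)=-1$ for $j=1,\dots,n$. -/

import Mathlib

open scoped TensorProduct SchwartzMap LineDeriv Topology

noncomputable section

namespace SuperSpin

/-! ### Indices, Grassmann algebras and supermatrices -/

/-- Indices of the homogeneous basis of `ℝ^{m,2n}`: `inl j` is the even index `j`; the odd indices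
`2j-1` and `2j` are `inr (j, 0)` and `inr (j, 1)`. -/
abbrev Idx (m n : ℕ) := Fin m ⊕ (Fin n × Fin 2)

/-- Parity of a basis index. -/
def parity {m n : ℕ} : Idx m n → ZMod 2 := Sum.elim (fun _ => 0) (fun _ => 1)

/-- The real Grassmann algebra with anticommuting generators indexed by `ι`. -/
abbrev Grassmann (ι : Type) := ExteriorAlgebra ℝ (ι → ℝ)

/-- The Grassmann algebra `Λ_N`. -/
abbrev Lam (N : ℕ) := Grassmann (Fin N)

/-- The generator with index `i`. -/
def gGen {ι : Type} [DecidableEq ι] (i : ι) : Grassmann ι := ExteriorAlgebra.ι ℝ (Pi.single i 1)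

/-- `Λ^(ev)` for `i = 0` and `Λ^(odd)` for `i = 1`. -/
def grade (ι : Type) (i : ZMod 2) : Submodule ℝ (Grassmann ι) :=
  CliffordAlgebra.evenOdd (0 : QuadraticForm ℝ (ι → ℝ)) i

/-- `Λ_N^+`: the elements with vanishing body. -/
def nilPart (N : ℕ) : Set (Lam N) := {a | ExteriorAlgebra.algebraMapInv a = 0}

/-- Square matrices of size `m + 2n` over `Λ_N`. -/
abbrev SMat (m n N : ℕ) := Matrix (Idx m n) (Idx m n) (Lam N)

/-- `Mat(m|2n)(Λ_N)`: even entries in the diagonal blocks, odd entries in the others. -/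
def IsSupermatrix {m n N : ℕ} (M : SMat m n N) : Prop :=
  ∀ j k, M j k ∈ grade (Fin N) (parity j + parity k)

/-- The supertranspose. -/
def supertranspose {m n N : ℕ} (M : SMat m n N) : SMat m n N :=
  Matrix.fromBlocks M.toBlocks₁₁.transpose M.toBlocks₂₁.transpose
    (-M.toBlocks₁₂.transpose) M.toBlocks₂₂.transpose

/-- `Ω_{2n} = diag ((0, 1), (-1, 0))`. -/
def Omega (n : ℕ) : Matrix (Fin n × Fin 2) (Fin n × Fin 2) ℝ :=
  fun j k => if j.1 = k.1 then !![0, 1; -1, 0] j.2 k.2 else 0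

/-- A real matrix as a matrix over `Λ_N`. -/
def realMat (N : ℕ) {m n : ℕ} (M : Matrix (Idx m n) (Idx m n) ℝ) : SMat m n N :=
  M.map (algebraMap ℝ (Lam N))

/-- The matrix `Q` of the inner product. -/
def Qmat (m n N : ℕ) : SMat m n N :=
  realMat N (Matrix.fromBlocks 1 0 0 (-(1 / 2 : ℝ) • Omega n))

/-- Determinant (Leibniz formula) of a square matrix over `Λ_N`; it is used for matrices with
even, hence commuting, entries only, so that the order of the factors is immaterial. -/
def gdet {N : ℕ} {ι : Type} [Fintype ι] [DecidableEq ι] (A : Matrix ι ι (Lam N)) : Lam N :=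
  ∑ σ : Equiv.Perm ι, ((Equiv.Perm.sign σ : ℤ) : ℝ) •
    (Finset.univ.toList.map fun i => A (σ i) i).prod

/-- The superdeterminant (Berezinian) `det (A - B D⁻¹ C) (det D)⁻¹` of an invertible supermatrix
(`Ring.inverse` is the inverse of a unit). -/
def sdet {m n N : ℕ} (M : SMat m n N) : Lam N :=
  gdet (M.toBlocks₁₁ - M.toBlocks₁₂ * Ring.inverse M.toBlocks₂₂ * M.toBlocks₂₁) *
    Ring.inverse (gdet M.toBlocks₂₂)

/-- The group of superrotations `SO₀(m|2n)(Λ_N)`. -/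
def SO0 (m n N : ℕ) : Set (SMat m n N) :=
  {M | IsSupermatrix M ∧ supertranspose M * Qmat m n N * M = Qmat m n N ∧ sdet M = 1}

/-- The Lie algebra `𝔰𝔬₀(m|2n)(Λ_N)`. -/
def so0 (m n N : ℕ) : Set (SMat m n N) :=
  {X | IsSupermatrix X ∧ supertranspose X * Qmat m n N + Qmat m n N * X = 0}

/-- `𝔰𝔬(m) × [𝔰𝔭_Ω(2n) ∩ 𝔰𝔬(2n)]`. -/
def compactPart (m n N : ℕ) : Set (SMat m n N) :=
  {X | ∃ (A : Matrix (Fin m) (Fin m) ℝ) (D : Matrix (Fin n × Fin 2) (Fin n × Fin 2) ℝ),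
    A.transpose + A = 0 ∧ D.transpose * Omega n + Omega n * D = 0 ∧ D.transpose + D = 0 ∧
    X = realMat N (Matrix.fromBlocks A 0 0 D)}

/-- `{0_m} × [𝔰𝔭_Ω(2n) ∩ Sym(2n)]`. -/
def symmetricPart (m n N : ℕ) : Set (SMat m n N) :=
  {X | ∃ D : Matrix (Fin n × Fin 2) (Fin n × Fin 2) ℝ,
    D.transpose * Omega n + Omega n * D = 0 ∧ D.transpose = D ∧
    X = realMat N (Matrix.fromBlocks 0 0 0 D)}

/-- `𝔰𝔬₀(m|2n)(Λ_N^+)`. -/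
def nilpotentPart (m n N : ℕ) : Set (SMat m n N) :=
  {X | X ∈ so0 m n N ∧ ∀ j k, X j k ∈ nilPart N}

/-! ### The Clifford–Weyl algebra and extended superbivectors -/

/-- The multiplication rules of the basis elements `e_j` (`inl`) and of the symplectic
generators (`inr`). -/
inductive CWRel (m n : ℕ) : FreeAlgebra ℝ (Idx m n) → FreeAlgebra ℝ (Idx m n) → Prop
  | ee (j k : Fin m) : CWRel m n
      (FreeAlgebra.ι ℝ (.inl j) * FreeAlgebra.ι ℝ (.inl k) +
        FreeAlgebra.ι ℝ (.inl k) * FreeAlgebra.ι ℝ (.inl j))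
      (algebraMap ℝ _ (if j = k then -2 else 0))
  | eo (j : Fin m) (k : Fin n × Fin 2) : CWRel m n
      (FreeAlgebra.ι ℝ (.inl j) * FreeAlgebra.ι ℝ (.inr k) +
        FreeAlgebra.ι ℝ (.inr k) * FreeAlgebra.ι ℝ (.inl j)) 0
  | oo (j k : Fin n × Fin 2) : CWRel m n
      (FreeAlgebra.ι ℝ (.inr j) * FreeAlgebra.ι ℝ (.inr k) -
        FreeAlgebra.ι ℝ (.inr k) * FreeAlgebra.ι ℝ (.inr j))
      (algebraMap ℝ _ (Omega n j k))

/-- The algebra `𝒞_{m,2n}`. -/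
abbrev CliffordWeyl (m n : ℕ) := RingQuot (CWRel m n)

/-- The generators of `𝒞_{m,2n}`. -/
def cwGen {m n : ℕ} (j : Idx m n) : CliffordWeyl m n :=
  RingQuot.mkAlgHom ℝ (CWRel m n) (FreeAlgebra.ι ℝ j)

/-- The space of extended superbivectors, inside `Λ_N ⊗ 𝒞_{m,2n}`. -/
def ExtBivector (m n N : ℕ) : Submodule ℝ (Lam N ⊗[ℝ] CliffordWeyl m n) :=
  Submodule.span ℝ
    ({B | ∃ (j k : Fin m) (b : Lam N), j < k ∧ b ∈ grade (Fin N) 0 ∧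
        B = b ⊗ₜ (cwGen (.inl j) * cwGen (.inl k))} ∪
     {B | ∃ (j : Fin m) (k : Fin n × Fin 2) (b : Lam N), b ∈ grade (Fin N) 1 ∧
        B = b ⊗ₜ (cwGen (.inl j) * cwGen (.inr k))} ∪
     {B | ∃ (j k : Fin n × Fin 2) (b : Lam N), b ∈ grade (Fin N) 0 ∧
        B = b ⊗ₜ ((1 / 2 : ℝ) • (cwGen (.inr j) * cwGen (.inr k) +
          cwGen (.inr k) * cwGen (.inr j)))})

/-! ### Supervector variables and the map `φ` -/

/-- `𝒱 ⊗ Λ_N`: superpolynomials, with coefficients in `Λ_N`, in the coordinates of `l` vector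
variables. The commuting variables are `(i, j)`, the `j`-th bosonic coordinate of the `i`-th vector
variable; the anticommuting generators are the `f_j` (`inl`) and the fermionic coordinates (`inr`),
all anticommuting with each other. -/
abbrev SuperPoly (m n N l : ℕ) :=
  MvPolynomial (Fin l × Fin m) ℝ ⊗[ℝ] Grassmann (Fin N ⊕ Fin l × Fin n × Fin 2)

/-- The coordinates of the `i`-th supervector variable. -/
def coord {m n : ℕ} (N : ℕ) {l : ℕ} (i : Fin l) : Idx m n → SuperPoly m n N l :=
  Sum.elim (fun j => MvPolynomial.X (i, j) ⊗ₜ 1) (fun k => 1 ⊗ₜ gGen (.inr (i, k)))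

/-- The inclusion of `Λ_N` in `𝒱 ⊗ Λ_N`. -/
def lamIncl (m n N l : ℕ) : Lam N →ₐ[ℝ] SuperPoly m n N l :=
  Algebra.TensorProduct.includeRight.comp
    (ExteriorAlgebra.map
      (LinearMap.pi (Sum.elim (fun j => LinearMap.proj j) fun _ => 0) :
        (Fin N → ℝ) →ₗ[ℝ] (Fin N ⊕ Fin l × Fin n × Fin 2 → ℝ)))

/-- The coordinates of `M x`, for the `i`-th supervector variable `x`. -/
def matCoord {m n N l : ℕ} (M : SMat m n N) (i : Fin l) : Idx m n → SuperPoly m n N l :=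
  (M.map (lamIncl m n N l)).mulVec (coord N i)

/-- The element of `(𝒱 ⊗ Λ_N) ⊗ 𝒞_{m,2n}` with the coordinates `y`. -/
def vec {m n N l : ℕ} (y : Idx m n → SuperPoly m n N l) :
    SuperPoly m n N l ⊗[ℝ] CliffordWeyl m n :=
  ∑ j, y j ⊗ₜ cwGen j

/-- Inclusion of `Λ_N ⊗ A` in `(𝒱 ⊗ Λ_N) ⊗ A`. -/
def extend (m n N l : ℕ) (A : Type) [Ring A] [Algebra ℝ A] :
    Lam N ⊗[ℝ] A →ₐ[ℝ] SuperPoly m n N l ⊗[ℝ] A :=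
  Algebra.TensorProduct.map (lamIncl m n N l) (AlgHom.id ℝ A)

/-- `X = φ(B)`, that is `X x = [B, x]` for each of the `l` supervector variables `x`. -/
def IsPhi {m n N : ℕ} (l : ℕ) (B : Lam N ⊗[ℝ] CliffordWeyl m n) (X : SMat m n N) : Prop :=
  ∀ i : Fin l, vec (matCoord X i) =
    extend m n N l _ B * vec (coord N i) - vec (coord N i) * extend m n N l _ B

/-- `φ⁻¹(T)`, a set of extended superbivectors. -/
def phiPreimage {m n N : ℕ} (l : ℕ) (T : Set (SMat m n N)) :
    Set (Lam N ⊗[ℝ] CliffordWeyl m n) :=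
  {B | B ∈ ExtBivector m n N ∧ ∃ X ∈ T, IsSupermatrix X ∧ IsPhi l B X}

/-- The subspace `Ξ₁`. -/
def Xi1 (m n N l : ℕ) := phiPreimage l (compactPart m n N)
/-- The subspace `Ξ₂`. -/
def Xi2 (m n N l : ℕ) := phiPreimage l (symmetricPart m n N)
/-- The subspace `Ξ₃`. -/
def Xi3 (m n N l : ℕ) := phiPreimage l (nilpotentPart m n N)

/-! ### The completed algebra and the exponential -/

/-- Complex-valued Schwartz functions of `n` real variables `a_1, …, a_n`. -/
abbrev Schw (n : ℕ) := 𝓢(EuclideanSpace ℝ (Fin n), ℂ)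

/-- The algebra of `ℂ`-linear operators on Schwartz functions. -/
def SchwOp (n : ℕ) : Type := Module.End ℂ (Schw n)

instance (n : ℕ) : Ring (SchwOp n) := inferInstanceAs (Ring (Module.End ℂ (Schw n)))

instance (n : ℕ) : Algebra ℝ (SchwOp n) := inferInstanceAs (Algebra ℝ (Module.End ℂ (Schw n)))

/-- The operator as a linear map. -/
def SchwOp.toEnd {n : ℕ} (T : SchwOp n) : Module.End ℂ (Schw n) := T

/-- The scalar multiple `c T` of an operator, `c ∈ ℂ`. -/
def SchwOp.scale {n : ℕ} (c : ℂ) (T : SchwOp n) : SchwOp n := c • T.toEnd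

/-- Multiplication by the variable `a_j`. -/
def mulVar {n : ℕ} (j : Fin n) : SchwOp n :=
  (SchwartzMap.smulLeftCLM ℂ fun a : EuclideanSpace ℝ (Fin n) => ((a j : ℝ) : ℂ)).toLinearMap

/-- The partial derivative with respect to `a_j`. -/
def partialD {n : ℕ} (j : Fin n) : SchwOp n :=
  (LineDeriv.lineDerivOpCLM ℂ (Schw n) (EuclideanSpace.single j (1 : ℝ))).toLinearMap

/-- The parity operator `f ↦ f (-·)`. -/
def reflect (n : ℕ) : SchwOp n :=
  (SchwartzMap.compCLMOfContinuousLinearEquiv ℂ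
    (ContinuousLinearEquiv.neg ℝ (M := EuclideanSpace ℝ (Fin n)))).toLinearMap

theorem mulVar_apply {n : ℕ} (j : Fin n) (f : Schw n) (a : EuclideanSpace ℝ (Fin n)) :
    (mulVar j).toEnd f a = (a j : ℂ) * f a := by
  have h : (fun a : EuclideanSpace ℝ (Fin n) => ((a j : ℝ) : ℂ)).HasTemperateGrowth :=
    (Complex.ofRealCLM.comp (EuclideanSpace.proj (𝕜 := ℝ) j)).hasTemperateGrowth
  simp [SchwOp.toEnd, mulVar, SchwartzMap.smulLeftCLM_apply_apply h]

theorem reflect_apply {n : ℕ} (f : Schw n) (a : EuclideanSpace ℝ (Fin n)) :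
    (reflect n).toEnd f a = f (-a) := by
  simp [SchwOp.toEnd, reflect]

theorem partialD_apply {n : ℕ} (j : Fin n) (f : Schw n) (a : EuclideanSpace ℝ (Fin n)) :
    (partialD j).toEnd f a = fderiv ℝ f a (EuclideanSpace.single j 1) := by
  simp [SchwOp.toEnd, partialD, SchwartzMap.lineDerivOp_apply_eq_fderiv]

theorem SchwOp.ext_apply {n : ℕ} {S T : SchwOp n} (h : ∀ f a, S.toEnd f a = T.toEnd f a) :
    S = T :=
  LinearMap.ext fun f => SchwartzMap.ext fun a => h f a

theorem SchwOp.mul_toEnd {n : ℕ} (S T : SchwOp n) (f : Schw n) :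
    (S * T).toEnd f = S.toEnd (T.toEnd f) := rfl

theorem SchwOp.neg_toEnd {n : ℕ} (S : SchwOp n) (f : Schw n) (a : EuclideanSpace ℝ (Fin n)) :
    (-S).toEnd f a = - S.toEnd f a := rfl

theorem SchwOp.sub_toEnd {n : ℕ} (S T : SchwOp n) (f : Schw n) (a : EuclideanSpace ℝ (Fin n)) :
    (S - T).toEnd f a = S.toEnd f a - T.toEnd f a := rfl

theorem SchwOp.one_toEnd {n : ℕ} (f : Schw n) : (1 : SchwOp n).toEnd f = f := rfl

theorem SchwOp.scale_mul_scale {n : ℕ} (c d : ℂ) (S T : SchwOp n) :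
    SchwOp.scale c S * SchwOp.scale d T = SchwOp.scale (c * d) (S * T) := by
  apply SchwOp.ext_apply
  intro f a
  change c • (S.toEnd (d • T.toEnd f)) a = (c * d) • (S.toEnd (T.toEnd f)) a
  rw [map_smul, mul_smul]
  rfl

theorem SchwOp.scale_sub {n : ℕ} (c : ℂ) (S T : SchwOp n) :
    SchwOp.scale c (S - T) = SchwOp.scale c S - SchwOp.scale c T :=
  smul_sub c S.toEnd T.toEnd

theorem SchwOp.scale_neg {n : ℕ} (c : ℂ) (S : SchwOp n) :
    SchwOp.scale c (-S) = -SchwOp.scale c S :=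
  smul_neg c S.toEnd

theorem SchwOp.scale_one {n : ℕ} (S : SchwOp n) : SchwOp.scale 1 S = S :=
  one_smul ℂ S.toEnd

theorem SchwOp.scale_zero {n : ℕ} (c : ℂ) : SchwOp.scale c (0 : SchwOp n) = 0 :=
  smul_zero (A := Module.End ℂ (Schw n)) c

theorem reflect_sq (n : ℕ) : reflect n * reflect n = 1 := by
  apply SchwOp.ext_apply
  intro f a
  rw [SchwOp.mul_toEnd, reflect_apply, reflect_apply, neg_neg, SchwOp.one_toEnd]

theorem reflect_mulVar {n : ℕ} (j : Fin n) :
    reflect n * mulVar j = - (mulVar j * reflect n) := by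
  apply SchwOp.ext_apply
  intro f a
  simp only [SchwOp.mul_toEnd, SchwOp.neg_toEnd, reflect_apply, mulVar_apply]
  simp

theorem reflect_partialD {n : ℕ} (j : Fin n) :
    reflect n * partialD j = - (partialD j * reflect n) := by
  apply SchwOp.ext_apply
  intro f a
  have h : ((reflect n).toEnd f : EuclideanSpace ℝ (Fin n) → ℂ) = fun x => f (-x) := by
    ext x
    exact reflect_apply f x
  have hd : HasFDerivAt (fun x : EuclideanSpace ℝ (Fin n) => f (-x))
      ((fderiv ℝ f (-a)).comp (-ContinuousLinearMap.id ℝ _)) a :=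
    HasFDerivAt.comp a f.differentiableAt.hasFDerivAt (hasFDerivAt_id a).neg
  simp only [SchwOp.mul_toEnd, SchwOp.neg_toEnd, reflect_apply, partialD_apply]
  rw [h, hd.fderiv]
  simp

theorem mulVar_comm {n : ℕ} (j k : Fin n) : mulVar j * mulVar k = mulVar k * mulVar j := by
  apply SchwOp.ext_apply
  intro f a
  simp only [SchwOp.mul_toEnd, mulVar_apply]
  ring

theorem partialD_comm {n : ℕ} (j k : Fin n) :
    partialD j * partialD k = partialD k * partialD j := by
  apply SchwOp.ext_apply
  intro f a
  simp only [SchwOp.mul_toEnd, partialD_apply]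
  have h : ∀ i, ((partialD i).toEnd f : EuclideanSpace ℝ (Fin n) → ℂ) =
      fun x => fderiv ℝ f x (EuclideanSpace.single i 1) := by
    intro i
    ext x
    exact partialD_apply i f x
  have hd : DifferentiableAt ℝ (fderiv ℝ f) a :=
    ((f.smooth 2).fderiv_right (m := 1) (by norm_num)).differentiable (by norm_num) a
  rw [h, h, fderiv_clm_apply hd (differentiableAt_const _),
    fderiv_clm_apply hd (differentiableAt_const _)]
  have := (f.smooth 2).contDiffAt.isSymmSndFDerivAt (x := a) (by simp)
  simpa using this _ _

theorem partialD_mulVar {n : ℕ} (j k : Fin n) :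
    partialD j * mulVar k - mulVar k * partialD j = if j = k then 1 else 0 := by
  apply SchwOp.ext_apply
  intro f a
  simp only [SchwOp.sub_toEnd, SchwOp.mul_toEnd, mulVar_apply, partialD_apply]
  have h : ((mulVar k).toEnd f : EuclideanSpace ℝ (Fin n) → ℂ) =
      fun x => (Complex.ofRealCLM.comp (EuclideanSpace.proj (𝕜 := ℝ) k)) x * f x := by
    ext x
    simp [mulVar_apply]
  rw [h, fderiv_fun_mul (ContinuousLinearMap.differentiableAt _) f.differentiableAt,
    ContinuousLinearMap.fderiv]
  by_cases hjk : j = k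
  · subst hjk
    simp [SchwOp.one_toEnd]
  · rw [if_neg hjk]
    change _ = (0 : ℂ)
    simp [Ne.symm hjk]

/-- The symplectic generators with indices `2j-1` and `2j`, as the operators `e^{πi/4} ∂_{a_j}` and
`e^{-πi/4} a_j`. -/
def sympOp {n : ℕ} (k : Fin n × Fin 2) : SchwOp n :=
  if k.2 = 0 then SchwOp.scale (Complex.exp (Real.pi / 4 * Complex.I)) (partialD k.1)
  else SchwOp.scale (Complex.exp (-(Real.pi / 4 * Complex.I))) (mulVar k.1)

theorem reflect_sympOp {n : ℕ} (k : Fin n × Fin 2) :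
    reflect n * sympOp k = -(sympOp k * reflect n) := by
  unfold sympOp
  rw [← SchwOp.scale_one (reflect n)]
  split_ifs
  · rw [SchwOp.scale_mul_scale, SchwOp.scale_mul_scale, reflect_partialD, SchwOp.scale_neg,
      mul_comm]
  · rw [SchwOp.scale_mul_scale, SchwOp.scale_mul_scale, reflect_mulVar, SchwOp.scale_neg,
      mul_comm]

theorem sympOp_comm {n : ℕ} (j k : Fin n × Fin 2) :
    sympOp j * sympOp k - sympOp k * sympOp j = algebraMap ℝ (SchwOp n) (Omega n j k) := by
  obtain ⟨j, p⟩ := j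
  obtain ⟨k, q⟩ := k
  have e : Complex.exp (Real.pi / 4 * Complex.I) * Complex.exp (-(Real.pi / 4 * Complex.I)) = 1 := by
    rw [← Complex.exp_add, add_neg_cancel, Complex.exp_zero]
  have e' : Complex.exp (-(Real.pi / 4 * Complex.I)) * Complex.exp (Real.pi / 4 * Complex.I) = 1 := by
    rw [mul_comm, e]
  fin_cases p <;> fin_cases q <;>
    simp only [sympOp, Omega, SchwOp.scale_mul_scale, ← SchwOp.scale_sub, e, e',
      SchwOp.scale_one, Fin.zero_eta, Fin.mk_one, if_true, one_ne_zero, if_false]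
  · simp [partialD_comm j k, SchwOp.scale_zero]
  · rw [partialD_mulVar]
    split_ifs <;> simp
  · rw [← neg_sub, partialD_mulVar]
    by_cases h : j = k
    · simp [h]
    · simp [h, Ne.symm h]
  · simp [mulVar_comm j k, SchwOp.scale_zero]

/-- The quadratic form `-|x|²` on `ℝ^m`. -/
def negForm (m : ℕ) : QuadraticForm ℝ (Fin m → ℝ) :=
  QuadraticMap.weightedSumSquares ℝ fun _ : Fin m => (-1 : ℝ)

/-- The algebra in which exponentials of quadratic elements of `𝒞_{m,2n}` live: the real Clifford
algebra of `ℝ^m` tensored with the operators on Schwartz functions. It contains `𝒞_{m,2n}` by letting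
the symplectic generators act through the oscillator (Schrödinger) representation. -/
abbrev CompletedCW (m n : ℕ) := CliffordAlgebra (negForm m) ⊗[ℝ] SchwOp n

/-- Images of the generators: the symplectic generators act on Schwartz functions; the generators
`e_j` act by Clifford multiplication, combined with the parity operator so that they anticommute
with the symplectic ones. -/
def oscGen {m n : ℕ} : Idx m n → CompletedCW m n :=
  Sum.elim (fun j => CliffordAlgebra.ι (negForm m) (Pi.single j 1) ⊗ₜ reflect n)
    (fun k => 1 ⊗ₜ sympOp k)

theorem cliff_rel {m : ℕ} (j k : Fin m) :
    CliffordAlgebra.ι (negForm m) (Pi.single j 1) * CliffordAlgebra.ι (negForm m) (Pi.single k 1) +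
      CliffordAlgebra.ι (negForm m) (Pi.single k 1) * CliffordAlgebra.ι (negForm m) (Pi.single j 1)
      = algebraMap ℝ _ (if j = k then -2 else 0) := by
  rw [CliffordAlgebra.ι_mul_ι_add_swap]
  congr 1
  have h : ∀ x : Fin m → ℝ, negForm m x = ∑ i, -(x i * x i) := by
    intro x
    simp [negForm, QuadraticMap.weightedSumSquares_apply]
  rw [QuadraticMap.polar, h, h, h, ← Finset.sum_sub_distrib, ← Finset.sum_sub_distrib]
  have h2 : ∀ i, -((Pi.single j (1 : ℝ) + Pi.single k (1 : ℝ) : Fin m → ℝ) i *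
      (Pi.single j (1 : ℝ) + Pi.single k (1 : ℝ) : Fin m → ℝ) i) -
      -((Pi.single j (1 : ℝ) : Fin m → ℝ) i * (Pi.single j (1 : ℝ) : Fin m → ℝ) i) -
      -((Pi.single k (1 : ℝ) : Fin m → ℝ) i * (Pi.single k (1 : ℝ) : Fin m → ℝ) i) =
      if i = j then (if j = k then -2 else 0) else 0 := by
    intro i
    simp only [Pi.add_apply, Pi.single_apply]
    by_cases hij : i = j
    · subst hij
      split_ifs <;> norm_num
    · simp [hij]
  rw [Finset.sum_congr rfl fun i _ => h2 i]
  simp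

theorem oscGen_rel {m n : ℕ} {x y : FreeAlgebra ℝ (Idx m n)} (h : CWRel m n x y) :
    FreeAlgebra.lift ℝ oscGen x = FreeAlgebra.lift ℝ (oscGen (m := m) (n := n)) y := by
  cases h with
  | ee j k =>
    simp only [map_add, map_mul, FreeAlgebra.lift_ι_apply, AlgHom.commutes, oscGen, Sum.elim_inl,
      Algebra.TensorProduct.tmul_mul_tmul, reflect_sq]
    rw [← TensorProduct.add_tmul, cliff_rel, Algebra.TensorProduct.algebraMap_apply]
  | eo j k =>
    simp only [map_add, map_mul, map_zero, FreeAlgebra.lift_ι_apply, oscGen, Sum.elim_inl,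
      Sum.elim_inr, Algebra.TensorProduct.tmul_mul_tmul, one_mul, mul_one, reflect_sympOp]
    rw [← TensorProduct.tmul_add, neg_add_cancel, TensorProduct.tmul_zero]
  | oo j k =>
    simp only [map_sub, map_mul, FreeAlgebra.lift_ι_apply, AlgHom.commutes, oscGen,
      Sum.elim_inr, Algebra.TensorProduct.tmul_mul_tmul, one_mul]
    rw [← TensorProduct.tmul_sub, sympOp_comm, Algebra.TensorProduct.algebraMap_apply']

/-- The embedding of `𝒞_{m,2n}` in its completion. -/
def osc (m n : ℕ) : CliffordWeyl m n →ₐ[ℝ] CompletedCW m n :=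
  RingQuot.liftAlgHom ℝ ⟨FreeAlgebra.lift ℝ oscGen, fun _ _ h => oscGen_rel h⟩

/-- The completed Clifford–Weyl algebra with coefficients in `Λ_N`. -/
abbrev Completed (m n N : ℕ) := Lam N ⊗[ℝ] CompletedCW m n

/-- The embedding of `G ⊗ 𝒞_{m,2n}` in `G ⊗` the completion, for an algebra `G` of coefficients. -/
def embed (m n : ℕ) (G : Type) [Ring G] [Algebra ℝ G] :
    G ⊗[ℝ] CliffordWeyl m n →ₐ[ℝ] G ⊗[ℝ] CompletedCW m n :=
  Algebra.TensorProduct.map (AlgHom.id ℝ G) (osc m n)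

/-- The component of an element of `Λ_N ⊗ (Cl ⊗ End)` along linear functionals on the two
finite-dimensional factors `Λ_N` and `Cl`: an operator on Schwartz functions. -/
def component {m n N : ℕ} (p : Module.Dual ℝ (Lam N))
    (q : Module.Dual ℝ (CliffordAlgebra (negForm m))) :
    Completed m n N →ₗ[ℝ] SchwOp n :=
  (TensorProduct.lid ℝ _).toLinearMap ∘ₗ
    TensorProduct.map p ((TensorProduct.lid ℝ _).toLinearMap ∘ₗ TensorProduct.map q LinearMap.id)

/-- `U` has the derivative `V` at time `t`, strongly (componentwise on every Schwartz function, in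
the topology of the Schwartz space). -/
def HasStrongDeriv {m n N : ℕ} (U : ℝ → Completed m n N) (V : Completed m n N) (t : ℝ) : Prop :=
  ∀ p q (f : Schw n), Filter.Tendsto
    (fun τ : ℝ => τ⁻¹ • ((component p q (U (t + τ))).toEnd f - (component p q (U t)).toEnd f))
    (𝓝[≠] 0) (𝓝 ((component p q V).toEnd f))

/-- `E = exp(B)`: `E` is the value at time `1` of a solution of `U' = B U`, `U(0) = 1`, that is, of
the one-parameter group `U(t) = exp(t B)` generated by `B`. -/
def IsExp {m n N : ℕ} (B : Lam N ⊗[ℝ] CliffordWeyl m n) (E : Completed m n N) : Prop :=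
  ∃ U : ℝ → Completed m n N, U 0 = 1 ∧
    (∀ t, HasStrongDeriv U (embed m n (Lam N) B * U t) t) ∧ U 1 = E

/-- `exp(T)` for a set `T`. -/
def expSet {m n N : ℕ} (T : Set (Lam N ⊗[ℝ] CliffordWeyl m n)) : Set (Completed m n N) :=
  {E | ∃ B, B ∈ T ∧ IsExp B E}

/-- The Spin group: finite products of exponentials of extended superbivectors. -/
def Spin (m n N : ℕ) : Submonoid (Completed m n N) :=
  Submonoid.closure (expSet (ExtBivector m n N : Set (Lam N ⊗[ℝ] CliffordWeyl m n)))

/-- `Ξ = exp(Ξ₁) exp(Ξ₂) exp(Ξ₃)`. -/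
def Xi (m n N l : ℕ) : Set (Completed m n N) :=
  {s | ∃ s₁ ∈ expSet (Xi1 m n N l), ∃ s₂ ∈ expSet (Xi2 m n N l), ∃ s₃ ∈ expSet (Xi3 m n N l),
    s = s₁ * s₂ * s₃}

/-- `h(s) = M`: `s` is invertible and `s x s⁻¹ = M x` for each of the `l` supervector variables
`x`. -/
def IsH {m n N : ℕ} (l : ℕ) (s : Completed m n N) (M : SMat m n N) : Prop :=
  IsUnit s ∧ ∀ i : Fin l,
    extend m n N l _ s * embed m n _ (vec (coord N i)) * extend m n N l _ (Ring.inverse s) =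
      embed m n _ (vec (matCoord M i))

end SuperSpin

end

noncomputable section

namespace SuperSpin

open scoped FourierTransform
open Filter

/-! ### Curves in Schwartz space and the energy method -/

/-! With the phases `e^{πi/4}` and `e^{-πi/4}` the symplectic generators act as operators `Q_k` with
`⟨Q_k f, g⟩ = i ⟨f, Q_k g⟩`. Hence `½ ∑ S_jk Q_j Q_k` is skew for the `L²` product whenever `S` is
real symmetric, and conservation of the norm makes its exponential on Schwartz functions unique. For
short times the exponential exists as an oscillating integral with quadratic phase, whose
coefficients solve a Riccati system (`exists_local`); repeated doubling of the time interval gives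
all times (`exists_isFlow`). This is the metaplectic representation. The orthogonal generators only
need the finite-dimensional Clifford algebra, and a superbivector with zero body is nilpotent, so it
too generates a finite-dimensional algebra. Both cases are joined to the flows by `isGen_add`, and
this yields the exponentials on the three subspaces.

The map `bv` is inverse to `φ` and identifies extended superbivectors with `𝔰𝔬₀`
(`mem_phiPreimage_iff`). For `X = φ(B)`, `s = e^{tB}` and `M = e^{tX}`, both sides of `s e_k = ∑
M_jk e_j σ^k(s)`, where `σ` is the parity automorphism of the coefficients, solve the same equation
with the same initial value. So `h(e^B) = e^X` (`IsGen.cov`). The matrix is unique because the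
generators are linearly independent and the coordinates of one supervector variable are independent
over `Λ_N`.

Every `M` in `SO₀` is reached: its body has an orthogonal block `a` and a symplectic block `d`, and
the superdeterminant is the real number `det a · det d` (`sdet_eq`). Since `det d = 1`, the block
`a` is a rotation `exp A`; the polar decomposition gives `d = exp D · exp S` with `D` compact and
`S` symmetric; what remains is `1` plus a nilpotent matrix, which is the exponential of a unique
nilpotent `X` in `𝔰𝔬₀` (`exists_mat_eq`).

The fibre has two elements. The matrix determines `S`, `X`, `exp A` and `exp D`. Two Spin elements
with the same `exp A` differ by an even element that commutes with all generators, hence by a sign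
(`spin_eq_or_eq_neg`). Two flows with the same `exp D` differ by an isometry that commutes with all
`Q_k` and has the Gaussian as an eigenvector, hence by a scalar; its square is a quotient of two
equal determinants, so it is again a sign (`flow_eq_or_eq_neg`). The sign `-1` does occur: a full
turn in a complex line invariant under `D` keeps `exp D` but multiplies the Gaussian eigenvalue by
`e^{-πi}`. Starting from `D = 0` the same full turn gives the exponential of the oscillators. -/

/-- The curve `u` in Schwartz space has the derivative `v` at time `t`. -/
def CurveDeriv {n : ℕ} (u : ℝ → Schw n) (v : Schw n) (t : ℝ) : Prop :=
  Tendsto (fun τ : ℝ => τ⁻¹ • (u (t + τ) - u t)) (𝓝[≠] 0) (𝓝 v)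

namespace CurveDeriv
variable {n : ℕ} {u w : ℝ → Schw n} {v v' : Schw n} {t : ℝ}

theorem add (hu : CurveDeriv u v t) (hw : CurveDeriv w v' t) :
    CurveDeriv (fun s => u s + w s) (v + v') t := by
  refine (Tendsto.add hu hw).congr fun τ => ?_
  rw [← smul_add]
  exact congrArg _ (by simp only; abel)

theorem const (f : Schw n) : CurveDeriv (fun _ => f) 0 t := by
  simp [CurveDeriv]

theorem clm (hu : CurveDeriv u v t) (T : Schw n →L[ℝ] Schw n) :
    CurveDeriv (fun s => T (u s)) (T v) t := by
  refine ((T.continuous.tendsto v).comp hu).congr fun τ => ?_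
  simp

theorem continuousAt (hu : CurveDeriv u v t) :
    Tendsto (fun τ => u (t + τ)) (𝓝[≠] 0) (𝓝 (u t)) := by
  have h0 : Tendsto (fun τ : ℝ => τ) (𝓝[≠] 0) (𝓝 0) := nhdsWithin_le_nhds
  have h1 : Tendsto (fun τ : ℝ => τ • (τ⁻¹ • (u (t + τ) - u t)) + u t) (𝓝[≠] 0)
      (𝓝 ((0 : ℝ) • v + u t)) := (h0.smul hu).add tendsto_const_nhds
  rw [zero_smul, zero_add] at h1
  refine h1.congr' ?_
  filter_upwards [self_mem_nhdsWithin] with τ hτ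
  rw [smul_inv_smul₀ hτ, sub_add_cancel]

theorem smul {c : ℝ → ℝ} {c' : ℝ} (hc : HasDerivAt c c' t) (hu : CurveDeriv u v t) :
    CurveDeriv (fun s => c s • u s) (c' • u t + c t • v) t := by
  have h1 : Tendsto (fun τ : ℝ => (τ⁻¹ • (c (t + τ) - c t)) • u (t + τ) +
      c t • (τ⁻¹ • (u (t + τ) - u t))) (𝓝[≠] 0) (𝓝 (c' • u t + c t • v)) :=
    ((hasDerivAt_iff_tendsto_slope_zero.1 hc).smul hu.continuousAt).add (hu.const_smul (c t))
  refine h1.congr fun τ => ?_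
  rw [smul_comm (c t), smul_assoc, ← smul_add, sub_smul, smul_sub (c t)]
  congr 1; abel

theorem const_smul (c : ℝ) (hu : CurveDeriv u v t) :
    CurveDeriv (fun s => c • u s) (c • v) t := by
  simpa using CurveDeriv.smul (hasDerivAt_const t c) hu

theorem shift (a : ℝ) (hu : CurveDeriv u v (t + a)) :
    CurveDeriv (fun s => u (s + a)) v t := by
  refine Tendsto.congr (fun τ => ?_) hu
  simp only [add_right_comm t a τ]

theorem congr (hu : CurveDeriv u v t) (h : u =ᶠ[𝓝 t] w) : CurveDeriv w v t := by
  have h0 : Tendsto (fun τ : ℝ => t + τ) (𝓝[≠] 0) (𝓝 t) := by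
    have : Tendsto (fun τ : ℝ => t + τ) (𝓝 0) (𝓝 (t + 0)) := tendsto_const_nhds.add tendsto_id
    rw [add_zero] at this
    exact this.mono_left nhdsWithin_le_nhds
  refine hu.congr' ?_
  filter_upwards [h0.eventually h] with τ hτ
  rw [hτ, h.self_of_nhds]

theorem hasDerivAt {F : Type*} [NormedAddCommGroup F] [NormedSpace ℝ F]
    (hu : CurveDeriv u v t) (L : Schw n →L[ℝ] F) : HasDerivAt (fun s => L (u s)) (L v) t := by
  rw [hasDerivAt_iff_tendsto_slope_zero]
  refine ((L.continuous.tendsto v).comp hu).congr fun τ => ?_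
  simp

end CurveDeriv

/-- The `L²` inner product of Schwartz functions. -/
def ip {n : ℕ} (f g : Schw n) : ℂ := inner ℂ (f.toLp 2) (g.toLp 2)

section ip
variable {n : ℕ}

theorem ip_eq_integral (f g : Schw n) : ip f g = ∫ a, (starRingEnd ℂ) (f a) * g a := by
  refine (SchwartzMap.inner_toL2_toL2_eq f g).trans ?_
  simp [mul_comm]

theorem toL2_add (f g : Schw n) : (f + g).toLp 2 MeasureTheory.volume =
    f.toLp 2 MeasureTheory.volume + g.toLp 2 MeasureTheory.volume :=
  map_add (SchwartzMap.toLpCLM ℂ ℂ 2 MeasureTheory.volume) f g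
theorem toL2_smul (c : ℂ) (f : Schw n) : (c • f).toLp 2 MeasureTheory.volume = c • f.toLp 2 MeasureTheory.volume :=
  map_smul (SchwartzMap.toLpCLM ℂ ℂ 2 MeasureTheory.volume) c f

theorem ip_add_left (f g h : Schw n) : ip (f + g) h = ip f h + ip g h := by
  rw [ip, toL2_add, inner_add_left]; rfl
theorem ip_add_right (f g h : Schw n) : ip f (g + h) = ip f g + ip f h := by
  rw [ip, toL2_add, inner_add_right]; rfl
theorem ip_smul_left (c : ℂ) (f g : Schw n) : ip (c • f) g = (starRingEnd ℂ) c * ip f g := by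
  rw [ip, toL2_smul, inner_smul_left]; rfl
theorem ip_smul_right (c : ℂ) (f g : Schw n) : ip f (c • g) = c * ip f g := by
  rw [ip, toL2_smul, inner_smul_right]; rfl
theorem ip_zero_left (f : Schw n) : ip 0 f = 0 := by
  simpa using ip_smul_left 0 0 f
theorem ip_zero_right (f : Schw n) : ip f 0 = 0 := by
  simpa using ip_smul_right 0 f 0

theorem ip_sum_left {ι : Type*} (s : Finset ι) (f : ι → Schw n) (g : Schw n) :
    ip (∑ i ∈ s, f i) g = ∑ i ∈ s, ip (f i) g := by
  classical
  induction s using Finset.induction_on with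
  | empty => simp [ip_zero_left]
  | insert i s hi ih => rw [Finset.sum_insert hi, Finset.sum_insert hi, ip_add_left, ih]

theorem ip_sum_right {ι : Type*} (s : Finset ι) (f : Schw n) (g : ι → Schw n) :
    ip f (∑ i ∈ s, g i) = ∑ i ∈ s, ip f (g i) := by
  classical
  induction s using Finset.induction_on with
  | empty => simp [ip_zero_right]
  | insert i s hi ih => rw [Finset.sum_insert hi, Finset.sum_insert hi, ip_add_right, ih]

theorem eq_zero_of_ip_self {f : Schw n} (h : ip f f = 0) : f = 0 := by
  have : f.toLp 2 = (0 : Schw n).toLp 2 := by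
    rw [ip, inner_self_eq_zero] at h
    rw [h]; exact (map_zero (SchwartzMap.toLpCLM ℂ ℂ 2 MeasureTheory.volume)).symm
  exact SchwartzMap.injective_toLp 2 MeasureTheory.volume this

theorem CurveDeriv.ip {u w : ℝ → Schw n} {v v' : Schw n} {t : ℝ} (hu : CurveDeriv u v t)
    (hw : CurveDeriv w v' t) :
    HasDerivAt (fun s => ip (u s) (w s)) (SuperSpin.ip (u t) v' + SuperSpin.ip v (w t)) t := by
  have h1 := hu.hasDerivAt ((SchwartzMap.toLpCLM ℂ ℂ 2 MeasureTheory.volume).restrictScalars ℝ)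
  have h2 := hw.hasDerivAt ((SchwartzMap.toLpCLM ℂ ℂ 2 MeasureTheory.volume).restrictScalars ℝ)
  exact h1.inner ℂ h2

end ip

/-! ### The oscillator operators are skew up to a phase -/

section osc
variable {n : ℕ}

/-- Multiplication by a variable, as a continuous operator. -/
def mulVarL (j : Fin n) : Schw n →L[ℂ] Schw n :=
  SchwartzMap.smulLeftCLM ℂ fun a : EuclideanSpace ℝ (Fin n) => ((a j : ℝ) : ℂ)

/-- Partial derivative, as a continuous operator. -/
def partialL (j : Fin n) : Schw n →L[ℂ] Schw n :=
  LineDeriv.lineDerivOpCLM ℂ (Schw n) (EuclideanSpace.single j (1 : ℝ))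

theorem mulVarL_apply (j : Fin n) (f : Schw n) (a : EuclideanSpace ℝ (Fin n)) :
    mulVarL j f a = (a j : ℂ) * f a := mulVar_apply j f a

theorem partialL_apply (j : Fin n) (f : Schw n) (a : EuclideanSpace ℝ (Fin n)) :
    partialL j f a = fderiv ℝ f a (EuclideanSpace.single j 1) := partialD_apply j f a

/-- The symplectic generators as continuous operators. -/
def sympL (k : Fin n × Fin 2) : Schw n →L[ℂ] Schw n :=
  if k.2 = 0 then Complex.exp (Real.pi / 4 * Complex.I) • partialL k.1
  else Complex.exp (-(Real.pi / 4 * Complex.I)) • mulVarL k.1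

theorem sympL_apply (k : Fin n × Fin 2) (f : Schw n) : sympL k f = (sympOp k).toEnd f := by
  unfold sympL sympOp
  split_ifs <;> rfl

theorem sympL_comm (j k : Fin n × Fin 2) (f : Schw n) :
    sympL j (sympL k f) = sympL k (sympL j f) + (Omega n j k : ℂ) • f := by
  have h := congrArg (fun T : SchwOp n => T.toEnd f) (sympOp_comm j k)
  have h' : (sympOp j).toEnd ((sympOp k).toEnd f) - (sympOp k).toEnd ((sympOp j).toEnd f) =
      (Omega n j k : ℂ) • f := h
  rw [sympL_apply, sympL_apply, sympL_apply, sympL_apply, ← h']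
  abel

theorem ip_mulVarL (j : Fin n) (f g : Schw n) : ip (mulVarL j f) g = ip f (mulVarL j g) := by
  rw [ip_eq_integral, ip_eq_integral]
  congr 1; ext a
  rw [mulVarL_apply, mulVarL_apply, map_mul, Complex.conj_ofReal]; ring

/-- The complex conjugate of a Schwartz function. -/
def conjS (f : Schw n) : Schw n :=
  SchwartzMap.postcompCLM (𝕜 := ℝ) (Complex.conjCLE : ℂ →L[ℝ] ℂ) f

theorem conjS_apply (f : Schw n) (a : EuclideanSpace ℝ (Fin n)) :
    conjS f a = (starRingEnd ℂ) (f a) := by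
  rw [conjS, SchwartzMap.postcompCLM_apply]; rfl

/-- Integration by parts, applied to the conjugate of `f` because the available formula is bilinear;
conjugation commutes with real derivatives. -/
theorem ip_partialL (j : Fin n) (f g : Schw n) : ip (partialL j f) g = -ip f (partialL j g) := by
  rw [ip_eq_integral, ip_eq_integral]
  have h := SchwartzMap.integral_mul_lineDerivOp_right_eq_neg_left (μ := MeasureTheory.volume)
    (conjS f) g (EuclideanSpace.single j (1 : ℝ))
  simp only [SchwartzMap.lineDerivOp_apply_eq_fderiv] at h
  simp only [partialL_apply]
  rw [eq_neg_iff_add_eq_zero]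
  simp only [conjS_apply] at h
  rw [h, ← sub_eq_add_neg, sub_eq_zero]
  congr 1; ext a
  congr 1
  have hc : (conjS f : EuclideanSpace ℝ (Fin n) → ℂ) = fun x => Complex.conjCLE (f x) := by
    ext x; exact conjS_apply f x
  have hd : HasFDerivAt (fun x => Complex.conjCLE (f x))
      ((Complex.conjCLE : ℂ →L[ℝ] ℂ).comp (fderiv ℝ f a)) a :=
    (Complex.conjCLE : ℂ →L[ℝ] ℂ).hasFDerivAt.comp a f.differentiableAt.hasFDerivAt
  rw [hc, hd.fderiv]; rfl

theorem sympL_zero (j : Fin n) :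
    sympL (j, 0) = Complex.exp (Real.pi / 4 * Complex.I) • partialL j := by
  simp [sympL]

theorem sympL_one (j : Fin n) :
    sympL (j, 1) = Complex.exp (-(Real.pi / 4 * Complex.I)) • mulVarL j := by
  simp [sympL]

theorem exp_pi_div_four : Complex.exp (Real.pi / 4 * Complex.I) =
    Complex.I * Complex.exp (-(Real.pi / 4 * Complex.I)) := by
  calc _ = Complex.exp (Real.pi / 2 * Complex.I + -(Real.pi / 4 * Complex.I)) := by
        congr 1; ring
    _ = _ := by rw [Complex.exp_add, Complex.exp_pi_div_two_mul_I]

theorem conj_exp_pi_div_four : (starRingEnd ℂ) (Complex.exp (Real.pi / 4 * Complex.I)) =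
    Complex.exp (-(Real.pi / 4 * Complex.I)) := by
  rw [← Complex.exp_conj, map_mul, map_div₀, Complex.conj_I, Complex.conj_ofReal, Complex.conj_ofNat,
    mul_neg]

/-- The phases serve exactly this: multiplication is symmetric and differentiation is skew, and
since `e^{πi/4} = i e^{-πi/4}` both acquire the same factor `i` when moved across the inner product.
-/
theorem ip_sympL (k : Fin n × Fin 2) (f g : Schw n) :
    ip (sympL k f) g = Complex.I * ip f (sympL k g) := by
  obtain ⟨j, p⟩ := k
  have e1 := conj_exp_pi_div_four
  have e2 : (starRingEnd ℂ) (Complex.exp (-(Real.pi / 4 * Complex.I))) =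
      Complex.exp (Real.pi / 4 * Complex.I) := by
    rw [← e1, Complex.conj_conj]
  have e3 := exp_pi_div_four
  have e4 : -Complex.exp (-(Real.pi / 4 * Complex.I)) =
      Complex.I * Complex.exp (Real.pi / 4 * Complex.I) := by
    rw [e3, ← mul_assoc, Complex.I_mul_I, neg_one_mul]
  generalize hx : Complex.exp (Real.pi / 4 * Complex.I) = x at *
  generalize hy : Complex.exp (-(Real.pi / 4 * Complex.I)) = y at *
  have h : p = 0 ∨ p = 1 := by omega
  rcases h with rfl | rfl
  · rw [sympL_zero, smul_apply, smul_apply, hx,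
      ip_smul_left, ip_smul_right, ip_partialL, e1, ← mul_assoc, ← e4]
    ring
  · rw [sympL_one, smul_apply, smul_apply, hy,
      ip_smul_left, ip_smul_right, ip_mulVarL, e2, ← mul_assoc, ← e3]

/-- The quadratic operator `½ ∑ S_{jk} Q_j Q_k` in the symplectic generators. -/
def quadL (S : Matrix (Fin n × Fin 2) (Fin n × Fin 2) ℝ) : Schw n →L[ℂ] Schw n :=
  ∑ j, ∑ k, ((1 / 2 * S j k : ℝ) : ℂ) • (sympL j).comp (sympL k)

theorem quadL_apply (S : Matrix (Fin n × Fin 2) (Fin n × Fin 2) ℝ) (f : Schw n) :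
    quadL S f = ∑ j, ∑ k, ((1 / 2 * S j k : ℝ) : ℂ) • sympL j (sympL k f) := by
  simp [quadL]

/-- Moving two generators across the inner product produces `i² = -1` and reverses their order; the
symmetry of `S` undoes the reversal. -/
theorem ip_quadL {S : Matrix (Fin n × Fin 2) (Fin n × Fin 2) ℝ} (hS : S.transpose = S)
    (f g : Schw n) : ip (quadL S f) g = -ip f (quadL S g) := by
  simp only [quadL_apply, ip_sum_left, ip_sum_right, ip_smul_left, ip_smul_right,
    Complex.conj_ofReal, ip_sympL]
  rw [Finset.sum_comm, ← Finset.sum_neg_distrib]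
  refine Finset.sum_congr rfl fun j _ => ?_
  rw [← Finset.sum_neg_distrib]
  refine Finset.sum_congr rfl fun k _ => ?_
  have hs : S k j = S j k := congrFun (congrFun hS j) k
  rw [hs]
  linear_combination ((1 / 2 * S j k : ℝ) : ℂ) * ip f (sympL j (sympL k g)) * Complex.I_mul_I

/-- Energy method: solutions of `u' = T u`, `T` skew, on an interval are determined by their initial
value. -/
theorem curve_eq_zero {T : Schw n → Schw n} (hT : ∀ f, ip (T f) f = -ip f (T f))
    {r : ℝ} {u : ℝ → Schw n} (hu : ∀ t ∈ Set.Ioo (-r) r, CurveDeriv u (T (u t)) t)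
    (h0 : u 0 = 0) : ∀ t ∈ Set.Ioo (-r) r, u t = 0 := by
  intro t ht
  have h0m : (0 : ℝ) ∈ Set.Ioo (-r) r := by
    constructor <;> nlinarith [ht.1, ht.2]
  have hd : ∀ s ∈ Set.Ioo (-r) r, HasDerivAt (fun s => ip (u s) (u s)) 0 s := by
    intro s hs
    have h := (hu s hs).ip (hu s hs)
    rwa [hT, add_neg_cancel] at h
  have := (convex_Ioo (-r) r).is_const_of_fderivWithin_eq_zero (𝕜 := ℝ)
    (f := fun s => ip (u s) (u s)) (fun s hs => (hd s hs).differentiableAt.differentiableWithinAt)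
    (fun s hs => by
      rw [fderivWithin_of_isOpen isOpen_Ioo hs, (hd s hs).hasFDerivAt.fderiv]; ext; simp)
    ht h0m
  refine eq_zero_of_ip_self ?_
  rw [this, h0, ip_zero_left]

end osc

/-! ### The Schwartz topology tested by differential operators with polynomial coefficients -/

section weyl
variable {n : ℕ}

/-- The algebra of differential operators with polynomial coefficients on Schwartz functions. -/
def weylAlg (n : ℕ) : Subalgebra ℂ (Module.End ℂ (Schw n)) :=
  Algebra.adjoin ℂ (Set.range (fun j : Fin n => (mulVarL j).toLinearMap) ∪
    Set.range (fun j : Fin n => (partialL j).toLinearMap))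

theorem mulVarL_mem (j : Fin n) : (mulVarL j).toLinearMap ∈ weylAlg n :=
  Algebra.subset_adjoin (Or.inl ⟨j, rfl⟩)

theorem partialL_mem (j : Fin n) : (partialL j).toLinearMap ∈ weylAlg n :=
  Algebra.subset_adjoin (Or.inr ⟨j, rfl⟩)

theorem sympL_mem (k : Fin n × Fin 2) : (sympL k).toLinearMap ∈ weylAlg n := by
  obtain ⟨j, p⟩ := k
  have h : p = 0 ∨ p = 1 := by omega
  rcases h with rfl | rfl
  · rw [sympL_zero]; exact (weylAlg n).smul_mem (partialL_mem j) _
  · rw [sympL_one]; exact (weylAlg n).smul_mem (mulVarL_mem j) _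

theorem quadL_mem (S : Matrix (Fin n × Fin 2) (Fin n × Fin 2) ℝ) :
    (quadL S).toLinearMap ∈ weylAlg n := by
  have : (quadL S).toLinearMap = ∑ j, ∑ k, ((1 / 2 * S j k : ℝ) : ℂ) •
      ((sympL j).toLinearMap * (sympL k).toLinearMap) := by
    ext f a
    simp [quadL_apply]
  rw [this]
  exact sum_mem fun j _ => sum_mem fun k _ =>
    (weylAlg n).smul_mem ((weylAlg n).mul_mem (sympL_mem j) (sympL_mem k)) _

theorem exists_iteratedLineDeriv_mem (l : ℕ) (v : Fin l → Fin n) :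
    ∃ w ∈ weylAlg n, ∀ f : Schw n,
      w f = ∂^{fun i => (EuclideanSpace.single (v i) (1 : ℝ) : EuclideanSpace ℝ (Fin n))} f := by
  induction l with
  | zero => exact ⟨1, (weylAlg n).one_mem, fun f => by simp⟩
  | succ l ih =>
    obtain ⟨w, hw, h⟩ := ih (fun i => v i.succ)
    refine ⟨(partialL (v 0)).toLinearMap * w, (weylAlg n).mul_mem (partialL_mem _) hw, fun f => ?_⟩
    rw [LineDeriv.iteratedLineDerivOp_succ_left]
    change partialL (v 0) (w f) = _
    rw [h]; rfl

/-- The weight is a polynomial, so multiplication by it is an element of `weylAlg`; it dominates the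
factor `‖a‖ ^ k` of the Schwartz seminorms. -/
theorem exists_weight_mem (k : ℕ) : ∃ w ∈ weylAlg n, ∀ (f : Schw n) a,
    w f a = ((1 + ‖a‖ ^ 2 : ℝ) ^ k : ℝ) * f a := by
  induction k with
  | zero => exact ⟨1, (weylAlg n).one_mem, fun f a => by simp⟩
  | succ k ih =>
    obtain ⟨w, hw, h⟩ := ih
    refine ⟨(1 + ∑ j, (mulVarL j).toLinearMap * (mulVarL j).toLinearMap) * w,
      (weylAlg n).mul_mem ((weylAlg n).add_mem (weylAlg n).one_mem (sum_mem fun j _ =>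
        (weylAlg n).mul_mem (mulVarL_mem j) (mulVarL_mem j))) hw, fun f a => ?_⟩
    have : ((1 + ∑ j, (mulVarL j).toLinearMap * (mulVarL j).toLinearMap :
        Module.End ℂ (Schw n)) * w) f = w f + ∑ j, mulVarL j (mulVarL j (w f)) := by
      simp [Module.End.mul_apply]
    rw [this]
    simp only [add_apply, sum_apply, mulVarL_apply, h]
    rw [EuclideanSpace.norm_sq_eq, pow_succ]
    simp only [Real.norm_eq_abs, sq_abs, ← mul_assoc, ← Finset.sum_mul]
    push_cast
    simp only [← pow_two]
    ring

/-- Each argument is expanded in the coordinate basis, and its coordinates are bounded by its norm.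
So finitely many iterated partial derivatives control the whole multilinear map. -/
theorem norm_iteratedFDeriv_le (l : ℕ) (f : Schw n) (a : EuclideanSpace ℝ (Fin n)) :
    ‖iteratedFDeriv ℝ l f a‖ ≤ ∑ v : Fin l → Fin n,
      ‖iteratedFDeriv ℝ l f a fun i => EuclideanSpace.single (v i) 1‖ := by
  refine ContinuousMultilinearMap.opNorm_le_bound (Finset.sum_nonneg fun _ _ => norm_nonneg _)
    fun m => ?_
  have hm : m = fun i => ∑ j, m i j • (EuclideanSpace.single j (1 : ℝ) :
      EuclideanSpace ℝ (Fin n)) := by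
    funext i
    ext k
    simp [Pi.single_apply]
  conv_lhs => rw [hm]
  rw [ContinuousMultilinearMap.map_sum, Finset.sum_mul]
  refine (norm_sum_le _ _).trans (Finset.sum_le_sum fun v _ => ?_)
  rw [ContinuousMultilinearMap.map_smul_univ, norm_smul, mul_comm]
  refine mul_le_mul_of_nonneg_left ?_ (norm_nonneg _)
  rw [norm_prod]
  exact Finset.prod_le_prod (fun _ _ => norm_nonneg _) fun i _ => PiLp.norm_apply_le (m i) (v i)

/-- Convergence to zero in Schwartz space can be tested uniformly after applying differential
operators with polynomial coefficients. -/
theorem tendsto_zero_of_weyl {g : ℝ → Schw n} {l : Filter ℝ}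
    (h : ∀ w ∈ weylAlg n, ∀ ε > 0, ∀ᶠ τ in l, ∀ a, ‖w (g τ) a‖ ≤ ε) : Tendsto g l (𝓝 0) := by
  rw [(schwartz_withSeminorms ℂ (EuclideanSpace ℝ (Fin n)) ℂ).tendsto_nhds]
  rintro ⟨k, m⟩ ε hε
  obtain ⟨wk, hwk, hk⟩ := exists_weight_mem (n := n) k
  choose w hw hwv using exists_iteratedLineDeriv_mem (n := n) m
  -- The summand `1` keeps `d` positive when there are no multi-indices, as for `n = 0` and `m > 0`.
  set d : ℝ := (Fintype.card (Fin m → Fin n) : ℝ) + 1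
  have hd : 0 < d := by positivity
  have key : ∀ᶠ τ in l, ∀ v, ∀ a, ‖(wk * w v) (g τ) a‖ ≤ ε / (2 * d) :=
    eventually_all.2 fun v => h _ ((weylAlg n).mul_mem hwk (hw v)) _ (by positivity)
  filter_upwards [key] with τ hτ
  rw [sub_zero]
  have hb : SchwartzMap.seminorm ℂ k m (g τ) ≤ ε / 2 := by
    refine SchwartzMap.seminorm_le_bound ℂ k m _ (by positivity) fun a => ?_
    calc ‖a‖ ^ k * ‖iteratedFDeriv ℝ m (g τ) a‖
        ≤ (1 + ‖a‖ ^ 2) ^ k * ∑ v : Fin m → Fin n, ‖iteratedFDeriv ℝ m (g τ) a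
            fun i => EuclideanSpace.single (v i) 1‖ := by
          refine mul_le_mul (pow_le_pow_left₀ (norm_nonneg _) ?_ k) (norm_iteratedFDeriv_le _ _ _)
            (norm_nonneg _) (by positivity)
          nlinarith [sq_nonneg (‖a‖ - 1), norm_nonneg a]
      _ = ∑ v : Fin m → Fin n, ‖(wk * w v) (g τ) a‖ := by
          rw [Finset.mul_sum]
          refine Finset.sum_congr rfl fun v _ => ?_
          rw [Module.End.mul_apply, hk, hwv, SchwartzMap.iteratedLineDerivOp_eq_iteratedFDeriv,
            norm_mul, Complex.norm_real, Real.norm_of_nonneg (by positivity)]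
      _ ≤ ∑ _v : Fin m → Fin n, ε / (2 * d) := Finset.sum_le_sum fun v _ => hτ v a
      _ ≤ ε / 2 := by
          rw [Finset.sum_const, Finset.card_univ, nsmul_eq_mul, mul_div_assoc', div_le_div_iff₀
            (by positivity) (by positivity)]
          have : (Fintype.card (Fin m → Fin n) : ℝ) ≤ d := by simp [d]
          nlinarith
  exact lt_of_le_of_lt hb (by linarith)

variable {I : Set ℝ} {u : ℝ → Schw n} {B : Module.End ℂ (Schw n)}

/-- Interchange of the time derivative with `∂_j`. The increment of `h` is the time integral of `k`;
differentiating under this integral in the direction `j`, with the constant bound as dominating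
function, gives the increment of `∂_j h`, and the fundamental theorem of calculus then gives its
time derivative. -/
theorem hasDerivAt_partialL (hI : IsOpen I) (hIc : Convex ℝ I) {h k : ℝ → Schw n} (j : Fin n)
    (hd : ∀ s ∈ I, ∀ a, HasDerivAt (fun s => h s a) (k s a) s)
    (hk : ∀ a, ContinuousOn (fun s => k s a) I)
    (hk' : ∀ a, ContinuousOn (fun s => partialL j (k s) a) I)
    (hb : ∃ C, ∀ s ∈ I, ∀ a, ‖partialL j (k s) a‖ ≤ C) :
    ∀ s ∈ I, ∀ a, HasDerivAt (fun s => partialL j (h s) a) (partialL j (k s) a) s := by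
  intro s hs a
  obtain ⟨C, hC⟩ := hb
  set e : EuclideanSpace ℝ (Fin n) := EuclideanSpace.single j 1
  have hsub : ∀ r ∈ I, Set.uIcc s r ⊆ I := fun r hr => by
    rw [← segment_eq_uIcc]; exact hIc.segment_subset hs hr
  have hline : ∀ (f : Schw n) (x : ℝ), HasDerivAt (fun x : ℝ => f (a + x • e))
      (partialL j f (a + x • e)) x := by
    intro f x
    rw [partialL_apply]
    have h1 : HasDerivAt (fun x : ℝ => a + x • e) e x := by
      simpa using ((hasDerivAt_id x).smul_const e).const_add a
    exact (f.hasFDerivAt (a + x • e)).comp_hasDerivAt x h1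
  have key : ∀ r ∈ I, partialL j (h r) a = partialL j (h s) a + ∫ q in s..r, partialL j (k q) a := by
    intro r hr
    have ftc : ∀ x : ℝ, h r (a + x • e) - h s (a + x • e) = ∫ q in s..r, k q (a + x • e) := by
      intro x
      rw [intervalIntegral.integral_eq_sub_of_hasDerivAt (fun q hq => hd q (hsub r hr hq) _)]
      exact ((hk _).mono (hsub r hr)).intervalIntegrable
    have h2 := (intervalIntegral.hasDerivAt_integral_of_dominated_loc_of_deriv_le
      (μ := MeasureTheory.volume) (𝕜 := ℝ) (s := Set.univ) (x₀ := (0 : ℝ))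
      (F := fun (x q : ℝ) => k q (a + x • e)) (F' := fun x q => partialL j (k q) (a + x • e))
      (a := s) (b := r) (bound := fun _ => C) univ_mem ?_ ?_ ?_ ?_ ?_ ?_).2
    · have h3 : HasDerivAt (fun x : ℝ => h r (a + x • e) - h s (a + x • e))
          (partialL j (h r) (a + (0 : ℝ) • e) - partialL j (h s) (a + (0 : ℝ) • e)) 0 :=
        (hline _ 0).sub (hline _ 0)
      simp only [ftc] at h3
      have h4 := h3.unique h2
      simp only [zero_smul, add_zero] at h4
      rw [← h4]; ring
    · exact Eventually.of_forall fun x =>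
        (((hk _).mono (hsub r hr)).intervalIntegrable (μ := MeasureTheory.volume)).aestronglyMeasurable_restrict_uIoc
    · exact ((hk _).mono (hsub r hr)).intervalIntegrable
    · exact (((hk' _).mono (hsub r hr)).intervalIntegrable (μ := MeasureTheory.volume)).aestronglyMeasurable_restrict_uIoc
    · exact Eventually.of_forall fun q hq x _ =>
        hC q (hsub r hr (Set.uIoc_subset_uIcc hq)) _
    · exact intervalIntegrable_const
    · exact Eventually.of_forall fun q _ x _ => hline _ x
  have hder : HasDerivAt (fun r => partialL j (h s) a + ∫ q in s..r, partialL j (k q) a)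
      (partialL j (k s) a) s := by
    refine HasDerivAt.const_add _ (intervalIntegral.integral_hasDerivAt_right ?_ ?_ ?_)
    · simp
    · exact (hk' a).stronglyMeasurableAtFilter hI s hs
    · exact (hk' a).continuousAt (hI.mem_nhds hs)
  refine hder.congr_of_eventuallyEq ?_
  filter_upwards [hI.mem_nhds hs] with r hr using key r hr

/-- Upgrades the pointwise equation from `u` to all `w u`: the generators of `weylAlg` are
multiplications, which are harmless, and partial derivatives, which are covered by
`hasDerivAt_partialL`. -/
theorem hasDerivAt_weyl (hI : IsOpen I) (hIc : Convex ℝ I) (hB : B ∈ weylAlg n)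
    (hb : ∀ w ∈ weylAlg n, ∃ C, ∀ s ∈ I, ∀ a, ‖w (u s) a‖ ≤ C)
    (hc : ∀ w ∈ weylAlg n, ∀ a, ContinuousOn (fun s => w (u s) a) I)
    (hd : ∀ s ∈ I, ∀ a, HasDerivAt (fun s => u s a) (B (u s) a) s) :
    ∀ w ∈ weylAlg n, ∀ s ∈ I, ∀ a, HasDerivAt (fun s => w (u s) a) (w (B (u s)) a) s := by
  -- An already treated operator `v` is kept on the right, so that in a product the factors can be
  -- added one after the other.
  suffices H : ∀ w ∈ weylAlg n, ∀ v ∈ weylAlg n,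
      (∀ s ∈ I, ∀ a, HasDerivAt (fun s => v (u s) a) (v (B (u s)) a) s) →
      (∀ s ∈ I, ∀ a, HasDerivAt (fun s => (w * v) (u s) a) ((w * v) (B (u s)) a) s) by
    intro w hw
    simpa using H w hw 1 (weylAlg n).one_mem hd
  intro w hw
  induction hw using Algebra.adjoin_induction with
  | mem x hx =>
    rcases hx with ⟨j, rfl⟩ | ⟨j, rfl⟩
    · intro v _ hv s hs a
      change HasDerivAt (fun s => mulVarL j (v (u s)) a) (mulVarL j (v (B (u s))) a) s
      simp only [mulVarL_apply]
      exact (hv s hs a).const_mul _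
    · intro v hvm hv
      have m1 : v * B ∈ weylAlg n := (weylAlg n).mul_mem hvm hB
      have m2 := (weylAlg n).mul_mem (partialL_mem j) m1
      exact hasDerivAt_partialL hI hIc j hv (hc _ m1) (hc _ m2) (hb _ m2)
  | algebraMap c =>
    intro v _ hv s hs a
    have : ∀ f : Schw n, (algebraMap ℂ (Module.End ℂ (Schw n)) c * v) f a = c * v f a :=
      fun f => rfl
    simp only [this]
    exact (hv s hs a).const_mul c
  | add x y _ _ hx hy =>
    intro v hvm hv s hs a
    simp only [add_mul]
    exact (hx v hvm hv s hs a).add (hy v hvm hv s hs a)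
  | mul x y hxm hym hx hy =>
    intro v hvm hv
    simp only [mul_assoc]
    exact hx (y * v) ((weylAlg n).mul_mem hym hvm) (hy v hvm hv)

/-- A curve satisfying `u' = B u` pointwise, all of whose images under differential operators with
polynomial coefficients are bounded and pointwise continuous, satisfies `u' = B u` in the topology of
Schwartz space. -/
theorem curveDeriv_of_pointwise (hI : IsOpen I) (hIc : Convex ℝ I) (hB : B ∈ weylAlg n)
    (hb : ∀ w ∈ weylAlg n, ∃ C, ∀ s ∈ I, ∀ a, ‖w (u s) a‖ ≤ C)
    (hc : ∀ w ∈ weylAlg n, ∀ a, ContinuousOn (fun s => w (u s) a) I)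
    (hd : ∀ s ∈ I, ∀ a, HasDerivAt (fun s => u s a) (B (u s) a) s) {t : ℝ} (ht : t ∈ I) :
    CurveDeriv u (B (u t)) t := by
  have hE := hasDerivAt_weyl hI hIc hB hb hc hd
  rw [CurveDeriv, ← tendsto_sub_nhds_zero_iff]
  refine tendsto_zero_of_weyl fun w hw ε hε => ?_
  have mB : w * B ∈ weylAlg n := (weylAlg n).mul_mem hw hB
  -- `C` bounds the second time derivative `w B² u` uniformly in space. The mean value inequality is
  -- used twice: it bounds the variation of the first derivative by `C|τ|`, and then the Taylor
  -- remainder by `C|τ|²`.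
  obtain ⟨C, hC⟩ := hb _ ((weylAlg n).mul_mem mB hB)
  have hC0 : 0 ≤ C := (norm_nonneg _).trans (hC t ht 0)
  have e1 : ∀ᶠ τ : ℝ in 𝓝[≠] 0, t + τ ∈ I := by
    refine nhdsWithin_le_nhds ?_
    have : Tendsto (fun τ : ℝ => t + τ) (𝓝 0) (𝓝 (t + 0)) := tendsto_const_nhds.add tendsto_id
    rw [add_zero] at this
    exact this (hI.mem_nhds ht)
  have e2 : ∀ᶠ τ : ℝ in 𝓝[≠] 0, C * |τ| < ε := by
    refine nhdsWithin_le_nhds ?_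
    have : Tendsto (fun τ : ℝ => C * |τ|) (𝓝 0) (𝓝 (C * |0|)) :=
      (continuous_const.mul continuous_abs).tendsto 0
    rw [abs_zero, mul_zero] at this
    exact this.eventually (gt_mem_nhds hε)
  filter_upwards [e1, e2, self_mem_nhdsWithin] with τ hτ hτε hτ0 a
  have hseg : segment ℝ t (t + τ) ⊆ I := hIc.segment_subset ht hτ
  have hle : ∀ s ∈ segment ℝ t (t + τ), ‖s - t‖ ≤ |τ| := by
    intro s hs
    have := norm_sub_le_of_mem_segment hs
    simpa using this
  have h1 : ∀ s ∈ segment ℝ t (t + τ), ‖(w * B) (u s) a - (w * B) (u t) a‖ ≤ C * |τ| := by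
    intro s hs
    refine ((convex_segment t (t + τ)).norm_image_sub_le_of_norm_hasDerivWithin_le
      (f := fun s => (w * B) (u s) a) (C := C)
      (fun x hx => (hE _ mB x (hseg hx) a).hasDerivWithinAt)
      (fun x hx => hC x (hseg hx) a) (left_mem_segment ℝ t (t + τ)) hs).trans ?_
    exact mul_le_mul_of_nonneg_left (hle s hs) hC0
  -- Subtracting the linear function with slope `w B u(t)` leaves a curve whose derivative is the
  -- variation bounded in `h1`.
  have h2 := (convex_segment t (t + τ)).norm_image_sub_le_of_norm_hasDerivWithin_le
      (f := fun s => w (u s) a - ((s : ℂ) * (w * B) (u t) a)) (C := C * |τ|)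
      (f' := fun s => (w * B) (u s) a - (w * B) (u t) a)
      (fun x hx => by
        refine (HasDerivAt.sub (hE _ hw x (hseg hx) a) ?_).hasDerivWithinAt
        simpa using (Complex.ofRealCLM.hasDerivAt (x := x)).mul_const ((w * B) (u t) a))
      h1 (left_mem_segment ℝ t (t + τ)) (right_mem_segment ℝ t (t + τ))
  have h3 : w (τ⁻¹ • (u (t + τ) - u t) - B (u t)) a = (τ : ℂ)⁻¹ *
      ((w (u (t + τ)) a - ((t + τ : ℝ) : ℂ) * (w * B) (u t) a) -
        (w (u t) a - (t : ℂ) * (w * B) (u t) a)) := by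
    have hτ0' : (τ : ℂ) ≠ 0 := by exact_mod_cast hτ0
    have : τ⁻¹ • (u (t + τ) - u t) = (τ : ℂ)⁻¹ • (u (t + τ) - u t) := by
      ext x; simp
    rw [this, map_sub, map_smul, map_sub]
    change (τ : ℂ)⁻¹ * (w (u (t + τ)) a - w (u t) a) - w (B (u t)) a = _
    rw [Module.End.mul_apply]
    push_cast
    field_simp
    ring
  rw [h3, norm_mul, norm_inv, Complex.norm_real]
  have hτp : 0 < ‖τ‖ := norm_pos_iff.2 hτ0
  rw [inv_mul_le_iff₀ hτp]
  refine h2.trans ?_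
  rw [add_sub_cancel_left, mul_comm]
  exact mul_le_mul_of_nonneg_left hτε.le hτp.le

end weyl

/-! ### Fourier integral operators with quadratic phase -/

section kernel
variable {n : ℕ}

theorem hasTemperateGrowth_cexp_mul_I :
    (fun x : ℝ => Complex.exp ((x : ℂ) * Complex.I)).HasTemperateGrowth := by
  have hs : ContDiff ℝ (⊤ : ℕ∞) (fun x : ℝ => Complex.exp ((x : ℂ) * Complex.I)) :=
    Complex.contDiff_exp.comp ((Complex.ofRealCLM.contDiff).mul contDiff_const)
  have hd : ∀ x : ℝ, HasDerivAt (fun x : ℝ => Complex.exp ((x : ℂ) * Complex.I))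
      (Complex.I * Complex.exp ((x : ℂ) * Complex.I)) x := by
    intro x
    have := ((Complex.ofRealCLM.hasDerivAt (x := x)).mul_const Complex.I).cexp
    simpa [mul_comm] using this
  have hi : ∀ k : ℕ, iteratedDeriv k (fun x : ℝ => Complex.exp ((x : ℂ) * Complex.I)) =
      fun x : ℝ => Complex.I ^ k * Complex.exp ((x : ℂ) * Complex.I) := by
    intro k
    induction k with
    | zero => simp
    | succ k ih =>
      rw [iteratedDeriv_succ, ih]
      ext x
      rw [((hd x).const_mul (Complex.I ^ k)).deriv, pow_succ]; ring
  refine ⟨hs, fun k => ⟨0, 1, fun x => ?_⟩⟩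
  rw [norm_iteratedFDeriv_eq_norm_iteratedDeriv, hi]
  simp [Complex.norm_exp_ofReal_mul_I]

/-- The quadratic form of a matrix. -/
def qform (P : Matrix (Fin n) (Fin n) ℝ) (a : EuclideanSpace ℝ (Fin n)) : ℝ :=
  ∑ j, ∑ k, a j * P j k * a k

theorem coord_hasTemperateGrowth (j : Fin n) :
    (fun a : EuclideanSpace ℝ (Fin n) => a j).HasTemperateGrowth :=
  (EuclideanSpace.proj (𝕜 := ℝ) j).hasTemperateGrowth

theorem qform_hasTemperateGrowth (P : Matrix (Fin n) (Fin n) ℝ) :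
    (qform P).HasTemperateGrowth := by
  have hj := coord_hasTemperateGrowth (n := n)
  unfold qform
  fun_prop (disch := assumption)

/-- The oscillating factor `exp (i q / 2)`. -/
def chirpFun (P : Matrix (Fin n) (Fin n) ℝ) (a : EuclideanSpace ℝ (Fin n)) : ℂ :=
  Complex.exp (((1 / 2 * qform P a : ℝ) : ℂ) * Complex.I)

theorem chirpFun_hasTemperateGrowth (P : Matrix (Fin n) (Fin n) ℝ) :
    (chirpFun P).HasTemperateGrowth := by
  have h1 := qform_hasTemperateGrowth P
  have h2 : (fun a => 1 / 2 * qform P a).HasTemperateGrowth := by fun_prop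
  exact hasTemperateGrowth_cexp_mul_I.comp h2

/-- Multiplication by `exp (i q / 2)`. -/
def chirp (P : Matrix (Fin n) (Fin n) ℝ) : Schw n →L[ℂ] Schw n :=
  SchwartzMap.smulLeftCLM ℂ (chirpFun P)

theorem chirp_apply (P : Matrix (Fin n) (Fin n) ℝ) (f : Schw n) (a : EuclideanSpace ℝ (Fin n)) :
    chirp P f a = chirpFun P a * f a :=
  SchwartzMap.smulLeftCLM_apply_apply (chirpFun_hasTemperateGrowth P) f a

theorem mulVarL_chirp (P : Matrix (Fin n) (Fin n) ℝ) (j : Fin n) (f : Schw n) :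
    mulVarL j (chirp P f) = chirp P (mulVarL j f) := by
  ext a
  rw [mulVarL_apply, chirp_apply, chirp_apply, mulVarL_apply]; ring

/-- The symmetric part of a matrix. -/
def symPart {ι : Type*} (P : Matrix ι ι ℝ) : Matrix ι ι ℝ := (1 / 2 : ℝ) • (P + P.transpose)

theorem symPart_symm {ι : Type*} (P : Matrix ι ι ℝ) (j k : ι) : symPart P j k = symPart P k j := by
  simp [symPart, add_comm]

theorem hasDerivAt_line (f : Schw n) (a : EuclideanSpace ℝ (Fin n)) (j : Fin n) :
    HasDerivAt (fun x : ℝ => f (a + x • EuclideanSpace.single j (1 : ℝ))) (partialL j f a) 0 := by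
  rw [partialL_apply]
  have h1 : HasDerivAt (fun x : ℝ => a + x • (EuclideanSpace.single j (1 : ℝ) :
      EuclideanSpace ℝ (Fin n))) (EuclideanSpace.single j (1 : ℝ)) 0 := by
    simpa using ((hasDerivAt_id (0 : ℝ)).smul_const
      (EuclideanSpace.single j (1 : ℝ) : EuclideanSpace ℝ (Fin n))).const_add a
  have h2 := f.hasFDerivAt (a + (0 : ℝ) • (EuclideanSpace.single j (1 : ℝ) :
      EuclideanSpace ℝ (Fin n)))
  have h3 := h2.comp_hasDerivAt (0 : ℝ) h1
  rw [zero_smul, add_zero] at h3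
  exact h3

/-- The gradient of a quadratic form sees only the symmetric part of its matrix. The matrices of the
Riccati system are not required to be symmetric, so `symPart` appears in all commutation rules. -/
theorem qform_line (P : Matrix (Fin n) (Fin n) ℝ) (a : EuclideanSpace ℝ (Fin n)) (j : Fin n) :
    HasDerivAt (fun x : ℝ => qform P (a + x • EuclideanSpace.single j (1 : ℝ)))
      (2 * ∑ k, symPart P j k * a k) 0 := by
  have h1 : ∀ i : Fin n, HasDerivAt (fun x : ℝ => (a + x • (EuclideanSpace.single j (1 : ℝ) :
      EuclideanSpace ℝ (Fin n))) i) (if i = j then 1 else 0) 0 := by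
    intro i
    have : (fun x : ℝ => (a + x • (EuclideanSpace.single j (1 : ℝ) :
      EuclideanSpace ℝ (Fin n))) i) = fun x => a i + x * (if i = j then 1 else 0) := by
      ext x; simp
    rw [this]
    simpa using ((hasDerivAt_id (0 : ℝ)).mul_const (if i = j then (1 : ℝ) else 0)).const_add (a i)
  have h2 : HasDerivAt (fun x : ℝ => qform P (a + x • EuclideanSpace.single j (1 : ℝ)))
      (∑ i, ∑ k, (((if i = j then (1 : ℝ) else 0) * P i k) * a k +
        (a i * P i k) * (if k = j then 1 else 0))) 0 := by
    unfold qform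
    refine HasDerivAt.fun_sum fun i _ => HasDerivAt.fun_sum fun k _ => ?_
    simpa using ((h1 i).mul_const (P i k)).fun_mul (h1 k)
  convert h2 using 1
  simp only [Finset.sum_add_distrib, ite_mul, one_mul, zero_mul, mul_ite, mul_one, mul_zero]
  rw [Finset.sum_comm]
  simp only [Finset.sum_ite_eq', Finset.mem_univ, if_true]
  rw [← Finset.sum_add_distrib, Finset.mul_sum]
  refine Finset.sum_congr rfl fun k _ => ?_
  simp [symPart]; ring

theorem partialL_chirp (P : Matrix (Fin n) (Fin n) ℝ) (j : Fin n) (f : Schw n) :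
    partialL j (chirp P f) = chirp P (partialL j f) +
      Complex.I • ∑ k, (symPart P j k : ℂ) • mulVarL k (chirp P f) := by
  ext a
  have h1 := hasDerivAt_line (chirp P f) a j
  have h2 : HasDerivAt (fun x : ℝ => chirpFun P (a + x • EuclideanSpace.single j (1 : ℝ)))
      (chirpFun P a * (((∑ k, symPart P j k * a k : ℝ) : ℂ) * Complex.I)) 0 := by
    have := (((qform_line P a j).const_mul (1 / 2 : ℝ)).ofReal_comp.mul_const Complex.I).cexp
    simp only [zero_smul, add_zero] at this
    rw [show 1 / 2 * (2 * ∑ k, symPart P j k * a k) = ∑ k, symPart P j k * a k by ring] at this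
    exact this
  have h3 := h2.mul (hasDerivAt_line f a j)
  simp only [chirp_apply] at h1
  have h4 := h1.unique h3
  rw [h4]
  simp only [add_apply, smul_apply, sum_apply, chirp_apply, mulVarL_apply, zero_smul, add_zero,
    smul_eq_mul]
  push_cast
  rw [add_comm, Finset.sum_mul, Finset.mul_sum, Finset.sum_mul, Finset.mul_sum]
  congr 1
  refine Finset.sum_congr rfl fun k _ => ?_
  ring

/-- The linear substitution by an invertible matrix. -/
theorem exists_dilation (R : Matrix (Fin n) (Fin n) ℝ) (hR : IsUnit R) :
    ∃ D : Schw n →L[ℂ] Schw n,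
      (∀ f a, D f a = f (WithLp.toLp 2 (R.transpose.mulVec a.ofLp))) ∧
      ∀ j f, partialL j (D f) = ∑ k, (R j k : ℂ) • D (partialL k f) := by
  have hu : IsUnit (Matrix.toEuclideanCLM (n := Fin n) (𝕜 := ℝ) R.transpose) :=
    (((Matrix.isUnit_transpose R).2 hR).map (Matrix.toEuclideanCLM (n := Fin n) (𝕜 := ℝ)))
  obtain ⟨U, hU⟩ := hu
  set g : EuclideanSpace ℝ (Fin n) ≃L[ℝ] EuclideanSpace ℝ (Fin n) := ContinuousLinearEquiv.ofUnit U
  have hg : ∀ a, g a = WithLp.toLp 2 (R.transpose.mulVec a.ofLp) := by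
    intro a
    change (U : EuclideanSpace ℝ (Fin n) →L[ℝ] EuclideanSpace ℝ (Fin n)) a = _
    rw [hU]; rfl
  refine ⟨SchwartzMap.compCLMOfContinuousLinearEquiv ℂ g, fun f a => ?_, fun j f => ?_⟩
  · rw [← hg]; rfl
  · have h := SchwartzMap.lineDerivOp_compCLMOfContinuousLinearEquiv ℂ
      (EuclideanSpace.single j (1 : ℝ)) g f
    change ∂_{EuclideanSpace.single j (1 : ℝ)} (SchwartzMap.compCLMOfContinuousLinearEquiv ℂ g f) = _
    rw [h]
    have hs : g (EuclideanSpace.single j (1 : ℝ)) =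
        ∑ k, R j k • (EuclideanSpace.single k (1 : ℝ) : EuclideanSpace ℝ (Fin n)) := by
      rw [hg]
      ext i
      simp [Matrix.mulVec, dotProduct, Pi.single_apply]
    ext a
    change (∂_{g (EuclideanSpace.single j (1 : ℝ))} f) (g a) = _
    rw [SchwartzMap.lineDerivOp_apply_eq_fderiv, hs, map_sum]
    simp only [sum_apply, smul_apply, map_smul]
    refine Finset.sum_congr rfl fun k _ => ?_
    change _ = (R j k : ℂ) • (partialL k f (g a))
    rw [partialL_apply]; simp


theorem partialL_fourierInv (j : Fin n) (f : Schw n) :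
    partialL j (𝓕⁻ f) = (2 * Real.pi * Complex.I) • 𝓕⁻ (mulVarL j f) := by
  change ∂_{EuclideanSpace.single j (1 : ℝ)} (𝓕⁻ f) = _
  rw [SchwartzMap.lineDerivOp_fourierInv_eq, FourierTransform.fourierInv_smul]
  congr 2
  ext a
  rw [SchwartzMap.smulLeftCLM_apply_apply (by fun_prop), mulVarL_apply]
  simp [EuclideanSpace.inner_single_right]

theorem fourierInv_partialL (j : Fin n) (f : Schw n) :
    𝓕⁻ (partialL j f) = -(2 * Real.pi * Complex.I) • mulVarL j (𝓕⁻ f) := by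
  change 𝓕⁻ (∂_{EuclideanSpace.single j (1 : ℝ)} f) = _
  rw [SchwartzMap.fourierInv_lineDerivOp_eq]
  congr 1
  ext a
  rw [SchwartzMap.smulLeftCLM_apply_apply (by fun_prop), mulVarL_apply]
  simp [EuclideanSpace.inner_single_right]

theorem fourier_partialL (j : Fin n) (f : Schw n) :
    𝓕 (partialL j f) = (2 * Real.pi * Complex.I) • mulVarL j (𝓕 f) := by
  change 𝓕 (∂_{EuclideanSpace.single j (1 : ℝ)} f) = _
  rw [SchwartzMap.fourier_lineDerivOp_eq]
  congr 1
  ext a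
  rw [SchwartzMap.smulLeftCLM_apply_apply (by fun_prop), mulVarL_apply]
  simp [EuclideanSpace.inner_single_right]

theorem partialL_fourier (j : Fin n) (f : Schw n) :
    partialL j (𝓕 f) = -(2 * Real.pi * Complex.I) • 𝓕 (mulVarL j f) := by
  change ∂_{EuclideanSpace.single j (1 : ℝ)} (𝓕 f) = _
  rw [SchwartzMap.lineDerivOp_fourier_eq, FourierTransform.fourier_smul]
  congr 2
  ext a
  rw [SchwartzMap.smulLeftCLM_apply_apply (by fun_prop), mulVarL_apply]
  simp [EuclideanSpace.inner_single_right]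

/-- The Fourier multiplier with an oscillating symbol. -/
def multiplier (Q : Matrix (Fin n) (Fin n) ℝ) : Schw n →L[ℂ] Schw n :=
  (FourierTransform.fourierInvCLM ℂ (Schw n)).comp
    ((chirp ((2 * Real.pi) ^ 2 • Q)).comp (FourierTransform.fourierCLM ℂ (Schw n)))

theorem multiplier_eq (Q : Matrix (Fin n) (Fin n) ℝ) (f : Schw n) :
    multiplier Q f = 𝓕⁻ (chirp ((2 * Real.pi) ^ 2 • Q) (𝓕 f)) := rfl

theorem two_pi_I_ne_zero : (2 * Real.pi * Complex.I : ℂ) ≠ 0 := Complex.two_pi_I_ne_zero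

theorem partialL_multiplier (Q : Matrix (Fin n) (Fin n) ℝ) (j : Fin n) (f : Schw n) :
    partialL j (multiplier Q f) = multiplier Q (partialL j f) := by
  rw [multiplier_eq, multiplier_eq, partialL_fourierInv, mulVarL_chirp, fourier_partialL, map_smul,
    FourierTransform.fourierInv_smul]

/-- On the Fourier side multiplication by a coordinate is a derivative, which also hits the
oscillating symbol. Formally `multiplier Q` is `exp (-(i/2) ∑ Q_kl ∂_k ∂_l)`, and the extra term is
its commutator with the coordinate. -/
theorem multiplier_mulVarL (Q : Matrix (Fin n) (Fin n) ℝ) (k : Fin n) (f : Schw n) :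
    multiplier Q (mulVarL k f) = mulVarL k (multiplier Q f) -
      Complex.I • ∑ l, (symPart Q k l : ℂ) • multiplier Q (partialL l f) := by
  have h1 : 𝓕 (mulVarL k f) = -(2 * Real.pi * Complex.I)⁻¹ • partialL k (𝓕 f) := by
    rw [partialL_fourier, smul_smul, neg_mul_neg, inv_mul_cancel₀ two_pi_I_ne_zero, one_smul]
  have h2 := partialL_chirp ((2 * Real.pi) ^ 2 • Q) k (𝓕 f)
  rw [← sub_eq_iff_eq_add] at h2
  have h3 : ∀ l, mulVarL l (chirp ((2 * Real.pi) ^ 2 • Q) (𝓕 f)) =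
      (2 * Real.pi * Complex.I)⁻¹ • chirp ((2 * Real.pi) ^ 2 • Q) (𝓕 (partialL l f)) := by
    intro l
    rw [mulVarL_chirp, fourier_partialL, map_smul, smul_smul,
      inv_mul_cancel₀ two_pi_I_ne_zero, one_smul]
  have h4 : ∀ l, symPart ((2 * Real.pi) ^ 2 • Q) k l = (2 * Real.pi) ^ 2 * symPart Q k l := by
    intro l; simp [symPart]; ring
  have h5 : ∀ g : Schw n, 𝓕⁻ g = FourierTransform.fourierInvCLM ℂ (Schw n) g := fun g => rfl
  rw [multiplier_eq, h1, map_smul, ← h2, FourierTransform.fourierInv_smul]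
  rw [h5, map_sub, map_smul, map_sum]
  simp only [map_smul, h3, h4]
  simp only [← h5, ← multiplier_eq]
  rw [fourierInv_partialL, smul_sub, smul_smul, neg_mul_neg, inv_mul_cancel₀ two_pi_I_ne_zero,
    one_smul, ← multiplier_eq, smul_smul, Finset.smul_sum, Finset.smul_sum]
  congr 1
  refine Finset.sum_congr rfl fun l _ => ?_
  rw [smul_smul, smul_smul, smul_smul]
  congr 1
  have := two_pi_I_ne_zero
  have hp : (Real.pi : ℂ) ≠ 0 := by exact_mod_cast Real.pi_ne_zero
  push_cast
  field_simp
  simp [Complex.I_sq]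

/-- The phase of the oscillating kernel. -/
def phase (P R Q : Matrix (Fin n) (Fin n) ℝ) (a ξ : EuclideanSpace ℝ (Fin n)) : ℝ :=
  1 / 2 * qform P a + 2 * Real.pi * (∑ j, ∑ k, a j * R j k * ξ k) +
    2 * Real.pi ^ 2 * qform Q ξ

/-- Existence of the Fourier integral operator with a quadratic phase, and its commutation rules. -/
theorem exists_kernel (P R Q : Matrix (Fin n) (Fin n) ℝ) (hR : IsUnit R) :
    ∃ K : Schw n →L[ℂ] Schw n,
      (∀ f a, K f a = ∫ ξ, Complex.exp ((phase P R Q a ξ : ℂ) * Complex.I) * 𝓕 f ξ) ∧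
      (∀ j f, partialL j (K f) = Complex.I • ∑ k, (symPart P j k : ℂ) • mulVarL k (K f) +
        ∑ k, (R j k : ℂ) • K (partialL k f)) ∧
      (∀ k f, K (mulVarL k f) = ∑ j, (R j k : ℂ) • mulVarL j (K f) -
        Complex.I • ∑ l, (symPart Q k l : ℂ) • K (partialL l f)) := by
  obtain ⟨D, hD, hD'⟩ := exists_dilation R hR
  have hDm : ∀ k f, D (mulVarL k f) = ∑ j, (R j k : ℂ) • mulVarL j (D f) := by
    intro k f
    ext a
    simp only [hD, mulVarL_apply, sum_apply, smul_apply, smul_eq_mul, Matrix.mulVec, dotProduct,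
      Matrix.transpose_apply]
    push_cast
    rw [Finset.sum_mul]
    exact Finset.sum_congr rfl fun j _ => by ring
  -- The three factors of the phase: a multiplication for `P`, a linear substitution for `R`, a
  -- Fourier multiplier for `Q`. In the Fourier inversion formula their exponentials multiply to the
  -- exponential of `phase`.
  refine ⟨(chirp P).comp (D.comp (multiplier Q)), fun f a => ?_, fun j f => ?_, fun k f => ?_⟩
  · change chirp P (D (multiplier Q f)) a = _
    rw [chirp_apply, hD, multiplier_eq, SchwartzMap.fourierInv_coe, Real.fourierInv_eq',
      ← MeasureTheory.integral_const_mul]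
    congr 1; ext ξ
    rw [chirp_apply, smul_eq_mul, ← mul_assoc, ← mul_assoc, chirpFun, chirpFun, ← Complex.exp_add,
      ← Complex.exp_add]
    congr 2
    rw [← add_mul, ← add_mul]
    congr 1
    have e1 : inner ℝ ξ (WithLp.toLp 2 (R.transpose.mulVec a.ofLp)) =
        ∑ j, ∑ k, a j * R j k * ξ k := by
      rw [PiLp.inner_apply, Finset.sum_comm]
      refine Finset.sum_congr rfl fun k _ => ?_
      simp only [Matrix.mulVec, dotProduct, Matrix.transpose_apply, RCLike.inner_apply, conj_trivial]
      rw [Finset.sum_mul]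
      exact Finset.sum_congr rfl fun j _ => by ring
    have e2 : qform ((2 * Real.pi) ^ 2 • Q) ξ = (2 * Real.pi) ^ 2 * qform Q ξ := by
      simp only [qform, Finset.mul_sum, Matrix.smul_apply, smul_eq_mul]
      exact Finset.sum_congr rfl fun j _ => Finset.sum_congr rfl fun k _ => by ring
    rw [e1, e2, phase]
    push_cast; ring
  · change partialL j (chirp P (D (multiplier Q f))) = _
    rw [partialL_chirp, hD', map_sum, add_comm]
    simp only [map_smul, partialL_multiplier]
    rfl
  · change chirp P (D (multiplier Q (mulVarL k f))) = _
    rw [multiplier_mulVarL, map_sub, map_sub, hDm, map_sum]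
    simp only [map_smul, map_sum, ← mulVarL_chirp]
    rfl

end kernel

/-! ### The Riccati system of a quadratic Hamiltonian -/

section riccati
variable {n : ℕ}

theorem partialL_mulVarL (j k : Fin n) (f : Schw n) :
    partialL j (mulVarL k f) = mulVarL k (partialL j f) + (if j = k then (1 : ℂ) else 0) • f := by
  have h := congrArg (fun T : SchwOp n => T.toEnd f) (partialD_mulVar j k)
  have h' : partialL j (mulVarL k f) - mulVarL k (partialL j f) =
      (if j = k then (1 : ℂ) else 0) • f := by
    refine Eq.trans h ?_
    split_ifs
    · rw [one_smul]; rfl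
    · rw [zero_smul]; rfl
  rw [← h']; abel

theorem exp_pi_div_four_mul_self : Complex.exp (Real.pi / 4 * Complex.I) *
    Complex.exp (Real.pi / 4 * Complex.I) = Complex.I := by
  rw [← Complex.exp_add]
  refine Eq.trans ?_ Complex.exp_pi_div_two_mul_I
  congr 1; ring

/-- The squares of the two phases are `i` and `-i`, and their product is `1`. Bringing the mixed
terms into the order multiplication after differentiation leaves the scalar term. -/
theorem quadL_eq (S : Matrix (Fin n × Fin 2) (Fin n × Fin 2) ℝ) (hS : S.transpose = S)
    (f : Schw n) : quadL S f =
      (Complex.I / 2) • (∑ j, ∑ k, (S (j, 0) (k, 0) : ℂ) • partialL j (partialL k f)) +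
      (∑ j, ∑ k, (S (k, 0) (j, 1) : ℂ) • mulVarL j (partialL k f)) +
      ((1 / 2 * ∑ j, S (j, 0) (j, 1) : ℝ) : ℂ) • f -
      (Complex.I / 2) • (∑ j, ∑ k, (S (j, 1) (k, 1) : ℂ) • mulVarL j (mulVarL k f)) := by
  have hs : ∀ j k, S (j, 1) (k, 0) = S (k, 0) (j, 1) := fun j k => congrFun (congrFun hS (k, 0)) (j, 1)
  have e1 := exp_pi_div_four_mul_self
  have e2 : Complex.exp (Real.pi / 4 * Complex.I) * Complex.exp (-(Real.pi / 4 * Complex.I)) = 1 := by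
    rw [← Complex.exp_add, add_neg_cancel, Complex.exp_zero]
  have e3 : Complex.exp (-(Real.pi / 4 * Complex.I)) * Complex.exp (-(Real.pi / 4 * Complex.I)) =
      -Complex.I := by
    have := exp_pi_div_four
    linear_combination (Complex.I * Complex.exp (-(Real.pi / 4 * Complex.I))) * this -
      Complex.I * e2 + Complex.exp (-(Real.pi / 4 * Complex.I)) *
        Complex.exp (-(Real.pi / 4 * Complex.I)) * Complex.I_sq
  rw [quadL_apply]
  simp only [Fintype.sum_prod_type, Fin.sum_univ_two, sympL_zero, sympL_one,
    FunLike.coe_smul, Pi.smul_apply, map_smul, smul_smul, hs]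
  ext a
  simp only [add_apply, sub_apply, smul_apply, sum_apply, smul_eq_mul, partialL_mulVarL,
    Finset.sum_add_distrib]
  generalize Complex.exp (Real.pi / 4 * Complex.I) = x at *
  generalize Complex.exp (-(Real.pi / 4 * Complex.I)) = y at *
  have c1 : ∀ j k, ((1 / 2 * S (j, 0) (k, 0) : ℝ) : ℂ) * x * x * partialL j (partialL k f) a =
      Complex.I / 2 * ((S (j, 0) (k, 0) : ℂ) * partialL j (partialL k f) a) := by
    intro j k; rw [mul_assoc _ x x, e1]; push_cast; ring
  have c4 : ∀ j k, ((1 / 2 * S (j, 1) (k, 1) : ℝ) : ℂ) * y * y * mulVarL j (mulVarL k f) a =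
      -(Complex.I / 2 * ((S (j, 1) (k, 1) : ℂ) * mulVarL j (mulVarL k f) a)) := by
    intro j k; rw [mul_assoc _ y y, e3]; push_cast; ring
  have c2 : ∀ j k, ((1 / 2 * S (j, 0) (k, 1) : ℝ) : ℂ) * y * x *
      (mulVarL k (partialL j f) a + (if j = k then (1 : ℂ) else 0) * f a) =
      1 / 2 * ((S (j, 0) (k, 1) : ℂ) * mulVarL k (partialL j f) a) +
        (if j = k then 1 / 2 * (S (j, 0) (k, 1) : ℂ) * f a else 0) := by
    intro j k; rw [mul_assoc _ y x, mul_comm y x, e2]; split_ifs <;> push_cast <;> ring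
  have c3 : ∀ j k, ((1 / 2 * S (k, 0) (j, 1) : ℝ) : ℂ) * x * y *
      (mulVarL j (partialL k f) a) =
      1 / 2 * ((S (k, 0) (j, 1) : ℂ) * mulVarL j (partialL k f) a) := by
    intro j k; rw [mul_assoc _ x y, e2]; push_cast; ring
  simp only [c1, c2, c3, c4, Finset.sum_add_distrib, Finset.sum_neg_distrib, ← Finset.mul_sum]
  simp only [Finset.sum_ite_eq, Finset.mem_univ, if_true]
  have c5 : ∑ j, ∑ k, (S (j, 0) (k, 1) : ℂ) * mulVarL k (partialL j f) a =
      ∑ j, ∑ k, (S (k, 0) (j, 1) : ℂ) * mulVarL j (partialL k f) a := Finset.sum_comm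
  have c6 : ∑ j, 1 / 2 * (S (j, 0) (j, 1) : ℂ) * f a =
      1 / 2 * (∑ j, (S (j, 0) (j, 1) : ℂ)) * f a := by
    rw [Finset.mul_sum, Finset.sum_mul]
  rw [c5, c6]
  push_cast
  ring

/-- The state space of the Riccati system. -/
abbrev RiccatiState (n : ℕ) :=
  (Fin n → Fin n → ℝ) × (Fin n → Fin n → ℝ) × (Fin n → Fin n → ℝ) × ℝ

/-- The vector field of the Riccati system of a quadratic Hamiltonian. -/
def riccatiField (α β γ : Matrix (Fin n) (Fin n) ℝ) (x : RiccatiState n) : RiccatiState n :=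
  (fun j k => (-(symPart (Matrix.of x.1) * α * symPart (Matrix.of x.1)) +
      (2 : ℝ) • (β * symPart (Matrix.of x.1)) - γ) j k,
    fun j k => (-(symPart (Matrix.of x.1) * α * Matrix.of x.2.1) + β * Matrix.of x.2.1) j k,
    fun j k => (-((Matrix.of x.2.1).transpose * α * Matrix.of x.2.1)) j k,
    (1 / 2 * β.trace - 1 / 2 * (α * symPart (Matrix.of x.1)).trace) * x.2.2.2)

theorem contDiff_riccatiField (α β γ : Matrix (Fin n) (Fin n) ℝ) :
    ContDiff ℝ 1 (riccatiField α β γ) := by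
  have hP : ∀ j k, ContDiff ℝ 1 fun x : RiccatiState n => x.1 j k := fun j k => by fun_prop
  have hR : ∀ j k, ContDiff ℝ 1 fun x : RiccatiState n => (Matrix.of x.2.1) j k := fun j k => by
    simp only [Matrix.of_apply]; fun_prop
  have hS : ∀ j k, ContDiff ℝ 1 fun x : RiccatiState n => symPart (Matrix.of x.1) j k :=
    fun j k => by
      simp only [symPart, Matrix.smul_apply, Matrix.add_apply, Matrix.transpose_apply,
        Matrix.of_apply]
      exact ((hP j k).add (hP k j)).const_smul _
  refine ContDiff.prodMk ?_ (ContDiff.prodMk ?_ (ContDiff.prodMk ?_ ?_))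
  · refine contDiff_pi.2 fun j => contDiff_pi.2 fun k => ?_
    simp only [Matrix.sub_apply, Matrix.add_apply, Matrix.neg_apply, Matrix.smul_apply,
      Matrix.mul_apply]
    fun_prop (disch := assumption)
  · refine contDiff_pi.2 fun j => contDiff_pi.2 fun k => ?_
    simp only [Matrix.add_apply, Matrix.neg_apply, Matrix.mul_apply]
    fun_prop (disch := assumption)
  · refine contDiff_pi.2 fun j => contDiff_pi.2 fun k => ?_
    simp only [Matrix.neg_apply, Matrix.mul_apply, Matrix.transpose_apply]
    fun_prop (disch := assumption)
  · simp only [Matrix.trace, Matrix.diag, Matrix.mul_apply]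
    fun_prop (disch := assumption)

/-- Local solutions of the Riccati system of a quadratic Hamiltonian. -/
theorem exists_riccati (α β γ : Matrix (Fin n) (Fin n) ℝ) :
    ∃ δ > 0, ∃ (P R Q : ℝ → Matrix (Fin n) (Fin n) ℝ) (c : ℝ → ℝ),
      P 0 = 0 ∧ R 0 = 1 ∧ Q 0 = 0 ∧ c 0 = 1 ∧ ∀ t ∈ Set.Icc (-δ) δ, IsUnit (R t) ∧
        (∀ j k, HasDerivAt (fun s => P s j k) ((-(symPart (P t) * α * symPart (P t)) +
          (2 : ℝ) • (β * symPart (P t)) - γ) j k) t) ∧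
        (∀ j k, HasDerivAt (fun s => R s j k)
          ((-(symPart (P t) * α * R t) + β * R t) j k) t) ∧
        (∀ j k, HasDerivAt (fun s => Q s j k) ((-((R t).transpose * α * R t)) j k) t) ∧
        HasDerivAt c ((1 / 2 * β.trace - 1 / 2 * (α * symPart (P t)).trace) * c t) t := by
  -- With the initial values `P = 0`, `R = 1`, `Q = 0`, `c = 1` the operator at time `0` is the
  -- identity, by Fourier inversion.
  obtain ⟨y, hy0, ε, hε, hy⟩ :=
    ((contDiff_riccatiField α β γ).contDiffAt (x := ((fun _ _ => 0, fun j k => (1 : Matrix (Fin n) (Fin n) ℝ) j k,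
      fun _ _ => 0, 1) : RiccatiState n))).exists_forall_mem_closedBall_exists_eq_forall_mem_Ioo_hasDerivAt₀ 0
  have hcont : ContinuousAt (fun t => Matrix.det (Matrix.of (y t).2.1)) 0 := by
    have h1 : ContinuousAt y 0 := (hy 0 (by simpa using hε)).continuousAt
    have h2 : ContinuousAt (fun t => Matrix.of (y t).2.1) 0 :=
      (continuous_fst.comp continuous_snd).continuousAt.comp h1
    exact (Continuous.matrix_det continuous_id).continuousAt.comp h2
  have hdet : ∀ᶠ t in 𝓝 (0 : ℝ), Matrix.det (Matrix.of (y t).2.1) ≠ 0 := by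
    refine hcont.eventually_ne ?_
    rw [hy0]
    change Matrix.det (1 : Matrix (Fin n) (Fin n) ℝ) ≠ 0
    rw [Matrix.det_one]; exact one_ne_zero
  obtain ⟨r, hr, hball⟩ := Metric.eventually_nhds_iff.1 hdet
  -- Half of the radius leaves a closed interval, whose compactness supplies the uniform bounds for
  -- `exists_local`.
  refine ⟨min r ε / 2, by positivity, fun t => Matrix.of (y t).1, fun t => Matrix.of (y t).2.1,
    fun t => Matrix.of (y t).2.2.1, fun t => (y t).2.2.2, by simp only [hy0]; rfl, by simp only [hy0]; rfl, by simp only [hy0]; rfl,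
    by simp only [hy0], fun t ht => ?_⟩
  have htr : |t| < r := by
    have : |t| ≤ min r ε / 2 := abs_le.2 ht
    have := min_le_left r ε
    have := lt_min hr hε
    linarith
  have htε : t ∈ Set.Ioo (0 - ε) (0 + ε) := by
    have : |t| ≤ min r ε / 2 := abs_le.2 ht
    have h1 := min_le_right r ε
    have h2 := lt_min hr hε
    have : |t| < ε := by linarith
    rw [zero_sub, zero_add]; exact abs_lt.1 this
  have hd := hy t htε
  have d1 : HasDerivAt (fun s => (y s).1) (riccatiField α β γ (y t)).1 t :=
    by simpa using hd.hasFDerivAt.fst.hasDerivAt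
  have d2 : HasDerivAt (fun s => (y s).2) (riccatiField α β γ (y t)).2 t :=
    by simpa using hd.hasFDerivAt.snd.hasDerivAt
  have d3 : HasDerivAt (fun s => (y s).2.1) (riccatiField α β γ (y t)).2.1 t :=
    by simpa using d2.hasFDerivAt.fst.hasDerivAt
  have d4 : HasDerivAt (fun s => (y s).2.2) (riccatiField α β γ (y t)).2.2 t :=
    by simpa using d2.hasFDerivAt.snd.hasDerivAt
  have d5 : HasDerivAt (fun s => (y s).2.2.1) (riccatiField α β γ (y t)).2.2.1 t :=
    by simpa using d4.hasFDerivAt.fst.hasDerivAt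
  have d6 : HasDerivAt (fun s => (y s).2.2.2) (riccatiField α β γ (y t)).2.2.2 t :=
    by simpa using d4.hasFDerivAt.snd.hasDerivAt
  refine ⟨?_, fun j k => ?_, fun j k => ?_, fun j k => ?_, d6⟩
  · rw [Matrix.isUnit_iff_isUnit_det, isUnit_iff_ne_zero]
    exact hball (by simpa using htr)
  · exact hasDerivAt_pi.1 (hasDerivAt_pi.1 d1 j) k
  · exact hasDerivAt_pi.1 (hasDerivAt_pi.1 d3 j) k
  · exact hasDerivAt_pi.1 (hasDerivAt_pi.1 d5 j) k

end riccati


/-! ### Time derivatives of the oscillating integrals -/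

section localsol
variable {n : ℕ}

/-- The sum of the absolute values of the entries of a matrix. -/
def entrySum (P : Matrix (Fin n) (Fin n) ℝ) : ℝ := ∑ j, ∑ k, |P j k|

theorem abs_bilin_le (P : Matrix (Fin n) (Fin n) ℝ) (a b : EuclideanSpace ℝ (Fin n)) :
    |∑ j, ∑ k, a j * P j k * b k| ≤ entrySum P * (‖a‖ * ‖b‖) := by
  rw [entrySum, Finset.sum_mul]
  refine (Finset.abs_sum_le_sum_abs _ _).trans (Finset.sum_le_sum fun j _ => ?_)
  rw [Finset.sum_mul]
  refine (Finset.abs_sum_le_sum_abs _ _).trans (Finset.sum_le_sum fun k _ => ?_)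
  have h1 : |a j| ≤ ‖a‖ := PiLp.norm_apply_le a j
  have h2 : |b k| ≤ ‖b‖ := PiLp.norm_apply_le b k
  rw [abs_mul, abs_mul, mul_comm |a j|, mul_assoc]
  exact mul_le_mul_of_nonneg_left (mul_le_mul h1 h2 (abs_nonneg _) (norm_nonneg _)) (abs_nonneg _)

theorem entrySum_nonneg (P : Matrix (Fin n) (Fin n) ℝ) : 0 ≤ entrySum P :=
  Finset.sum_nonneg fun _ _ => Finset.sum_nonneg fun _ _ => abs_nonneg _

/-- For fixed `a` the phase grows at most quadratically in `ξ`, with a constant controlled by the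
entries of the three matrices. Applied to their derivatives this is the domination in
`kernel_hasDerivAt`. -/
theorem abs_phase_le (P R Q : Matrix (Fin n) (Fin n) ℝ) (a ξ : EuclideanSpace ℝ (Fin n)) :
    |phase P R Q a ξ| ≤ (entrySum P + entrySum R + entrySum Q) *
      ((‖a‖ ^ 2 + 2 * Real.pi * ‖a‖ + 2 * Real.pi ^ 2) * (1 + ‖ξ‖ ^ 2)) := by
  have h1 := abs_bilin_le P a a
  have h2 := abs_bilin_le R a ξ
  have h3 := abs_bilin_le Q ξ ξ
  have hp := entrySum_nonneg P
  have hr := entrySum_nonneg R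
  have hq := entrySum_nonneg Q
  have hpi := Real.pi_pos
  have ha := norm_nonneg a
  have hx := norm_nonneg ξ
  have hx1 : ‖ξ‖ ≤ 1 + ‖ξ‖ ^ 2 := by nlinarith [sq_nonneg (‖ξ‖ - 1)]
  have hx2 : ‖ξ‖ ^ 2 ≤ 1 + ‖ξ‖ ^ 2 := by linarith
  have hx0 : 1 ≤ 1 + ‖ξ‖ ^ 2 := by nlinarith [sq_nonneg ‖ξ‖]
  set p := entrySum P
  set r := entrySum R
  set q := entrySum Q
  set X := 1 + ‖ξ‖ ^ 2
  have t1 : |1 / 2 * qform P a| ≤ p * (‖a‖ ^ 2 * X) := by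
    rw [abs_mul, abs_of_pos (by norm_num : (0 : ℝ) < 1 / 2), qform]
    have : p * (‖a‖ * ‖a‖) ≤ p * (‖a‖ ^ 2 * X) := by
      refine mul_le_mul_of_nonneg_left ?_ hp
      nlinarith [sq_nonneg ‖a‖]
    have h0 := abs_nonneg (∑ j, ∑ k, a j * P j k * a k)
    linarith
  have t2 : |2 * Real.pi * ∑ j, ∑ k, a j * R j k * ξ k| ≤ r * (2 * Real.pi * ‖a‖ * X) := by
    rw [abs_mul, abs_of_pos (by positivity : (0 : ℝ) < 2 * Real.pi)]
    calc _ ≤ 2 * Real.pi * (r * (‖a‖ * ‖ξ‖)) := mul_le_mul_of_nonneg_left h2 (by positivity)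
      _ = r * (2 * Real.pi * ‖a‖) * ‖ξ‖ := by ring
      _ ≤ r * (2 * Real.pi * ‖a‖) * X := mul_le_mul_of_nonneg_left hx1 (by positivity)
      _ = _ := by ring
  have t3 : |2 * Real.pi ^ 2 * qform Q ξ| ≤ q * (2 * Real.pi ^ 2 * X) := by
    rw [abs_mul, abs_of_pos (by positivity : (0 : ℝ) < 2 * Real.pi ^ 2), qform]
    calc _ ≤ 2 * Real.pi ^ 2 * (q * (‖ξ‖ * ‖ξ‖)) := mul_le_mul_of_nonneg_left h3 (by positivity)
      _ = q * (2 * Real.pi ^ 2) * ‖ξ‖ ^ 2 := by ring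
      _ ≤ q * (2 * Real.pi ^ 2) * X := mul_le_mul_of_nonneg_left hx2 (by positivity)
      _ = _ := by ring
  have := (abs_add_three (1 / 2 * qform P a) (2 * Real.pi * ∑ j, ∑ k, a j * R j k * ξ k)
    (2 * Real.pi ^ 2 * qform Q ξ))
  rw [phase]
  have hX0 : 0 ≤ X := by linarith
  have A : 0 ≤ ‖a‖ ^ 2 * X := by positivity
  have B : 0 ≤ 2 * Real.pi * ‖a‖ * X := by positivity
  have C : 0 ≤ 2 * Real.pi ^ 2 * X := by positivity
  calc _ ≤ _ := this
    _ ≤ p * (‖a‖ ^ 2 * X) + r * (2 * Real.pi * ‖a‖ * X) + q * (2 * Real.pi ^ 2 * X) := by linarith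
    _ ≤ _ := by
      nlinarith [mul_nonneg hp B, mul_nonneg hp C, mul_nonneg hr A, mul_nonneg hr C,
        mul_nonneg hq A, mul_nonneg hq B]

theorem continuous_phase (P R Q : Matrix (Fin n) (Fin n) ℝ) (a : EuclideanSpace ℝ (Fin n)) :
    Continuous fun ξ => phase P R Q a ξ := by
  unfold phase qform; fun_prop

theorem norm_kernel (P R Q : Matrix (Fin n) (Fin n) ℝ) (a ξ : EuclideanSpace ℝ (Fin n)) :
    ‖Complex.exp ((phase P R Q a ξ : ℂ) * Complex.I)‖ = 1 := Complex.norm_exp_ofReal_mul_I _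

theorem norm_kernel_integral_le (P R Q : Matrix (Fin n) (Fin n) ℝ) (f : Schw n)
    (a : EuclideanSpace ℝ (Fin n)) :
    ‖∫ ξ, Complex.exp ((phase P R Q a ξ : ℂ) * Complex.I) * 𝓕 f ξ‖ ≤ ∫ ξ, ‖𝓕 f ξ‖ := by
  refine (MeasureTheory.norm_integral_le_integral_norm _).trans_eq ?_
  simp only [norm_mul, norm_kernel, one_mul]

theorem integrable_weight (g : Schw n) :
    MeasureTheory.Integrable fun ξ : EuclideanSpace ℝ (Fin n) => (1 + ‖ξ‖ ^ 2) * ‖g ξ‖ := by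
  obtain ⟨w, -, hw⟩ := exists_weight_mem (n := n) 1
  have := ((w g).integrable (μ := MeasureTheory.volume)).norm
  refine this.congr (Eventually.of_forall fun ξ => ?_)
  simp only [hw, pow_one, norm_mul, Complex.norm_real]
  rw [Real.norm_of_nonneg (by positivity)]

variable {P R Q P' R' Q' : ℝ → Matrix (Fin n) (Fin n) ℝ} {δ : ℝ}

theorem phase_hasDerivAt {t : ℝ} (hP : ∀ j k, HasDerivAt (fun s => P s j k) (P' t j k) t)
    (hR : ∀ j k, HasDerivAt (fun s => R s j k) (R' t j k) t)
    (hQ : ∀ j k, HasDerivAt (fun s => Q s j k) (Q' t j k) t) (a ξ : EuclideanSpace ℝ (Fin n)) :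
    HasDerivAt (fun s => phase (P s) (R s) (Q s) a ξ) (phase (P' t) (R' t) (Q' t) a ξ) t := by
  unfold phase qform
  refine ((HasDerivAt.const_mul _ ?_).add (HasDerivAt.const_mul _ ?_)).add
    (HasDerivAt.const_mul _ ?_)
  · exact HasDerivAt.fun_sum fun j _ => HasDerivAt.fun_sum fun k _ =>
      ((hP j k).const_mul _).mul_const _
  · exact HasDerivAt.fun_sum fun j _ => HasDerivAt.fun_sum fun k _ =>
      ((hR j k).const_mul _).mul_const _
  · exact HasDerivAt.fun_sum fun j _ => HasDerivAt.fun_sum fun k _ =>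
      ((hQ j k).const_mul _).mul_const _

/-- Differentiation under the integral sign: the exponential has modulus one and the derivative of
the phase grows quadratically in `ξ`, which the decay of `𝓕 f` absorbs. -/
theorem kernel_hasDerivAt
    (hP : ∀ t ∈ Set.Icc (-δ) δ, ∀ j k, HasDerivAt (fun s => P s j k) (P' t j k) t)
    (hR : ∀ t ∈ Set.Icc (-δ) δ, ∀ j k, HasDerivAt (fun s => R s j k) (R' t j k) t)
    (hQ : ∀ t ∈ Set.Icc (-δ) δ, ∀ j k, HasDerivAt (fun s => Q s j k) (Q' t j k) t)
    (hM : ∃ M, ∀ t ∈ Set.Icc (-δ) δ, entrySum (P' t) + entrySum (R' t) + entrySum (Q' t) ≤ M)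
    {t : ℝ} (ht : t ∈ Set.Ioo (-δ) δ) (f : Schw n) (a : EuclideanSpace ℝ (Fin n)) :
    HasDerivAt (fun s => ∫ ξ, Complex.exp ((phase (P s) (R s) (Q s) a ξ : ℂ) * Complex.I) * 𝓕 f ξ)
      (∫ ξ, Complex.exp ((phase (P t) (R t) (Q t) a ξ : ℂ) * Complex.I) *
        ((phase (P' t) (R' t) (Q' t) a ξ : ℂ) * Complex.I * 𝓕 f ξ)) t := by
  obtain ⟨M, hM⟩ := hM
  have hmeas : ∀ P R Q : Matrix (Fin n) (Fin n) ℝ,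
      Continuous fun ξ => Complex.exp ((phase P R Q a ξ : ℂ) * Complex.I) := fun P R Q =>
    Complex.continuous_exp.comp
      ((Complex.continuous_ofReal.comp (continuous_phase P R Q a)).mul continuous_const)
  refine (hasDerivAt_integral_of_dominated_loc_of_deriv_le (𝕜 := ℝ)
    (F := fun s ξ => Complex.exp ((phase (P s) (R s) (Q s) a ξ : ℂ) * Complex.I) * 𝓕 f ξ)
    (F' := fun s ξ => Complex.exp ((phase (P s) (R s) (Q s) a ξ : ℂ) * Complex.I) *
        ((phase (P' s) (R' s) (Q' s) a ξ : ℂ) * Complex.I * 𝓕 f ξ))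
    (bound := fun ξ => M * (‖a‖ ^ 2 + 2 * Real.pi * ‖a‖ + 2 * Real.pi ^ 2) *
      ((1 + ‖ξ‖ ^ 2) * ‖𝓕 f ξ‖))
    (s := Set.Ioo (-δ) δ) (Ioo_mem_nhds ht.1 ht.2) ?_ ?_ ?_ ?_ ?_ ?_).2
  · exact Eventually.of_forall fun s =>
      ((hmeas _ _ _).mul (𝓕 f).continuous).aestronglyMeasurable
  · refine (𝓕 f).integrable.bdd_mul (hmeas _ _ _).aestronglyMeasurable
      (Eventually.of_forall fun ξ => (norm_kernel _ _ _ a ξ).le)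
  · exact ((hmeas _ _ _).mul (((Complex.continuous_ofReal.comp (continuous_phase _ _ _ a)).mul
      continuous_const).mul (𝓕 f).continuous)).aestronglyMeasurable
  · refine Eventually.of_forall fun ξ s hs => ?_
    rw [norm_mul, norm_kernel, one_mul, norm_mul, norm_mul, Complex.norm_I, mul_one,
      Complex.norm_real, Real.norm_eq_abs]
    have h1 := abs_phase_le (P' s) (R' s) (Q' s) a ξ
    have h2 := hM s (Set.Ioo_subset_Icc_self hs)
    rw [← mul_assoc]
    refine mul_le_mul_of_nonneg_right (h1.trans ?_) (norm_nonneg _)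
    rw [← mul_assoc]
    have hpi := Real.pi_pos
    exact mul_le_mul_of_nonneg_right (mul_le_mul_of_nonneg_right h2 (by positivity)) (by positivity)
  · exact (integrable_weight _).const_mul _
  · refine Eventually.of_forall fun ξ s hs => ?_
    have hs' := Set.Ioo_subset_Icc_self hs
    have h1 := ((phase_hasDerivAt (hP s hs') (hR s hs') (hQ s hs') a ξ).ofReal_comp.mul_const
      Complex.I).cexp.mul_const (𝓕 f ξ)
    simpa only [mul_assoc] using h1

/-- Derivative of the kernel operators with respect to the parameters of the phase, in terms of the
operators themselves. -/
theorem kernel_deriv_eq {P R Q P' R' Q' : Matrix (Fin n) (Fin n) ℝ} {K : Schw n →L[ℂ] Schw n}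
    (hK : ∀ f a, K f a = ∫ ξ, Complex.exp ((phase P R Q a ξ : ℂ) * Complex.I) * 𝓕 f ξ)
    (f : Schw n) (a : EuclideanSpace ℝ (Fin n)) :
    ∫ ξ, Complex.exp ((phase P R Q a ξ : ℂ) * Complex.I) *
        ((phase P' R' Q' a ξ : ℂ) * Complex.I * 𝓕 f ξ) =
      (Complex.I / 2 * qform P' a) * K f a +
        ∑ j, ∑ k, ((a j * R' j k : ℝ) : ℂ) * K (partialL k f) a -
        Complex.I / 2 * ∑ j, ∑ k, (Q' j k : ℂ) * K (partialL j (partialL k f)) a := by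
  -- The point `a` is frozen and enters `g` as a constant. The powers of `ξ` in the derivative of
  -- the phase are written as partial derivatives of `f`, so that `𝓕 g` is `i` times that derivative
  -- times `𝓕 f`.
  set g : Schw n := (Complex.I / 2 * qform P' a) • f +
    ∑ j, ∑ k, ((a j * R' j k : ℝ) : ℂ) • partialL k f -
    (Complex.I / 2) • ∑ j, ∑ k, (Q' j k : ℂ) • partialL j (partialL k f) with hg
  have hF : ∀ h : Schw n, 𝓕 h = FourierTransform.fourierCLM ℂ (Schw n) h := fun h => rfl
  have h1 : K g a = (Complex.I / 2 * qform P' a) * K f a +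
        ∑ j, ∑ k, ((a j * R' j k : ℝ) : ℂ) * K (partialL k f) a -
        Complex.I / 2 * ∑ j, ∑ k, (Q' j k : ℂ) * K (partialL j (partialL k f)) a := by
    simp only [hg, map_sub, map_add, map_smul, map_sum, add_apply, sub_apply, smul_apply,
      sum_apply, smul_eq_mul]
  rw [← h1, hK]
  congr 1; ext ξ
  congr 1
  have h2 : ∀ k, 𝓕 (partialL k f) ξ = 2 * Real.pi * Complex.I * (ξ k * 𝓕 f ξ) := by
    intro k; rw [fourier_partialL, smul_apply, mulVarL_apply, smul_eq_mul]
  have h3 : ∀ j k, 𝓕 (partialL j (partialL k f)) ξ =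
      -(4 * Real.pi ^ 2) * (ξ j * ξ k * 𝓕 f ξ) := by
    intro j k
    rw [fourier_partialL, smul_apply, mulVarL_apply, smul_eq_mul, h2]
    linear_combination (4 * Real.pi ^ 2 * (ξ j * ξ k * 𝓕 f ξ)) * Complex.I_sq
  have h4 : 𝓕 g ξ = (Complex.I / 2 * qform P' a) * 𝓕 f ξ +
        ∑ j, ∑ k, ((a j * R' j k : ℝ) : ℂ) * 𝓕 (partialL k f) ξ -
        Complex.I / 2 * ∑ j, ∑ k, (Q' j k : ℂ) * 𝓕 (partialL j (partialL k f)) ξ := by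
    rw [hF g]
    simp only [hg, map_sub, map_add, map_smul, map_sum, add_apply, sub_apply, smul_apply,
      sum_apply, smul_eq_mul, hF]
  rw [h4]
  simp only [h2, h3, phase, qform]
  push_cast
  simp only [add_mul, Finset.mul_sum, Finset.sum_mul]
  rw [sub_eq_add_neg]
  simp only [← Finset.sum_neg_distrib]
  congr 1
  · congr 1
    · refine Finset.sum_congr rfl fun j _ => Finset.sum_congr rfl fun k _ => ?_
      ring
    · refine Finset.sum_congr rfl fun j _ => Finset.sum_congr rfl fun k _ => ?_
      ring
  · refine Finset.sum_congr rfl fun j _ => Finset.sum_congr rfl fun k _ => ?_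
    ring

end localsol


/-! ### The algebraic identity behind the Riccati system -/

section localsol
variable {n : ℕ}

/-- The complex bilinear form of a real matrix. -/
def bil (M : Matrix (Fin n) (Fin n) ℝ) (u v : Fin n → ℂ) : ℂ :=
  ∑ j, ∑ k, u j * (M j k : ℂ) * v k

theorem bil_add (M N : Matrix (Fin n) (Fin n) ℝ) (u v : Fin n → ℂ) :
    bil (M + N) u v = bil M u v + bil N u v := by
  simp only [bil, Matrix.add_apply, Complex.ofReal_add, mul_add, add_mul, Finset.sum_add_distrib]

theorem bil_smul (c : ℝ) (M : Matrix (Fin n) (Fin n) ℝ) (u v : Fin n → ℂ) :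
    bil (c • M) u v = c * bil M u v := by
  simp only [bil, Matrix.smul_apply, smul_eq_mul, Complex.ofReal_mul, Finset.mul_sum]
  exact Finset.sum_congr rfl fun j _ => Finset.sum_congr rfl fun k _ => by ring

theorem bil_neg (M : Matrix (Fin n) (Fin n) ℝ) (u v : Fin n → ℂ) : bil (-M) u v = -bil M u v := by
  simpa using bil_smul (-1) M u v

theorem bil_sub (M N : Matrix (Fin n) (Fin n) ℝ) (u v : Fin n → ℂ) :
    bil (M - N) u v = bil M u v - bil N u v := by
  rw [sub_eq_add_neg, bil_add, bil_neg, sub_eq_add_neg]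

theorem bil_mul (M N : Matrix (Fin n) (Fin n) ℝ) (u v : Fin n → ℂ) :
    bil (M * N) u v = bil M u fun l => ∑ k, (N l k : ℂ) * v k := by
  simp only [bil, Matrix.mul_apply, Complex.ofReal_sum, Complex.ofReal_mul, Finset.mul_sum,
    Finset.sum_mul]
  refine Finset.sum_congr rfl fun j _ => ?_
  rw [Finset.sum_comm]
  exact Finset.sum_congr rfl fun l _ => Finset.sum_congr rfl fun k _ => by ring

theorem bil_mul' (M N : Matrix (Fin n) (Fin n) ℝ) (u v : Fin n → ℂ) :
    bil (M * N) u v = bil N (fun l => ∑ j, u j * (M j l : ℂ)) v := by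
  rw [bil_mul]
  simp only [bil, Finset.mul_sum, Finset.sum_mul]
  rw [Finset.sum_comm]
  refine Finset.sum_congr rfl fun l _ => ?_
  rw [Finset.sum_comm]
  exact Finset.sum_congr rfl fun k _ => Finset.sum_congr rfl fun j _ => by ring

theorem sum_four_rev {M : Type*} [AddCommMonoid M] (F : Fin n → Fin n → Fin n → Fin n → M) :
    ∑ l, ∑ m, ∑ k, ∑ j, F l m k j = ∑ j, ∑ k, ∑ m, ∑ l, F l m k j := by
  have h3 (G : Fin n → Fin n → Fin n → M) : ∑ m, ∑ k, ∑ j, G m k j = ∑ j, ∑ k, ∑ m, G m k j := by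
    rw [Finset.sum_congr rfl fun m _ => Finset.sum_comm, Finset.sum_comm]
    exact Finset.sum_congr rfl fun j _ => Finset.sum_comm
  rw [Finset.sum_congr rfl fun l _ => h3 (F l), Finset.sum_comm]
  refine Finset.sum_congr rfl fun j _ => ?_
  rw [Finset.sum_comm]
  exact Finset.sum_congr rfl fun k _ => Finset.sum_comm

/-- Here `y`, `y1`, `y2` stand for the values at `a` of `K f`, `K ∂_l f`, `K ∂_m ∂_l f`. The left
side is the time derivative of `c K f` divided by `c`; the right side is the quadratic operator
applied to `K f`, with the derivatives of `K f` resolved by the commutation rules. Comparing the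
coefficients of `y`, `y1` and `y2` is what dictates the vector field `riccatiField`. -/
theorem riccati_identity (α β γ Ps R : Matrix (Fin n) (Fin n) ℝ) (hα : α.transpose = α)
    (hPs : ∀ j k, Ps j k = Ps k j) (a : Fin n → ℂ) (y : ℂ) (y1 : Fin n → ℂ)
    (y2 : Fin n → Fin n → ℂ) :
    ((1 / 2 * β.trace - 1 / 2 * (α * Ps).trace : ℝ) : ℂ) * y +
      ((Complex.I / 2 * bil (-(Ps * α * Ps) + (2 : ℝ) • (β * Ps) - γ) a a) * y +
        bil (-(Ps * α * R) + β * R) a y1 -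
        Complex.I / 2 * ∑ j, ∑ k, ((-(R.transpose * α * R)) j k : ℂ) * y2 j k) =
      Complex.I / 2 * (∑ j, ∑ k, (α j k : ℂ) *
        (Complex.I * ((Ps k j : ℂ) * y + (∑ i, (Ps k i : ℂ) * a i) *
            (Complex.I * (∑ i, (Ps j i : ℂ) * a i) * y + ∑ l, (R j l : ℂ) * y1 l)) +
          ∑ l, (R k l : ℂ) * (Complex.I * (∑ i, (Ps j i : ℂ) * a i) * y1 l +
            ∑ m, (R j m : ℂ) * y2 m l))) +
      (∑ j, ∑ k, (β j k : ℂ) * (a j *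
        (Complex.I * (∑ i, (Ps k i : ℂ) * a i) * y + ∑ l, (R k l : ℂ) * y1 l))) +
      ((1 / 2 * ∑ j, β j j : ℝ) : ℂ) * y -
      Complex.I / 2 * (∑ j, ∑ k, (γ j k : ℂ) * (a j * (a k * y))) := by
  set p : Fin n → ℂ := fun k => ∑ i, (Ps k i : ℂ) * a i with hp
  set r : Fin n → ℂ := fun k => ∑ l, (R k l : ℂ) * y1 l with hr
  have hp' : (fun l => ∑ j, a j * (Ps j l : ℂ)) = p := by
    funext l
    exact Finset.sum_congr rfl fun j _ => by rw [hPs, mul_comm]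
  have hsym : bil α p r = bil α r p := by
    rw [bil, Finset.sum_comm]
    refine Finset.sum_congr rfl fun j _ => Finset.sum_congr rfl fun k _ => ?_
    rw [show α k j = α j k from congrFun (congrFun hα j) k]; ring
  have t1 : bil (-(Ps * α * Ps) + (2 : ℝ) • (β * Ps) - γ) a a =
      -bil α p p + 2 * bil β a p - bil γ a a := by
    rw [bil_sub, bil_add, bil_neg, bil_smul, bil_mul, bil_mul', bil_mul, hp']
    push_cast; rfl
  have t2 : bil (-(Ps * α * R) + β * R) a y1 = -bil α p r + bil β a r := by
    rw [bil_add, bil_neg, bil_mul, bil_mul', bil_mul, hp']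
  have t3 : ∑ j, ∑ k, ((-(R.transpose * α * R)) j k : ℂ) * y2 j k =
      -∑ j, ∑ k, (α j k : ℂ) * ∑ l, (R k l : ℂ) * ∑ m, (R j m : ℂ) * y2 m l := by
    simp only [Matrix.neg_apply, Matrix.mul_apply, Matrix.transpose_apply, Finset.mul_sum,
      Finset.sum_mul, Complex.ofReal_neg, Complex.ofReal_sum, Complex.ofReal_mul, neg_mul,
      Finset.sum_neg_distrib]
    rw [sum_four_rev]
    exact congrArg _ (Finset.sum_congr rfl fun j _ => Finset.sum_congr rfl fun k _ =>
      Finset.sum_congr rfl fun m _ => Finset.sum_congr rfl fun l _ => by ring)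
  have t4 : ((α * Ps).trace : ℂ) = ∑ j, ∑ k, (α j k : ℂ) * (Ps k j : ℂ) := by
    simp only [Matrix.trace, Matrix.diag, Matrix.mul_apply, Complex.ofReal_sum, Complex.ofReal_mul]
  have t5 : ∑ j, ∑ k, (α j k : ℂ) *
        (Complex.I * ((Ps k j : ℂ) * y + p k * (Complex.I * p j * y + r j)) +
          ∑ l, (R k l : ℂ) * (Complex.I * p j * y1 l + ∑ m, (R j m : ℂ) * y2 m l)) =
      Complex.I * (∑ j, ∑ k, (α j k : ℂ) * (Ps k j : ℂ)) * y - bil α p p * y +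
        Complex.I * bil α r p + Complex.I * bil α p r +
        ∑ j, ∑ k, (α j k : ℂ) * ∑ l, (R k l : ℂ) * ∑ m, (R j m : ℂ) * y2 m l := by
    simp only [bil, Finset.mul_sum (Finset.univ : Finset (Fin n)) _ Complex.I, Finset.sum_mul _ _ y,
      ← Finset.sum_add_distrib, ← Finset.sum_sub_distrib]
    refine Finset.sum_congr rfl fun j _ => Finset.sum_congr rfl fun k _ => ?_
    have : ∑ l, (R k l : ℂ) * (Complex.I * p j * y1 l + ∑ m, (R j m : ℂ) * y2 m l) =
        Complex.I * p j * r k + ∑ l, (R k l : ℂ) * ∑ m, (R j m : ℂ) * y2 m l := by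
      simp only [hr, mul_add, Finset.sum_add_distrib]
      rw [Finset.mul_sum (Finset.univ : Finset (Fin n)) _ (Complex.I * p j)]
      congr 1
      exact Finset.sum_congr rfl fun l _ => by ring
    rw [this]
    linear_combination (α j k : ℂ) * p k * p j * y * Complex.I_sq
  have t6 : ∑ j, ∑ k, (β j k : ℂ) * (a j * (Complex.I * p k * y + r k)) =
      Complex.I * bil β a p * y + bil β a r := by
    simp only [bil, Finset.mul_sum (Finset.univ : Finset (Fin n)) _ Complex.I, Finset.sum_mul _ _ y,
      ← Finset.sum_add_distrib]
    exact Finset.sum_congr rfl fun j _ => Finset.sum_congr rfl fun k _ => by ring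
  have t7 : ∑ j, ∑ k, (γ j k : ℂ) * (a j * (a k * y)) = bil γ a a * y := by
    simp only [bil, Finset.sum_mul]
    exact Finset.sum_congr rfl fun j _ => Finset.sum_congr rfl fun k _ => by ring
  rw [t1, t2, t3, t5, t6, t7, hsym]
  push_cast
  rw [t4]
  have : (β.trace : ℂ) = ∑ j, (β j j : ℂ) := by
    simp only [Matrix.trace, Matrix.diag, Complex.ofReal_sum]
  rw [this]
  linear_combination (-1 / 2 * (∑ j, ∑ k, (α j k : ℂ) * (Ps k j : ℂ)) * y
    - bil α r p) * Complex.I_sq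

end localsol


/-! ### Curves stable under polynomial differential operators -/

section comb
variable {n : ℕ} {J : Set ℝ} {K : ℝ → Schw n →L[ℂ] Schw n}

/-- Curves which are, on `J`, combinations of the curves `t ↦ K t f` with continuous coefficients. -/
inductive IsComb (J : Set ℝ) (K : ℝ → Schw n →L[ℂ] Schw n) : (ℝ → Schw n) → Prop
  | base (μ : ℝ → ℂ) (f : Schw n) (u : ℝ → Schw n) (hμ : ContinuousOn μ J)
      (hu : ∀ t ∈ J, u t = μ t • K t f) : IsComb J K u
  | add (u v w : ℝ → Schw n) (hu : IsComb J K u) (hv : IsComb J K v)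
      (hw : ∀ t ∈ J, w t = u t + v t) : IsComb J K w

namespace IsComb

theorem congr {u v : ℝ → Schw n} (hu : IsComb J K u) (h : ∀ t ∈ J, v t = u t) : IsComb J K v :=
  .add u (fun _ => 0) v hu (.base (fun _ => 0) 0 _ continuousOn_const fun t _ => by simp)
    fun t ht => by rw [h t ht, add_zero]

theorem smul {μ : ℝ → ℂ} (hμ : ContinuousOn μ J) {u : ℝ → Schw n} (hu : IsComb J K u) :
    IsComb J K fun t => μ t • u t := by
  induction hu with
  | base ν f u hν hu =>
    exact .base (fun t => μ t * ν t) f _ (hμ.mul hν) fun t ht => by rw [hu t ht, smul_smul]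
  | add u v w _ _ hw hu hv =>
    exact .add _ _ _ hu hv fun t ht => by rw [hw t ht, smul_add]

theorem sum {ι : Type*} (s : Finset ι) {u : ι → ℝ → Schw n} (hu : ∀ i ∈ s, IsComb J K (u i)) :
    IsComb J K fun t => ∑ i ∈ s, u i t := by
  classical
  induction s using Finset.induction_on with
  | empty => exact .base (fun _ => 0) 0 _ continuousOn_const fun t _ => by simp
  | insert i s hi ih =>
    refine .add (u i) _ _ (hu i (Finset.mem_insert_self i s))
      (ih fun j hj => hu j (Finset.mem_insert_of_mem hj)) fun t _ => ?_
    rw [Finset.sum_insert hi]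

theorem lin (T : Module.End ℂ (Schw n))
    (hT : ∀ f, IsComb J K fun t => T (K t f)) {u : ℝ → Schw n} (hu : IsComb J K u) :
    IsComb J K fun t => T (u t) := by
  induction hu with
  | base μ f u hμ hu => exact ((hT f).smul hμ).congr fun t ht => by rw [hu t ht, map_smul]
  | add u v w _ _ hw hu hv => exact .add _ _ _ hu hv fun t ht => by rw [hw t ht, map_add]

/-- Stability under the generators of `weylAlg` on the basic curves implies stability under the
whole algebra. Bounds and continuity for the curves `t ↦ K t f` alone then control every `w (u t)`,
as `curveDeriv_of_pointwise` requires. -/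
theorem weyl (hm : ∀ j f, IsComb J K fun t => mulVarL j (K t f))
    (hp : ∀ j f, IsComb J K fun t => partialL j (K t f)) {w : Module.End ℂ (Schw n)}
    (hw : w ∈ weylAlg n) : ∀ {u : ℝ → Schw n}, IsComb J K u → IsComb J K fun t => w (u t) := by
  induction hw using Algebra.adjoin_induction with
  | mem x hx =>
    intro u hu
    rcases hx with ⟨j, rfl⟩ | ⟨j, rfl⟩
    · exact lin _ (hm j) hu
    · exact lin _ (hp j) hu
  | algebraMap c => exact fun hu => hu.smul (continuousOn_const (c := c))
  | add x y _ _ hx hy => exact fun hu => .add _ _ _ (hx hu) (hy hu) fun t _ => rfl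
  | mul x y _ _ hx hy => exact fun hu => hx (hy hu)

theorem bounded (hJ : IsCompact J) (hK : ∀ f, ∃ C, ∀ t ∈ J, ∀ a, ‖K t f a‖ ≤ C)
    {u : ℝ → Schw n} (hu : IsComb J K u) : ∃ C, ∀ t ∈ J, ∀ a, ‖u t a‖ ≤ C := by
  induction hu with
  | base μ f u hμ hu =>
    obtain ⟨C, hC⟩ := hK f
    obtain ⟨D, hD⟩ := hJ.exists_bound_of_continuousOn hμ
    refine ⟨D * C, fun t ht a => ?_⟩
    rw [hu t ht, smul_apply, norm_smul]
    exact mul_le_mul (hD t ht) (hC t ht a) (norm_nonneg _) ((norm_nonneg _).trans (hD t ht))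
  | add u v w _ _ hw hu hv =>
    obtain ⟨C, hC⟩ := hu
    obtain ⟨D, hD⟩ := hv
    refine ⟨C + D, fun t ht a => ?_⟩
    rw [hw t ht, add_apply]
    exact (norm_add_le _ _).trans (add_le_add (hC t ht a) (hD t ht a))

theorem continuousOn (hK : ∀ f a, ContinuousOn (fun t => K t f a) J)
    {u : ℝ → Schw n} (hu : IsComb J K u) (a : EuclideanSpace ℝ (Fin n)) :
    ContinuousOn (fun t => u t a) J := by
  induction hu with
  | base μ f u hμ hu => exact (hμ.mul (hK f a)).congr fun t ht => by rw [hu t ht]; rfl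
  | add u v w _ _ hw hu hv => exact (hu.add hv).congr fun t ht => by rw [hw t ht]; rfl

end IsComb

end comb

/-! ### Local existence for quadratic Hamiltonians -/

section localsol
variable {n : ℕ}

/-- The solution is `u t = c t • K t f`. Multiplications and derivatives of `K t f` are combinations
of curves `K t g` with continuous coefficients, so the analytic hypotheses of
`curveDeriv_of_pointwise` hold; the pointwise equation is `riccati_identity`. The interval does not
depend on `f`, which makes the later extension possible. -/
theorem exists_local (S : Matrix (Fin n × Fin 2) (Fin n × Fin 2) ℝ) (hS : S.transpose = S) :
    ∃ δ > 0, ∀ f : Schw n, ∃ u : ℝ → Schw n, u 0 = f ∧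
      ∀ t ∈ Set.Ioo (-δ) δ, CurveDeriv u (quadL S (u t)) t := by
  set α : Matrix (Fin n) (Fin n) ℝ := fun j k => S (j, 0) (k, 0) with hα
  set β : Matrix (Fin n) (Fin n) ℝ := fun j k => S (k, 0) (j, 1) with hβ
  set γ : Matrix (Fin n) (Fin n) ℝ := fun j k => S (j, 1) (k, 1) with hγ
  have hαs : α.transpose = α := by
    ext j k; exact congrFun (congrFun hS (j, 0)) (k, 0)
  obtain ⟨δ, hδ, P, R, Q, c, hP0, hR0, hQ0, hc0, h⟩ := exists_riccati α β γ
  have hK : ∀ t, ∃ K : Schw n →L[ℂ] Schw n, t ∈ Set.Icc (-δ) δ →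
      (∀ f a, K f a = ∫ ξ, Complex.exp ((phase (P t) (R t) (Q t) a ξ : ℂ) * Complex.I) * 𝓕 f ξ) ∧
      (∀ j f, partialL j (K f) = Complex.I • ∑ k, (symPart (P t) j k : ℂ) • mulVarL k (K f) +
        ∑ k, (R t j k : ℂ) • K (partialL k f)) ∧
      (∀ k f, K (mulVarL k f) = ∑ j, (R t j k : ℂ) • mulVarL j (K f) -
        Complex.I • ∑ l, (symPart (Q t) k l : ℂ) • K (partialL l f)) := by
    intro t
    by_cases ht : t ∈ Set.Icc (-δ) δ
    · obtain ⟨K, hK⟩ := exists_kernel (P t) (R t) (Q t) (h t ht).1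
      exact ⟨K, fun _ => hK⟩
    · exact ⟨0, fun h => absurd h ht⟩
  choose K hK using hK
  have cP : ∀ j k, ContinuousOn (fun t => P t j k) (Set.Icc (-δ) δ) := fun j k t ht =>
    ((h t ht).2.1 j k).continuousAt.continuousWithinAt
  have cR : ∀ j k, ContinuousOn (fun t => R t j k) (Set.Icc (-δ) δ) := fun j k t ht =>
    ((h t ht).2.2.1 j k).continuousAt.continuousWithinAt
  have cQ : ∀ j k, ContinuousOn (fun t => Q t j k) (Set.Icc (-δ) δ) := fun j k t ht =>
    ((h t ht).2.2.2.1 j k).continuousAt.continuousWithinAt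
  have cc : ContinuousOn c (Set.Icc (-δ) δ) := fun t ht =>
    (h t ht).2.2.2.2.continuousAt.continuousWithinAt
  have cPs : ∀ j k, ContinuousOn (fun t => symPart (P t) j k) (Set.Icc (-δ) δ) := fun j k =>
    ((cP j k).add (cP k j)).const_smul (1 / 2 : ℝ)
  have cQs : ∀ j k, ContinuousOn (fun t => symPart (Q t) j k) (Set.Icc (-δ) δ) := fun j k =>
    ((cQ j k).add (cQ k j)).const_smul (1 / 2 : ℝ)
  have cRm : ContinuousOn R (Set.Icc (-δ) δ) :=
    continuousOn_pi.2 fun j => continuousOn_pi.2 fun k => cR j k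
  have cPm : ContinuousOn (fun t => symPart (P t)) (Set.Icc (-δ) δ) :=
    continuousOn_pi.2 fun j => continuousOn_pi.2 fun k => cPs j k
  have cRi : ∀ j k, ContinuousOn (fun t => (R t)⁻¹ j k) (Set.Icc (-δ) δ) := by
    intro j k
    simp only [Matrix.inv_def, Ring.inverse_eq_inv', Matrix.smul_apply, smul_eq_mul]
    refine ContinuousOn.mul (ContinuousOn.inv₀ ?_ fun t ht => ?_) ?_
    · exact (Continuous.matrix_det continuous_id).comp_continuousOn cRm
    · exact ((Matrix.isUnit_iff_isUnit_det _).1 (h t ht).1).ne_zero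
    · exact ((Continuous.matrix_adjugate continuous_id).matrix_elem j k).comp_continuousOn cRm
  have ofR : ∀ {g : ℝ → ℝ}, ContinuousOn g (Set.Icc (-δ) δ) →
      ContinuousOn (fun t => (g t : ℂ)) (Set.Icc (-δ) δ) := fun hg =>
    Complex.continuous_ofReal.comp_continuousOn hg
  have base : ∀ f, IsComb (Set.Icc (-δ) δ) K fun t => K t f := fun f =>
    .base (fun _ => 1) f _ continuousOn_const fun t _ => by simp
  have hm : ∀ j f, IsComb (Set.Icc (-δ) δ) K fun t => mulVarL j (K t f) := by
    intro j f
    -- The rule for `K (a_k f)` is a linear system for the functions `a_j K f` with matrix `R`; it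
    -- is solved by the inverse of `R`.
    have : IsComb (Set.Icc (-δ) δ) K fun t => ∑ k, ((R t)⁻¹ k j : ℂ) • (K t (mulVarL k f) +
        ∑ l, (Complex.I * (symPart (Q t) k l : ℂ)) • K t (partialL l f)) :=
      .sum _ fun k _ => .smul (ofR (cRi k j)) (.add _ _ _ (base _)
        (.sum _ fun l _ => .smul (continuousOn_const.mul (ofR (cQs k l))) (base _)) fun t _ => rfl)
    refine this.congr fun t ht => ?_
    have hi : R t * (R t)⁻¹ = 1 :=
      Matrix.mul_nonsing_inv _ ((Matrix.isUnit_iff_isUnit_det _).1 (h t ht).1)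
    have e : ∀ k, K t (mulVarL k f) +
        ∑ l, (Complex.I * (symPart (Q t) k l : ℂ)) • K t (partialL l f) =
        ∑ i, (R t i k : ℂ) • mulVarL i (K t f) := by
      intro k
      rw [(hK t ht).2.2 k f, Finset.smul_sum]
      simp only [smul_smul]
      abel
    simp only [e, Finset.smul_sum, smul_smul]
    rw [Finset.sum_comm]
    simp only [← Finset.sum_smul]
    have e2 : ∀ i, ∑ k, ((R t)⁻¹ k j : ℂ) * (R t i k : ℂ) = if i = j then 1 else 0 := by
      intro i
      have := congrFun (congrFun hi i) j
      rw [Matrix.mul_apply, Matrix.one_apply] at this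
      have := congrArg (Complex.ofReal) this
      push_cast at this
      rw [Finset.sum_congr rfl fun k _ => mul_comm _ _, this]
      split_ifs <;> simp
    simp [e2]
  have hp : ∀ j f, IsComb (Set.Icc (-δ) δ) K fun t => partialL j (K t f) := by
    intro j f
    have : IsComb (Set.Icc (-δ) δ) K fun t =>
        Complex.I • ∑ k, (symPart (P t) j k : ℂ) • mulVarL k (K t f) +
        ∑ k, (R t j k : ℂ) • K t (partialL k f) :=
      .add _ _ _ (.smul continuousOn_const (.sum _ fun k _ => .smul (ofR (cPs j k)) (hm k f)))
        (.sum _ fun k _ => .smul (ofR (cR j k)) (base _)) fun t _ => rfl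
    exact this.congr fun t ht => (hK t ht).2.1 j f
  have hKb : ∀ f, ∃ C, ∀ t ∈ Set.Icc (-δ) δ, ∀ a, ‖K t f a‖ ≤ C := fun f =>
    ⟨∫ ξ, ‖𝓕 f ξ‖, fun t ht a => by
      rw [(hK t ht).1]; exact norm_kernel_integral_le _ _ _ f a⟩
  have hKc : ∀ f a, ContinuousOn (fun t => K t f a) (Set.Icc (-δ) δ) := by
    intro f a
    have : ContinuousOn (fun t => ∫ ξ, Complex.exp ((phase (P t) (R t) (Q t) a ξ : ℂ) *
        Complex.I) * 𝓕 f ξ) (Set.Icc (-δ) δ) := by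
      refine MeasureTheory.continuousOn_of_dominated (bound := fun ξ => ‖𝓕 f ξ‖) ?_ ?_ ?_ ?_
      · intro t _
        have := continuous_phase (P t) (R t) (Q t) a
        exact Continuous.aestronglyMeasurable (by fun_prop)
      · intro t _
        exact Eventually.of_forall fun ξ => by rw [norm_mul, norm_kernel, one_mul]
      · exact ((𝓕 f).integrable (μ := MeasureTheory.volume)).norm
      · refine Eventually.of_forall fun ξ => ContinuousOn.mul ?_ continuousOn_const
        refine Complex.continuous_exp.comp_continuousOn (ContinuousOn.mul (ofR ?_) continuousOn_const)
        unfold phase qform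
        fun_prop (disch := assumption)
    exact this.congr fun t ht => (hK t ht).1 f a
  have hsub : Set.Ioo (-δ) δ ⊆ Set.Icc (-δ) δ := Set.Ioo_subset_Icc_self
  have h0 : (0 : ℝ) ∈ Set.Icc (-δ) δ := ⟨by linarith, hδ.le⟩
  refine ⟨δ, hδ, fun f => ⟨fun t => (c t : ℂ) • K t f, ?_, fun t ht => ?_⟩⟩
  · simp only [hc0, Complex.ofReal_one, one_smul]
    ext a
    rw [(hK 0 h0).1, hP0, hR0, hQ0]
    have : 𝓕⁻ (𝓕 f) a = f a := by
      rw [FourierTransform.fourierInv_fourier_eq]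
    rw [← this, SchwartzMap.fourierInv_coe, Real.fourierInv_eq']
    congr 1; ext ξ
    rw [smul_eq_mul]
    congr 3
    simp only [phase, qform, Matrix.zero_apply, Matrix.one_apply, PiLp.inner_apply]
    simp
  · have hw : IsComb (Set.Icc (-δ) δ) K fun t => (c t : ℂ) • K t f := (base f).smul (ofR cc)
    refine curveDeriv_of_pointwise (B := (quadL S).toLinearMap) isOpen_Ioo (convex_Ioo _ _)
      (quadL_mem S) ?_ ?_ ?_ ht
    · intro w hwm
      obtain ⟨C, hC⟩ := (hw.weyl hm hp hwm).bounded isCompact_Icc hKb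
      exact ⟨C, fun s hs => hC s (hsub hs)⟩
    · intro w hwm a
      exact ((hw.weyl hm hp hwm).continuousOn hKc a).mono hsub
    · intro s hs a
      have hs' := hsub hs
      have hM : ∃ M, ∀ t ∈ Set.Icc (-δ) δ,
          entrySum (-(symPart (P t) * α * symPart (P t)) + (2 : ℝ) • (β * symPart (P t)) - γ) +
          entrySum (-(symPart (P t) * α * R t) + β * R t) +
          entrySum (-((R t).transpose * α * R t)) ≤ M := by
        have hcont : ContinuousOn (fun t =>
          entrySum (-(symPart (P t) * α * symPart (P t)) + (2 : ℝ) • (β * symPart (P t)) - γ) +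
          entrySum (-(symPart (P t) * α * R t) + β * R t) +
          entrySum (-((R t).transpose * α * R t))) (Set.Icc (-δ) δ) := by
          simp only [entrySum, Matrix.sub_apply, Matrix.add_apply, Matrix.neg_apply,
            Matrix.smul_apply, Matrix.mul_apply, Matrix.transpose_apply, smul_eq_mul]
          fun_prop (disch := assumption)
        obtain ⟨M, hM⟩ := isCompact_Icc.exists_bound_of_continuousOn hcont
        exact ⟨M, fun t ht => (le_abs_self _).trans (hM t ht)⟩
      have hd := kernel_hasDerivAt (fun t ht => (h t ht).2.1) (fun t ht => (h t ht).2.2.1)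
        (fun t ht => (h t ht).2.2.2.1) hM hs f a
      rw [kernel_deriv_eq (hK s hs').1] at hd
      have hd2 := (h s hs').2.2.2.2.ofReal_comp.mul hd
      have heq : (fun t => ((c t : ℂ) • K t f) a) =ᶠ[𝓝 s] (fun t => (c t : ℂ) *
          ∫ ξ, Complex.exp ((phase (P t) (R t) (Q t) a ξ : ℂ) * Complex.I) * 𝓕 f ξ) := by
        filter_upwards [isOpen_Ioo.mem_nhds hs] with t ht'
        rw [← (hK t (hsub ht')).1]; rfl
      refine (hd2.congr_of_eventuallyEq heq).congr_deriv ?_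
      rw [← (hK s hs').1]
      have hK1 := (hK s hs').2.1
      have key := riccati_identity α β γ (symPart (P s)) (R s) hαs (symPart_symm _)
        (fun j => (a j : ℂ)) (K s f a) (fun l => K s (partialL l f) a)
        (fun j k => K s (partialL j (partialL k f)) a)
      change _ = (quadL S ((c s : ℂ) • K s f)) a
      rw [map_smul, smul_apply, smul_eq_mul, quadL_eq S hS]
      have d1 : ∀ j g, partialL j (K s g) a = Complex.I * (∑ i, (symPart (P s) j i : ℂ) * a i) *
          K s g a + ∑ l, (R s j l : ℂ) * K s (partialL l g) a := by
        intro j g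
        rw [hK1]
        simp only [add_apply, smul_apply, sum_apply, smul_eq_mul, mulVarL_apply, Finset.sum_mul,
          Finset.mul_sum]
        congr 1
        exact Finset.sum_congr rfl fun i _ => by ring
      have d2 : ∀ j k, partialL j (partialL k (K s f)) a =
        (Complex.I * ((symPart (P s) k j : ℂ) * K s f a + (∑ i, (symPart (P s) k i : ℂ) * a i) *
            (Complex.I * (∑ i, (symPart (P s) j i : ℂ) * a i) * K s f a +
              ∑ l, (R s j l : ℂ) * K s (partialL l f) a)) +
          ∑ l, (R s k l : ℂ) * (Complex.I * (∑ i, (symPart (P s) j i : ℂ) * a i) *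
            K s (partialL l f) a + ∑ m, (R s j m : ℂ) * K s (partialL m (partialL l f)) a)) := by
        intro j k
        rw [hK1 k f]
        simp only [map_add, map_smul, map_sum, partialL_mulVarL, add_apply, smul_apply, sum_apply,
          smul_eq_mul, mulVarL_apply, d1]
        congr 2
        simp only [mul_add, Finset.sum_add_distrib, ite_mul, one_mul, zero_mul, mul_ite, mul_zero]
        rw [Finset.sum_ite_eq, if_pos (Finset.mem_univ j), add_comm]
        congr 1
        simp only [← mul_assoc, ← Finset.sum_mul]
      simp only [add_apply, sub_apply, smul_apply, sum_apply, smul_eq_mul, mulVarL_apply, d2, d1]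
      refine Eq.trans ?_ (congrArg (fun z => (c s : ℂ) * z) key)
      have q : ∀ M : Matrix (Fin n) (Fin n) ℝ,
          (qform M a : ℂ) = bil M (fun j => (a j : ℂ)) (fun j => (a j : ℂ)) := by
        intro M; simp only [qform, bil]; push_cast; rfl
      have b : ∀ (M : Matrix (Fin n) (Fin n) ℝ) (y : Fin n → ℂ),
          ∑ j, ∑ k, ((a j * M j k : ℝ) : ℂ) * y k = bil M (fun j => (a j : ℂ)) y := by
        intro M y; simp only [bil]; push_cast; rfl
      rw [q, b _ fun k => K s (partialL k f) a]
      push_cast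
      ring

end localsol

/-! ### Global flows and their symplectic covariance -/

section flow
variable {n : ℕ}

theorem CurveDeriv.sub {u w : ℝ → Schw n} {v v' : Schw n} {t : ℝ} (hu : CurveDeriv u v t)
    (hw : CurveDeriv w v' t) : CurveDeriv (fun s => u s - w s) (v - v') t := by
  simpa [sub_eq_add_neg] using hu.add (hw.const_smul (-1))

theorem CurveDeriv.const_smulC {u : ℝ → Schw n} {v : Schw n} {t : ℝ} (hu : CurveDeriv u v t)
    (c : ℂ) : CurveDeriv (fun s => c • u s) (c • v) t :=
  hu.clm ((c • ContinuousLinearMap.id ℂ (Schw n)).restrictScalars ℝ)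

theorem CurveDeriv.sum {ι : Type*} (s : Finset ι) {u : ι → ℝ → Schw n} {v : ι → Schw n} {t : ℝ}
    (h : ∀ i ∈ s, CurveDeriv (u i) (v i) t) :
    CurveDeriv (fun r => ∑ i ∈ s, u i r) (∑ i ∈ s, v i) t := by
  classical
  induction s using Finset.induction_on with
  | empty => simpa using CurveDeriv.const (0 : Schw n)
  | insert i s hi ih =>
    simp only [Finset.sum_insert hi]
    exact (h i (Finset.mem_insert_self i s)).add
      (ih fun j hj => h j (Finset.mem_insert_of_mem hj))

variable {S : Matrix (Fin n × Fin 2) (Fin n × Fin 2) ℝ}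

theorem curve_unique (hS : S.transpose = S) {r : ℝ} {u v : ℝ → Schw n}
    (hu : ∀ t ∈ Set.Ioo (-r) r, CurveDeriv u (quadL S (u t)) t)
    (hv : ∀ t ∈ Set.Ioo (-r) r, CurveDeriv v (quadL S (v t)) t)
    (h0 : u 0 = v 0) {t : ℝ} (ht : t ∈ Set.Ioo (-r) r) : u t = v t :=
  sub_eq_zero.1 <| curve_eq_zero (T := fun f => quadL S f) (u := fun t => u t - v t)
    (fun f => ip_quadL hS f f) (fun t ht => by simpa using (hu t ht).sub (hv t ht))
    (by rw [h0, sub_self]) t ht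

/-- Two half-steps are composed. By the local group law, for `s` near `t` the composed curve at `s`
equals the solution starting from `w f (t / 2)`, evaluated at `s - t / 2`, and this has the right
derivative at `s = t`. -/
theorem exists_doubled (hS : S.transpose = S) {r : ℝ}
    (h : ∀ f : Schw n, ∃ u : ℝ → Schw n, u 0 = f ∧
      ∀ t ∈ Set.Ioo (-r) r, CurveDeriv u (quadL S (u t)) t) (f : Schw n) :
    ∃ u : ℝ → Schw n, u 0 = f ∧
      ∀ t ∈ Set.Ioo (-(2 * r)) (2 * r), CurveDeriv u (quadL S (u t)) t := by
  choose w w0 hw using h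
  have grp : ∀ a b : ℝ, |a| + |b| < r → ∀ f, w (w f b) a = w f (a + b) := by
    intro a b hab f
    refine curve_unique (S := S) (r := r - |b|) (v := fun s => w f (s + b)) hS (fun t ht => hw _ t ?_)
      (fun t ht => (hw f (t + b) ?_).shift b) ?_ ?_
    · exact ⟨by linarith [ht.1, abs_nonneg b], by linarith [ht.2, abs_nonneg b]⟩
    · exact ⟨by linarith [ht.1, neg_abs_le b], by linarith [ht.2, le_abs_self b]⟩
    · rw [w0, zero_add]
    · exact abs_lt.1 (by linarith)
  refine ⟨fun t => w (w f (t / 2)) (t / 2), by simp [w0], fun t ht => ?_⟩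
  have ht2 : |t / 2| < r := abs_lt.2 ⟨by linarith [ht.1], by linarith [ht.2]⟩
  have hd := (hw (w f (t / 2)) (t / 2) (abs_lt.1 ht2))
  have hd2 : CurveDeriv (fun s => w (w f (t / 2)) (s - t / 2))
      (quadL S (w (w f (t / 2)) (t / 2))) t := by
    have : CurveDeriv (fun s => w (w f (t / 2)) (s + -(t / 2)))
        (quadL S (w (w f (t / 2)) (t / 2))) t :=
      CurveDeriv.shift _ (by convert hd using 1; ring)
    simpa only [sub_eq_add_neg] using this
  refine hd2.congr ?_
  have hpos : 0 < r - |t / 2| := by linarith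
  filter_upwards [Metric.ball_mem_nhds t (half_pos hpos)] with s hs
  have hs' : |s - t| < (r - |t / 2|) / 2 := hs
  set ε := (s - t) / 2 with hε
  have hεa : |ε| = |s - t| / 2 := by rw [hε, abs_div, abs_two]
  have e1 : w f (s / 2) = w (w f (t / 2)) ε := by
    rw [grp _ _ (by linarith [abs_nonneg (t / 2)])]
    congr 1; rw [hε]; ring
  have e2 : |s / 2| ≤ |t / 2| + |ε| := by
    have : s / 2 = t / 2 + ε := by rw [hε]; ring
    rw [this]; exact abs_add_le _ _
  rw [e1, grp (s / 2) ε (by linarith [abs_nonneg (s - t)])]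
  congr 1; rw [hε]; ring

theorem exists_long (hS : S.transpose = S) (r : ℝ) (f : Schw n) : ∃ u : ℝ → Schw n, u 0 = f ∧
    ∀ t ∈ Set.Ioo (-r) r, CurveDeriv u (quadL S (u t)) t := by
  obtain ⟨δ, hδ, h⟩ := exists_local S hS
  have H : ∀ k : ℕ, ∀ f : Schw n, ∃ u : ℝ → Schw n, u 0 = f ∧
      ∀ t ∈ Set.Ioo (-(2 ^ k * δ)) (2 ^ k * δ), CurveDeriv u (quadL S (u t)) t := by
    intro k
    induction k with
    | zero => simpa using h
    | succ k ih =>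
      intro f
      have := exists_doubled hS ih f
      rwa [← mul_assoc, ← pow_succ'] at this
  obtain ⟨k, hk⟩ := pow_unbounded_of_one_lt (r / δ) one_lt_two
  obtain ⟨u, h0, hu⟩ := H k f
  have hr : r < 2 ^ k * δ := (div_lt_iff₀ hδ).1 hk
  exact ⟨u, h0, fun t ht => hu t ⟨by linarith [ht.1], by linarith [ht.2]⟩⟩

theorem exists_solution (hS : S.transpose = S) (f : Schw n) : ∃ u : ℝ → Schw n, u 0 = f ∧
    ∀ t, CurveDeriv u (quadL S (u t)) t := by
  choose w w0 hw using fun r => exists_long hS r f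
  have agree : ∀ r r' s, |s| < r → |s| < r' → w r s = w r' s := by
    intro r r' s h1 h2
    refine curve_unique (S := S) (r := min r r') hS (fun t ht => hw r t ?_) (fun t ht => hw r' t ?_)
      (by rw [w0, w0]) (abs_lt.1 (lt_min h1 h2))
    · exact abs_lt.1 ((abs_lt.2 ht).trans_le (min_le_left _ _))
    · exact abs_lt.1 ((abs_lt.2 ht).trans_le (min_le_right _ _))
  refine ⟨fun t => w (|t| + 1) t, w0 _, fun t => ?_⟩
  have h1 := hw (|t| + 2) t (abs_lt.1 (by linarith))
  rw [agree _ (|t| + 1) t (by linarith) (by linarith)] at h1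
  refine h1.congr ?_
  filter_upwards [Metric.ball_mem_nhds t one_pos] with s hs
  have hs' : |s - t| < 1 := hs
  have : |s| ≤ |t| + |s - t| := by simpa using abs_add_le t (s - t)
  exact agree _ _ _ (by linarith) (by linarith)

/-- `W` is the one-parameter group generated by the quadratic Hamiltonian with matrix `S`. -/
structure IsFlow (S : Matrix (Fin n × Fin 2) (Fin n × Fin 2) ℝ)
    (W : ℝ → Module.End ℂ (Schw n)) : Prop where
  symm : S.transpose = S
  zero : W 0 = 1
  deriv : ∀ f t, CurveDeriv (fun s => W s f) (quadL S (W t f)) t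

theorem curve_unique_global (hS : S.transpose = S) {u v : ℝ → Schw n}
    (hu : ∀ t, CurveDeriv u (quadL S (u t)) t) (hv : ∀ t, CurveDeriv v (quadL S (v t)) t)
    (h0 : u 0 = v 0) (t : ℝ) : u t = v t :=
  curve_unique hS (r := |t| + 1) (fun t _ => hu t) (fun t _ => hv t) h0 (abs_lt.1 (by linarith))

/-- The linearity of the solution in its initial value is an instance of uniqueness. -/
theorem exists_isFlow (hS : S.transpose = S) : ∃ W, IsFlow S W := by
  choose w w0 hw using exists_solution hS
  refine ⟨fun t => { toFun := fun f => w f t, map_add' := fun f g => ?_, map_smul' := fun c f => ?_ },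
    hS, ?_, fun f t => hw f t⟩
  · exact curve_unique_global hS (hw _) (v := fun t => w f t + w g t)
      (fun t => by simpa using (hw f t).add (hw g t)) (by simp [w0]) t
  · exact curve_unique_global hS (hw _) (v := fun t => c • w f t)
      (fun t => by simpa using (hw f t).const_smulC c) (by simp [w0]) t
  · ext f a; simp [w0]

namespace IsFlow
variable {W : ℝ → Module.End ℂ (Schw n)} (hW : IsFlow S W)
include hW

theorem unique_curve {u : ℝ → Schw n} (hu : ∀ t, CurveDeriv u (quadL S (u t)) t) (t : ℝ) :
    u t = W t (u 0) :=
  curve_unique_global hW.symm hu (hW.deriv _) (by simp [hW.zero]) t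

theorem add (s t : ℝ) : W (s + t) = W s * W t := by
  ext1 f
  exact hW.unique_curve (u := fun s => W (s + t) f) (fun r => (hW.deriv f (r + t)).shift t) s |>.trans
    (by simp)

theorem mul_neg (t : ℝ) : W t * W (-t) = 1 := by
  rw [← hW.add, add_neg_cancel, hW.zero]

theorem ip (f g : Schw n) (t : ℝ) : ip (W t f) (W t g) = SuperSpin.ip f g := by
  have hd : ∀ s, HasDerivAt (fun s => SuperSpin.ip (W s f) (W s g)) 0 s := by
    intro s
    have h := (hW.deriv f s).ip (hW.deriv g s)
    rwa [ip_quadL hW.symm, add_neg_cancel] at h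
  have := is_const_of_deriv_eq_zero (fun s => (hd s).differentiableAt) (fun s => (hd s).deriv) t 0
  simpa [hW.zero] using this

/-- The commutator of a quadratic expression with a generator is linear in the generators. Both
positions in the product contribute, and by the symmetry of `S` they contribute equally, which
cancels the factor `½`. -/
theorem quadL_comm_sympL (l : Fin n × Fin 2) (f : Schw n) :
    quadL S (sympL l f) = sympL l (quadL S f) + ∑ j, ((S * Omega n) j l : ℂ) • sympL j f := by
  have e : ∀ j k, sympL j (sympL k (sympL l f)) = sympL l (sympL j (sympL k f)) +
      ((Omega n j l : ℂ) • sympL k f + (Omega n k l : ℂ) • sympL j f) := by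
    intro j k
    rw [sympL_comm k l, map_add, map_smul, sympL_comm j l]
    abel
  simp only [quadL_apply, e, map_sum, map_smul, smul_add, Finset.sum_add_distrib, smul_smul]
  congr 1
  have h1 : ∑ j, ∑ k, (((1 / 2 * S j k : ℝ) : ℂ) * (Omega n j l : ℂ)) • sympL k f =
      ∑ j, ∑ k, (((1 / 2 * S j k : ℝ) : ℂ) * (Omega n k l : ℂ)) • sympL j f := by
    rw [Finset.sum_comm]
    refine Finset.sum_congr rfl fun j _ => Finset.sum_congr rfl fun k _ => ?_
    rw [show S k j = S j k from congrFun (congrFun hW.symm j) k]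
  rw [h1, ← Finset.sum_add_distrib]
  refine Finset.sum_congr rfl fun j _ => ?_
  rw [← Finset.sum_smul, ← add_smul, ← Finset.sum_add_distrib, Matrix.mul_apply]
  congr 1
  push_cast
  exact Finset.sum_congr rfl fun k _ => by ring

/-- Both sides solve the flow equation and agree at time `0`: the derivative of `M` supplies
precisely the commutator of `quadL_comm_sympL`. -/
theorem sympL_covariant {M : ℝ → Matrix (Fin n × Fin 2) (Fin n × Fin 2) ℝ} (h0 : M 0 = 1)
    (hM : ∀ t j k, HasDerivAt (fun s => M s j k) ((S * Omega n * M t) j k) t) (t : ℝ)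
    (k : Fin n × Fin 2) (f : Schw n) :
    W t (sympL k f) = ∑ j, (M t j k : ℂ) • sympL j (W t f) := by
  have key := hW.unique_curve (u := fun t => ∑ j, (M t j k : ℂ) • sympL j (W t f)) ?_ t
  · rw [key]
    congr 1
    simp [h0, hW.zero, Matrix.one_apply]
  · intro t
    have hc : ∀ j, CurveDeriv (fun s => (M s j k : ℂ) • sympL j (W s f))
        (((S * Omega n * M t) j k : ℂ) • sympL j (W t f) +
          (M t j k : ℂ) • sympL j (quadL S (W t f))) t := fun j =>
      CurveDeriv.smul (hM t j k) ((hW.deriv f t).clm ((sympL j).restrictScalars ℝ))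
    refine Eq.mp ?_ (CurveDeriv.sum Finset.univ fun j _ => hc j)
    congr 1
    simp only [map_sum, map_smul, hW.quadL_comm_sympL, smul_add, Finset.sum_add_distrib]
    rw [add_comm]
    congr 1
    simp only [Finset.smul_sum, smul_smul]
    rw [Finset.sum_comm]
    refine Finset.sum_congr rfl fun j _ => ?_
    rw [← Finset.sum_smul, Matrix.mul_apply]
    congr 1
    push_cast
    exact Finset.sum_congr rfl fun i _ => by ring

end IsFlow

end flow


/-! ### The Gaussian as vacuum vector, and rigidity of intertwiners -/

section gaussian
variable {n : ℕ}

theorem one_add_pow_mul_exp_le (p : ℕ) (r : ℝ) (hr : 0 ≤ r) :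
    (1 + r) ^ p * Real.exp (-(1 / 2) * r ^ 2) ≤ p.factorial * Real.exp (3 / 2) := by
  have h1 := Real.pow_div_factorial_le_exp (1 + r) (by positivity) p
  rw [div_le_iff₀ (by positivity)] at h1
  calc (1 + r) ^ p * Real.exp (-(1 / 2) * r ^ 2)
      ≤ (Real.exp (1 + r) * p.factorial) * Real.exp (-(1 / 2) * r ^ 2) := by gcongr
    _ = p.factorial * Real.exp (1 + r + -(1 / 2) * r ^ 2) := by
      rw [Real.exp_add (1 + r) (-(1 / 2) * r ^ 2)]; ring
    _ ≤ _ := by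
      gcongr
      nlinarith [sq_nonneg (r - 1)]

/-- The real Gaussian. -/
def gaussR (n : ℕ) : 𝓢(EuclideanSpace ℝ (Fin n), ℝ) where
  toFun a := Real.exp (-(1 / 2) * ‖a‖ ^ 2)
  smooth' := Real.contDiff_exp.comp (contDiff_const.mul (contDiff_norm_sq ℝ))
  decay' k p := by
    have ht : (fun a : EuclideanSpace ℝ (Fin n) => -(1 / 2) * ‖a‖ ^ 2).HasTemperateGrowth :=
      (Function.HasTemperateGrowth.const _).mul (Function.hasTemperateGrowth_norm_sq _)
    obtain ⟨K, C, hC, hK⟩ := ht.norm_iteratedFDeriv_le_uniform p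
    refine ⟨(p.factorial * (C + 1) ^ p) * ((k + K * p).factorial * Real.exp (3 / 2)), fun a => ?_⟩
    have hone : 1 ≤ (C + 1) * (1 + ‖a‖) ^ K :=
      one_le_mul_of_one_le_of_one_le (by linarith) (one_le_pow₀ (by linarith [norm_nonneg a]))
    -- All derivatives of `exp` are `exp`, and those of the exponent are polynomially bounded. As
    -- the bound is at least one, it may be raised to the power of the order, as the estimate for
    -- compositions demands.
    have h := norm_iteratedFDeriv_comp_le (𝕜 := ℝ) (n := p) (N := p) (g := Real.exp)
      (f := fun a : EuclideanSpace ℝ (Fin n) => -(1 / 2) * ‖a‖ ^ 2) Real.contDiff_exp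
      (contDiff_const.mul (contDiff_norm_sq ℝ)) le_rfl a
      (C := Real.exp (-(1 / 2) * ‖a‖ ^ 2)) (D := (C + 1) * (1 + ‖a‖) ^ K) (fun i _ => by
        rw [norm_iteratedFDeriv_eq_norm_iteratedDeriv, iteratedDeriv_eq_iterate,
          Real.iter_deriv_exp, Real.norm_of_nonneg (Real.exp_pos _).le])
      (fun i hi hip => (hK i hip a).trans <| by
        refine le_trans ?_ (le_self_pow₀ hone (by omega))
        gcongr; linarith)
    calc _ ≤ (1 + ‖a‖) ^ k * (p.factorial * Real.exp (-(1 / 2) * ‖a‖ ^ 2) *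
          ((C + 1) * (1 + ‖a‖) ^ K) ^ p) := by
            refine mul_le_mul ?_ h (norm_nonneg _) (by positivity)
            gcongr; linarith
      _ = (p.factorial * (C + 1) ^ p) *
          ((1 + ‖a‖) ^ (k + K * p) * Real.exp (-(1 / 2) * ‖a‖ ^ 2)) := by
            rw [mul_pow, ← pow_mul, pow_add]; ring
      _ ≤ _ := mul_le_mul_of_nonneg_left (one_add_pow_mul_exp_le _ _ (norm_nonneg a))
        (by positivity)

/-- The Gaussian `exp (-|a|² / 2)`. -/
def gauss (n : ℕ) : Schw n := SchwartzMap.postcompCLM (𝕜 := ℝ) Complex.ofRealCLM (gaussR n)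

theorem gauss_apply (a : EuclideanSpace ℝ (Fin n)) :
    gauss n a = (Real.exp (-(1 / 2) * ‖a‖ ^ 2) : ℝ) := by
  rw [gauss, SchwartzMap.postcompCLM_apply]; rfl

theorem gauss_ne_zero (a : EuclideanSpace ℝ (Fin n)) : gauss n a ≠ 0 := by
  rw [gauss_apply]; exact_mod_cast (Real.exp_pos _).ne'

theorem partialL_gauss (j : Fin n) : partialL j (gauss n) = -mulVarL j (gauss n) := by
  ext a
  have h1 := hasDerivAt_line (gauss n) a j
  have h2 : HasDerivAt (fun x : ℝ => gauss n (a + x • EuclideanSpace.single j (1 : ℝ)))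
      ((-(a j) * Real.exp (-(1 / 2) * ‖a‖ ^ 2) : ℝ)) 0 := by
    simp only [gauss_apply]
    have e : ∀ x : ℝ, ‖a + x • (EuclideanSpace.single j (1 : ℝ) : EuclideanSpace ℝ (Fin n))‖ ^ 2 =
        ‖a‖ ^ 2 + 2 * (x * a j) + x ^ 2 := by
      intro x
      rw [norm_add_sq_real, inner_smul_right, norm_smul, mul_pow, EuclideanSpace.inner_single_right]
      simp
    simp only [e]
    have : HasDerivAt (fun x : ℝ => -(1 / 2) * (‖a‖ ^ 2 + 2 * (x * a j) + x ^ 2)) (-(a j)) 0 := by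
      have h3 := ((((hasDerivAt_id (0 : ℝ)).mul_const (a j)).const_mul 2).const_add
        (‖a‖ ^ 2)).add ((hasDerivAt_id (0 : ℝ)).pow 2)
      refine (h3.const_mul (-(1 / 2))).congr_deriv ?_
      simp
    have h4 := this.exp.ofReal_comp
    refine h4.congr_deriv ?_
    simp [mul_comm]
  rw [h1.unique h2, neg_apply, mulVarL_apply, gauss_apply]
  push_cast; ring

theorem ip_gauss_ne_zero : ip (gauss n) (gauss n) ≠ 0 := fun h => by
  have := congrArg (fun f : Schw n => f 0) (eq_zero_of_ip_self h)
  exact gauss_ne_zero 0 this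

/-- Multiplication by the linear form with coefficients `ξ`. -/
def linForm (ξ : EuclideanSpace ℝ (Fin n)) : Schw n →L[ℂ] Schw n := ∑ j, (ξ j : ℂ) • mulVarL j

theorem linForm_apply (ξ : EuclideanSpace ℝ (Fin n)) (f : Schw n) (a : EuclideanSpace ℝ (Fin n)) :
    linForm ξ f a = (inner ℝ a ξ : ℝ) * f a := by
  simp only [linForm, sum_apply, smul_apply, mulVarL_apply, smul_eq_mul, PiLp.inner_apply]
  push_cast
  rw [Finset.sum_mul]
  refine Finset.sum_congr rfl fun j _ => ?_
  simp; ring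

theorem linForm_pow_apply (ξ : EuclideanSpace ℝ (Fin n)) (p : ℕ) (f : Schw n)
    (a : EuclideanSpace ℝ (Fin n)) :
    ((linForm ξ) ^ p) f a = (inner ℝ a ξ : ℝ) ^ p * f a := by
  induction p with
  | zero => simp
  | succ p ih =>
    rw [pow_succ', mul_apply_eq_comp, linForm_apply, ih]
    ring

/-- Completeness of polynomials times the Gaussian. The Fourier transform of `conj h` times the
Gaussian is expanded into the exponential series in `⟨a, ξ⟩`, and every term vanishes by hypothesis.
The decay of the Gaussian justifies exchanging sum and integral. -/
theorem eq_zero_of_ip_linForm_pow {h : Schw n}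
    (hh : ∀ ξ p, ip h (((linForm ξ) ^ p) (gauss n)) = 0) : h = 0 := by
  set k : Schw n := SchwartzMap.smulLeftCLM ℂ (gauss n) (conjS h) with hk
  have hka : ∀ a, k a = gauss n a * (starRingEnd ℂ) (h a) := by
    intro a
    rw [hk, SchwartzMap.smulLeftCLM_apply_apply (gauss n).hasTemperateGrowth, conjS_apply,
      smul_eq_mul]
  have hF : 𝓕 k = 0 := by
    ext ξ
    rw [SchwartzMap.fourier_coe, Real.fourier_eq']
    set c : ℝ := 2 * Real.pi * ‖ξ‖ with hc
    have hsum := MeasureTheory.hasSum_integral_of_dominated_convergence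
      (μ := MeasureTheory.volume)
      (F := fun (p : ℕ) (a : EuclideanSpace ℝ (Fin n)) =>
        ((-2 * Real.pi * inner ℝ a ξ : ℝ) * Complex.I) ^ p / (p.factorial : ℂ) * k a)
      (f := fun a => Complex.exp ((-2 * Real.pi * inner ℝ a ξ : ℝ) * Complex.I) * k a)
      (fun p a => (c * ‖a‖) ^ p / p.factorial * ‖k a‖) ?_ ?_ ?_ ?_ ?_
    · have hz : ∀ p : ℕ, ∫ a, ((-2 * Real.pi * inner ℝ a ξ : ℝ) * Complex.I) ^ p /
          (p.factorial : ℂ) * k a = 0 := by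
        intro p
        have := hh ξ p
        rw [ip_eq_integral] at this
        have e : ∀ a, ((-2 * Real.pi * inner ℝ a ξ : ℝ) * Complex.I) ^ p /
          (p.factorial : ℂ) * k a = ((-2 * Real.pi * Complex.I) ^ p / p.factorial) *
            ((starRingEnd ℂ) (h a) * ((linForm ξ) ^ p) (gauss n) a) := by
          intro a
          rw [linForm_pow_apply, hka]
          push_cast
          simp only [mul_pow]
          ring
        simp only [e]
        rw [MeasureTheory.integral_const_mul, this, mul_zero]
      simp only [hz] at hsum
      have := hsum.unique hasSum_zero
      exact this
    · intro p
      exact Continuous.aestronglyMeasurable (by fun_prop)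
    · intro p
      refine Eventually.of_forall fun a => ?_
      rw [norm_mul, norm_div, norm_pow, norm_mul, Complex.norm_I, mul_one, Complex.norm_real,
        Complex.norm_natCast]
      gcongr
      rw [norm_mul, norm_mul, Real.norm_eq_abs (-2), abs_neg, abs_two, Real.norm_of_nonneg Real.pi_pos.le,
        hc, mul_assoc (2 * Real.pi), mul_comm ‖ξ‖]
      gcongr
      exact norm_inner_le_norm a ξ
    · exact Eventually.of_forall fun a => (Real.summable_pow_div_factorial _).mul_right _
    · have e : (fun a => ∑' p : ℕ, (c * ‖a‖) ^ p / p.factorial * ‖k a‖) =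
          fun a => Real.exp (c * ‖a‖) * ‖k a‖ := by
        ext a
        rw [tsum_mul_right, Real.exp_eq_exp_ℝ, NormedSpace.exp_eq_tsum_div]
      rw [e]
      -- By completing the square, `c‖a‖ - ‖a‖²/2 ≤ c²/2`, so a multiple of `‖h‖` dominates.
      refine MeasureTheory.Integrable.mono'
        (((h.integrable (μ := MeasureTheory.volume)).norm).const_mul (Real.exp (c ^ 2 / 2)))
        (Continuous.aestronglyMeasurable (by fun_prop)) (Eventually.of_forall fun a => ?_)
      rw [Real.norm_of_nonneg (by positivity), hka, norm_mul, RCLike.norm_conj, gauss_apply,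
        Complex.norm_real, Real.norm_of_nonneg (Real.exp_pos _).le, ← mul_assoc, ← Real.exp_add]
      gcongr
      nlinarith [sq_nonneg (c - ‖a‖)]
    · refine Eventually.of_forall fun a => HasSum.mul_right _ ?_
      have := NormedSpace.expSeries_div_hasSum_exp (𝔸 := ℂ)
        ((-2 * Real.pi * inner ℝ a ξ : ℝ) * Complex.I)
      rwa [← Complex.exp_eq_exp_ℂ] at this
  have hk0 : k = 0 := by
    rw [← FourierTransform.fourierInv_fourier_eq (F := Schw n) k, hF]
    exact map_zero (FourierTransform.fourierInvCLM ℂ (Schw n))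
  ext a
  have h2 := congrArg (fun f : Schw n => f a) hk0
  simp only [hka] at h2
  have h3 := (mul_eq_zero.1 h2).resolve_left (gauss_ne_zero a)
  simpa using h3

/-- An isometric operator commuting with the multiplications, for which the Gaussian is an
eigenvector, is scalar. -/
theorem eq_smul_of_comm_mulVarL {Z : Module.End ℂ (Schw n)} (hip : ∀ f g, ip (Z f) (Z g) = ip f g)
    (hm : ∀ j f, Z (mulVarL j f) = mulVarL j (Z f)) {ζ : ℂ} (hζ : Z (gauss n) = ζ • gauss n)
    (f : Schw n) : Z f = ζ • f := by
  have hz : (starRingEnd ℂ) ζ * ζ = 1 := by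
    have := hip (gauss n) (gauss n)
    rw [hζ, ip_smul_left, ip_smul_right, ← mul_assoc] at this
    exact mul_right_cancel₀ ip_gauss_ne_zero (this.trans (one_mul _).symm)
  have hl : ∀ ξ g, Z (linForm ξ g) = linForm ξ (Z g) := by
    intro ξ g
    simp [linForm, hm]
  have hlp : ∀ ξ (p : ℕ) g, Z (((linForm ξ) ^ p) g) = ((linForm ξ) ^ p) (Z g) := by
    intro ξ p
    induction p with
    | zero => simp
    | succ p ih =>
      intro g
      rw [pow_succ', mul_apply_eq_comp, hl, ih]; rfl
  have hsa : ∀ ξ (p : ℕ) (g k : Schw n),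
      ip (((linForm ξ) ^ p) g) k = ip g (((linForm ξ) ^ p) k) := by
    intro ξ p g k
    rw [ip_eq_integral, ip_eq_integral]
    congr 1; ext a
    rw [linForm_pow_apply, linForm_pow_apply, map_mul, map_pow, Complex.conj_ofReal]; ring
  rw [← sub_eq_zero]
  -- Powers of linear forms are symmetric and commute with `Z`, so the pairing moves to `⟨Z L^p f,
  -- G⟩` with the Gaussian `G`. The isometry property and `Z G = ζ G` evaluate it, since `ζ` has
  -- modulus one.
  refine eq_zero_of_ip_linForm_pow fun ξ p => ?_
  rw [sub_eq_add_neg, ← neg_smul, ip_add_left, ip_smul_left, ← hsa, ← hlp, map_neg]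
  have h1 := hip (((linForm ξ) ^ p) f) (gauss n)
  rw [hζ, ip_smul_right, hsa] at h1
  rw [← h1]
  linear_combination -ip (Z (((linForm ξ) ^ p) f)) (gauss n) * hz

theorem Omega_transpose : (Omega n).transpose = -Omega n := by
  ext ⟨j, p⟩ ⟨k, q⟩
  have hp : p = 0 ∨ p = 1 := by omega
  have hq : q = 0 ∨ q = 1 := by omega
  by_cases h : j = k
  · rcases hp with rfl | rfl <;> rcases hq with rfl | rfl <;> simp [Omega, h]
  · simp [Omega, h, Ne.symm h]

theorem Omega_mul_self : Omega n * Omega n = -1 := by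
  ext ⟨j, p⟩ ⟨k, q⟩
  rw [Matrix.mul_apply, Fintype.sum_prod_type]
  have hp : p = 0 ∨ p = 1 := by omega
  have hq : q = 0 ∨ q = 1 := by omega
  by_cases h : j = k
  · rcases hp with rfl | rfl <;> rcases hq with rfl | rfl <;>
      simp [Omega, Fin.sum_univ_two, h]
  · simp [Omega, Fin.sum_univ_two, h]

theorem sympL_gauss (j : Fin n) :
    sympL (j, 1) (gauss n) = Complex.I • sympL (j, 0) (gauss n) := by
  rw [sympL_zero, sympL_one, smul_apply, smul_apply, partialL_gauss, exp_pi_div_four, smul_neg,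
    smul_neg, smul_smul, ← mul_assoc, Complex.I_mul_I, neg_one_mul, neg_smul, neg_neg]

/-- The vacuum condition in a form uniform in `k`: on the Gaussian the generators satisfy `Q = -i Ω
Q`. -/
theorem sympL_gauss_eq (k : Fin n × Fin 2) :
    sympL k (gauss n) = -Complex.I • ∑ i, (Omega n k i : ℂ) • sympL i (gauss n) := by
  obtain ⟨j, p⟩ := k
  have h : p = 0 ∨ p = 1 := by omega
  rcases h with rfl | rfl
  · simp [Fintype.sum_prod_type, Fin.sum_univ_two, Omega, sympL_gauss, ite_smul, smul_smul]
  · simp [Fintype.sum_prod_type, Fin.sum_univ_two, Omega, sympL_gauss, ite_smul]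

/-- The vacuum condition replaces the coefficients `½ S` by `-(i/2) S Ω`. As `S Ω` is antisymmetric,
only the commutators of the generators survive, and these are scalars that add up to the trace. -/
theorem quadL_gauss {S : Matrix (Fin n × Fin 2) (Fin n × Fin 2) ℝ}
    (hD : (S * Omega n).transpose = -(S * Omega n)) :
    quadL S (gauss n) = (-(Complex.I / 4) * (S.trace : ℂ)) • gauss n := by
  have hD' : ∀ i j, (S * Omega n) i j = -(S * Omega n) j i := fun i j => congrFun (congrFun hD j) i
  have h1 : quadL S (gauss n) = (-Complex.I / 2) •
      ∑ j, ∑ i, ((S * Omega n) j i : ℂ) • sympL j (sympL i (gauss n)) := by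
    rw [quadL_apply, Finset.smul_sum]
    refine Finset.sum_congr rfl fun j _ => ?_
    rw [Finset.sum_congr rfl fun k _ => by rw [sympL_gauss_eq k]]
    simp only [map_smul, map_sum, Finset.smul_sum, smul_smul]
    rw [Finset.sum_comm]
    refine Finset.sum_congr rfl fun i _ => ?_
    rw [← Finset.sum_smul, Matrix.mul_apply]
    congr 1
    push_cast
    rw [Finset.mul_sum]
    exact Finset.sum_congr rfl fun k _ => by ring
  have h2 : ∑ j, ∑ i, ((S * Omega n) j i : ℂ) • sympL j (sympL i (gauss n)) =
      (1 / 2 * ∑ j, ∑ i, ((S * Omega n) j i : ℂ) * (Omega n j i : ℂ)) • gauss n := by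
    set A := ∑ j, ∑ i, ((S * Omega n) j i : ℂ) • sympL j (sympL i (gauss n)) with hA
    have h3 : A = -A + (∑ j, ∑ i, ((S * Omega n) j i : ℂ) * (Omega n j i : ℂ)) • gauss n := by
      conv_lhs => rw [hA]
      rw [Finset.sum_congr rfl fun j _ => Finset.sum_congr rfl fun i _ => by
        rw [sympL_comm j i, smul_add, smul_smul]]
      simp only [Finset.sum_add_distrib, ← Finset.sum_smul]
      congr 1
      rw [Finset.sum_comm, hA, ← Finset.sum_neg_distrib]
      refine Finset.sum_congr rfl fun j _ => ?_
      rw [← Finset.sum_neg_distrib]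
      refine Finset.sum_congr rfl fun i _ => ?_
      rw [hD' i j]; push_cast; rw [neg_smul]
    have h4 : (2 : ℂ) • A =
        (∑ j, ∑ i, ((S * Omega n) j i : ℂ) * (Omega n j i : ℂ)) • gauss n := by
      rw [two_smul]
      nth_rewrite 1 [h3]
      abel
    rw [mul_smul, ← h4, smul_smul]; norm_num
  have h5 : ∑ j, ∑ i, (S * Omega n) j i * Omega n j i = S.trace := by
    have : Omega n * (Omega n).transpose = 1 := by
      rw [Omega_transpose, Matrix.mul_neg, Omega_mul_self, neg_neg]
    calc _ = ((S * Omega n) * (Omega n).transpose).trace := by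
          simp [Matrix.trace, Matrix.mul_apply (M := S * Omega n)]
      _ = _ := by rw [Matrix.mul_assoc, this, Matrix.mul_one]
  rw [h1, h2, smul_smul, ← h5]
  congr 1
  push_cast
  ring

theorem IsFlow.gauss {S : Matrix (Fin n × Fin 2) (Fin n × Fin 2) ℝ}
    {W : ℝ → Module.End ℂ (Schw n)} (hW : IsFlow S W)
    (hD : (S * Omega n).transpose = -(S * Omega n)) (t : ℝ) :
    W t (SuperSpin.gauss n) = Complex.exp (-(Complex.I / 4) * (S.trace : ℂ) * t) • gauss n := by
  have key := hW.unique_curve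
    (u := fun t : ℝ => Complex.exp (-(Complex.I / 4) * (S.trace : ℂ) * t) • SuperSpin.gauss n) ?_ t
  · rw [key]; simp
  · intro t
    rw [map_smul, quadL_gauss hD, smul_smul]
    have hd : HasDerivAt (fun t : ℝ => Complex.exp (-(Complex.I / 4) * (S.trace : ℂ) * t))
        (Complex.exp (-(Complex.I / 4) * (S.trace : ℂ) * t) * (-(Complex.I / 4) * (S.trace : ℂ)))
        t := by
      have := ((Complex.ofRealCLM.hasDerivAt (x := t)).const_mul
        (-(Complex.I / 4) * (S.trace : ℂ))).cexp
      simpa using this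
    have h2 := hasDerivAt_iff_tendsto_slope_zero.1 hd
    refine (h2.smul_const (SuperSpin.gauss n)).congr fun τ => ?_
    rw [smul_assoc, sub_smul]

end gaussian

/-! ### Unitary matrices, and compact flows with the same symplectic matrix -/

section unitary
variable {n : ℕ}

theorem det_exp_of_isHermitian {ι : Type*} [Fintype ι] [DecidableEq ι] {H : Matrix ι ι ℂ}
    (hH : H.IsHermitian) (c : ℂ) :
    (NormedSpace.exp (c • H)).det = Complex.exp (c * H.trace) := by
  set U : Matrix ι ι ℂ := hH.eigenvectorUnitary.1 with hU
  have hinv : U * star U = 1 := Unitary.coe_mul_star_self hH.eigenvectorUnitary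
  have hinv' : U⁻¹ = star U := Matrix.inv_eq_right_inv hinv
  have hUu : IsUnit U := IsUnit.of_mul_eq_one _ hinv
  have h := hH.spectral_theorem
  rw [Unitary.conjStarAlgAut_apply] at h
  have h2 : c • H = U * Matrix.diagonal (fun i => c * (hH.eigenvalues i : ℂ)) * U⁻¹ := by
    conv_lhs => rw [h]
    rw [hinv', ← Matrix.smul_mul, ← Matrix.mul_smul, ← Matrix.diagonal_smul]
    rfl
  rw [h2, Matrix.exp_conj _ _ hUu, Matrix.det_mul, Matrix.det_mul, mul_right_comm, ← Matrix.det_mul,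
    hinv', hinv, Matrix.det_one, one_mul, Matrix.exp_diagonal, Matrix.det_diagonal,
    hH.trace_eq_sum_eigenvalues, Finset.mul_sum, Complex.exp_sum]
  refine Finset.prod_congr rfl fun i _ => ?_
  rw [Pi.coe_exp, Complex.exp_eq_exp_ℂ]; rfl

/-- Complex matrices as real matrices commuting with `Ω`. -/
def realify (n : ℕ) : Matrix (Fin n) (Fin n) ℂ →ₐ[ℝ] Matrix (Fin n × Fin 2) (Fin n × Fin 2) ℝ :=
  (Matrix.compAlgEquiv (Fin n) (Fin 2) ℝ ℝ).toAlgHom.comp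
    (Algebra.leftMulMatrix Complex.basisOneI).mapMatrix

theorem realify_apply (Z : Matrix (Fin n) (Fin n) ℂ) (j k : Fin n × Fin 2) :
    realify n Z j k = !![(Z j.1 k.1).re, -(Z j.1 k.1).im; (Z j.1 k.1).im, (Z j.1 k.1).re] j.2 k.2 := by
  rw [← Algebra.leftMulMatrix_complex]; rfl

theorem realify_injective : Function.Injective (realify n) := by
  intro Z Z' h
  ext j k
  have h0 := congrFun (congrFun h (j, 0)) (k, 0)
  have h1 := congrFun (congrFun h (j, 1)) (k, 0)
  simp only [realify_apply] at h0 h1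
  exact Complex.ext (by simpa using h0) (by simpa using h1)

/-- A real matrix commuting with `Ω` as a complex matrix. -/
def complexify (D : Matrix (Fin n × Fin 2) (Fin n × Fin 2) ℝ) : Matrix (Fin n) (Fin n) ℂ :=
  fun j k => ⟨D (j, 0) (k, 0), -D (j, 0) (k, 1)⟩

theorem Omega_mul_apply (D : Matrix (Fin n × Fin 2) (Fin n × Fin 2) ℝ) (j : Fin n)
    (k : Fin n × Fin 2) : (Omega n * D) (j, 0) k = D (j, 1) k ∧ (Omega n * D) (j, 1) k = -D (j, 0) k := by
  constructor <;> simp [Matrix.mul_apply, Fintype.sum_prod_type, Fin.sum_univ_two, Omega]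

theorem mul_Omega_apply (D : Matrix (Fin n × Fin 2) (Fin n × Fin 2) ℝ) (j : Fin n × Fin 2)
    (k : Fin n) : (D * Omega n) j (k, 0) = -D j (k, 1) ∧ (D * Omega n) j (k, 1) = D j (k, 0) := by
  constructor <;> simp [Matrix.mul_apply, Fintype.sum_prod_type, Fin.sum_univ_two, Omega]

theorem realify_complexify {D : Matrix (Fin n × Fin 2) (Fin n × Fin 2) ℝ}
    (hD : D * Omega n = Omega n * D) : realify n (complexify D) = D := by
  have h1 : ∀ j k, D (j, 1) (k, 0) = -D (j, 0) (k, 1) := fun j k => by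
    rw [← (Omega_mul_apply D j (k, 0)).1, ← hD, (mul_Omega_apply D (j, 0) k).1]
  have h2 : ∀ j k, D (j, 1) (k, 1) = D (j, 0) (k, 0) := fun j k => by
    rw [← (Omega_mul_apply D j (k, 1)).1, ← hD, (mul_Omega_apply D (j, 0) k).2]
  ext ⟨j, p⟩ ⟨k, q⟩
  have hp : p = 0 ∨ p = 1 := by omega
  have hq : q = 0 ∨ q = 1 := by omega
  rcases hp with rfl | rfl <;> rcases hq with rfl | rfl <;>
    simp [realify_apply, complexify, h1, h2]

theorem exp_realify (Z : Matrix (Fin n) (Fin n) ℂ) :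
    realify n (NormedSpace.exp Z) = NormedSpace.exp (realify n Z) := by
  let _ : NormedRing (Matrix (Fin n) (Fin n) ℂ) := Matrix.linftyOpNormedRing
  let _ : NormedAlgebra ℝ (Matrix (Fin n) (Fin n) ℂ) := Matrix.linftyOpNormedAlgebra
  let _ : NormedAlgebra ℚ (Matrix (Fin n) (Fin n) ℂ) := Matrix.linftyOpNormedAlgebra
  let _ : NormedRing (Matrix (Fin n × Fin 2) (Fin n × Fin 2) ℝ) := Matrix.linftyOpNormedRing
  have _ : CompleteSpace (Matrix (Fin n) (Fin n) ℂ) := FiniteDimensional.complete ℝ _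
  refine NormedSpace.map_exp (realify n) ?_ Z
  exact (realify n).toLinearMap.continuous_of_finiteDimensional

/-- `(i/2) tr(D Ω)` is the complex trace of `complexify D`, so its exponential is the determinant of
the complex matrix of `exp D` and depends on `exp D` only. By `IsFlow.gauss` the Gaussian eigenvalue
of the flow at time `1` is a square root of this determinant; this is the source of the sign
ambiguity. -/
theorem exp_trace_eq {D D' : Matrix (Fin n × Fin 2) (Fin n × Fin 2) ℝ}
    (hD : D * Omega n = Omega n * D) (hDt : D.transpose = -D)
    (hD' : D' * Omega n = Omega n * D') (hDt' : D'.transpose = -D')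
    (h : NormedSpace.exp D = NormedSpace.exp D') :
    Complex.exp ((Complex.I / 2) * ((D * Omega n).trace : ℂ)) =
      Complex.exp ((Complex.I / 2) * ((D' * Omega n).trace : ℂ)) := by
  have key : ∀ D : Matrix (Fin n × Fin 2) (Fin n × Fin 2) ℝ, D * Omega n = Omega n * D →
      D.transpose = -D → (NormedSpace.exp (complexify D)).det =
        Complex.exp ((Complex.I / 2) * ((D * Omega n).trace : ℂ)) := by
    intro D hD hDt
    have ht : ∀ j k, D k j = -D j k := fun j k => congrFun (congrFun hDt j) k
    have h1 : ∀ j k, D (j, 1) (k, 0) = -D (j, 0) (k, 1) := fun j k => by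
      rw [← (Omega_mul_apply D j (k, 0)).1, ← hD, (mul_Omega_apply D (j, 0) k).1]
    have hH : (Complex.I • complexify D).IsHermitian := by
      ext j k
      apply Complex.ext
      · simp [complexify]
        exact (ht (j, 1) (k, 0)).trans (by rw [h1, neg_neg])
      · simp [complexify]
        rw [ht]; ring
    have h2 := det_exp_of_isHermitian hH (-Complex.I)
    rw [smul_smul, neg_mul, Complex.I_mul_I, neg_neg, one_smul] at h2
    rw [h2]
    congr 1
    have h3 : (D * Omega n).trace = -2 * ∑ j, D (j, 0) (j, 1) := by
      rw [Matrix.trace, Fintype.sum_prod_type, Finset.mul_sum]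
      refine Finset.sum_congr rfl fun j _ => ?_
      simp only [Fin.sum_univ_two, Matrix.diag, (mul_Omega_apply D _ j).1,
        (mul_Omega_apply D _ j).2, h1]
      ring
    have h4 : (complexify D).trace = -Complex.I * ∑ j, (D (j, 0) (j, 1) : ℂ) := by
      rw [Matrix.trace, Finset.mul_sum]
      refine Finset.sum_congr rfl fun j _ => ?_
      have : D (j, 0) (j, 0) = 0 := by linarith [ht (j, 0) (j, 0)]
      apply Complex.ext <;> simp [complexify, this]
    rw [Matrix.trace_smul, h3, h4]
    push_cast
    simp only [smul_eq_mul]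
    linear_combination (Complex.I * ∑ j, (D (j, 0) (j, 1) : ℂ)) * Complex.I_sq
  rw [← key D hD hDt, ← key D' hD' hDt']
  have : NormedSpace.exp (complexify D) = NormedSpace.exp (complexify D') := by
    apply realify_injective
    rw [exp_realify, exp_realify, realify_complexify hD, realify_complexify hD', h]
  rw [this]

/-- `T` is the matrix exponential curve. -/
theorem hasDerivAt_exp_smul {ι : Type*} [Fintype ι] [DecidableEq ι] (X : Matrix ι ι ℝ) (t : ℝ)
    (j k : ι) : HasDerivAt (fun s : ℝ => NormedSpace.exp (s • X) j k)
      ((X * NormedSpace.exp (t • X)) j k) t := by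
  let _ : NormedRing (Matrix ι ι ℝ) := Matrix.linftyOpNormedRing
  let _ : NormedAlgebra ℝ (Matrix ι ι ℝ) := Matrix.linftyOpNormedAlgebra
  have _ : CompleteSpace (Matrix ι ι ℝ) := FiniteDimensional.complete ℝ _
  have h := hasDerivAt_exp_smul_const' (𝕂 := ℝ) X t
  have h2 : HasFDerivAt (fun M : Matrix ι ι ℝ => M j k)
      (LinearMap.toContinuousLinearMap (Matrix.entryLinearMap ℝ ℝ j k))
      (NormedSpace.exp (t • X)) :=
    (LinearMap.toContinuousLinearMap (Matrix.entryLinearMap ℝ ℝ j k)).hasFDerivAt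
  exact h2.comp_hasDerivAt t h

/-- Two compact flows with the same symplectic matrix agree up to sign. -/
theorem flow_eq_or_eq_neg {D D' : Matrix (Fin n × Fin 2) (Fin n × Fin 2) ℝ}
    (hD : D * Omega n = Omega n * D) (hDt : D.transpose = -D)
    (hD' : D' * Omega n = Omega n * D') (hDt' : D'.transpose = -D')
    (h : NormedSpace.exp D = NormedSpace.exp D') {W W' : ℝ → Module.End ℂ (Schw n)}
    (hW : IsFlow (-(D * Omega n)) W) (hW' : IsFlow (-(D' * Omega n)) W') :
    W 1 = W' 1 ∨ W 1 = -W' 1 := by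
  have eD : ∀ D : Matrix (Fin n × Fin 2) (Fin n × Fin 2) ℝ, -(D * Omega n) * Omega n = D := by
    intro D; rw [Matrix.neg_mul, Matrix.mul_assoc, Omega_mul_self, Matrix.mul_neg, neg_neg,
      Matrix.mul_one]
  have cov : ∀ {D W}, IsFlow (-(D * Omega n)) W → ∀ (t : ℝ) (k : Fin n × Fin 2) (f : Schw n),
      W t (sympL k f) = ∑ j, (((NormedSpace.exp (t • D) :
        Matrix (Fin n × Fin 2) (Fin n × Fin 2) ℝ) j k : ℝ) : ℂ) • sympL j (W t f) := by
    intro D W hW t k f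
    refine hW.sympL_covariant (M := fun t => NormedSpace.exp (t • D)) (by simp) (fun t j k => ?_) t k f
    rw [eD]; exact hasDerivAt_exp_smul D t j k
  -- The covariance matrices of the two factors are inverse to each other, so `Z` commutes with all
  -- symplectic generators.
  set Z : Module.End ℂ (Schw n) := W' (-1) * W 1 with hZ
  have hQ : ∀ k f, Z (sympL k f) = sympL k (Z f) := by
    intro k f
    have h0 : NormedSpace.exp ((-1 : ℝ) • D') * NormedSpace.exp ((1 : ℝ) • D) = 1 := by
      rw [one_smul, h, neg_one_smul, Matrix.exp_neg]
      exact Matrix.nonsing_inv_mul _ ((Matrix.isUnit_iff_isUnit_det _).1 (Matrix.isUnit_exp D'))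
    rw [hZ, Module.End.mul_apply, Module.End.mul_apply, cov hW, map_sum]
    simp only [map_smul, cov hW', Finset.smul_sum, smul_smul]
    rw [Finset.sum_comm]
    simp only [← Finset.sum_smul]
    have h1 : ∀ i, ∑ j, (NormedSpace.exp ((1 : ℝ) • D) j k : ℂ) *
        (NormedSpace.exp ((-1 : ℝ) • D') i j : ℂ) = if i = k then 1 else 0 := by
      intro i
      have h2 := congrArg Complex.ofReal (congrFun (congrFun h0 i) k)
      rw [Matrix.mul_apply, Matrix.one_apply] at h2
      push_cast at h2
      rw [Finset.sum_congr rfl fun j _ => mul_comm _ _, h2]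
      split_ifs <;> simp
    simp only [h1]
    simp
  have hm : ∀ j f, Z (mulVarL j f) = mulVarL j (Z f) := by
    intro j f
    have h1 := hQ (j, 1) f
    rw [sympL_one, smul_apply, smul_apply, map_smul] at h1
    exact smul_right_injective _ (Complex.exp_ne_zero _) h1
  have hip : ∀ f g, SuperSpin.ip (Z f) (Z g) = SuperSpin.ip f g := by
    intro f g
    rw [hZ, Module.End.mul_apply, Module.End.mul_apply, hW'.ip, hW.ip]
  have hg := hW.gauss (by rw [eD, hDt]) 1
  have hg' := hW'.gauss (by rw [eD, hDt']) (-1)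
  set ζ : ℂ := Complex.exp (-(Complex.I / 4) * ((-(D * Omega n)).trace : ℂ) * (1 : ℝ)) *
    Complex.exp (-(Complex.I / 4) * ((-(D' * Omega n)).trace : ℂ) * (-1 : ℝ)) with hζ
  have hZg : Z (gauss n) = ζ • gauss n := by
    rw [hZ, Module.End.mul_apply, hg, map_smul, hg', smul_smul]
  have hsc := eq_smul_of_comm_mulVarL hip hm hZg
  -- The square of `ζ` is the quotient of the two determinants compared in `exp_trace_eq`.
  have hsq : ζ * ζ = 1 := by
    have := exp_trace_eq hD hDt hD' hDt' h
    rw [hζ, ← Complex.exp_add, ← Complex.exp_add, Matrix.trace_neg, Matrix.trace_neg]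
    have h3 : ∀ x y : ℂ, Complex.exp (Complex.I / 2 * x) = Complex.exp (Complex.I / 2 * y) →
        Complex.exp (Complex.I / 2 * x - Complex.I / 2 * y) = 1 := by
      intro x y hxy
      rw [Complex.exp_sub, hxy, div_self (Complex.exp_ne_zero _)]
    rw [← h3 _ _ this]
    congr 1
    push_cast
    ring
  have hWeq : ∀ f, W 1 f = ζ • W' 1 f := by
    intro f
    have h1 : W' 1 (Z f) = W 1 f := by
      rw [hZ, ← Module.End.mul_apply, ← mul_assoc, hW'.mul_neg, one_mul]
    rw [← h1, hsc, map_smul]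
  rcases mul_self_eq_one_iff.1 hsq with h1 | h1
  · left; ext1 f; rw [hWeq, h1, one_smul]
  · right; ext1 f; rw [hWeq, h1, neg_one_smul]; rfl

end unitary

/-! ### Linear differential equations in finite-dimensional spaces -/

/-- The curve `u` has the derivative `v` at `t`, tested on linear functionals. -/
def WeakDeriv {A : Type*} [AddCommGroup A] [Module ℝ A] (u : ℝ → A) (v : A) (t : ℝ) : Prop :=
  ∀ q : Module.Dual ℝ A, HasDerivAt (fun s => q (u s)) (q v) t

namespace WeakDeriv
variable {A B : Type*} [AddCommGroup A] [Module ℝ A] [AddCommGroup B] [Module ℝ B]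
  {u w : ℝ → A} {v v' : A} {t : ℝ}

theorem map (hu : WeakDeriv u v t) (L : A →ₗ[ℝ] B) : WeakDeriv (fun s => L (u s)) (L v) t :=
  fun q => hu (q ∘ₗ L)

theorem add (hu : WeakDeriv u v t) (hw : WeakDeriv w v' t) :
    WeakDeriv (fun s => u s + w s) (v + v') t := fun q => by
  simpa only [map_add] using (hu q).fun_add (hw q)

theorem sum {ι : Type*} (s : Finset ι) {u : ι → ℝ → A} {v : ι → A}
    (h : ∀ i ∈ s, WeakDeriv (u i) (v i) t) :
    WeakDeriv (fun r => ∑ i ∈ s, u i r) (∑ i ∈ s, v i) t := fun q => by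
  simpa only [map_sum] using HasDerivAt.fun_sum fun i hi => h i hi q

theorem smul {c : ℝ → ℝ} {c' : ℝ} (hc : HasDerivAt c c' t) (hu : WeakDeriv u v t) :
    WeakDeriv (fun s => c s • u s) (c' • u t + c t • v) t := fun q => by
  simpa only [map_add, map_smul, smul_eq_mul] using hc.fun_mul (hu q)

theorem smul_const {c : ℝ → ℝ} {c' : ℝ} (hc : HasDerivAt c c' t) (a : A) :
    WeakDeriv (fun s => c s • a) (c' • a) t := fun q => by
  simpa only [map_smul, smul_eq_mul] using hc.mul_const (q a)

theorem comp_add (a : ℝ) (hu : WeakDeriv u v (t + a)) : WeakDeriv (fun s => u (s + a)) v t :=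
  fun q => (hu q).comp_add_const t a

theorem comp_neg (hu : WeakDeriv u v (-t)) : WeakDeriv (fun s => u (-s)) (-v) t :=
  fun q => by simpa [Function.comp_def] using (hu q).scomp t (hasDerivAt_neg t)

variable [FiniteDimensional ℝ A]

/-- In coordinates this is an ordinary linear system. Testing on linear functionals avoids the
choice of a norm on `A`. -/
theorem unique {L : A →ₗ[ℝ] A} (hu : ∀ t, WeakDeriv u (L (u t)) t)
    (hw : ∀ t, WeakDeriv w (L (w t)) t) (h0 : u 0 = w 0) (t : ℝ) : u t = w t := by
  set b := Module.finBasis ℝ A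
  set L' : (Fin (Module.finrank ℝ A) → ℝ) →L[ℝ] (Fin (Module.finrank ℝ A) → ℝ) :=
    LinearMap.toContinuousLinearMap
      ((b.equivFun : A →ₗ[ℝ] _) ∘ₗ L ∘ₗ (b.equivFun.symm : _ →ₗ[ℝ] A)) with hL'
  have key : ∀ u : ℝ → A, (∀ t, WeakDeriv u (L (u t)) t) →
      ∀ t, HasDerivAt (fun s => b.equivFun (u s)) (L' (b.equivFun (u t))) t := by
    intro u hu t
    refine hasDerivAt_pi.2 fun i => ?_
    have := hu t (b.coord i)
    simp only [Module.Basis.coord_apply] at this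
    simpa [hL'] using this
  have := ODE_solution_unique_univ (v := fun _ => L') (s := fun _ => Set.univ) (t₀ := 0)
    (fun t => L'.lipschitz.lipschitzOnWith) (fun t => ⟨key u hu t, Set.mem_univ _⟩)
    (fun t => ⟨key w hw t, Set.mem_univ _⟩) (by simp only [h0])
  exact b.equivFun.injective (congrFun this t)

theorem exists_solution (L : A →ₗ[ℝ] A) (a : A) :
    ∃ u : ℝ → A, u 0 = a ∧ ∀ t, WeakDeriv u (L (u t)) t := by
  set b := Module.finBasis ℝ A
  set M := LinearMap.toMatrix b b L with hM
  refine ⟨fun t => ∑ j, (NormedSpace.exp (t • M)).mulVec (b.equivFun a) j • b j, ?_, fun t => ?_⟩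
  · simp only [zero_smul, NormedSpace.exp_zero, Matrix.one_mulVec]
    exact b.sum_equivFun a
  · have h := WeakDeriv.sum (t := t) Finset.univ fun j _ => WeakDeriv.smul_const
      (c := fun s => (NormedSpace.exp (s • M)).mulVec (b.equivFun a) j)
      (c' := (M * NormedSpace.exp (t • M)).mulVec (b.equivFun a) j) (a := b j) (by
        simp only [Matrix.mulVec, dotProduct]
        exact HasDerivAt.fun_sum fun k _ => (hasDerivAt_exp_smul M t j k).mul_const _)
    refine Eq.mp ?_ h
    congr 1
    rw [← Matrix.mulVec_mulVec]
    set y := (NormedSpace.exp (t • M)).mulVec (b.equivFun a)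
    have : L (∑ j, y j • b j) = ∑ i, (M.mulVec y) i • b i := by
      apply b.equivFun.injective
      ext i
      have h1 := LinearMap.toMatrix_mulVec_repr b b L (∑ j, y j • b j)
      have h2 : ⇑(b.repr (∑ j, y j • b j)) = y := b.equivFun_symm_apply y ▸
        b.equivFun.apply_symm_apply y
      rw [h2] at h1
      have h3 : ⇑(b.repr (∑ i, (M.mulVec y) i • b i)) = M.mulVec y :=
        b.equivFun_symm_apply (M.mulVec y) ▸ b.equivFun.apply_symm_apply _
      change b.repr _ i = b.repr _ i
      rw [h3, ← h1]
    exact this.symm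

end WeakDeriv

/-! ### One-parameter groups in finite-dimensional algebras -/

section algebra
variable {A : Type*} [Ring A] [Algebra ℝ A]

/-- `s` is the one-parameter group generated by `b`. -/
structure IsExpCurve (b : A) (s : ℝ → A) : Prop where
  zero : s 0 = 1
  deriv : ∀ t, WeakDeriv s (b * s t) t

variable [FiniteDimensional ℝ A] {b : A} {s : ℝ → A}

theorem exists_isExpCurve (b : A) : ∃ s, IsExpCurve b s := by
  obtain ⟨s, h0, hs⟩ := WeakDeriv.exists_solution (LinearMap.mulLeft ℝ b) 1
  exact ⟨s, h0, hs⟩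

namespace IsExpCurve
variable (hs : IsExpCurve b s)
include hs

theorem unique_curve {u : ℝ → A} (hu : ∀ t, WeakDeriv u (b * u t) t) (t : ℝ) :
    u t = s t * u 0 :=
  WeakDeriv.unique (L := LinearMap.mulLeft ℝ b) (w := fun t => s t * u 0) hu
    (fun t => by
      have := (hs.deriv t).map (LinearMap.mulRight ℝ (u 0))
      simpa only [LinearMap.mulRight_apply, LinearMap.mulLeft_apply, mul_assoc] using this)
    (by rw [hs.zero, one_mul]) t

theorem add (r t : ℝ) : s (r + t) = s r * s t := by
  have := hs.unique_curve (u := fun r => s (r + t)) (fun r => (hs.deriv (r + t)).comp_add t) r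
  simpa using this

theorem mul_neg (t : ℝ) : s t * s (-t) = 1 := by rw [← hs.add, add_neg_cancel, hs.zero]

theorem neg_mul (t : ℝ) : s (-t) * s t = 1 := by rw [← hs.add, neg_add_cancel, hs.zero]

theorem comm (t : ℝ) : s t * b = b * s t := by
  have := hs.unique_curve (u := fun t => b * s t) (fun t => (hs.deriv t).map (LinearMap.mulLeft ℝ b)) t
  rw [this, hs.zero, mul_one]

end IsExpCurve

end algebra

theorem IsExpCurve.eq_exp {ι : Type*} [Fintype ι] [DecidableEq ι] {b : Matrix ι ι ℝ} {s : ℝ → Matrix ι ι ℝ}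
    (hs : IsExpCurve b s) (t : ℝ) : s t = NormedSpace.exp (t • b) := by
  have h := hs.unique_curve (u := fun t => NormedSpace.exp (t • b)) (fun t q => ?_) t
  · rw [h]; simp
  · have hq : ∀ M : Matrix ι ι ℝ, q M = ∑ i, ∑ j, M i j * q (Matrix.single i j 1) := by
      intro M
      conv_lhs => rw [Matrix.matrix_eq_sum_single M]
      simp only [map_sum]
      refine Finset.sum_congr rfl fun i _ => Finset.sum_congr rfl fun j _ => ?_
      rw [← smul_eq_mul, ← map_smul, Matrix.smul_single, smul_eq_mul, mul_one]
    rw [hq]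
    refine HasDerivAt.congr_of_eventuallyEq ?_ (Eventually.of_forall fun s => hq _)
    exact HasDerivAt.fun_sum fun i _ => HasDerivAt.fun_sum fun j _ =>
      (hasDerivAt_exp_smul b t i j).mul_const _

/-! ### The real Clifford algebra -/

section clifford
variable {m : ℕ}

/-- The generators of the Clifford algebra. -/
def eps (j : Fin m) : CliffordAlgebra (negForm m) :=
  CliffordAlgebra.ι (negForm m) (Pi.single j 1)

theorem eps_mul_eps (j k : Fin m) :
    eps j * eps k = -(eps k * eps j) + algebraMap ℝ _ (if j = k then -2 else 0) := by
  rw [← cliff_rel j k]; simp only [eps]; abel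

theorem eps_sq (j : Fin m) : eps j * eps j = -1 := by
  have h := cliff_rel j j
  rw [if_pos rfl, ← two_smul ℝ] at h
  refine smul_right_injective _ (two_ne_zero (α := ℝ)) (h.trans ?_)
  rw [Algebra.algebraMap_eq_smul_one, neg_smul]
  exact (smul_neg _ _).symm

theorem involute_eps (j : Fin m) : CliffordAlgebra.involute (eps j) = -eps j :=
  CliffordAlgebra.involute_ι _

/-- The subalgebra generated by the `ε_j`, `j ∈ K`. -/
def adjEps (K : Finset (Fin m)) : Subalgebra ℝ (CliffordAlgebra (negForm m)) :=
  Algebra.adjoin ℝ (eps '' (K : Set (Fin m)))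

theorem adjEps_univ : adjEps (Finset.univ : Finset (Fin m)) = ⊤ := by
  rw [← CliffordAlgebra.adjoin_range_ι, adjEps]
  refine le_antisymm (Algebra.adjoin_mono ?_) (Algebra.adjoin_le ?_)
  · rintro _ ⟨j, -, rfl⟩; exact ⟨_, rfl⟩
  · rintro _ ⟨v, rfl⟩
    have : v = ∑ j, v j • (Pi.single j 1 : Fin m → ℝ) := by
      ext i; simp [Finset.sum_apply, Pi.single_apply]
    rw [this, map_sum]
    refine Subalgebra.sum_mem _ fun j _ => ?_
    rw [map_smul]
    exact Subalgebra.smul_mem _ (Algebra.subset_adjoin (Set.mem_image_of_mem eps (by simp))) _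

theorem involute_mem_adjEps {K : Finset (Fin m)} {x : CliffordAlgebra (negForm m)}
    (hx : x ∈ adjEps K) : CliffordAlgebra.involute x ∈ adjEps K := by
  have : adjEps K ≤ (adjEps K).comap CliffordAlgebra.involute := by
    refine Algebra.adjoin_le ?_
    rintro _ ⟨j, hj, rfl⟩
    change CliffordAlgebra.involute (eps j) ∈ adjEps K
    rw [involute_eps]
    exact neg_mem (Algebra.subset_adjoin ⟨j, hj, rfl⟩)
  exact this hx

theorem mul_eps_of_mem_adjEps {K : Finset (Fin m)} {j : Fin m} (hj : j ∉ K)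
    {x : CliffordAlgebra (negForm m)} (hx : x ∈ adjEps K) :
    x * eps j = eps j * CliffordAlgebra.involute x := by
  induction hx using Algebra.adjoin_induction with
  | mem x hx =>
    obtain ⟨k, hk, rfl⟩ := hx
    have : k ≠ j := fun h => hj (h ▸ hk)
    rw [involute_eps, eps_mul_eps, if_neg this, map_zero, add_zero, mul_neg]
  | algebraMap c => rw [AlgHom.commutes]; exact Algebra.commutes _ _
  | add x y _ _ hx hy => rw [add_mul, hx, hy, map_add, mul_add]
  | mul x y _ _ hx hy => rw [mul_assoc, hy, ← mul_assoc, hx, mul_assoc, map_mul]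

/-- A normal form: moving `eps j` to the left across `adjEps K` costs only the grade involution, and
`eps j` has square `-1`, so it never occurs more than once. -/
theorem exists_of_mem_adjEps_insert {K : Finset (Fin m)} {j : Fin m} (hj : j ∉ K)
    {x : CliffordAlgebra (negForm m)} (hx : x ∈ adjEps (insert j K)) :
    ∃ u ∈ adjEps K, ∃ v ∈ adjEps K, x = u + eps j * v := by
  induction hx using Algebra.adjoin_induction with
  | mem x hx =>
    obtain ⟨k, hk, rfl⟩ := hx
    rw [Finset.coe_insert] at hk
    rcases hk with rfl | hk
    · exact ⟨0, zero_mem _, 1, one_mem _, by simp⟩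
    · exact ⟨eps k, Algebra.subset_adjoin ⟨k, hk, rfl⟩, 0, zero_mem _, by simp⟩
  | algebraMap c => exact ⟨_, Subalgebra.algebraMap_mem _ c, 0, zero_mem _, by simp⟩
  | add x y _ _ hx hy =>
    obtain ⟨u, hu, v, hv, rfl⟩ := hx
    obtain ⟨u', hu', v', hv', rfl⟩ := hy
    exact ⟨u + u', add_mem hu hu', v + v', add_mem hv hv', by rw [mul_add]; abel⟩
  | mul x y _ _ hx hy =>
    obtain ⟨u, hu, v, hv, rfl⟩ := hx
    obtain ⟨u', hu', v', hv', rfl⟩ := hy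
    refine ⟨u * u' - CliffordAlgebra.involute v * v',
      sub_mem (mul_mem hu hu') (mul_mem (involute_mem_adjEps hv) hv'),
      CliffordAlgebra.involute u * v' + v * u',
      add_mem (mul_mem (involute_mem_adjEps hu) hv') (mul_mem hv hu'), ?_⟩
    calc _ = u * u' + (u * eps j) * v' + eps j * v * u' + eps j * (v * eps j) * v' := by noncomm_ring
      _ = u * u' + (eps j * CliffordAlgebra.involute u) * v' + eps j * v * u' +
          (eps j * eps j) * CliffordAlgebra.involute v * v' := by
        rw [mul_eps_of_mem_adjEps hj hu, mul_eps_of_mem_adjEps hj hv]; noncomm_ring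
      _ = _ := by rw [eps_sq]; noncomm_ring

/-- By the normal form, each further generator at most doubles a finite spanning set. -/
instance : FiniteDimensional ℝ (CliffordAlgebra (negForm m)) := by
  have h : ∀ K : Finset (Fin m), (Subalgebra.toSubmodule (adjEps K)).FG := by
    intro K
    induction K using Finset.induction_on with
    | empty =>
      simp only [adjEps, Finset.coe_empty, Set.image_empty, Algebra.adjoin_empty]
      rw [Algebra.toSubmodule_bot]
      rw [Submodule.one_eq_span]; exact Submodule.fg_span_singleton _
    | insert j K hj ih =>
      have hf : (Subalgebra.toSubmodule (adjEps K) ⊔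
          (Subalgebra.toSubmodule (adjEps K)).map (LinearMap.mulLeft ℝ (eps j))).FG :=
        ih.sup (ih.map _)
      refine Submodule.FG.of_le hf fun x hx => ?_
      obtain ⟨u, hu, v, hv, rfl⟩ := exists_of_mem_adjEps_insert hj hx
      exact add_mem (Submodule.mem_sup_left hu) (Submodule.mem_sup_right ⟨v, hv, rfl⟩)
  have := h Finset.univ
  rw [adjEps_univ, Algebra.top_toSubmodule] at this
  exact ⟨this⟩

/-- Even elements of the Clifford algebra commuting with the generators are scalars. -/
theorem exists_eq_algebraMap {x : CliffordAlgebra (negForm m)}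
    (hx : CliffordAlgebra.involute x = x) (hc : ∀ j, x * eps j = eps j * x) :
    ∃ c : ℝ, x = algebraMap ℝ _ c := by
  have h : ∀ K : Finset (Fin m), x ∈ adjEps K → ∃ c : ℝ, x = algebraMap ℝ _ c := by
    intro K
    induction K using Finset.induction_on with
    | empty =>
      intro h
      simp only [adjEps, Finset.coe_empty, Set.image_empty, Algebra.adjoin_empty] at h
      obtain ⟨c, hc⟩ := Algebra.mem_bot.1 h
      exact ⟨c, hc.symm⟩
    | insert j K hj ih =>
      intro h
      obtain ⟨u, hu, v, hv, huv⟩ := exists_of_mem_adjEps_insert hj h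
      -- As `x` is even, `u` may be replaced by its even part and `v` by its odd part. Commuting
      -- with `eps j` then forces `v1 = -v1`, so `eps j` does not occur in `x`.
      set u1 := (1 / 2 : ℝ) • (u + CliffordAlgebra.involute u) with hu1
      set v1 := (1 / 2 : ℝ) • (v - CliffordAlgebra.involute v) with hv1
      have mu1 : u1 ∈ adjEps K := Subalgebra.smul_mem _ (add_mem hu (involute_mem_adjEps hu)) _
      have mv1 : v1 ∈ adjEps K := Subalgebra.smul_mem _ (sub_mem hv (involute_mem_adjEps hv)) _
      have eu1 : CliffordAlgebra.involute u1 = u1 := by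
        rw [hu1, map_smul, map_add, CliffordAlgebra.involute_involute, add_comm]
      have ev1 : CliffordAlgebra.involute v1 = -v1 := by
        rw [hv1, map_smul, map_sub, CliffordAlgebra.involute_involute, ← smul_neg, neg_sub]
      have ex : x = u1 + eps j * v1 := by
        have h1 : x = (1 / 2 : ℝ) • (x + CliffordAlgebra.involute x) := by
          rw [hx, ← two_smul ℝ, smul_smul]; norm_num
        rw [h1, huv, map_add, map_mul, involute_eps, hu1, hv1, mul_smul_comm, ← smul_add]
        congr 1; noncomm_ring
      have hcj := hc j
      have e1 : x * eps j = eps j * u1 + v1 := by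
        calc x * eps j = u1 * eps j + eps j * (v1 * eps j) := by rw [ex]; noncomm_ring
          _ = eps j * u1 - (eps j * eps j) * v1 := by
            rw [mul_eps_of_mem_adjEps hj mu1, mul_eps_of_mem_adjEps hj mv1, eu1, ev1]; noncomm_ring
          _ = _ := by rw [eps_sq]; noncomm_ring
      have e2 : eps j * x = eps j * u1 - v1 := by
        calc eps j * x = eps j * u1 + (eps j * eps j) * v1 := by rw [ex]; noncomm_ring
          _ = _ := by rw [eps_sq]; noncomm_ring
      have hv0 : v1 = 0 := by
        rw [e1, e2] at hcj
        have h2 : (2 : ℝ) • v1 = 0 := by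
          rw [two_smul]
          have := sub_eq_zero.2 hcj
          rw [← this]; abel
        exact (smul_eq_zero.1 h2).resolve_left two_ne_zero
      rw [hv0, mul_zero, add_zero] at ex
      exact ih (ex ▸ mu1)
  exact h Finset.univ (by rw [adjEps_univ]; trivial)

/-- The bivector of an antisymmetric matrix. -/
def biv (A : Matrix (Fin m) (Fin m) ℝ) : CliffordAlgebra (negForm m) :=
  (-1 / 4 : ℝ) • ∑ j, ∑ k, A j k • (eps j * eps k)

/-- The factor `-1/4` in `biv` is chosen for this rule: the two contractions of `eps j * eps k` with
`eps l` contribute `-2` each, with equal signs by antisymmetry of `A`. -/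
theorem biv_mul_eps {A : Matrix (Fin m) (Fin m) ℝ} (hA : A.transpose = -A) (l : Fin m) :
    biv A * eps l = eps l * biv A + ∑ j, A j l • eps j := by
  have hA' : ∀ j k, A k j = -A j k := fun j k => congrFun (congrFun hA j) k
  have e : ∀ j k, eps j * eps k * eps l = eps l * (eps j * eps k) +
      ((if k = l then -2 else 0 : ℝ) • eps j - (if j = l then -2 else 0 : ℝ) • eps k) := by
    intro j k
    calc eps j * eps k * eps l = eps j * (eps k * eps l) := mul_assoc _ _ _
      _ = -(eps j * eps l) * eps k + eps j * algebraMap ℝ _ (if k = l then -2 else 0) := by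
        rw [eps_mul_eps k l]; noncomm_ring
      _ = _ := by
        rw [eps_mul_eps j l, ← Algebra.commutes, ← Algebra.smul_def, neg_add, neg_neg, add_mul,
          neg_mul, ← Algebra.smul_def]
        rw [mul_assoc]; abel
  simp only [biv, smul_mul_assoc, mul_smul_comm, Finset.sum_mul, Finset.mul_sum, e, smul_add,
    Finset.sum_add_distrib]
  congr 1
  have h1 : ∑ j, ∑ k, A j k • ((if k = l then -2 else 0 : ℝ) • eps j -
      (if j = l then -2 else 0 : ℝ) • eps k) = (-4 : ℝ) • ∑ j, A j l • eps j := by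
    have p1 : ∀ j, ∑ k, A j k • ((if k = l then -2 else 0 : ℝ) • eps j) =
        (-2 * A j l) • eps j := by
      intro j
      rw [Finset.sum_eq_single l (fun k _ hk => by rw [if_neg hk, zero_smul, smul_zero])
        (fun h => absurd (Finset.mem_univ l) h), if_pos rfl, smul_smul, mul_comm]
    have p2 : ∑ j, ∑ k, A j k • ((if j = l then -2 else 0 : ℝ) • eps k) =
        ∑ k, (-2 * A l k) • eps k := by
      rw [Finset.sum_eq_single l (fun k _ hk => by simp [if_neg hk])
        (fun h => absurd (Finset.mem_univ l) h)]
      exact Finset.sum_congr rfl fun k _ => by rw [if_pos rfl, smul_smul, mul_comm]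
    simp only [smul_sub, Finset.sum_sub_distrib, p1, p2]
    rw [← Finset.sum_sub_distrib, Finset.smul_sum]
    refine Finset.sum_congr rfl fun j _ => ?_
    rw [← sub_smul, smul_smul, hA' j l]
    congr 1; ring
  rw [h1, smul_smul]; norm_num

theorem involute_biv (A : Matrix (Fin m) (Fin m) ℝ) : CliffordAlgebra.involute (biv A) = biv A := by
  simp [biv, map_sum, involute_eps]

theorem reverse_biv {A : Matrix (Fin m) (Fin m) ℝ} (hA : A.transpose = -A) :
    CliffordAlgebra.reverse (biv A) = -biv A := by
  have hA' : ∀ j k, A k j = -A j k := fun j k => congrFun (congrFun hA j) k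
  have hr : ∀ j : Fin m, CliffordAlgebra.reverse (eps j) = eps j :=
    fun j => CliffordAlgebra.reverse_ι _
  simp only [biv, map_smul, map_sum, CliffordAlgebra.reverse.map_mul, hr]
  rw [Finset.sum_comm, ← smul_neg, ← Finset.sum_neg_distrib]
  refine congrArg _ (Finset.sum_congr rfl fun j _ => ?_)
  rw [← Finset.sum_neg_distrib]
  exact Finset.sum_congr rfl fun k _ => by rw [hA' j k, neg_smul]

theorem IsExpCurve.involute {A : Matrix (Fin m) (Fin m) ℝ} {s : ℝ → CliffordAlgebra (negForm m)}
    (hs : IsExpCurve (biv A) s) (t : ℝ) : CliffordAlgebra.involute (s t) = s t := by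
  have := hs.unique_curve (u := fun t => CliffordAlgebra.involute (s t)) (fun t => by
    have := (hs.deriv t).map (CliffordAlgebra.involute (Q := negForm m)).toLinearMap
    rwa [AlgHom.toLinearMap_apply, map_mul, involute_biv] at this) t
  rw [this, hs.zero, map_one, mul_one]

theorem IsExpCurve.reverse {A : Matrix (Fin m) (Fin m) ℝ} (hA : A.transpose = -A)
    {s : ℝ → CliffordAlgebra (negForm m)} (hs : IsExpCurve (biv A) s) (t : ℝ) :
    CliffordAlgebra.reverse (s t) = s (-t) := by
  have := hs.unique_curve (u := fun t => CliffordAlgebra.reverse (s (-t))) (fun t => by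
    have := ((hs.deriv (-t)).comp_neg).map (CliffordAlgebra.reverse (Q := negForm m))
    rwa [map_neg, ← hs.comm, CliffordAlgebra.reverse.map_mul, reverse_biv hA, _root_.neg_mul, neg_neg]
      at this) (-t)
  simp only [neg_neg, neg_zero, hs.zero, CliffordAlgebra.reverse.map_one, mul_one] at this
  exact this

/-- The Clifford counterpart of `sympL_covariant`: the right side solves the equation of `s`, by
`biv_mul_eps`. -/
theorem IsExpCurve.mul_eps {A : Matrix (Fin m) (Fin m) ℝ} (hA : A.transpose = -A)
    {s : ℝ → CliffordAlgebra (negForm m)} (hs : IsExpCurve (biv A) s) (t : ℝ) (l : Fin m) :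
    s t * eps l = ∑ j, (NormedSpace.exp (t • A) : Matrix (Fin m) (Fin m) ℝ) j l • (eps j * s t) := by
  have h1 := hs.unique_curve (u := fun t => ∑ j,
    (NormedSpace.exp (t • A) : Matrix (Fin m) (Fin m) ℝ) j l • (eps j * s t)) (fun t => ?_) t
  · rw [h1]
    congr 1
    simp [hs.zero, Matrix.one_apply, ite_smul]
  · refine Eq.mp ?_ (WeakDeriv.sum Finset.univ fun j _ => WeakDeriv.smul
      (hasDerivAt_exp_smul A t j l) ((hs.deriv t).map (LinearMap.mulLeft ℝ (eps j))))
    congr 1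
    simp only [LinearMap.mulLeft_apply, Finset.mul_sum, mul_smul_comm, Finset.sum_add_distrib]
    have e : ∀ j, biv A * (eps j * s t) = eps j * (biv A * s t) + ∑ i, A i j • (eps i * s t) := by
      intro j
      rw [← mul_assoc, biv_mul_eps hA, add_mul, mul_assoc, Finset.sum_mul]
      simp only [smul_mul_assoc]
    simp only [e, smul_add, Finset.sum_add_distrib]
    rw [add_comm]
    congr 1
    simp only [Finset.smul_sum, smul_smul]
    rw [Finset.sum_comm]
    refine Finset.sum_congr rfl fun j _ => ?_
    rw [← Finset.sum_smul, Matrix.mul_apply]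
    congr 1
    exact Finset.sum_congr rfl fun k _ => mul_comm _ _

/-- Spin elements with the same rotation agree up to sign. -/
theorem spin_eq_or_eq_neg {A A' : Matrix (Fin m) (Fin m) ℝ} (hA : A.transpose = -A)
    (hA' : A'.transpose = -A') (h : NormedSpace.exp A = NormedSpace.exp A')
    {s s' : ℝ → CliffordAlgebra (negForm m)} (hs : IsExpCurve (biv A) s)
    (hs' : IsExpCurve (biv A') s') : s 1 = s' 1 ∨ s 1 = -s' 1 := by
  -- The rotations cancel, so `y` commutes with all generators. Being even, it is a scalar `c`, and
  -- the reversal, which inverts both factors, gives `c² = 1`.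
  set y := s' (-1) * s 1 with hy
  have hyi : CliffordAlgebra.involute y = y := by rw [hy, map_mul, hs.involute, hs'.involute]
  have hr : CliffordAlgebra.reverse y * y = 1 := by
    rw [hy, CliffordAlgebra.reverse.map_mul, hs.reverse hA, hs'.reverse hA', neg_neg, mul_assoc,
      ← mul_assoc (s' 1), hs'.mul_neg, one_mul, hs.neg_mul]
  have hc : ∀ l, y * eps l = eps l * y := by
    intro l
    have h0 : (NormedSpace.exp ((-1 : ℝ) • A') : Matrix (Fin m) (Fin m) ℝ) *
        NormedSpace.exp ((1 : ℝ) • A) = 1 := by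
      rw [one_smul, h, neg_one_smul, Matrix.exp_neg]
      exact Matrix.nonsing_inv_mul _ ((Matrix.isUnit_iff_isUnit_det _).1 (Matrix.isUnit_exp A'))
    rw [hy, mul_assoc, hs.mul_eps hA, Finset.mul_sum]
    simp only [mul_smul_comm, ← mul_assoc, hs'.mul_eps hA', Finset.sum_mul, smul_mul_assoc,
      Finset.smul_sum, smul_smul]
    rw [Finset.sum_comm]
    simp only [← Finset.sum_smul]
    have h1 : ∀ i, ∑ j, (NormedSpace.exp ((1 : ℝ) • A) : Matrix (Fin m) (Fin m) ℝ) j l *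
        (NormedSpace.exp ((-1 : ℝ) • A') : Matrix (Fin m) (Fin m) ℝ) i j =
          if i = l then 1 else 0 := by
      intro i
      have h2 := congrFun (congrFun h0 i) l
      rw [Matrix.mul_apply, Matrix.one_apply] at h2
      rw [Finset.sum_congr rfl fun j _ => mul_comm _ _, h2]
    simp only [h1]
    simp [ite_smul]
  obtain ⟨c, hcy⟩ := exists_eq_algebraMap hyi hc
  have hs1 : s 1 = c • s' 1 := by
    have : s' 1 * y = s 1 := by rw [hy, ← mul_assoc, hs'.mul_neg, one_mul]
    rw [← this, hcy, ← Algebra.commutes, Algebra.smul_def]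
  have hcc : c * c = 1 := by
    rw [hcy, CliffordAlgebra.reverse.commutes, ← map_mul] at hr
    exact (algebraMap ℝ (CliffordAlgebra (negForm m))).injective (hr.trans (map_one _).symm)
  rcases mul_self_eq_one_iff.1 hcc with h1 | h1
  · left; rw [hs1, h1, one_smul]
  · right; rw [hs1, h1, neg_one_smul]

end clifford

/-! ### Parity in Grassmann algebras -/

section parity
variable {ι : Type}

/-- The parity automorphism of a Grassmann algebra, to the power `p`. -/
def sgn (p : ZMod 2) : Grassmann ι →ₐ[ℝ] Grassmann ι :=
  if p = 0 then AlgHom.id ℝ _ else CliffordAlgebra.involute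

theorem sgn_zero : (sgn 0 : Grassmann ι →ₐ[ℝ] Grassmann ι) = AlgHom.id ℝ _ := if_pos rfl

theorem sgn_one : (sgn 1 : Grassmann ι →ₐ[ℝ] Grassmann ι) = CliffordAlgebra.involute :=
  if_neg one_ne_zero

theorem ZMod.two_cases : ∀ p : ZMod 2, p = 0 ∨ p = 1 := by
  decide

theorem ZMod.two_add_self (p : ZMod 2) : p + p = 0 := by
  rcases ZMod.two_cases p with rfl | rfl <;> rfl

theorem sgn_sgn (p q : ZMod 2) (x : Grassmann ι) : sgn p (sgn q x) = sgn (p + q) x := by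
  rcases ZMod.two_cases p with rfl | rfl <;> rcases ZMod.two_cases q with rfl | rfl
  · simp [sgn_zero]
  · simp [sgn_zero]
  · simp [sgn_zero]
  · have : (1 : ZMod 2) + 1 = 0 := rfl
    simp [this, sgn_zero, sgn_one]

theorem mul_gen (x : Grassmann ι) (v : ι → ℝ) :
    x * ExteriorAlgebra.ι ℝ v = ExteriorAlgebra.ι ℝ v * CliffordAlgebra.involute x := by
  induction x using CliffordAlgebra.induction with
  | algebraMap r => rw [AlgHom.commutes, Algebra.commutes]
  | ι w =>
    rw [CliffordAlgebra.involute_ι, mul_neg, eq_neg_iff_add_eq_zero]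
    exact ExteriorAlgebra.ι_add_mul_swap w v
  | mul a b ha hb => rw [mul_assoc, hb, ← mul_assoc, ha, map_mul, mul_assoc]
  | add a b ha hb => rw [add_mul, ha, hb, map_add, mul_add]

theorem mul_of_mem_grade {p : ZMod 2} {a : Grassmann ι} (ha : a ∈ grade ι p) (x : Grassmann ι) :
    x * a = a * sgn p x := by
  have hodd : ∀ v : ι → ℝ, ∀ y : Grassmann ι, y * ExteriorAlgebra.ι ℝ v =
    ExteriorAlgebra.ι ℝ v * CliffordAlgebra.involute y := fun v y => mul_gen y v
  have h2 : ∀ v w : ι → ℝ, ∀ y : Grassmann ι,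
      y * (ExteriorAlgebra.ι ℝ v * ExteriorAlgebra.ι ℝ w) =
      ExteriorAlgebra.ι ℝ v * ExteriorAlgebra.ι ℝ w * y := by
    intro v w y
    rw [← mul_assoc, hodd v, mul_assoc, hodd w (CliffordAlgebra.involute y),
      CliffordAlgebra.involute_involute, mul_assoc]
  rcases ZMod.two_cases p with rfl | rfl
  · simp only [sgn_zero, AlgHom.coe_id, id_eq]
    induction a, ha using CliffordAlgebra.even_induction with
    | algebraMap r => exact (Algebra.commutes r x).symm
    | add a b _ _ iha ihb => rw [mul_add, add_mul, iha, ihb]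
    | ι_mul_ι_mul v w a _ ih => rw [← mul_assoc, h2, mul_assoc, ih, mul_assoc _ a x]
  · rw [sgn_one]
    induction a, ha using CliffordAlgebra.odd_induction with
    | ι v => exact hodd v x
    | add a b _ _ iha ihb => rw [mul_add, add_mul, iha, ihb]
    | ι_mul_ι_mul v w a _ ih =>
      rw [← mul_assoc, h2, mul_assoc, ih, mul_assoc _ a]

theorem sgn_of_mem_grade_zero {p : ZMod 2} {a : Grassmann ι} (ha : a ∈ grade ι 0) :
    sgn p a = a := by
  rcases ZMod.two_cases p with rfl | rfl
  · simp [sgn_zero]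
  · rw [sgn_one]; exact CliffordAlgebra.involute_eq_of_mem_even ha

theorem sgn_one_of_mem_grade_one {a : Grassmann ι} (ha : a ∈ grade ι 1) :
    sgn 1 a = -a := by
  rw [sgn_one]; exact CliffordAlgebra.involute_eq_of_mem_odd ha

theorem mul_mem_grade {p q : ZMod 2} {a b : Grassmann ι} (ha : a ∈ grade ι p)
    (hb : b ∈ grade ι q) : a * b ∈ grade ι (p + q) :=
  CliffordAlgebra.evenOdd_mul_le _ p q (Submodule.mul_mem_mul ha hb)

theorem algebraMap_mem_grade (r : ℝ) : algebraMap ℝ (Grassmann ι) r ∈ grade ι 0 := by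
  rw [Algebra.algebraMap_eq_smul_one]
  exact Submodule.smul_mem _ _ (CliffordAlgebra.one_le_evenOdd_zero _ (Submodule.one_le.1 le_rfl))

theorem map_sgn {κ : Type} (f : (ι → ℝ) →ₗ[ℝ] (κ → ℝ)) (p : ZMod 2) (x : Grassmann ι) :
    ExteriorAlgebra.map f (sgn p x) = sgn p (ExteriorAlgebra.map f x) := by
  have : (ExteriorAlgebra.map f).comp (sgn p) = (sgn p).comp (ExteriorAlgebra.map f) := by
    rcases ZMod.two_cases p with rfl | rfl
    · simp [sgn_zero]
    · rw [sgn_one, sgn_one]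
      apply ExteriorAlgebra.hom_ext
      ext v
      simp [CliffordAlgebra.involute_ι]
  exact DFunLike.congr_fun this x

end parity

section sig
variable {N : ℕ} {A : Type} [Ring A] [Algebra ℝ A]

/-- The parity automorphism of `Λ_N`, extended to `Λ_N ⊗ A`. -/
def sig (p : ZMod 2) : Lam N ⊗[ℝ] A →ₐ[ℝ] Lam N ⊗[ℝ] A :=
  Algebra.TensorProduct.map (sgn p) (AlgHom.id ℝ A)

theorem sig_tmul (p : ZMod 2) (a : Lam N) (x : A) : sig p (a ⊗ₜ[ℝ] x) = sgn p a ⊗ₜ x := rfl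

theorem sig_sig (p q : ZMod 2) (x : Lam N ⊗[ℝ] A) : sig p (sig q x) = sig (p + q) x := by
  induction x with
  | zero => simp
  | tmul a x => simp only [sig_tmul, sgn_sgn]
  | add x y hx hy => simp only [map_add, hx, hy]

theorem sig_zero (x : Lam N ⊗[ℝ] A) : sig 0 x = x := by
  induction x with
  | zero => simp
  | tmul a x => simp [sig_tmul, sgn_zero]
  | add x y hx hy => simp only [map_add, hx, hy]

theorem sig_self (p : ZMod 2) (x : Lam N ⊗[ℝ] A) : sig p (sig p x) = x := by
  rw [sig_sig, ZMod.two_add_self, sig_zero]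

theorem mul_tmul_one_of_mem_grade {p : ZMod 2} {a : Lam N} (ha : a ∈ grade (Fin N) p)
    (x : Lam N ⊗[ℝ] A) : x * (a ⊗ₜ[ℝ] 1) = (a ⊗ₜ[ℝ] 1) * sig p x := by
  induction x with
  | zero => simp
  | tmul b x =>
    rw [sig_tmul, Algebra.TensorProduct.tmul_mul_tmul, Algebra.TensorProduct.tmul_mul_tmul,
      mul_of_mem_grade ha, mul_one, one_mul]
  | add x y hx hy => simp only [map_add, hx, hy, add_mul, mul_add]

variable {m n l : ℕ}

/-- Fermionic coordinates anticommute with the generators of `Λ_N`, so passing one of them applies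
the parity automorphism. All twists by `sig` in `Inf` and `Cov` originate here. -/
theorem lamIncl_mul_coord (a : Lam N) (i : Fin l) (k : Idx m n) :
    lamIncl m n N l a * coord N i k = coord N i k * lamIncl m n N l (sgn (parity k) a) := by
  rcases k with k | k
  · simp [lamIncl, coord, parity, sgn_zero]
  · simp only [lamIncl, coord, parity, sgn_one, Sum.elim_inr, AlgHom.comp_apply,
      Algebra.TensorProduct.includeRight_apply, Algebra.TensorProduct.tmul_mul_tmul, one_mul]
    rw [gGen, mul_gen, ← sgn_one, ← sgn_one, map_sgn]

section coefficients
variable {R : Type} [Ring R] [Algebra ℝ R] {f : Lam N →ₐ[ℝ] R} {x : Idx m n → R}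
  (hx : ∀ a k, f a * x k = x k * f (sgn (parity k) a))

theorem map_mul_tmul (hx : ∀ a k, f a * x k = x k * f (sgn (parity k) a)) (y : Lam N ⊗[ℝ] A)
    (k : Idx m n) (g : A) :
    Algebra.TensorProduct.map f (AlgHom.id ℝ A) y * (x k ⊗ₜ g) = (x k ⊗ₜ 1) *
      Algebra.TensorProduct.map f (AlgHom.id ℝ A) (sig (parity k) y * (1 ⊗ₜ g)) := by
  induction y with
  | zero => simp
  | tmul a y => simp [sig_tmul, hx]
  | add y z hy hz => simp only [map_add, hy, hz, add_mul, mul_add]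

theorem tmul_mul_map (y : Lam N ⊗[ℝ] A) (k : Idx m n) (g : A) :
    (x k ⊗ₜ g) * Algebra.TensorProduct.map f (AlgHom.id ℝ A) y =
      (x k ⊗ₜ 1) * Algebra.TensorProduct.map f (AlgHom.id ℝ A) ((1 ⊗ₜ g) * y) := by
  rw [map_mul, ← mul_assoc]
  congr 1
  simp

theorem sum_mulVec (hx : ∀ a k, f a * x k = x k * f (sgn (parity k) a)) (X : SMat m n N)
    (g : Idx m n → A) :
    ∑ j, (X.map f).mulVec x j ⊗ₜ[ℝ] g j = ∑ k, (x k ⊗ₜ 1) *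
      Algebra.TensorProduct.map f (AlgHom.id ℝ A) (sig (parity k) (∑ j, X j k ⊗ₜ g j)) := by
  simp only [Matrix.mulVec, dotProduct, TensorProduct.sum_tmul, Matrix.map_apply,
    hx, map_sum, sig_tmul, Finset.mul_sum]
  rw [Finset.sum_comm]
  simp only [Algebra.TensorProduct.map_tmul, AlgHom.id_apply, Algebra.TensorProduct.tmul_mul_tmul,
    one_mul]

end coefficients

/-- The commutation relations `B e_k - e_k σ^k(B) = ∑ X_jk e_j` that express `X x = [B, x]`. -/
def Inf (g : Idx m n → A) (B : Lam N ⊗[ℝ] A) (X : SMat m n N) : Prop :=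
  ∀ k, B * (1 ⊗ₜ g k) = (1 ⊗ₜ g k) * sig (parity k) B + ∑ j, X j k ⊗ₜ g j

/-- The commutation relations `s e_k = ∑ M_jk e_j σ^k(s)` that express `s x s⁻¹ = M x`. -/
def Cov (g : Idx m n → A) (s : Lam N ⊗[ℝ] A) (M : SMat m n N) : Prop :=
  ∀ k, s * (1 ⊗ₜ g k) = (∑ j, M j k ⊗ₜ g j) * sig (parity k) s

section coefficients
variable {R : Type} [Ring R] [Algebra ℝ R] {f : Lam N →ₐ[ℝ] R} {x : Idx m n → R}

/-- Collecting the coordinate `x k` on the left twists `B` by the parity of `k`. The `k`-th relation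
is therefore used after applying `sig (parity k)`, which turns it into the commutator with the
untwisted `B` on the right. -/
theorem Inf.sum_eq (hx : ∀ a k, f a * x k = x k * f (sgn (parity k) a)) {g : Idx m n → A}
    {B : Lam N ⊗[ℝ] A} {X : SMat m n N} (h : Inf g B X) :
    ∑ j, (X.map f).mulVec x j ⊗ₜ[ℝ] g j =
      Algebra.TensorProduct.map f (AlgHom.id ℝ A) B * ∑ k, x k ⊗ₜ g k -
        (∑ k, x k ⊗ₜ g k) * Algebra.TensorProduct.map f (AlgHom.id ℝ A) B := by
  rw [sum_mulVec hx, Finset.mul_sum, Finset.sum_mul, ← Finset.sum_sub_distrib]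
  refine Finset.sum_congr rfl fun k _ => ?_
  have := congrArg (sig (parity k)) (h k)
  rw [map_mul, map_add, map_mul, sig_self, sig_tmul, map_one] at this
  rw [map_mul_tmul hx, tmul_mul_map B, this, map_add, mul_add, add_sub_cancel_left]

theorem Cov.sum_eq (hx : ∀ a k, f a * x k = x k * f (sgn (parity k) a)) {g : Idx m n → A}
    {s t : Lam N ⊗[ℝ] A} {M : SMat m n N} (h : Cov g s M) (hst : s * t = 1) :
    Algebra.TensorProduct.map f (AlgHom.id ℝ A) s * (∑ k, x k ⊗ₜ g k) *
      Algebra.TensorProduct.map f (AlgHom.id ℝ A) t = ∑ k, (M.map f).mulVec x k ⊗ₜ[ℝ] g k := by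
  have : Algebra.TensorProduct.map f (AlgHom.id ℝ A) s * (∑ k, x k ⊗ₜ g k) =
      (∑ k, (M.map f).mulVec x k ⊗ₜ[ℝ] g k) * Algebra.TensorProduct.map f (AlgHom.id ℝ A) s := by
    rw [sum_mulVec hx, Finset.mul_sum, Finset.sum_mul]
    refine Finset.sum_congr rfl fun k _ => ?_
    have := congrArg (sig (parity k)) (h k)
    rw [map_mul, map_mul, sig_self, sig_tmul, map_one] at this
    rw [map_mul_tmul hx, this, map_mul, mul_assoc]
  rw [this, mul_assoc, ← map_mul, hst, map_one, mul_one]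

end coefficients

theorem Inf.isPhi {B : Lam N ⊗[ℝ] CliffordWeyl m n} {X : SMat m n N} (h : Inf cwGen B X) :
    IsPhi l B X :=
  fun i => h.sum_eq fun a k => lamIncl_mul_coord a i k

theorem osc_cwGen (k : Idx m n) : osc m n (cwGen k) = oscGen k := by
  rw [osc, cwGen, RingQuot.liftAlgHom_mkAlgHom_apply, FreeAlgebra.lift_ι_apply]

theorem embed_vec (y : Idx m n → SuperPoly m n N l) :
    embed m n _ (vec y) = ∑ k, y k ⊗ₜ oscGen k := by
  simp [vec, embed, osc_cwGen]

theorem Cov.isH {s : Completed m n N} {M : SMat m n N} (h : Cov oscGen s M) (hs : IsUnit s) :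
    IsH l s M := by
  refine ⟨hs, fun i => ?_⟩
  rw [embed_vec, embed_vec]
  exact h.sum_eq (fun a k => lamIncl_mul_coord a i k) (Ring.mul_inverse_cancel _ hs)

theorem Inf.embed {B : Lam N ⊗[ℝ] CliffordWeyl m n} {X : SMat m n N} (h : Inf cwGen B X) :
    Inf oscGen (embed m n _ B) X := by
  intro k
  have hs : ∀ B : Lam N ⊗[ℝ] CliffordWeyl m n, ∀ p,
      SuperSpin.embed m n _ (sig p B) = sig p (SuperSpin.embed m n _ B) := by
    intro B p
    induction B with
    | zero => simp
    | tmul a x => simp [SuperSpin.embed, sig_tmul]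
    | add x y hx hy => simp only [map_add, hx, hy]
  have := congrArg (SuperSpin.embed m n _) (h k)
  rw [map_mul, map_add, map_mul, hs, map_sum] at this
  simpa only [SuperSpin.embed, Algebra.TensorProduct.map_tmul, osc_cwGen, map_one,
    AlgHom.id_apply] using this

end sig

/-! ### Uniqueness of the matrices `φ(B)` and `h(s)` -/

section
variable {m n N l : ℕ}

/-- The Gaussian separates `0` from `1`. Nontriviality is needed for linear independence of the
generators and for `s ≠ -s`. -/
instance (n : ℕ) : Nontrivial (SchwOp n) :=
  ⟨0, 1, fun h => gauss_ne_zero 0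
    (DFunLike.congr_fun (congrArg (fun T : SchwOp n => T.toEnd (gauss n)) h).symm 0)⟩

instance {A B : Type} [Ring A] [Algebra ℝ A] [Ring B] [Algebra ℝ B] [Nontrivial A] [Nontrivial B] :
    Nontrivial (A ⊗[ℝ] B) :=
  (Algebra.TensorProduct.includeLeft_injective (S := ℝ) (A := A)
    (FaithfulSMul.algebraMap_injective ℝ B)).nontrivial

/-- The multiplication rules of the generators of the Clifford–Weyl algebra. -/
structure IsCW {A : Type} [Ring A] [Algebra ℝ A] (g : Idx m n → A) : Prop where
  ee : ∀ j k, g (.inl j) * g (.inl k) + g (.inl k) * g (.inl j) =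
    algebraMap ℝ A (if j = k then -2 else 0)
  eo : ∀ j k, g (.inl j) * g (.inr k) + g (.inr k) * g (.inl j) = 0
  oo : ∀ j k, g (.inr j) * g (.inr k) - g (.inr k) * g (.inr j) = algebraMap ℝ A (Omega n j k)

theorem isCW_cwGen : IsCW (cwGen : Idx m n → CliffordWeyl m n) where
  ee j k := by simpa [cwGen] using RingQuot.mkAlgHom_rel ℝ (CWRel.ee (m := m) (n := n) j k)
  eo j k := by simpa [cwGen] using RingQuot.mkAlgHom_rel ℝ (CWRel.eo (m := m) (n := n) j k)
  oo j k := by simpa [cwGen] using RingQuot.mkAlgHom_rel ℝ (CWRel.oo (m := m) (n := n) j k)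

theorem isCW_oscGen : IsCW (oscGen : Idx m n → CompletedCW m n) where
  ee j k := by
    have := congrArg (osc m n) (isCW_cwGen.ee j k)
    rwa [map_add, map_mul, map_mul, osc_cwGen, osc_cwGen, AlgHom.commutes] at this
  eo j k := by
    have := congrArg (osc m n) (isCW_cwGen.eo j k)
    rwa [map_add, map_mul, map_mul, osc_cwGen, osc_cwGen, map_zero] at this
  oo j k := by
    have := congrArg (osc m n) (isCW_cwGen.oo j k)
    rwa [map_sub, map_mul, map_mul, osc_cwGen, osc_cwGen, AlgHom.commutes] at this

/-- In a linear relation, the anticommutator with an orthogonal generator isolates its coefficient.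
For the remaining relation, the commutators with the symplectic generators give a vector annihilated
by `Ω`, which is invertible. -/
theorem IsCW.linearIndependent {A : Type} [Ring A] [Algebra ℝ A] [Nontrivial A] {g : Idx m n → A}
    (hg : IsCW g) : LinearIndependent ℝ g := by
  rw [Fintype.linearIndependent_iff]
  intro c hc
  rw [Fintype.sum_sum_type] at hc
  have inj := FaithfulSMul.algebraMap_injective ℝ A
  have h1 : ∀ k, c (.inl k) = 0 := by
    intro k
    have h := congrArg (fun x => x * g (.inl k) + g (.inl k) * x) hc
    simp only [add_mul, mul_add, Finset.sum_mul, Finset.mul_sum, zero_mul, mul_zero, add_zero,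
      smul_mul_assoc, mul_smul_comm] at h
    rw [add_add_add_comm, ← Finset.sum_add_distrib, ← Finset.sum_add_distrib] at h
    simp only [← smul_add, hg.ee] at h
    rw [Finset.sum_eq_zero (s := Finset.univ) (f := fun x => c (.inr x) • _)
      (fun j _ => by rw [add_comm (g (.inr j) * _), hg.eo, smul_zero]), add_zero] at h
    simp only [Algebra.smul_def, ← map_mul, ← map_sum] at h
    have := inj (h.trans (map_zero _).symm)
    simpa using this
  have h2 : ∀ k, ∑ j, c (.inr j) * Omega n j k = 0 := by
    intro k
    have h := congrArg (fun x => x * g (.inr k) - g (.inr k) * x) hc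
    simp only [h1, zero_smul, Finset.sum_const_zero, zero_add, Finset.sum_mul, Finset.mul_sum,
      zero_mul, mul_zero, sub_zero, smul_mul_assoc, mul_smul_comm] at h
    rw [← Finset.sum_sub_distrib] at h
    have h' : ∀ j, c (.inr j) • (g (.inr j) * g (.inr k)) - c (.inr j) • (g (.inr k) * g (.inr j)) =
        algebraMap ℝ A (c (.inr j) * Omega n j k) := fun j => by
      rw [← smul_sub, hg.oo, Algebra.smul_def, ← map_mul]
    rw [Finset.sum_congr rfl fun j _ => h' j, ← map_sum] at h
    exact inj (h.trans (map_zero _).symm)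
  have h3 : Matrix.vecMul (fun j => c (.inr j)) (Omega n) = 0 := funext h2
  have h4 : (fun j => c (.inr j)) = 0 := by
    have := congrArg (fun v => Matrix.vecMul v (Omega n)) h3
    simpa [Matrix.vecMul_vecMul, Omega_mul_self, Matrix.vecMul_neg] using this
  rintro (k | k)
  · exact h1 k
  · exact congrFun h4 k

theorem eq_of_sum_tmul_eq {A R : Type} [Ring A] [Algebra ℝ A] [Ring R] [Algebra ℝ R] {κ : Type}
    [Fintype κ] {g : κ → A} (hg : LinearIndependent ℝ g) {y z : κ → R}
    (h : ∑ j, y j ⊗ₜ[ℝ] g j = ∑ j, z j ⊗ₜ[ℝ] g j) : y = z := by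
  obtain ⟨f, hf⟩ := LinearMap.exists_leftInverse_of_injective (Finsupp.linearCombination ℝ g)
    (LinearMap.ker_eq_bot.2 hg)
  classical
  have hfg : ∀ j k, (f (g j)) k = if j = k then 1 else 0 := by
    intro j k
    have := congrArg (fun x : κ →₀ ℝ => x k) (LinearMap.congr_fun hf (Finsupp.single j 1))
    simpa [Finsupp.single_apply] using this
  funext k
  have := congrArg (TensorProduct.rid ℝ R ∘ LinearMap.lTensor R (Finsupp.lapply k ∘ₗ f)) h
  simpa [hfg, ite_smul] using this

/-- The inclusion of the generators of `Λ_N` among the anticommuting variables. -/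
abbrev lamLin (n N l : ℕ) : (Fin N → ℝ) →ₗ[ℝ] (Fin N ⊕ Fin l × Fin n × Fin 2 → ℝ) :=
  LinearMap.pi (Sum.elim (fun j => LinearMap.proj j) fun _ => 0)

theorem lamMap_injective : Function.Injective (ExteriorAlgebra.map
      (lamLin n N l)) := by
  refine ExteriorAlgebra.map_injective_field (LinearMap.ker_eq_bot'.2 fun v hv => ?_)
  funext j
  exact congrFun hv (.inl j)

/-- The coordinates of a single variable are independent over `Λ_N`: the coefficient of a monomial
of degree one isolates a bosonic term, and contraction with a fermionic direction, which kills the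
image of `Λ_N`, isolates a fermionic one. -/
theorem eq_zero_of_sum_lamIncl {a : Idx m n → Lam N} (i : Fin l)
    (h : ∑ k, lamIncl m n N l (a k) * coord N i k = 0) : a = 0 := by
  have e1 : ∀ (b : Lam N) k, lamIncl m n N l b * coord N i (.inl k) =
    MvPolynomial.X (i, k) ⊗ₜ ExteriorAlgebra.map (lamLin n N l) b := by
    intro b k
    simp only [lamIncl, coord, Sum.elim_inl, AlgHom.comp_apply,
      Algebra.TensorProduct.includeRight_apply, Algebra.TensorProduct.tmul_mul_tmul, one_mul, mul_one]
  have e2 : ∀ (b : Lam N) k, lamIncl m n N l b * coord N i (.inr k) =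
    1 ⊗ₜ (ExteriorAlgebra.map (lamLin n N l) b * gGen (.inr (i, k))) := by
    intro b k
    simp only [lamIncl, coord, Sum.elim_inr, AlgHom.comp_apply,
      Algebra.TensorProduct.includeRight_apply, Algebra.TensorProduct.tmul_mul_tmul, one_mul]
  rw [Fintype.sum_sum_type] at h
  simp only [e1, e2] at h
  have h1 : ∀ k, a (.inl k) = 0 := by
    intro k
    have := congrArg (TensorProduct.lid ℝ _ ∘
      LinearMap.rTensor _ (MvPolynomial.lcoeff (R := ℝ) (Finsupp.single (i, k) 1))) h
    simp only [Function.comp_apply, map_add, map_sum, LinearMap.rTensor_tmul,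
      TensorProduct.lid_tmul, MvPolynomial.lcoeff_apply, MvPolynomial.coeff_X, map_zero,
      MvPolynomial.coeff_one, Finsupp.single_eq_single_iff] at this
    refine lamMap_injective (n := n) (l := l) ?_
    rw [map_zero, ← this]
    simp only [Prod.mk.injEq, true_and, and_true, one_ne_zero, and_false, or_false]
    rw [if_neg fun h0 => one_ne_zero (Finsupp.single_eq_zero.1 h0.symm)]
    simp
  have h2 := congrArg (TensorProduct.lid ℝ _ ∘
      LinearMap.rTensor _ (MvPolynomial.lcoeff (R := ℝ) 0)) h
  simp only [Function.comp_apply, map_sum, LinearMap.rTensor_tmul, h1, map_zero,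
      TensorProduct.lid_tmul, MvPolynomial.lcoeff_apply, MvPolynomial.coeff_zero_one, one_smul,
      TensorProduct.tmul_zero, Finset.sum_const_zero, zero_add] at h2
  have h3 : ∀ k, a (.inr k) = 0 := by
    intro k
    have hz : ∀ b : Lam N, CliffordAlgebra.contractRight (Q := 0)
        (ExteriorAlgebra.map (lamLin n N l) b)
        (LinearMap.proj (.inr (i, k))) = 0 := by
      intro b
      induction b using CliffordAlgebra.right_induction with
      | algebraMap r => rw [AlgHom.commutes]; exact CliffordAlgebra.contractRight_algebraMap _ _ r
      | add x y hx hy => rw [map_add, map_add, LinearMap.add_apply, hx, hy, add_zero]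
      | mul_ι v x hx =>
        rw [map_mul]
        erw [ExteriorAlgebra.map_apply_ι]
        erw [CliffordAlgebra.contractRight_mul_ι]
        rw [hx]
        simp
    have := congrArg (fun x => CliffordAlgebra.contractRight (Q := 0) x
      (LinearMap.proj (.inr (i, k)))) h2
    simp only [map_sum, LinearMap.sum_apply, map_zero, LinearMap.zero_apply, gGen] at this
    refine lamMap_injective (n := n) (l := l) ?_
    rw [map_zero, ← this]
    symm
    rw [Finset.sum_eq_single k]
    · erw [CliffordAlgebra.contractRight_mul_ι]
      rw [hz]
      simp
    · intro j _ hj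
      erw [CliffordAlgebra.contractRight_mul_ι]
      rw [hz]
      simp [Ne.symm hj]
    · simp
  funext k
  rcases k with k | k
  · exact h1 k
  · exact h3 k

theorem matCoord_injective (i : Fin l) {M M' : SMat m n N} (h : matCoord M i = matCoord M' i) :
    M = M' := by
  ext j k
  have : (fun k => M j k - M' j k) = 0 := by
    refine eq_zero_of_sum_lamIncl i ?_
    simp only [map_sub, sub_mul, Finset.sum_sub_distrib]
    exact sub_eq_zero.2 (congrFun h j)
  exact sub_eq_zero.1 (congrFun this k)

theorem IsH.unique (hl : 0 < l) {s : Completed m n N} {M M' : SMat m n N} (h : IsH l s M)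
    (h' : IsH l s M') : M = M' := by
  have := (h.2 ⟨0, hl⟩).symm.trans (h'.2 ⟨0, hl⟩)
  rw [embed_vec, embed_vec] at this
  exact matCoord_injective _ (eq_of_sum_tmul_eq isCW_oscGen.linearIndependent this)

theorem IsPhi.unique (hl : 0 < l) {B : Lam N ⊗[ℝ] CliffordWeyl m n} {X X' : SMat m n N}
    (h : IsPhi l B X) (h' : IsPhi l B X') : X = X' := by
  have := congrArg (SuperSpin.embed m n _) ((h ⟨0, hl⟩).trans (h' ⟨0, hl⟩).symm)
  rw [embed_vec, embed_vec] at this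
  exact matCoord_injective _ (eq_of_sum_tmul_eq isCW_oscGen.linearIndependent this)

end

/-! ### Extended superbivectors and `𝔰𝔬₀` -/

section
variable {m n N l : ℕ}

/-- The product of a real matrix and the odd-odd block of `X`. -/
def oddForm (X : SMat m n N) (j k : Fin n × Fin 2) : Lam N :=
  -∑ i, Omega n i k • X (.inr j) (.inr i)

theorem oddForm_add (X Y : SMat m n N) (j k) :
    oddForm (X + Y) j k = oddForm X j k + oddForm Y j k := by
  simp [oddForm, Finset.sum_add_distrib, add_comm]

theorem oddForm_smul (c : ℝ) (X : SMat m n N) (j k) : oddForm (c • X) j k = c • oddForm X j k := by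
  simp [oddForm, Finset.smul_sum, smul_comm c]

/-- The superbivector with the matrix `X ∈ 𝔰𝔬₀`. -/
def bv (X : SMat m n N) : Lam N ⊗[ℝ] CliffordWeyl m n :=
  (∑ j, ∑ k, ((-1 / 4 : ℝ) • X (.inl j) (.inl k)) ⊗ₜ (cwGen (.inl j) * cwGen (.inl k))) +
  (∑ j, ∑ k, ((1 / 2 : ℝ) • X (.inr k) (.inl j)) ⊗ₜ (cwGen (.inl j) * cwGen (.inr k))) +
  (∑ j, ∑ k, ((1 / 2 : ℝ) • oddForm X j k) ⊗ₜ (cwGen (.inr j) * cwGen (.inr k)))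

theorem bv_add (X Y : SMat m n N) : bv (X + Y) = bv X + bv Y := by
  simp only [bv, oddForm_add, Matrix.add_apply, smul_add, TensorProduct.add_tmul, Finset.sum_add_distrib]
  abel

theorem bv_smul (c : ℝ) (X : SMat m n N) : bv (c • X) = c • bv X := by
  simp only [bv, oddForm_smul, Matrix.smul_apply, smul_add, Finset.smul_sum, ← TensorProduct.smul_tmul',
    smul_comm c]

/-- The defining equations of `𝔰𝔬₀`, in terms of entries. -/
structure SoEntries (X : SMat m n N) : Prop where
  ee : ∀ j k, X (.inl j) (.inl k) = -X (.inl k) (.inl j)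
  eo : ∀ j k, X (.inl j) (.inr k) = (1 / 2 : ℝ) • ∑ i, Omega n i k • X (.inr i) (.inl j)
  oo : ∀ j k, oddForm X j k = oddForm X k j

theorem Omega_apply_neg (j k : Fin n × Fin 2) : Omega n j k = -Omega n k j := by
  have := congrFun (congrFun (Omega_transpose (n := n)) k) j
  simpa using this

theorem mul_Omega_map (D : Matrix (Fin n × Fin 2) (Fin n × Fin 2) (Lam N)) (j k) :
    (D * (Omega n).map (algebraMap ℝ (Lam N))) j k = ∑ i, Omega n i k • D j i := by
  simp [Matrix.mul_apply, Algebra.smul_def, Algebra.commutes]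

theorem Omega_map_mul (D : Matrix (Fin n × Fin 2) (Fin n × Fin 2) (Lam N)) (j k) :
    ((Omega n).map (algebraMap ℝ (Lam N)) * D) j k = ∑ i, Omega n j i • D i k := by
  simp [Matrix.mul_apply, Algebra.smul_def]

theorem Omega_map_mul_self : (Omega n).map (algebraMap ℝ (Lam N)) *
    (Omega n).map (algebraMap ℝ (Lam N)) = -1 := by
  rw [← Matrix.map_mul, Omega_mul_self]
  ext j k
  by_cases h : j = k <;> simp [h]

theorem transpose_mul_Omega_map (D : Matrix (Fin n × Fin 2) (Fin n × Fin 2) (Lam N)) :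
    (D * (Omega n).map (algebraMap ℝ (Lam N))).transpose =
      -((Omega n).map (algebraMap ℝ (Lam N)) * D.transpose) := by
  ext j k
  rw [Matrix.transpose_apply, mul_Omega_map, Matrix.neg_apply, Omega_map_mul,
    ← Finset.sum_neg_distrib]
  exact Finset.sum_congr rfl fun i _ => by rw [Omega_apply_neg j i, neg_smul, neg_neg]; rfl

theorem oddForm_eq (X : SMat m n N) :
    (oddForm X : Matrix _ _ _) = -(X.toBlocks₂₂ * (Omega n).map (algebraMap ℝ (Lam N))) := by
  ext j k
  rw [Matrix.neg_apply, mul_Omega_map]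
  rfl

theorem oddForm_mul_Omega (X : SMat m n N) (j k) :
    ∑ i, Omega n i k • oddForm X j i = X (.inr j) (.inr k) := by
  rw [← mul_Omega_map (oddForm X), oddForm_eq, neg_mul, Matrix.mul_assoc, Omega_map_mul_self]
  simp [Matrix.toBlocks₂₂]

theorem supertranspose_mul_Qmat_add (X : SMat m n N) :
    supertranspose X * Qmat m n N + Qmat m n N * X = Matrix.fromBlocks
      (X.toBlocks₁₁.transpose + X.toBlocks₁₁)
      (-(1 / 2 : ℝ) • (X.toBlocks₂₁.transpose * (Omega n).map (algebraMap ℝ (Lam N))) + X.toBlocks₁₂)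
      (-X.toBlocks₁₂.transpose - (1 / 2 : ℝ) • ((Omega n).map (algebraMap ℝ (Lam N)) * X.toBlocks₂₁))
      (-(1 / 2 : ℝ) • (X.toBlocks₂₂.transpose * (Omega n).map (algebraMap ℝ (Lam N)) +
        (Omega n).map (algebraMap ℝ (Lam N)) * X.toBlocks₂₂)) := by
  have hω : (-(1 / 2 : ℝ) • Omega n).map (algebraMap ℝ (Lam N)) =
      -(1 / 2 : ℝ) • (Omega n).map (algebraMap ℝ (Lam N)) := by
    ext j k
    rw [Matrix.map_apply, Matrix.smul_apply, Matrix.smul_apply, smul_eq_mul, map_mul,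
      Algebra.smul_def, Matrix.map_apply]
  rw [← Matrix.fromBlocks_toBlocks X, Qmat, realMat, supertranspose, Matrix.fromBlocks_map, hω]
  simp only [Matrix.toBlocks_fromBlocks₁₁, Matrix.toBlocks_fromBlocks₁₂,
    Matrix.toBlocks_fromBlocks₂₁, Matrix.toBlocks_fromBlocks₂₂, Matrix.fromBlocks_multiply,
    Matrix.fromBlocks_add]
  simp [sub_eq_add_neg]

theorem mul_eq_neg_mul_iff_of_sq_eq_neg_one {R : Type*} [Ring R] {o x y : R} (ho : o * o = -1) :
    o * y = -(x * o) ↔ y * o + o * x = 0 := by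
  constructor
  · intro h
    have h1 : y = o * x * o := by
      have := congrArg (o * ·) h
      simpa [← mul_assoc, ho] using this
    rw [h1, mul_assoc _ o o, ho]
    simp
  · intro h
    have h1 : y = o * x * o := by
      have := congrArg (· * o) h
      simp only [add_mul, mul_assoc y, ho, zero_mul] at this
      simpa [neg_add_eq_zero] using this
    rw [h1, ← mul_assoc, ← mul_assoc, ho]
    simp

/-- The four blocks of the defining equation give only three conditions: the lower left block
follows from the upper right one by antisymmetry of `Ω`, and the odd diagonal block says that `X₂₂
Ω` is symmetric. -/
theorem mem_so0_iff (X : SMat m n N) : X ∈ so0 m n N ↔ IsSupermatrix X ∧ SoEntries X := by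
  refine and_congr_right fun _ => ?_
  rw [supertranspose_mul_Qmat_add, ← Matrix.fromBlocks_zero, Matrix.fromBlocks_inj]
  have hoo : (∀ j k, oddForm X j k = oddForm X k j) ↔
      X.toBlocks₂₂.transpose * (Omega n).map (algebraMap ℝ (Lam N)) +
        (Omega n).map (algebraMap ℝ (Lam N)) * X.toBlocks₂₂ = 0 := by
    have h1 : (∀ j k, oddForm X j k = oddForm X k j) ↔
        Matrix.transpose (oddForm X : Matrix _ _ _) = oddForm X :=
      ⟨fun h => Matrix.ext fun j k => (h j k).symm, fun h j k => (congrFun (congrFun h j) k).symm⟩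
    rw [h1, oddForm_eq, Matrix.transpose_neg, transpose_mul_Omega_map, neg_neg]
    exact mul_eq_neg_mul_iff_of_sq_eq_neg_one Omega_map_mul_self
  have heo : (∀ j k, X (.inl j) (.inr k) = (1 / 2 : ℝ) • ∑ i, Omega n i k • X (.inr i) (.inl j)) ↔
      -(1 / 2 : ℝ) • (X.toBlocks₂₁.transpose * (Omega n).map (algebraMap ℝ (Lam N))) +
        X.toBlocks₁₂ = 0 := by
    rw [← Matrix.ext_iff]
    refine forall_congr' fun j => forall_congr' fun k => ?_
    rw [Matrix.add_apply, Matrix.smul_apply, neg_smul, Matrix.zero_apply, neg_add_eq_zero, eq_comm]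
    simp [Matrix.mul_apply, Algebra.smul_def, Algebra.commutes, Matrix.toBlocks₁₂,
      Matrix.toBlocks₂₁]
  have hoe : (∀ j k, X (.inl j) (.inr k) = (1 / 2 : ℝ) • ∑ i, Omega n i k • X (.inr i) (.inl j)) →
      -X.toBlocks₁₂.transpose - (1 / 2 : ℝ) • ((Omega n).map (algebraMap ℝ (Lam N)) * X.toBlocks₂₁)
        = 0 := by
    intro h
    ext k j
    have : X.toBlocks₁₂.transpose k j = X (.inl j) (.inr k) := rfl
    rw [Matrix.sub_apply, Matrix.neg_apply, this, h, Matrix.smul_apply, Matrix.mul_apply,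
      Matrix.zero_apply, sub_eq_zero, ← smul_neg, ← Finset.sum_neg_distrib]
    congr 1
    refine Finset.sum_congr rfl fun i _ => ?_
    rw [Omega_apply_neg i k, neg_smul, neg_neg, Algebra.smul_def]
    rfl
  have hee : (∀ j k, X (.inl j) (.inl k) = -X (.inl k) (.inl j)) ↔
      X.toBlocks₁₁.transpose + X.toBlocks₁₁ = 0 := by
    rw [← Matrix.ext_iff]
    refine forall_congr' fun j => forall_congr' fun k => ?_
    rw [eq_neg_iff_add_eq_zero, add_comm]
    rfl
  have hs : -(1 / 2 : ℝ) ≠ 0 := by norm_num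
  rw [← hee, ← heo, smul_eq_zero_iff_right hs, ← hoo]
  exact ⟨fun h => ⟨h.1, h.2.1, h.2.2.2⟩, fun h => ⟨h.ee, h.eo, hoe h.eo, h.oo⟩⟩

section commutators
variable {A : Type} [Ring A] [Algebra ℝ A] {g : Idx m n → A}

/-- The commutator (or anticommutator, for odd `λ` and odd `e_k`) of `λ x` and `e_k`. -/
def scomm (g : Idx m n → A) (k : Idx m n) : Lam N ⊗[ℝ] A →ₗ[ℝ] Lam N ⊗[ℝ] A :=
  LinearMap.mulRight ℝ (1 ⊗ₜ g k) - LinearMap.mulLeft ℝ (1 ⊗ₜ g k) ∘ₗ (sig (parity k)).toLinearMap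

theorem scomm_tmul (k : Idx m n) (a : Lam N) (x : A) :
    scomm g k (a ⊗ₜ x) = a ⊗ₜ (x * g k) - sgn (parity k) a ⊗ₜ (g k * x) := by
  simp [scomm, sig_tmul]

theorem inf_iff (B : Lam N ⊗[ℝ] A) (X : SMat m n N) :
    Inf g B X ↔ ∀ k, scomm g k B = ∑ j, X j k ⊗ₜ g j :=
  forall_congr' fun _ => by simp only [scomm, LinearMap.sub_apply, sub_eq_iff_eq_add']; rfl

variable (hg : IsCW g)
include hg

/-- This and the next five rules rest on identities such as `[ab, c] = a{b, c} - {a, c}b` or `[ab,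
c] = a[b, c] + [a, c]b`, chosen so that the inner brackets are the scalars of the multiplication
rules. An odd coefficient paired with an odd generator turns the outer commutator into an
anticommutator. -/
theorem scomm_ee_e (a : Lam N) (i j k : Fin m) :
    scomm g (.inl k) (a ⊗ₜ (g (.inl i) * g (.inl j))) =
      (if j = k then (-2 : ℝ) else 0) • a ⊗ₜ g (.inl i) -
      (if i = k then (-2 : ℝ) else 0) • a ⊗ₜ g (.inl j) := by
  rw [scomm_tmul, parity, Sum.elim_inl, sgn_zero, AlgHom.id_apply, ← TensorProduct.tmul_sub,
    ← TensorProduct.tmul_smul, ← TensorProduct.tmul_smul, ← TensorProduct.tmul_sub]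
  congr 1
  have h1 := hg.ee j k
  have h2 := hg.ee i k
  have : g (.inl i) * g (.inl j) * g (.inl k) - g (.inl k) * (g (.inl i) * g (.inl j)) =
    g (.inl i) * (g (.inl j) * g (.inl k) + g (.inl k) * g (.inl j)) -
    (g (.inl i) * g (.inl k) + g (.inl k) * g (.inl i)) * g (.inl j) := by noncomm_ring
  rw [this, h1, h2, ← Algebra.commutes, Algebra.smul_def, Algebra.smul_def]

theorem scomm_oo_e {a : Lam N} (i j : Fin n × Fin 2) (k : Fin m) :
    scomm g (.inl k) (a ⊗ₜ (g (.inr i) * g (.inr j))) = 0 := by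
  rw [scomm_tmul, parity, Sum.elim_inl, sgn_zero, AlgHom.id_apply, ← TensorProduct.tmul_sub]
  have h1 := hg.eo k j
  have h2 := hg.eo k i
  have : g (.inr i) * g (.inr j) * g (.inl k) - g (.inl k) * (g (.inr i) * g (.inr j)) =
    g (.inr i) * (g (.inl k) * g (.inr j) + g (.inr j) * g (.inl k)) -
    (g (.inl k) * g (.inr i) + g (.inr i) * g (.inl k)) * g (.inr j) := by noncomm_ring
  rw [this, h1, h2, mul_zero, zero_mul, sub_zero, TensorProduct.tmul_zero]

theorem scomm_ee_o {a : Lam N} (ha : a ∈ grade (Fin N) 0) (i j : Fin m) (k : Fin n × Fin 2) :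
    scomm g (.inr k) (a ⊗ₜ (g (.inl i) * g (.inl j))) = 0 := by
  rw [scomm_tmul, sgn_of_mem_grade_zero ha, ← TensorProduct.tmul_sub]
  have h1 := hg.eo j k
  have h2 := hg.eo i k
  have : g (.inl i) * g (.inl j) * g (.inr k) - g (.inr k) * (g (.inl i) * g (.inl j)) =
    g (.inl i) * (g (.inl j) * g (.inr k) + g (.inr k) * g (.inl j)) -
    (g (.inl i) * g (.inr k) + g (.inr k) * g (.inl i)) * g (.inl j) := by noncomm_ring
  rw [this, h1, h2, mul_zero, zero_mul, sub_zero, TensorProduct.tmul_zero]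

theorem scomm_oo_o {a : Lam N} (ha : a ∈ grade (Fin N) 0) (i j k : Fin n × Fin 2) :
    scomm g (.inr k) (a ⊗ₜ (g (.inr i) * g (.inr j))) =
      Omega n j k • a ⊗ₜ g (.inr i) + Omega n i k • a ⊗ₜ g (.inr j) := by
  rw [scomm_tmul, sgn_of_mem_grade_zero ha, ← TensorProduct.tmul_sub,
    ← TensorProduct.tmul_smul, ← TensorProduct.tmul_smul, ← TensorProduct.tmul_add]
  congr 1
  have h1 := hg.oo j k
  have h2 := hg.oo i k
  have : g (.inr i) * g (.inr j) * g (.inr k) - g (.inr k) * (g (.inr i) * g (.inr j)) =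
    g (.inr i) * (g (.inr j) * g (.inr k) - g (.inr k) * g (.inr j)) +
    (g (.inr i) * g (.inr k) - g (.inr k) * g (.inr i)) * g (.inr j) := by noncomm_ring
  rw [this, h1, h2, ← Algebra.commutes, Algebra.smul_def, Algebra.smul_def]

theorem scomm_eo_e (a : Lam N) (i : Fin m) (j : Fin n × Fin 2) (k : Fin m) :
    scomm g (.inl k) (a ⊗ₜ (g (.inl i) * g (.inr j))) =
      (if i = k then (2 : ℝ) else 0) • a ⊗ₜ g (.inr j) := by
  rw [scomm_tmul, parity, Sum.elim_inl, sgn_zero, AlgHom.id_apply, ← TensorProduct.tmul_sub,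
    ← TensorProduct.tmul_smul]
  congr 1
  have h1 := hg.eo k j
  have h2 := hg.ee i k
  have : g (.inl i) * g (.inr j) * g (.inl k) - g (.inl k) * (g (.inl i) * g (.inr j)) =
    g (.inl i) * (g (.inl k) * g (.inr j) + g (.inr j) * g (.inl k)) -
    (g (.inl i) * g (.inl k) + g (.inl k) * g (.inl i)) * g (.inr j) := by noncomm_ring
  rw [this, h1, h2, mul_zero, zero_sub, ← neg_mul, ← map_neg, Algebra.smul_def]
  split_ifs <;> simp

theorem scomm_eo_o {a : Lam N} (ha : a ∈ grade (Fin N) 1) (i : Fin m) (j k : Fin n × Fin 2) :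
    scomm g (.inr k) (a ⊗ₜ (g (.inl i) * g (.inr j))) = Omega n j k • a ⊗ₜ g (.inl i) := by
  rw [scomm_tmul, parity, Sum.elim_inr, sgn_one_of_mem_grade_one ha, TensorProduct.neg_tmul,
    sub_neg_eq_add, ← TensorProduct.tmul_add, ← TensorProduct.tmul_smul]
  congr 1
  have h1 := hg.eo i k
  have h2 := hg.oo j k
  have : g (.inl i) * g (.inr j) * g (.inr k) + g (.inr k) * (g (.inl i) * g (.inr j)) =
    g (.inl i) * (g (.inr j) * g (.inr k) - g (.inr k) * g (.inr j)) +
    (g (.inl i) * g (.inr k) + g (.inr k) * g (.inl i)) * g (.inr j) := by noncomm_ring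
  rw [this, h1, h2, ← Algebra.commutes, Algebra.smul_def, zero_mul, add_zero]

end commutators

theorem oddForm_mem {X : SMat m n N} (h : IsSupermatrix X) (j k) : oddForm X j k ∈ grade (Fin N) 0 :=
  Submodule.neg_mem _ (Submodule.sum_mem _ fun i _ => Submodule.smul_mem _ _ (h (.inr j) (.inr i)))

/-- The constants `-1/4`, `1/2`, `1/2` in `bv` are fixed by this rule: in the pure orthogonal and
pure symplectic sums, each entry of `X` arises twice, by the symmetries in `SoEntries`. -/
theorem inf_bv {X : SMat m n N} (hX : X ∈ so0 m n N) : Inf cwGen (bv X) X := by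
  obtain ⟨hs, h⟩ := (mem_so0_iff X).1 hX
  have e0 : ∀ j k, X (.inl j) (.inl k) ∈ grade (Fin N) 0 := fun j k => hs (.inl j) (.inl k)
  have e1 : ∀ j k, X (.inr j) (.inl k) ∈ grade (Fin N) 1 := fun j k => hs (.inr j) (.inl k)
  rw [inf_iff]
  rintro (k | k)
  · simp only [bv, map_add, map_sum, scomm_ee_e isCW_cwGen, scomm_oo_e isCW_cwGen,
      scomm_eo_e isCW_cwGen, Finset.sum_const_zero, add_zero, Finset.sum_sub_distrib, ite_smul,
      zero_smul, Finset.sum_ite_eq', Finset.mem_univ, if_true, Fintype.sum_sum_type]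
    rw [Finset.sum_comm]
    simp only [Finset.sum_ite_eq', Finset.mem_univ, if_true]
    rw [Finset.sum_comm]
    simp only [Finset.sum_ite_eq', Finset.mem_univ, if_true]
    rw [← Finset.sum_sub_distrib]
    refine congrArg₂ _ (Finset.sum_congr rfl fun x _ => ?_) (Finset.sum_congr rfl fun x _ => ?_)
    · rw [h.ee k x, TensorProduct.smul_tmul', TensorProduct.smul_tmul', ← TensorProduct.sub_tmul]
      congr 1
      module
    · rw [TensorProduct.smul_tmul']
      congr 1
      module
  · simp only [bv, map_add, map_sum, scomm_ee_o isCW_cwGen (Submodule.smul_mem _ _ (e0 _ _)),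
      scomm_oo_o isCW_cwGen (Submodule.smul_mem _ _ (oddForm_mem hs _ _)),
      scomm_eo_o isCW_cwGen (Submodule.smul_mem _ _ (e1 _ _)), Finset.sum_const_zero, zero_add,
      Finset.sum_add_distrib, Fintype.sum_sum_type]
    congr 1
    · refine Finset.sum_congr rfl fun x _ => ?_
      rw [h.eo, Finset.smul_sum, TensorProduct.sum_tmul]
      refine Finset.sum_congr rfl fun y _ => ?_
      rw [TensorProduct.smul_tmul', smul_comm]
    · have h3 : ∑ x, ∑ y, Omega n x k • ((1 / 2 : ℝ) • oddForm X x y) ⊗ₜ[ℝ] cwGen (m := m) (.inr y) =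
          ∑ x, ∑ y, Omega n y k • ((1 / 2 : ℝ) • oddForm X x y) ⊗ₜ[ℝ] cwGen (m := m) (.inr x) := by
        rw [Finset.sum_comm]
        exact Finset.sum_congr rfl fun x _ => Finset.sum_congr rfl fun y _ => by rw [h.oo x y]
      rw [h3, ← Finset.sum_add_distrib]
      refine Finset.sum_congr rfl fun x _ => ?_
      rw [← Finset.sum_add_distrib, ← oddForm_mul_Omega X x k, TensorProduct.sum_tmul]
      refine Finset.sum_congr rfl fun y _ => ?_
      rw [TensorProduct.smul_tmul', ← TensorProduct.add_tmul]
      congr 1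
      module

/-- The matrix in `𝔰𝔬₀` with given blocks. -/
def soMat (a : Matrix (Fin m) (Fin m) (Lam N)) (c : Matrix (Fin n × Fin 2) (Fin m) (Lam N))
    (S : Matrix (Fin n × Fin 2) (Fin n × Fin 2) (Lam N)) : SMat m n N :=
  Matrix.fromBlocks a (fun j k => (1 / 2 : ℝ) • ∑ i, Omega n i k • c i j) c
    (fun j k => ∑ i, Omega n i k • S j i)

theorem oddForm_soMat (a : Matrix (Fin m) (Fin m) (Lam N)) (c) (S) (j k : Fin n × Fin 2) :
    oddForm (soMat a c S) j k = S j k := by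
  have h : (soMat a c S).toBlocks₂₂ = S * (Omega n).map (algebraMap ℝ (Lam N)) := by
    ext j k
    rw [mul_Omega_map]
    rfl
  rw [oddForm_eq, h, Matrix.mul_assoc, Omega_map_mul_self]
  simp

theorem soMat_mem {a : Matrix (Fin m) (Fin m) (Lam N)} {c} {S : Matrix (Fin n × Fin 2) _ (Lam N)}
    (ha : ∀ j k, a j k = -a k j) (hS : ∀ j k, S j k = S k j)
    (ha' : ∀ j k, a j k ∈ grade (Fin N) 0) (hc : ∀ j k, c j k ∈ grade (Fin N) 1)
    (hS' : ∀ j k, S j k ∈ grade (Fin N) 0) : soMat a c S ∈ so0 m n N := by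
  rw [mem_so0_iff]
  refine ⟨?_, ⟨ha, fun _ _ => rfl, fun j k => by rw [oddForm_soMat, oddForm_soMat, hS]⟩⟩
  rintro (j | j) (k | k)
  · exact ha' j k
  · exact Submodule.smul_mem _ _ (Submodule.sum_mem _ fun i _ => Submodule.smul_mem _ _ (hc i j))
  · exact hc j k
  · exact Submodule.sum_mem _ fun i _ => Submodule.smul_mem _ _ (hS' j i)

theorem so0_eq : (so0 m n N : Set (SMat m n N)) = {X | ∃ a c S, (∀ j k, a j k = -a k j) ∧
    (∀ j k, S j k = S k j) ∧ (∀ j k, a j k ∈ grade (Fin N) 0) ∧ (∀ j k, c j k ∈ grade (Fin N) 1) ∧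
    (∀ j k, S j k ∈ grade (Fin N) 0) ∧ X = soMat a c S} := by
  ext X
  constructor
  · intro hX
    obtain ⟨hs, h⟩ := (mem_so0_iff X).1 hX
    refine ⟨X.toBlocks₁₁, X.toBlocks₂₁, oddForm X, h.ee, h.oo, fun j k => hs (.inl j) (.inl k),
      fun j k => hs (.inr j) (.inl k), oddForm_mem hs, ?_⟩
    ext j k
    rcases j with j | j <;> rcases k with k | k
    · rfl
    · exact h.eo j k
    · rfl
    · exact (oddForm_mul_Omega X j k).symm
  · rintro ⟨a, c, S, h1, h2, h3, h4, h5, rfl⟩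
    exact soMat_mem h1 h2 h3 h4 h5

theorem bv_soMat (a : Matrix (Fin m) (Fin m) (Lam N)) (c) (S : Matrix (Fin n × Fin 2) _ (Lam N)) :
    bv (soMat a c S) =
      (∑ j, ∑ k, ((-1 / 4 : ℝ) • a j k) ⊗ₜ (cwGen (.inl j) * cwGen (.inl k))) +
      (∑ j, ∑ k, ((1 / 2 : ℝ) • c k j) ⊗ₜ (cwGen (.inl j) * cwGen (.inr k))) +
      (∑ j, ∑ k, ((1 / 2 : ℝ) • S j k) ⊗ₜ (cwGen (.inr j) * cwGen (.inr k))) := by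
  simp only [bv, oddForm_soMat]
  rfl

theorem so0_add {X Y : SMat m n N} (hX : X ∈ so0 m n N) (hY : Y ∈ so0 m n N) :
    X + Y ∈ so0 m n N := by
  rw [mem_so0_iff] at *
  obtain ⟨hs, h⟩ := hX
  obtain ⟨hs', h'⟩ := hY
  refine ⟨fun j k => Submodule.add_mem _ (hs j k) (hs' j k), fun j k => ?_, fun j k => ?_,
    fun j k => ?_⟩
  · rw [Matrix.add_apply, Matrix.add_apply, h.ee, h'.ee, neg_add]
  · rw [Matrix.add_apply, h.eo, h'.eo]
    simp only [Matrix.add_apply, smul_add, Finset.sum_add_distrib]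
  · rw [oddForm_add, oddForm_add, h.oo, h'.oo]

theorem so0_smul (r : ℝ) {X : SMat m n N} (hX : X ∈ so0 m n N) : r • X ∈ so0 m n N := by
  rw [mem_so0_iff] at *
  obtain ⟨hs, h⟩ := hX
  refine ⟨fun j k => Submodule.smul_mem _ _ (hs j k), fun j k => ?_, fun j k => ?_, fun j k => ?_⟩
  · rw [Matrix.smul_apply, Matrix.smul_apply, h.ee, smul_neg]
  · rw [Matrix.smul_apply, h.eo]
    simp only [Matrix.smul_apply, Finset.smul_sum, smul_comm r]
  · rw [oddForm_smul, oddForm_smul, h.oo]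

theorem bv_mem {X : SMat m n N} (hX : X ∈ so0 m n N) : bv X ∈ ExtBivector m n N := by
  rw [so0_eq] at hX
  obtain ⟨a, c, S, h1, h2, h3, h4, h5, rfl⟩ := hX
  rw [bv_soMat]
  refine Submodule.add_mem _ (Submodule.add_mem _ ?_ ?_) ?_
  · refine Submodule.sum_mem _ fun j _ => Submodule.sum_mem _ fun k _ => ?_
    rcases lt_trichotomy j k with hjk | rfl | hjk
    · exact Submodule.subset_span (.inl (.inl ⟨j, k, _, hjk, Submodule.smul_mem _ _ (h3 j k), rfl⟩))
    · have : a j j = 0 := by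
        have := h1 j j
        rwa [eq_neg_iff_add_eq_zero, ← two_smul ℝ, smul_eq_zero_iff_right two_ne_zero] at this
      rw [this, smul_zero, TensorProduct.zero_tmul]
      exact zero_mem _
    · refine Submodule.subset_span (.inl (.inl ⟨k, j, _, hjk,
        Submodule.neg_mem _ (Submodule.smul_mem _ (-1 / 4 : ℝ) (h3 j k)), ?_⟩))
      have := isCW_cwGen.ee (n := n) j k
      rw [if_neg hjk.ne', map_zero, add_eq_zero_iff_eq_neg] at this
      rw [this, TensorProduct.tmul_neg, TensorProduct.neg_tmul]
  · exact Submodule.sum_mem _ fun j _ => Submodule.sum_mem _ fun k _ => Submodule.subset_span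
      (.inl (.inr ⟨j, k, _, Submodule.smul_mem _ _ (h4 k j), rfl⟩))
  · have : ∑ j, ∑ k, ((1 / 2 : ℝ) • S j k) ⊗ₜ (cwGen (.inr j) * cwGen (m := m) (.inr k)) =
        ∑ j, ∑ k, ((1 / 2 : ℝ) • S j k) ⊗ₜ[ℝ] ((1 / 2 : ℝ) • (cwGen (m := m) (.inr j) *
          cwGen (.inr k) + cwGen (.inr k) * cwGen (.inr j))) := by
      simp only [smul_add, TensorProduct.tmul_add, Finset.sum_add_distrib]
      rw [Finset.sum_comm (f := fun j k => ((1 / 2 : ℝ) • S j k) ⊗ₜ[ℝ]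
        ((1 / 2 : ℝ) • (cwGen (m := m) (.inr k) * cwGen (.inr j))))]
      simp only [h2, ← Finset.sum_add_distrib]
      refine Finset.sum_congr rfl fun j _ => Finset.sum_congr rfl fun k _ => ?_
      rw [TensorProduct.tmul_smul, ← add_smul]
      norm_num
    rw [this]
    exact Submodule.sum_mem _ fun j _ => Submodule.sum_mem _ fun k _ => Submodule.subset_span
      (.inr ⟨j, k, _, Submodule.smul_mem _ _ (h5 j k), rfl⟩)

/-- With `inf_bv` this makes `bv` and `φ` mutually inverse between `𝔰𝔬₀` and the extended
superbivectors. By linearity the spanning elements suffice. -/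
theorem exists_eq_bv {B : Lam N ⊗[ℝ] CliffordWeyl m n} (hB : B ∈ ExtBivector m n N) :
    ∃ X ∈ so0 m n N, B = bv X := by
  have mem_ite : ∀ (p : Prop) [Decidable p] (q : ZMod 2) (b : Lam N), b ∈ grade (Fin N) q →
      (if p then b else 0) ∈ grade (Fin N) q := by
    intro p _ q b hb
    split_ifs
    · exact hb
    · exact zero_mem _
  induction hB using Submodule.span_induction with
  | zero =>
    have h0 : bv (0 : SMat m n N) = 0 := by simpa using bv_smul (0 : ℝ) (0 : SMat m n N)
    refine ⟨0, (mem_so0_iff _).2 ⟨fun _ _ => zero_mem _, ?_, ?_, ?_⟩, h0.symm⟩ <;> simp [oddForm]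
  | add x y _ _ hx hy =>
    obtain ⟨X, hX, rfl⟩ := hx
    obtain ⟨Y, hY, rfl⟩ := hy
    exact ⟨X + Y, so0_add hX hY, (bv_add X Y).symm⟩
  | smul r x _ hx =>
    obtain ⟨X, hX, rfl⟩ := hx
    exact ⟨r • X, so0_smul r hX, (bv_smul r X).symm⟩
  | mem B hB =>
    obtain (⟨j, k, b, hjk, hb, rfl⟩ | ⟨j, k, b, hb, rfl⟩) | ⟨j, k, b, hb, rfl⟩ := hB
    -- The entries `∓2b` at the positions `(j, k)` and `(k, j)` meet the factor `-1/4`; as the two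
    -- generators anticommute, both terms equal half of the given element.
    · refine ⟨soMat (fun p q => (if p = j then if q = k then -(2 : ℝ) • b else 0 else 0) +
        (if q = j then if p = k then (2 : ℝ) • b else 0 else 0)) 0 0, soMat_mem ?_ ?_ ?_ ?_ ?_, ?_⟩
      · intro p q
        rw [neg_add_rev]
        congr 1 <;> split_ifs <;> simp
      · simp
      · intro p q
        refine Submodule.add_mem _ ?_ ?_ <;>
          exact mem_ite _ _ _ (mem_ite _ _ _ (Submodule.smul_mem _ _ hb))
      · simp
      · simp
      · have := isCW_cwGen.ee (n := n) j k
        rw [if_neg hjk.ne, map_zero, add_eq_zero_iff_eq_neg'] at this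
        refine Eq.trans ?_ (bv_soMat _ _ _).symm
        simp only [smul_add, TensorProduct.add_tmul, Finset.sum_add_distrib, smul_ite, smul_zero,
          TensorProduct.ite_tmul]
        rw [Finset.sum_comm (f := fun p q => if q = j then _ else _)]
        simp [this, TensorProduct.tmul_neg, ← TensorProduct.smul_tmul', smul_smul]
        norm_num
        rw [← TensorProduct.smul_tmul', ← add_smul]
        norm_num
    · refine ⟨soMat 0 (fun q p => if p = j then if q = k then (2 : ℝ) • b else 0 else 0) 0,
        soMat_mem ?_ ?_ ?_ ?_ ?_, ?_⟩
      · simp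
      · simp
      · simp
      · exact fun p q => mem_ite _ _ _ (mem_ite _ _ _ (Submodule.smul_mem _ _ hb))
      · simp
      · refine Eq.trans ?_ (bv_soMat _ _ _).symm
        simp [TensorProduct.ite_tmul, smul_smul]
    · refine ⟨soMat 0 0 (fun p q => (if p = j then if q = k then b else 0 else 0) +
        (if q = j then if p = k then b else 0 else 0)), soMat_mem ?_ ?_ ?_ ?_ ?_, ?_⟩
      · simp
      · intro p q
        exact add_comm _ _
      · simp
      · simp
      · intro p q
        refine Submodule.add_mem _ ?_ ?_ <;>
          exact mem_ite _ _ _ (mem_ite _ _ _ hb)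
      · refine Eq.trans ?_ (bv_soMat _ _ _).symm
        simp only [smul_add, TensorProduct.add_tmul, Finset.sum_add_distrib, smul_ite, smul_zero,
          TensorProduct.ite_tmul]
        rw [Finset.sum_comm (f := fun p q => if q = j then _ else _)]
        simp [TensorProduct.tmul_add, ← TensorProduct.smul_tmul']

/-- The sets `Ξ₁`, `Ξ₂`, `Ξ₃` can thus be handled as images of explicit sets of matrices under `bv`.
-/
theorem mem_phiPreimage_iff (hl : 0 < l) {T : Set (SMat m n N)} (hT : T ⊆ so0 m n N)
    (B : Lam N ⊗[ℝ] CliffordWeyl m n) : B ∈ phiPreimage l T ↔ ∃ X ∈ T, B = bv X := by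
  constructor
  · rintro ⟨hB, X, hX, -, h⟩
    obtain ⟨Y, hY, rfl⟩ := exists_eq_bv hB
    obtain rfl := h.unique hl (inf_bv hY).isPhi
    exact ⟨X, hX, rfl⟩
  · rintro ⟨X, hX, rfl⟩
    exact ⟨bv_mem (hT hX), X, hX, (hT hX).1, (inf_bv (hT hX)).isPhi⟩

end

/-! ### Strong derivatives in the completed algebra -/

/-- An endomorphism of Schwartz space as an element of the algebra of operators. -/
def ofEnd {n : ℕ} (T : Module.End ℂ (Schw n)) : SchwOp n := T

theorem SchwOp.add_toEnd {n : ℕ} (S T : SchwOp n) (f : Schw n) :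
    (S + T).toEnd f = S.toEnd f + T.toEnd f := LinearMap.add_apply S T f

theorem SchwOp.smul_toEnd {n : ℕ} (c : ℝ) (T : SchwOp n) (f : Schw n) :
    (c • T).toEnd f = c • T.toEnd f := LinearMap.smul_apply c T f

section
variable {m n N : ℕ}

theorem component_tmul (p : Module.Dual ℝ (Lam N)) (q : Module.Dual ℝ (CliffordAlgebra (negForm m)))
    (a : Lam N) (y : CliffordAlgebra (negForm m)) (Z : SchwOp n) :
    component p q (a ⊗ₜ (y ⊗ₜ Z)) = (p a * q y) • Z := by
  simp [component, smul_smul, mul_comm]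

theorem completed_induction {motive : Completed m n N → Prop} (x : Completed m n N) (zero : motive 0)
    (tmul : ∀ a y Z, motive (a ⊗ₜ (y ⊗ₜ Z))) (add : ∀ x y, motive x → motive y → motive (x + y)) :
    motive x := by
  induction x using TensorProduct.induction_on with
  | zero => exact zero
  | add x y hx hy => exact add x y hx hy
  | tmul a x =>
    induction x using TensorProduct.induction_on with
    | zero => rwa [TensorProduct.tmul_zero]
    | add x y hx hy => rw [TensorProduct.tmul_add]; exact add _ _ hx hy
    | tmul y Z => exact tmul a y Z

/-- A component of a left multiple is an operator applied to another component of the same element.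
This reduces strong derivatives of products to curves in Schwartz space. -/
theorem component_tmul_mul (p : Module.Dual ℝ (Lam N))
    (q : Module.Dual ℝ (CliffordAlgebra (negForm m))) (a : Lam N) (y : CliffordAlgebra (negForm m))
    (Z : SchwOp n) (u : Completed m n N) : component p q (a ⊗ₜ (y ⊗ₜ Z) * u) =
      Z * component (p ∘ₗ LinearMap.mulLeft ℝ a) (q ∘ₗ LinearMap.mulLeft ℝ y) u := by
  induction u using completed_induction with
  | zero => simp
  | tmul b x T => simp [component_tmul]
  | add x y hx hy => rw [mul_add, map_add, map_add, hx, hy, mul_add]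

theorem component_sig (p : Module.Dual ℝ (Lam N))
    (q : Module.Dual ℝ (CliffordAlgebra (negForm m))) (r : ZMod 2) (u : Completed m n N) :
    component p q (sig r u) = component (p ∘ₗ (sgn r).toLinearMap) q u := by
  induction u using completed_induction with
  | zero => simp
  | tmul b x T => simp [component_tmul, sig_tmul]
  | add x y hx hy => rw [map_add, map_add, map_add, hx, hy]

/-- The coordinate functionals of a basis of `M` already suffice. -/
theorem eq_zero_of_forall_dual {M P : Type} [AddCommGroup M] [Module ℝ M] [AddCommGroup P]
    [Module ℝ P] {u : M ⊗[ℝ] P}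
    (h : ∀ p : Module.Dual ℝ M, TensorProduct.lid ℝ P (LinearMap.rTensor P p u) = 0) : u = 0 := by
  classical
  let b := Module.Basis.ofVectorSpace ℝ M
  have e : ∀ i, ∀ u : M ⊗[ℝ] P, TensorProduct.equivFinsuppOfBasisLeft (N := P) b u i =
      TensorProduct.lid ℝ P (LinearMap.rTensor P (b.coord i) u) := by
    intro i u
    induction u with
    | zero => simp
    | tmul a x => simp
    | add x y hx hy => rw [map_add, Finsupp.add_apply, map_add, map_add, hx, hy]
  apply (TensorProduct.equivFinsuppOfBasisLeft (N := P) b).injective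
  ext i
  rw [map_zero, Finsupp.zero_apply, e, h]

theorem component_ext {u v : Completed m n N} (h : ∀ p q, component p q u = component p q v) :
    u = v := by
  rw [← sub_eq_zero]
  refine eq_zero_of_forall_dual fun p => eq_zero_of_forall_dual fun q => ?_
  have : component p q (u - v) = 0 := by rw [map_sub, h, sub_self]
  rw [← this]
  generalize u - v = w
  induction w using completed_induction with
  | zero => simp
  | tmul b x T => simp [component_tmul, smul_smul]
  | add x y hx hy => simp only [map_add, hx, hy]

namespace HasStrongDeriv
variable {U U' : ℝ → Completed m n N} {V V' : Completed m n N} {t : ℝ}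

theorem curve (h : HasStrongDeriv U V t) (p q) (f : Schw n) :
    CurveDeriv (fun s => (component p q (U s)).toEnd f) ((component p q V).toEnd f) t := h p q f

theorem const (u : Completed m n N) : HasStrongDeriv (fun _ => u) 0 t := fun p q f => by
  rw [map_zero]; exact CurveDeriv.const (t := t) _

theorem add (h : HasStrongDeriv U V t) (h' : HasStrongDeriv U' V' t) :
    HasStrongDeriv (fun s => U s + U' s) (V + V') t := by
  intro p q f
  have h1 := CurveDeriv.add (h.curve p q f) (h'.curve p q f)
  rw [← SchwOp.add_toEnd, ← map_add] at h1
  refine Tendsto.congr (fun τ => ?_) h1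
  simp only [map_add, SchwOp.add_toEnd]

theorem sum {ι : Type*} (s : Finset ι) {U : ι → ℝ → Completed m n N} {V : ι → Completed m n N}
    (h : ∀ i ∈ s, HasStrongDeriv (U i) (V i) t) :
    HasStrongDeriv (fun r => ∑ i ∈ s, U i r) (∑ i ∈ s, V i) t := by
  classical
  induction s using Finset.induction_on with
  | empty => simpa using const (0 : Completed m n N)
  | insert i s hi ih =>
    simp only [Finset.sum_insert hi]
    exact (h i (Finset.mem_insert_self i s)).add
      (ih fun j hj => h j (Finset.mem_insert_of_mem hj))

theorem smul {c : ℝ → ℝ} {c' : ℝ} (hc : HasDerivAt c c' t) (h : HasStrongDeriv U V t) :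
    HasStrongDeriv (fun s => c s • U s) (c' • U t + c t • V) t := by
  intro p q f
  have h1 := CurveDeriv.smul hc (h.curve p q f)
  rw [← SchwOp.smul_toEnd, ← SchwOp.smul_toEnd, ← SchwOp.add_toEnd, ← map_smul, ← map_smul,
    ← map_add] at h1
  refine Tendsto.congr (fun τ => ?_) h1
  simp only [map_smul, SchwOp.smul_toEnd]

theorem sig (h : HasStrongDeriv U V t) (r : ZMod 2) :
    HasStrongDeriv (fun s => sig r (U s)) (SuperSpin.sig r V) t := fun p q f => by
  simp only [component_sig]
  exact h _ _ f

theorem comp_add (a : ℝ) (h : HasStrongDeriv U V (t + a)) :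
    HasStrongDeriv (fun s => U (s + a)) V t := fun p q f => (h.curve p q f).shift a

end HasStrongDeriv

/-- Left multiplication by `c` is compatible with strong derivatives. -/
def StrongLeft (c : Completed m n N) : Prop :=
  ∀ (U : ℝ → Completed m n N) (V : Completed m n N) (t : ℝ),
    HasStrongDeriv U V t → HasStrongDeriv (fun s => c * U s) (c * V) t

namespace StrongLeft
variable {c d : Completed m n N}

theorem add (hc : StrongLeft c) (hd : StrongLeft d) : StrongLeft (c + d) := fun U V t h => by
  simpa only [add_mul] using (hc U V t h).add (hd U V t h)

theorem mul (hc : StrongLeft c) (hd : StrongLeft d) : StrongLeft (c * d) := fun U V t h => by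
  simpa only [mul_assoc] using hc _ _ t (hd U V t h)

theorem sum {ι : Type*} (s : Finset ι) {c : ι → Completed m n N} (h : ∀ i ∈ s, StrongLeft (c i)) :
    StrongLeft (∑ i ∈ s, c i) := fun U V t hU => by
  simpa only [Finset.sum_mul] using HasStrongDeriv.sum s fun i hi => h i hi U V t hU

/-- Continuity of `T` is essential: `SchwOp` contains all linear operators, also those that do not
respect limits in Schwartz space. -/
theorem tmul (a : Lam N) (y : CliffordAlgebra (negForm m)) (T : Schw n →L[ℂ] Schw n) :
    StrongLeft (a ⊗ₜ[ℝ] (y ⊗ₜ[ℝ] ofEnd T.toLinearMap)) := fun U V t h p q f => by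
  simp only [component_tmul_mul]
  exact (h.curve _ _ f).clm (T.restrictScalars ℝ)

theorem tmul_one (a : Lam N) (y : CliffordAlgebra (negForm m)) :
    StrongLeft (a ⊗ₜ[ℝ] (y ⊗ₜ[ℝ] (1 : SchwOp n))) :=
  tmul a y (ContinuousLinearMap.id ℂ (Schw n))

theorem tmul_oscGen (a : Lam N) (k : Idx m n) : StrongLeft (a ⊗ₜ[ℝ] oscGen k) := by
  rcases k with k | k
  · exact tmul a _ (SchwartzMap.compCLMOfContinuousLinearEquiv ℂ
      (ContinuousLinearEquiv.neg ℝ (M := EuclideanSpace ℝ (Fin n))))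
  · have : (sympOp k : SchwOp n) = ofEnd (sympL k).toLinearMap :=
      LinearMap.ext fun f => (sympL_apply k f).symm
    rw [oscGen, Sum.elim_inr, this]
    exact tmul a 1 (sympL k)

theorem embed_bv (X : SMat m n N) : StrongLeft (embed m n _ (bv X)) := by
  have h : ∀ (a : Lam N) (j k : Idx m n),
      StrongLeft (embed m n _ (a ⊗ₜ[ℝ] (cwGen j * cwGen k))) := by
    intro a j k
    have : embed m n _ (a ⊗ₜ[ℝ] (cwGen j * cwGen k)) =
        (a ⊗ₜ[ℝ] oscGen j) * ((1 : Lam N) ⊗ₜ[ℝ] oscGen k) := by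
      simp [embed, osc_cwGen]
    rw [this]
    exact (tmul_oscGen a j).mul (tmul_oscGen 1 k)
  simp only [bv, map_add, map_sum]
  refine add (add ?_ ?_) ?_ <;> exact sum _ fun _ _ => sum _ fun _ _ => h _ _ _

end StrongLeft

section product
variable {E : Type*} [AddCommGroup E] [Module ℝ E] [FiniteDimensional ℝ E]
  {L : E →ₗ[ℝ] Completed m n N} {s : ℝ → E} {s' : E} {U : ℝ → Completed m n N}
  {V : Completed m n N} {t : ℝ}

/-- The product rule with a left factor from a finite-dimensional space. In a basis it becomes the
rule for a differentiable real coefficient times a strongly differentiable curve. -/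
theorem HasStrongDeriv.clm_mul (hL : ∀ e, StrongLeft (L e)) (hs : WeakDeriv s s' t)
    (hU : HasStrongDeriv U V t) :
    HasStrongDeriv (fun r => L (s r) * U r) (L s' * U t + L (s t) * V) t := by
  let b := Module.finBasis ℝ E
  have e : ∀ x : E, L x = ∑ i, b.coord i x • L (b i) := by
    intro x
    conv_lhs => rw [← b.sum_repr x]
    simp only [map_sum, map_smul, Module.Basis.coord_apply]
  have := HasStrongDeriv.sum Finset.univ fun i _ =>
    HasStrongDeriv.smul (hs (b.coord i)) (hL (b i) U V t hU)
  rw [Finset.sum_add_distrib] at this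
  simp only [← smul_mul_assoc, ← Finset.sum_mul, ← e] at this
  exact this

end product

/-! ### One-parameter groups -/

/-- `G` is the one-parameter group `exp (t B)`. -/
structure IsGen (B : Completed m n N) (G : ℝ → Completed m n N) : Prop where
  zero : G 0 = 1
  deriv : ∀ t, HasStrongDeriv G (B * G t) t
  unique : ∀ U : ℝ → Completed m n N, (∀ t, HasStrongDeriv U (B * U t) t) → ∀ t, U t = G t * U 0

namespace IsGen
variable {B : Completed m n N} {G : ℝ → Completed m n N} (hG : IsGen B G)
include hG

theorem add (r t : ℝ) : G (r + t) = G r * G t := by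
  simpa using hG.unique (fun r => G (r + t)) (fun r => (hG.deriv (r + t)).comp_add t) r

theorem mul_neg (t : ℝ) : G t * G (-t) = 1 := by rw [← hG.add, add_neg_cancel, hG.zero]

theorem isUnit (t : ℝ) : IsUnit (G t) :=
  ⟨⟨G t, G (-t), hG.mul_neg t, by simpa using hG.mul_neg (-t)⟩, rfl⟩

end IsGen

theorem IsGen.isExp_iff {B : Lam N ⊗[ℝ] CliffordWeyl m n} {G : ℝ → Completed m n N}
    (hG : IsGen (embed m n _ B) G) (E : Completed m n N) : IsExp B E ↔ E = G 1 := by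
  constructor
  · rintro ⟨U, h0, hU, rfl⟩
    rw [hG.unique U hU 1, h0, mul_one]
  · rintro rfl
    exact ⟨G, hG.zero, hG.deriv, rfl⟩

/-- An operator on Schwartz space, as an element of the completed algebra. -/
def opIncl (m N : ℕ) {n : ℕ} (T : Module.End ℂ (Schw n)) : Completed m n N := 1 ⊗ₜ (1 ⊗ₜ ofEnd T)

theorem component_opIncl_mul (p q) (T : Module.End ℂ (Schw n)) (u : Completed m n N) (f : Schw n) :
    (component p q (opIncl m N T * u)).toEnd f = T ((component p q u).toEnd f) := by
  rw [opIncl, component_tmul_mul]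
  have h1 : p ∘ₗ LinearMap.mulLeft ℝ (1 : Lam N) = p := by ext; simp
  have h2 : q ∘ₗ LinearMap.mulLeft ℝ (1 : CliffordAlgebra (negForm m)) = q := by ext; simp
  rw [h1, h2]
  rfl

section
variable {S : Matrix (Fin n × Fin 2) (Fin n × Fin 2) ℝ} {W : ℝ → Module.End ℂ (Schw n)}
  {E : Type} [Ring E] [Algebra ℝ E] [FiniteDimensional ℝ E] {L : E →ₐ[ℝ] Completed m n N}
  {b : E} {s : ℝ → E}

theorem IsFlow.hasStrongDeriv (hW : IsFlow S W) (t : ℝ) :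
    HasStrongDeriv (fun r => opIncl m N (W r)) (opIncl m N (quadL S).toLinearMap * opIncl m N (W t))
      t := by
  intro p q f
  have h : ∀ T : Module.End ℂ (Schw n), (component p q (opIncl m N T)).toEnd f =
      (p 1 * q 1) • T f := fun T => by
    rw [opIncl, component_tmul]
    exact LinearMap.smul_apply (p 1 * q 1) T f
  have e : (component p q (opIncl m N (quadL S).toLinearMap * opIncl m N (W t))).toEnd f =
      (p 1 * q 1) • quadL S (W t f) := by
    rw [component_opIncl_mul, h]
    exact ((quadL S).restrictScalars ℝ).map_smul _ _
  change CurveDeriv (fun s => (component p q (opIncl m N (W s))).toEnd f) _ t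
  rw [e, funext fun s => h (W s)]
  exact (hW.deriv f t).const_smul (p 1 * q 1)

/-- The exponential of a sum of two commuting generators, one from a finite-dimensional algebra and
one quadratic. For uniqueness, the finite-dimensional factor is removed by multiplying a solution by
`L (s (-t))`; every component of the result is a curve satisfying the flow equation and is
determined by its initial value. -/
theorem isGen_add (hs : IsExpCurve b s) (hW : IsFlow S W) (hL : ∀ e, StrongLeft (L e))
    (hc : ∀ e, L e * opIncl m N (quadL S).toLinearMap = opIncl m N (quadL S).toLinearMap * L e) :
    IsGen (L b + opIncl m N (quadL S).toLinearMap) (fun t => L (s t) * opIncl m N (W t)) where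
  zero := by
    simp only [hs.zero, hW.zero, map_one, one_mul]
    rfl
  deriv t := by
    have := HasStrongDeriv.clm_mul (L := L.toLinearMap) hL (hs.deriv t)
      (hW.hasStrongDeriv (m := m) (N := N) t)
    refine Eq.subst (motive := fun v => HasStrongDeriv _ v t) ?_ this
    simp only [AlgHom.toLinearMap_apply]
    rw [add_mul, map_mul, mul_assoc, ← mul_assoc (L (s t)) (opIncl _ _ _), hc (s t),
      mul_assoc]
  unique U hU t := by
    have hV : ∀ t, HasStrongDeriv (fun r => L (s (-r)) * U r)
        (opIncl m N (quadL S).toLinearMap * (L (s (-t)) * U t)) t := by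
      intro t
      have := HasStrongDeriv.clm_mul (L := L.toLinearMap) hL (hs.deriv (-t)).comp_neg (hU t)
      refine Eq.subst (motive := fun v => HasStrongDeriv _ v t) ?_ this
      simp only [AlgHom.toLinearMap_apply, map_neg, map_mul]
      rw [add_mul, mul_add, ← mul_assoc (L (s (-t))) (L b), ← map_mul L, ← map_mul L, hs.comm,
        ← add_assoc, ← add_mul, neg_add_cancel, zero_mul, zero_add, ← mul_assoc, hc, mul_assoc]
    have hV' : ∀ t, L (s (-t)) * U t = opIncl m N (W t) * U 0 := by
      intro t
      refine component_ext fun p q => LinearMap.ext fun f => ?_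
      have := hW.unique_curve (u := fun r => (component p q (L (s (-r)) * U r)).toEnd f)
        (fun r => by
          have := (hV r).curve p q f
          rw [component_opIncl_mul] at this
          exact this) t
      simp only [neg_zero, hs.zero, map_one, one_mul] at this
      exact this.trans (component_opIncl_mul p q (W t) (U 0) f).symm
    rw [mul_assoc, ← hV', ← mul_assoc, ← map_mul, hs.mul_neg, map_one, one_mul]

end

end

/-! ### Nilpotency in Grassmann algebras -/

section
variable {N : ℕ}

/-- The span of the generators of `Λ_N`. -/
abbrev gens (N : ℕ) : Submodule ℝ (Lam N) := LinearMap.range (ExteriorAlgebra.ι ℝ)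

theorem gens_pow (N : ℕ) {k : ℕ} (hk : N < k) : gens N ^ k = ⊥ := by
  have h : Module.finrank ℝ (⋀[ℝ]^k (Fin N → ℝ)) = 0 := by
    rw [exteriorPower.finrank_eq, Module.finrank_fin_fun, Nat.choose_eq_zero_of_lt hk]
  exact Submodule.finrank_eq_zero.1 h

instance : FiniteDimensional ℝ (Lam N) := by
  have h1 : (⨆ i ∈ Finset.range (N + 1), gens N ^ i) = ⊤ := by
    rw [eq_top_iff]
    refine (CliffordAlgebra.iSup_ι_range_eq_top (0 : QuadraticForm ℝ (Fin N → ℝ))).symm.le.trans ?_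
    refine iSup_le fun i => ?_
    by_cases hi : i < N + 1
    · exact le_biSup (fun i => gens N ^ i) (Finset.mem_range.2 hi)
    · exact (gens_pow N (by omega)).le.trans bot_le
  have h2 : (⨆ i ∈ Finset.range (N + 1), gens N ^ i).FG :=
    Submodule.fg_biSup _ _ fun i _ => by
      rw [gens, LinearMap.range_eq_map]
      exact Submodule.FG.pow (Submodule.FG.map _ Module.Finite.fg_top) i
  rw [h1] at h2
  exact ⟨h2⟩

/-- The body of an element of `Λ_N`. -/
abbrev body (N : ℕ) : Lam N →ₐ[ℝ] ℝ := ExteriorAlgebra.algebraMapInv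

/-- The elements of `Λ_N` with vanishing body. -/
def nilIdeal (N : ℕ) : Submodule ℝ (Lam N) := LinearMap.ker (body N).toLinearMap

theorem mem_nilIdeal {a : Lam N} : a ∈ nilIdeal N ↔ body N a = 0 := Iff.rfl

theorem body_ι (v : Fin N → ℝ) : body N (ExteriorAlgebra.ι ℝ v) = 0 := by
  simp [body, ExteriorAlgebra.algebraMapInv]

theorem gens_mul_top_eq : nilIdeal N = gens N * ⊤ := by
  have hle : gens N * ⊤ ≤ nilIdeal N := by
    rw [Submodule.mul_le]
    rintro _ ⟨v, rfl⟩ b -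
    rw [mem_nilIdeal, map_mul, body_ι, zero_mul]
  refine le_antisymm (fun x hx => ?_) hle
  have h : ∀ x : Lam N, x - algebraMap ℝ _ (body N x) ∈ gens N * (⊤ : Submodule ℝ (Lam N)) := by
    intro x
    induction x using CliffordAlgebra.left_induction with
    | algebraMap r =>
      rw [AlgHom.commutes]
      exact (sub_self (algebraMap ℝ (Lam N) r)).symm ▸ zero_mem _
    | add x y hx hy =>
      rw [map_add, map_add, add_sub_add_comm]
      exact Submodule.add_mem _ hx hy
    | ι_mul v x _ =>
      have h0 : body N (CliffordAlgebra.ι 0 x * v) = 0 := by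
        rw [map_mul]; erw [body_ι]; rw [zero_mul]
      rw [h0, map_zero, sub_zero]
      exact Submodule.mul_mem_mul ⟨x, rfl⟩ trivial
  have := h x
  rwa [mem_nilIdeal.1 hx, map_zero, sub_zero] at this

/-- Generators can be moved to the left past any element at the cost of the parity automorphism, so
a power of the ideal is the same power of the span of the generators times the whole algebra. -/
theorem nilIdeal_pow_eq (k : ℕ) : nilIdeal N ^ (k + 1) = gens N ^ (k + 1) * ⊤ := by
  have hcomm : (⊤ : Submodule ℝ (Lam N)) * gens N ≤ gens N * ⊤ := by
    rw [Submodule.mul_le]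
    rintro a - _ ⟨v, rfl⟩
    rw [mul_gen]
    exact Submodule.mul_mem_mul ⟨v, rfl⟩ trivial
  have htop : (⊤ : Submodule ℝ (Lam N)) * ⊤ = ⊤ :=
    eq_top_iff.2 fun x _ => by
      simpa using Submodule.mul_mem_mul (Submodule.mem_top (x := x)) (Submodule.mem_top (x := (1 : Lam N)))
  have hcomm' : (⊤ : Submodule ℝ (Lam N)) * gens N * ⊤ = gens N * ⊤ := by
    apply le_antisymm
    · calc _ ≤ gens N * ⊤ * ⊤ := mul_le_mul' hcomm le_rfl
        _ = _ := by rw [mul_assoc, htop]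
    · rw [mul_assoc]
      intro x hx
      simpa using Submodule.mul_mem_mul (trivial : (1 : Lam N) ∈ ⊤) hx
  induction k with
  | zero => rw [zero_add, pow_one, pow_one, gens_mul_top_eq]
  | succ k ih => rw [pow_succ, ih, gens_mul_top_eq, mul_assoc, ← mul_assoc ⊤, hcomm', ← mul_assoc,
      ← pow_succ]

theorem nilIdeal_pow (N : ℕ) : nilIdeal N ^ (N + 1) = ⊥ := by
  rw [nilIdeal_pow_eq, gens_pow N (Nat.lt_succ_self N), Submodule.bot_mul]

theorem isNilpotent_of_body_eq_zero {a : Lam N} (ha : body N a = 0) : IsNilpotent a :=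
  ⟨N + 1, by
    have := Submodule.pow_mem_pow (nilIdeal N) (mem_nilIdeal.2 ha) (N + 1)
    rwa [nilIdeal_pow] at this⟩

section tensor
variable {A : Type} [Ring A] [Algebra ℝ A]

theorem pow_mem_span {I : Submodule ℝ (Lam N)} {x : Lam N ⊗[ℝ] A}
    (hx : x ∈ Submodule.span ℝ {z | ∃ a ∈ I, ∃ y : A, z = a ⊗ₜ[ℝ] y}) (k : ℕ) :
    x ^ k ∈ Submodule.span ℝ {z | ∃ a ∈ I ^ k, ∃ y : A, z = a ⊗ₜ[ℝ] y} := by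
  induction k with
  | zero =>
    exact Submodule.subset_span ⟨1, by rw [pow_zero]; exact Submodule.one_le.1 le_rfl, 1, rfl⟩
  | succ k ih =>
    rw [pow_succ]
    have := Submodule.mul_mem_mul ih hx
    rw [Submodule.span_mul_span] at this
    refine Submodule.span_mono ?_ this
    rintro _ ⟨_, ⟨a, ha, y, rfl⟩, _, ⟨b, hb, z, rfl⟩, rfl⟩
    exact ⟨a * b, Submodule.mul_mem_mul ha hb, y * z,
      Algebra.TensorProduct.tmul_mul_tmul _ _ _ _⟩

end tensor

/-- Whatever the Clifford–Weyl factors are, the coefficients of the power lie in the power `N + 1`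
of the ideal, which is zero. -/
theorem bv_pow_eq_zero {m n : ℕ} {X : SMat m n N} (hX : ∀ j k, X j k ∈ nilPart N) :
    bv X ^ (N + 1) = 0 := by
  have hX' : ∀ j k, X j k ∈ nilIdeal N := hX
  have h : bv X ∈ Submodule.span ℝ
      {z | ∃ a ∈ nilIdeal N, ∃ y : CliffordWeyl m n, z = a ⊗ₜ[ℝ] y} := by
    rw [bv]
    refine Submodule.add_mem _ (Submodule.add_mem _ ?_ ?_) ?_ <;>
      refine Submodule.sum_mem _ fun j _ => Submodule.sum_mem _ fun k _ => Submodule.subset_span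
        ⟨_, Submodule.smul_mem _ _ ?_, _, rfl⟩
    · exact hX' _ _
    · exact hX' _ _
    · exact Submodule.neg_mem _ (Submodule.sum_mem _ fun i _ => Submodule.smul_mem _ _ (hX' _ _))
  have := pow_mem_span h (N + 1)
  rw [nilIdeal_pow] at this
  have h0 : {z | ∃ a ∈ (⊥ : Submodule ℝ (Lam N)), ∃ y : CliffordWeyl m n, z = a ⊗ₜ[ℝ] y} ⊆ {0} := by
    rintro _ ⟨a, ha, y, rfl⟩
    rw [(Submodule.mem_bot ℝ).1 ha, TensorProduct.zero_tmul]
    rfl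
  exact (Submodule.mem_bot ℝ).1 (Submodule.span_le.2 (h0.trans (by simp)) this)

end

section
variable {m n N : ℕ}

/-! ### The exponentials on the three subspaces -/

/-- The equation can be solved inside the subalgebra, and the solution is unique. -/
theorem IsExpCurve.mem_subalgebra {A : Type*} [Ring A] [Algebra ℝ A] [FiniteDimensional ℝ A]
    {b : A} {s : ℝ → A} (hs : IsExpCurve b s) {S : Subalgebra ℝ A} (hb : b ∈ S) (t : ℝ) :
    s t ∈ S := by
  obtain ⟨r, hr⟩ := exists_isExpCurve (⟨b, hb⟩ : S)
  have := hs.unique_curve (u := fun t => (r t : A))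
    (fun t => (hr.deriv t).map S.val.toLinearMap) t
  rw [hr.zero] at this
  have h2 : (r t : A) = s t := by simpa using this
  rw [← h2]
  exact (r t).2

theorem isFlow_zero : IsFlow (0 : Matrix (Fin n × Fin 2) (Fin n × Fin 2) ℝ) (fun _ => 1) where
  symm := by simp
  zero := rfl
  deriv f t := by
    have : quadL (0 : Matrix (Fin n × Fin 2) (Fin n × Fin 2) ℝ) f = 0 := by simp [quadL_apply]
    simp only [Module.End.one_apply, this]
    exact CurveDeriv.const f

/-- The operators are unbounded, but a nilpotent element generates a finite-dimensional algebra,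
where the exponential exists. Uniqueness among all strongly differentiable curves comes from
`isGen_add` with the trivial flow. -/
theorem exists_isGen_nil {X : SMat m n N} (hX : ∀ j k, X j k ∈ nilPart N) :
    ∃ G, IsGen (embed m n _ (bv X)) G := by
  set B := embed m n _ (bv X) with hB
  have hpow : B ^ (N + 1) = 0 := by rw [hB, ← map_pow, bv_pow_eq_zero hX, map_zero]
  have hint : IsIntegral ℝ B := ⟨Polynomial.X ^ (N + 1), Polynomial.monic_X_pow _, by simp [hpow]⟩
  have : FiniteDimensional ℝ (Algebra.adjoin ℝ {B}) :=
    Module.Finite.iff_fg.2 hint.fg_adjoin_singleton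
  obtain ⟨s, hs⟩ := exists_isExpCurve (⟨B, Algebra.self_mem_adjoin_singleton ℝ B⟩ : Algebra.adjoin ℝ {B})
  have h0 : opIncl m N (quadL (0 : Matrix (Fin n × Fin 2) (Fin n × Fin 2) ℝ)).toLinearMap = 0 := by
    have : (quadL (0 : Matrix (Fin n × Fin 2) (Fin n × Fin 2) ℝ)) = 0 := by
      ext1 f; simp [quadL_apply]
    rw [this, opIncl]
    have h : ofEnd ((0 : Schw n →L[ℂ] Schw n) : Module.End ℂ (Schw n)) = 0 := rfl
    rw [h, TensorProduct.tmul_zero, TensorProduct.tmul_zero]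
  have := isGen_add (L := (Algebra.adjoin ℝ {B}).val) hs (isFlow_zero (n := n)) ?_ ?_
  · rw [h0, add_zero] at this
    exact ⟨_, this⟩
  · rintro ⟨e, he⟩
    induction he using Algebra.adjoin_induction with
    | mem x hx =>
      obtain rfl := Set.mem_singleton_iff.1 hx
      exact StrongLeft.embed_bv X
    | algebraMap r => exact StrongLeft.tmul_one _ _
    | add x y _ _ hx hy => exact hx.add hy
    | mul x y _ _ hx hy => exact hx.mul hy
  · intro e
    rw [h0, mul_zero, zero_mul]

theorem oddForm_realMat (A : Matrix (Fin m) (Fin m) ℝ)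
    (D : Matrix (Fin n × Fin 2) (Fin n × Fin 2) ℝ) (j k : Fin n × Fin 2) :
    oddForm (realMat N (Matrix.fromBlocks A 0 0 D)) j k =
      algebraMap ℝ _ ((-(D * Omega n)) j k) := by
  have h : (realMat N (Matrix.fromBlocks A 0 0 D)).toBlocks₂₂ = D.map (algebraMap ℝ (Lam N)) := rfl
  rw [oddForm_eq, h, ← Matrix.map_mul, Matrix.neg_apply, Matrix.neg_apply, map_neg]
  rfl

/-- A product of two orthogonal generators contains the reflection twice, and its square is `1`.
Hence a real generator splits into a Clifford part and a quadratic operator, which commute and can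
be exponentiated separately. -/
theorem embed_bv_realMat (A : Matrix (Fin m) (Fin m) ℝ)
    (D : Matrix (Fin n × Fin 2) (Fin n × Fin 2) ℝ) :
    embed m n _ (bv (realMat N (Matrix.fromBlocks A 0 0 D))) =
      1 ⊗ₜ (biv A ⊗ₜ 1) + opIncl m N (quadL (-(D * Omega n))).toLinearMap := by
  have hodd : ∀ j k, oddForm (realMat N (Matrix.fromBlocks A 0 0 D)) j k =
      algebraMap ℝ _ ((-(D * Omega n)) j k) := oddForm_realMat A D
  have h1 : ∀ (r : ℝ) (x : CompletedCW m n), (algebraMap ℝ (Lam N) r) ⊗ₜ[ℝ] x = r • (1 ⊗ₜ[ℝ] x) := by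
    intro r x
    rw [Algebra.algebraMap_eq_smul_one, TensorProduct.smul_tmul']
  have h2 : opIncl m N (quadL (-(D * Omega n))).toLinearMap = ∑ j, ∑ k,
      (1 / 2 * (-(D * Omega n)) j k) • ((1 : Lam N) ⊗ₜ[ℝ]
        ((1 : CliffordAlgebra (negForm m)) ⊗ₜ[ℝ] (sympOp j * sympOp k))) := by
    simp only [← TensorProduct.tmul_smul, ← TensorProduct.tmul_sum, opIncl]
    congr 2
    refine LinearMap.ext fun f => ?_
    have e : ∀ (c : Fin n × Fin 2 → Fin n × Fin 2 → SchwOp n),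
        (∑ j, ∑ k, c j k).toEnd f = ∑ j, ∑ k, (c j k).toEnd f := by
      intro c
      let ev : SchwOp n →+ Schw n :=
        { toFun := fun T => T.toEnd f, map_zero' := rfl, map_add' := fun S T => S.add_toEnd T f }
      exact (map_sum ev _ _).trans (Finset.sum_congr rfl fun j _ => map_sum ev _ _)
    refine Eq.trans ?_ (e _).symm
    refine (quadL_apply _ f).trans (Finset.sum_congr rfl fun j _ => Finset.sum_congr rfl fun k _ => ?_)
    rw [sympL_apply, sympL_apply]
    exact (Complex.coe_smul _ _).trans (SchwOp.smul_toEnd _ (sympOp j * sympOp k) f).symm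
  rw [h2, biv]
  simp only [bv, hodd, map_add, map_sum]
  have e1 : ∀ j k : Fin m, embed m n _ (((-1 / 4 : ℝ) • realMat N (Matrix.fromBlocks A 0 0 D)
      (.inl j) (.inl k)) ⊗ₜ[ℝ] (cwGen (.inl j) * cwGen (.inl k))) =
      (-1 / 4 * A j k) • (1 : Lam N) ⊗ₜ[ℝ] ((eps j * eps k) ⊗ₜ[ℝ] (1 : SchwOp n)) := by
    intro j k
    have : realMat N (Matrix.fromBlocks A 0 0 D) (.inl j) (.inl k) = algebraMap ℝ _ (A j k) := rfl
    rw [this, ← smul_smul, ← h1, TensorProduct.smul_tmul', embed, Algebra.TensorProduct.map_tmul,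
      map_mul, osc_cwGen, osc_cwGen]
    simp [oscGen, eps, reflect_sq]
  have e2 : ∀ (j : Fin m) (k : Fin n × Fin 2), embed m n _ (((1 / 2 : ℝ) •
      realMat N (Matrix.fromBlocks A 0 0 D) (.inr k) (.inl j)) ⊗ₜ[ℝ]
        (cwGen (.inl j) * cwGen (.inr k))) = 0 := by
    intro j k
    have : realMat N (Matrix.fromBlocks A 0 0 D) (.inr k) (.inl j) = algebraMap ℝ _ 0 := rfl
    rw [this, map_zero, smul_zero, TensorProduct.zero_tmul, map_zero]
  have e3 : ∀ j k : Fin n × Fin 2, embed m n _ (((1 / 2 : ℝ) • algebraMap ℝ (Lam N)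
      ((-(D * Omega n)) j k)) ⊗ₜ[ℝ] (cwGen (.inr j) * cwGen (.inr k))) =
      (1 / 2 * (-(D * Omega n)) j k) • (1 : Lam N) ⊗ₜ[ℝ]
        ((1 : CliffordAlgebra (negForm m)) ⊗ₜ[ℝ] (sympOp j * sympOp k)) := by
    intro j k
    rw [← smul_smul, ← h1, TensorProduct.smul_tmul', embed, Algebra.TensorProduct.map_tmul,
      map_mul, osc_cwGen, osc_cwGen]
    simp [oscGen]
  simp only [e1, e2, e3, Finset.sum_const_zero, add_zero]
  simp only [← TensorProduct.smul_tmul', TensorProduct.tmul_smul, TensorProduct.sum_tmul, TensorProduct.tmul_sum, Finset.smul_sum,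
    smul_smul]

theorem exists_isGen_real {A : Matrix (Fin m) (Fin m) ℝ}
    {D : Matrix (Fin n × Fin 2) (Fin n × Fin 2) ℝ} {s : ℝ → CliffordAlgebra (negForm m)}
    {W : ℝ → Module.End ℂ (Schw n)} (hs : IsExpCurve (biv A) s) (hW : IsFlow (-(D * Omega n)) W) :
    IsGen (embed m n _ (bv (realMat N (Matrix.fromBlocks A 0 0 D))))
      (fun t => 1 ⊗ₜ (s t ⊗ₜ ofEnd (W t))) := by
  have := isGen_add (N := N) (L := (Algebra.TensorProduct.includeRight : CompletedCW m n →ₐ[ℝ] _).comp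
    Algebra.TensorProduct.includeLeft) hs hW (fun e => StrongLeft.tmul_one 1 e) (fun e => by
      simp [opIncl])
  rw [embed_bv_realMat]
  convert this using 2 with t
  · simp
  · simp [opIncl]

/-! ### Covariance -/

theorem mul_grade_comm {p : ZMod 2} {a : Lam N} (ha : a ∈ grade (Fin N) p) (b : Lam N) :
    a * sgn p b = b * a := (mul_of_mem_grade ha b).symm

/-- Moving the entry `M' j k` to the left of `s` twists `s` by the parity `j + k` of that entry.
Together with the twist by `j` from the relation for `s`, only the twist by `k` remains. -/
theorem Cov.mul {A : Type} [Ring A] [Algebra ℝ A] {g : Idx m n → A} {s t : Lam N ⊗[ℝ] A}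
    {M M' : SMat m n N} (hs : Cov g s M) (ht : Cov g t M') (hM' : IsSupermatrix M') :
    Cov g (s * t) (M * M') := by
  intro k
  have key : ∀ j, s * (M' j k ⊗ₜ g j) = (∑ i, (M i j * M' j k) ⊗ₜ g i) * sig (parity k) s := by
    intro j
    have h1 : M' j k ⊗ₜ[ℝ] g j = (M' j k ⊗ₜ[ℝ] (1 : A)) * ((1 : Lam N) ⊗ₜ[ℝ] g j) := by simp
    have h2 := congrArg (sig (parity j + parity k)) (hs j)
    rw [map_mul, map_mul, sig_tmul, map_one, sig_sig, add_right_comm, ZMod.two_add_self,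
      zero_add] at h2
    rw [h1, ← mul_assoc, mul_tmul_one_of_mem_grade (hM' j k), mul_assoc, h2, ← mul_assoc]
    congr 1
    rw [map_sum, Finset.mul_sum]
    refine Finset.sum_congr rfl fun i _ => ?_
    rw [sig_tmul, Algebra.TensorProduct.tmul_mul_tmul, mul_grade_comm (hM' j k), one_mul]
  rw [mul_assoc, ht, ← mul_assoc, map_mul, ← mul_assoc]
  congr 1
  rw [Finset.mul_sum]
  simp only [key, ← Finset.sum_mul, Matrix.mul_apply, TensorProduct.sum_tmul]
  rw [Finset.sum_comm]

/-- The elements `∑ M_jk e_j`, as a linear function of `M`. -/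
def colSum (k : Idx m n) : SMat m n N →ₗ[ℝ] Completed m n N where
  toFun M := ∑ j, M j k ⊗ₜ oscGen j
  map_add' M M' := by simp only [Matrix.add_apply, TensorProduct.add_tmul, Finset.sum_add_distrib]
  map_smul' c M := by
    simp only [Matrix.smul_apply, ← TensorProduct.smul_tmul', Finset.smul_sum, RingHom.id_apply]

theorem colSum_apply (k : Idx m n) (M : SMat m n N) : colSum k M = ∑ j, M j k ⊗ₜ oscGen j := rfl

/-- Both sides of the relation solve `U' = B U` with the initial value `e_k`. For the right side,
`Inf` is used to move `B` past the column of `M t`, twisted by the parities of its entries. -/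
theorem IsGen.cov {B : Completed m n N} {G : ℝ → Completed m n N} (hG : IsGen B G) {X : SMat m n N}
    (hX : Inf oscGen B X) {M : ℝ → SMat m n N} (hM : IsExpCurve X M)
    (hM' : ∀ t, IsSupermatrix (M t)) (t : ℝ) : Cov oscGen (G t) (M t) := by
  intro k
  have h := hG.unique (fun t => colSum k (M t) * sig (parity k) (G t)) ?_ t
  · rw [hM.zero, hG.zero, map_one (sig _), mul_one] at h
    have : colSum k (1 : SMat m n N) = 1 ⊗ₜ oscGen k := by
      rw [colSum_apply, Finset.sum_eq_single k]
      · simp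
      · intro j _ hj
        rw [Matrix.one_apply_ne hj, TensorProduct.zero_tmul]
      · simp
    rw [this] at h
    exact h.symm
  · intro t
    have := HasStrongDeriv.clm_mul (L := colSum k)
      (fun e => StrongLeft.sum _ fun j _ => StrongLeft.tmul_oscGen (e j k) j) (hM.deriv t)
      ((hG.deriv t).sig (parity k))
    refine Eq.subst (motive := fun v => HasStrongDeriv _ v t) ?_ this
    have key : ∀ j, B * (M t j k ⊗ₜ oscGen j) = (M t j k ⊗ₜ oscGen j) * sig (parity k) B +
        ∑ i, (X i j * M t j k) ⊗ₜ oscGen i := by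
      intro j
      have h1 : M t j k ⊗ₜ[ℝ] oscGen j = (M t j k ⊗ₜ[ℝ] (1 : CompletedCW m n)) *
        ((1 : Lam N) ⊗ₜ[ℝ] oscGen j) := by simp
      have h2 := congrArg (sig (parity j + parity k)) (hX j)
      rw [map_mul, map_add, map_mul, sig_tmul, map_one, sig_sig, add_right_comm,
        ZMod.two_add_self, zero_add] at h2
      rw [h1, ← mul_assoc, mul_tmul_one_of_mem_grade (hM' t j k), mul_assoc, h2, mul_add,
        ← mul_assoc]
      congr 1
      rw [map_sum, Finset.mul_sum]
      refine Finset.sum_congr rfl fun i _ => ?_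
      rw [sig_tmul, Algebra.TensorProduct.tmul_mul_tmul, mul_grade_comm (hM' t j k), one_mul]
    have h3 : B * colSum k (M t) = colSum k (M t) * sig (parity k) B + colSum k (X * M t) := by
      simp only [colSum_apply, Finset.mul_sum, key, Finset.sum_add_distrib, Finset.sum_mul,
        Matrix.mul_apply, TensorProduct.sum_tmul]
      rw [Finset.sum_comm (f := fun i j => (X i j * M t j k) ⊗ₜ[ℝ] (oscGen i : CompletedCW m n))]
    rw [← mul_assoc, h3, add_mul, map_mul (sig _), mul_assoc, add_comm]

/-- Supermatrices form a subalgebra. -/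
def superSubalgebra (m n N : ℕ) : Subalgebra ℝ (SMat m n N) where
  carrier := {M | IsSupermatrix M}
  mul_mem' {M M'} hM hM' j k := Submodule.sum_mem _ fun i _ => by
    have := mul_mem_grade (hM j i) (hM' i k)
    rwa [add_assoc, ← add_assoc (parity i), ZMod.two_add_self, zero_add] at this
  add_mem' hM hM' j k := Submodule.add_mem _ (hM j k) (hM' j k)
  algebraMap_mem' r j k := by
    rw [Matrix.algebraMap_matrix_apply]
    split_ifs with h
    · rw [h, ZMod.two_add_self]
      exact algebraMap_mem_grade r
    · exact zero_mem _

theorem IsExpCurve.isSupermatrix {X : SMat m n N} {M : ℝ → SMat m n N} (hM : IsExpCurve X M)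
    (hX : IsSupermatrix X) (t : ℝ) : IsSupermatrix (M t) :=
  hM.mem_subalgebra (S := superSubalgebra m n N) hX t

end

/-! ### The adjoint with respect to `Q` -/

section
variable {m n N : ℕ}

/-- The sign in the supertranspose. -/
def stSign : Idx m n → Idx m n → ℝ
  | .inr _, .inl _ => -1
  | _, _ => 1

theorem supertranspose_apply (M : SMat m n N) (j k : Idx m n) :
    supertranspose M j k = stSign j k • M k j := by
  rcases j with j | j <;> rcases k with k | k <;>
    simp [supertranspose, stSign, Matrix.toBlocks₁₁, Matrix.toBlocks₁₂, Matrix.toBlocks₂₁,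
      Matrix.toBlocks₂₂]

theorem super_comm {p q : ZMod 2} {a b : Lam N} (ha : a ∈ grade (Fin N) p)
    (hb : b ∈ grade (Fin N) q) :
    a * b = (if p = 1 ∧ q = 1 then -1 else 1 : ℝ) • (b * a) := by
  rw [mul_of_mem_grade hb]
  rcases ZMod.two_cases p with rfl | rfl
  · rw [sgn_of_mem_grade_zero ha]
    simp
  · rcases ZMod.two_cases q with rfl | rfl
    · simp [sgn_zero]
    · rw [sgn_one_of_mem_grade_one ha]
      simp

/-- The signs from exchanging odd entries are exactly compensated by those in the definition of the
supertranspose. -/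
theorem supertranspose_mul {M M' : SMat m n N} (hM : IsSupermatrix M) (hM' : IsSupermatrix M') :
    supertranspose (M * M') = supertranspose M' * supertranspose M := by
  ext j k
  rw [supertranspose_apply, Matrix.mul_apply, Matrix.mul_apply, Finset.smul_sum]
  refine Finset.sum_congr rfl fun i _ => ?_
  rw [supertranspose_apply, supertranspose_apply, super_comm (hM k i) (hM' i j), smul_mul_smul_comm,
    smul_smul]
  congr 1
  rcases j with j | j <;> rcases k with k | k <;> rcases i with i | i <;>
    simp [stSign, parity]

/-- The inverse of `Q`. -/
def Qinv (m n N : ℕ) : SMat m n N :=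
  realMat N (Matrix.fromBlocks 1 0 0 ((2 : ℝ) • Omega n))

theorem realMat_mul (A B : Matrix (Idx m n) (Idx m n) ℝ) :
    realMat N (A * B) = realMat N A * realMat N B := Matrix.map_mul

theorem realMat_one : realMat N (1 : Matrix (Idx m n) (Idx m n) ℝ) = 1 :=
  Matrix.map_one _ (map_zero _) (map_one _)

theorem Qinv_mul_Qmat : Qinv m n N * Qmat m n N = 1 := by
  rw [Qinv, Qmat, ← realMat_mul, Matrix.fromBlocks_multiply, ← realMat_one]
  congr 1
  rw [← Matrix.fromBlocks_one]
  simp [Omega_mul_self]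

theorem Qmat_mul_Qinv : Qmat m n N * Qinv m n N = 1 := by
  rw [Qinv, Qmat, ← realMat_mul, Matrix.fromBlocks_multiply, ← realMat_one]
  congr 1
  rw [← Matrix.fromBlocks_one]
  simp [Omega_mul_self]

/-- The adjoint of a supermatrix with respect to `Q`. -/
def adj : SMat m n N →ₗ[ℝ] SMat m n N where
  toFun M := Qinv m n N * supertranspose M * Qmat m n N
  map_add' M M' := by
    have : supertranspose (M + M') = supertranspose M + supertranspose M' := by
      ext j k
      simp only [supertranspose_apply, Matrix.add_apply, smul_add]
    rw [this, mul_add, add_mul]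
  map_smul' c M := by
    have : supertranspose (c • M) = c • supertranspose M := by
      ext j k
      simp only [supertranspose_apply, Matrix.smul_apply, smul_comm c]
    rw [this, Matrix.mul_smul, Matrix.smul_mul, RingHom.id_apply]

theorem adj_apply (M : SMat m n N) : adj M = Qinv m n N * supertranspose M * Qmat m n N := rfl

theorem adj_mul {M M' : SMat m n N} (hM : IsSupermatrix M) (hM' : IsSupermatrix M') :
    adj (M * M') = adj M' * adj M := by
  simp only [adj_apply, supertranspose_mul hM hM']
  rw [mul_assoc (_ * _) (Qmat m n N), ← mul_assoc (Qmat m n N), ← mul_assoc (Qmat m n N),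
    Qmat_mul_Qinv, one_mul]
  simp only [mul_assoc]

theorem adj_one : adj (1 : SMat m n N) = 1 := by
  have : supertranspose (1 : SMat m n N) = 1 := by
    ext j k
    rw [supertranspose_apply]
    rcases j with j | j <;> rcases k with k | k <;> simp [stSign, Matrix.one_apply, eq_comm]
  rw [adj_apply, this, mul_one, Qinv_mul_Qmat]

theorem Qmat_mul_adj (M : SMat m n N) : Qmat m n N * adj M = supertranspose M * Qmat m n N := by
  rw [adj_apply, ← mul_assoc, ← mul_assoc, Qmat_mul_Qinv, one_mul]

theorem adj_mul_self_iff (M : SMat m n N) :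
    supertranspose M * Qmat m n N * M = Qmat m n N ↔ adj M * M = 1 := by
  rw [← Qmat_mul_adj, mul_assoc]
  constructor
  · intro h
    have := congrArg (Qinv m n N * ·) h
    simpa only [← mul_assoc, Qinv_mul_Qmat, one_mul] using this
  · intro h
    rw [h, mul_one]

theorem adj_eq_neg_iff (X : SMat m n N) :
    supertranspose X * Qmat m n N + Qmat m n N * X = 0 ↔ adj X = -X := by
  rw [← Qmat_mul_adj, ← mul_add]
  constructor
  · intro h
    have := congrArg (Qinv m n N * ·) h
    rwa [← mul_assoc, Qinv_mul_Qmat, one_mul, mul_zero, add_eq_zero_iff_eq_neg] at this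
  · intro h
    rw [h, neg_add_cancel, mul_zero]

/-- The adjoint reverses products and sends `X` to `-X`, so `adj (M t)` is the one-parameter group
of `-X`. -/
theorem IsExpCurve.adj_eq {X : SMat m n N} {M : ℝ → SMat m n N} (hM : IsExpCurve X M)
    (hX : X ∈ so0 m n N) (t : ℝ) : adj (M t) = M (-t) := by
  have hs := hM.isSupermatrix hX.1
  have hneg : IsExpCurve (-X) (fun t => M (-t)) := by
    refine ⟨by simp [hM.zero], fun t => ?_⟩
    have := (hM.deriv (-t)).comp_neg
    rwa [← _root_.neg_mul] at this
  have := hneg.unique_curve (u := fun t => adj (M t)) (fun t => ?_) t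
  · rwa [hM.zero, adj_one, mul_one] at this
  · have := (hM.deriv t).map adj
    rwa [← hM.comm, adj_mul (hs t) hX.1, (adj_eq_neg_iff X).1 hX.2] at this

theorem IsExpCurve.adj_mul_self {X : SMat m n N} {M : ℝ → SMat m n N} (hM : IsExpCurve X M)
    (hX : X ∈ so0 m n N) (t : ℝ) : adj (M t) * M t = 1 := by
  rw [hM.adj_eq hX, hM.neg_mul]

/-! ### Exponentials of nilpotent supermatrices -/

/-- Matrices with entries in the `r`-th power of the ideal of nilpotent elements. -/
def nilMat (m n N r : ℕ) : Submodule ℝ (SMat m n N) where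
  carrier := {M | ∀ j k, M j k ∈ nilIdeal N ^ r}
  add_mem' hM hM' j k := Submodule.add_mem _ (hM j k) (hM' j k)
  zero_mem' _ _ := zero_mem _
  smul_mem' c _ hM j k := Submodule.smul_mem _ c (hM j k)

theorem nilMat_mul {r s : ℕ} {M M' : SMat m n N} (hM : M ∈ nilMat m n N r)
    (hM' : M' ∈ nilMat m n N s) : M * M' ∈ nilMat m n N (r + s) := fun j k =>
  Submodule.sum_mem _ fun i _ => by
    rw [pow_add]
    exact Submodule.mul_mem_mul (hM j i) (hM' i k)

theorem nilMat_pow {r : ℕ} {M : SMat m n N} (hM : M ∈ nilMat m n N 1) :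
    M ^ r ∈ nilMat m n N r := by
  induction r with
  | zero =>
    intro j k
    rw [pow_zero, pow_zero, Matrix.one_apply]
    split_ifs
    · exact Submodule.one_le.1 le_rfl
    · exact zero_mem _
  | succ r ih =>
    rw [pow_succ]
    exact nilMat_mul ih hM

theorem eq_zero_of_mem_nilMat {M : SMat m n N} (hM : M ∈ nilMat m n N (N + 1)) : M = 0 := by
  ext j k
  have := hM j k
  rwa [nilIdeal_pow, Submodule.mem_bot] at this

/-- The condition `1 ≤ r` matters: the power `0` of the submodule consists of the scalars and does
not contain the ideal. -/
theorem nilMat_succ_le {r : ℕ} {M : SMat m n N} (hM : M ∈ nilMat m n N (r + 1)) (hr : 1 ≤ r) :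
    M ∈ nilMat m n N r := fun j k => by
  obtain ⟨r, rfl⟩ := Nat.exists_eq_add_of_le' hr
  have := hM j k
  rw [nilIdeal_pow_eq] at this ⊢
  rw [pow_succ, mul_assoc] at this
  exact (mul_le_mul' le_rfl le_top : gens N ^ (r + 1) * (gens N * ⊤) ≤ gens N ^ (r + 1) * ⊤) this

/-- The exponential series of a nilpotent supermatrix. -/
def nilExp (X : SMat m n N) : SMat m n N :=
  ∑ p ∈ Finset.range (N + 1), ((p.factorial : ℝ)⁻¹) • X ^ p

theorem IsExpCurve.eq_nilExp {X : SMat m n N} {M : ℝ → SMat m n N} (hM : IsExpCurve X M)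
    (hX : X ∈ nilMat m n N 1) : M 1 = nilExp X := by
  have h := hM.unique_curve
    (u := fun t => ∑ p ∈ Finset.range (N + 1), (t ^ p * (p.factorial : ℝ)⁻¹) • X ^ p) (fun t => ?_) 1
  · have h0 : ∑ p ∈ Finset.range (N + 1), ((0 : ℝ) ^ p * (p.factorial : ℝ)⁻¹) • X ^ p = 1 := by
      rw [Finset.sum_eq_single 0 (fun p _ hp => by rw [zero_pow hp, zero_mul, zero_smul]) (by simp)]
      simp
    simp only [h0, one_pow, one_mul, mul_one] at h
    exact h.symm
  · have := WeakDeriv.sum (Finset.range (N + 1)) fun p _ =>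
      WeakDeriv.smul_const ((hasDerivAt_pow p t).mul_const (p.factorial : ℝ)⁻¹) (X ^ p)
    refine Eq.subst (motive := fun v => WeakDeriv _ v t) ?_ this
    rw [Finset.sum_range_succ', Finset.mul_sum, Finset.sum_range_succ _ N, Matrix.mul_smul,
      ← pow_succ', eq_zero_of_mem_nilMat (nilMat_pow hX), smul_zero, add_zero]
    simp only [Nat.cast_zero, zero_mul, zero_smul, add_zero, Matrix.mul_smul, ← pow_succ']
    refine Finset.sum_congr rfl fun p _ => ?_
    congr 1
    rw [Nat.add_sub_cancel, Nat.factorial_succ]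
    push_cast
    field_simp

/-- Modulo the next step of the filtration, the exponential is translation by `Z`: in the powers
from the second on, every term containing `Z` has another nilpotent factor. This drives the
successive approximations for injectivity and surjectivity. -/
theorem nilExp_add_sub {r : ℕ} (hr : 1 ≤ r) {X Z : SMat m n N} (hX : X ∈ nilMat m n N 1)
    (hZ : Z ∈ nilMat m n N r) : nilExp (X + Z) - nilExp X - Z ∈ nilMat m n N (r + 1) := by
  have hZ1 : Z ∈ nilMat m n N 1 := by
    induction r, hr using Nat.le_induction with
    | base => exact hZ
    | succ r hr ih => exact ih (nilMat_succ_le hZ hr)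
  have key : ∀ p : ℕ, (X + Z) ^ (p + 1) - X ^ (p + 1) ∈ nilMat m n N (r + p) := by
    intro p
    induction p with
    | zero => simpa using hZ
    | succ p ih =>
      have : (X + Z) ^ (p + 1 + 1) - X ^ (p + 1 + 1) =
          ((X + Z) ^ (p + 1) - X ^ (p + 1)) * (X + Z) + X ^ (p + 1) * Z := by
        rw [pow_succ, pow_succ X]; noncomm_ring
      have h1 := nilMat_mul ih (Submodule.add_mem _ hX hZ1)
      have h2 := nilMat_mul (nilMat_pow (r := p + 1) hX) hZ
      rw [add_assoc] at h1
      rw [add_comm] at h2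
      rw [this]
      exact Submodule.add_mem _ h1 h2
  -- For `N = 0` the truncated series has no linear term, but then the nilpotent matrices vanish as
  -- well.
  rcases Nat.eq_zero_or_pos N with rfl | hN
  · rw [eq_zero_of_mem_nilMat hX, eq_zero_of_mem_nilMat hZ1]
    simp
  obtain ⟨K, rfl⟩ := Nat.exists_eq_add_of_le' hN
  have h : nilExp (X + Z) - nilExp X - Z =
      ∑ p ∈ Finset.range K, (((p + 1 + 1).factorial : ℝ)⁻¹) • ((X + Z) ^ (p + 1 + 1) - X ^ (p + 1 + 1)) := by
    rw [nilExp, nilExp, ← Finset.sum_sub_distrib, Finset.sum_range_succ', Finset.sum_range_succ']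
    simp [smul_sub]
  rw [h]
  refine Submodule.sum_mem _ fun p _ => Submodule.smul_mem _ _ ?_
  have := key (p + 1)
  have hle : ∀ q, ∀ M ∈ nilMat m n (K + 1) (r + 1 + q), M ∈ nilMat m n (K + 1) (r + 1) := by
    intro q
    induction q with
    | zero => exact fun M h => h
    | succ q ih => exact fun M h => ih M (nilMat_succ_le h (by omega))
  refine hle p _ ?_
  rwa [add_assoc, add_comm 1]

/-- If the exponentials agree, `nilExp_add_sub` with `Z = X - Y` moves the difference one step
deeper in the filtration, which ends at zero. -/
theorem nilExp_injective {X Y : SMat m n N} (hX : X ∈ nilMat m n N 1) (hY : Y ∈ nilMat m n N 1)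
    (h : nilExp X = nilExp Y) : X = Y := by
  have key : ∀ r, X - Y ∈ nilMat m n N (r + 1) := by
    intro r
    induction r with
    | zero => exact Submodule.sub_mem _ hX hY
    | succ r ih =>
      have := nilExp_add_sub (Nat.le_add_left 1 r) hY ih
      rw [add_sub_cancel, h, sub_self, zero_sub] at this
      exact (Submodule.neg_mem_iff _).1 this
  exact sub_eq_zero.1 (eq_zero_of_mem_nilMat (key N))

theorem nilExp_mem {X : SMat m n N} {S : Subalgebra ℝ (SMat m n N)} (hX : X ∈ S) :
    nilExp X ∈ S :=
  Subalgebra.sum_mem _ fun p _ => Subalgebra.smul_mem _ (Subalgebra.pow_mem _ hX p) _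

theorem nilExp_zero : nilExp (0 : SMat m n N) = 1 := by
  rw [nilExp, Finset.sum_eq_single 0 (fun p _ hp => by simp [hp]) (by simp)]
  simp

theorem nilExp_sub_one_mem {X : SMat m n N} (hX : X ∈ nilMat m n N 1) :
    nilExp X - 1 ∈ nilMat m n N 1 := by
  have h := nilMat_succ_le (nilExp_add_sub le_rfl (zero_mem _) hX) le_rfl
  rw [zero_add, nilExp_zero] at h
  simpa using Submodule.add_mem _ h hX

/-- Successive approximation: adding the current error to `X` moves the error one step deeper in the
filtration, and stays within supermatrices. -/
theorem exists_nilExp_eq {E : SMat m n N} (hE : E - 1 ∈ nilMat m n N 1) (hs : IsSupermatrix E) :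
    ∃ X ∈ nilMat m n N 1, IsSupermatrix X ∧ nilExp X = E := by
  have key : ∀ r, ∃ X ∈ nilMat m n N 1, IsSupermatrix X ∧ E - nilExp X ∈ nilMat m n N (r + 1) := by
    intro r
    induction r with
    | zero =>
      refine ⟨0, zero_mem _, fun _ _ => zero_mem _, ?_⟩
      rwa [nilExp_zero]
    | succ r ih =>
      obtain ⟨X, hX, hXs, h⟩ := ih
      have hle : ∀ r, ∀ M ∈ nilMat m n N (r + 1), M ∈ nilMat m n N 1 := by
        intro r
        induction r with
        | zero => exact fun M h => h
        | succ r ih => exact fun M h => ih M (nilMat_succ_le h (by omega))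
      refine ⟨X + (E - nilExp X), Submodule.add_mem _ hX (hle r _ h), ?_, ?_⟩
      · exact Subalgebra.add_mem (superSubalgebra m n N) hXs (Subalgebra.sub_mem _ hs (nilExp_mem hXs))
      · have := nilExp_add_sub (Nat.le_add_left 1 r) hX h
        rw [sub_sub, add_sub_cancel] at this
        rw [← neg_sub]
        exact Submodule.neg_mem _ this
  obtain ⟨X, hX, hXs, h⟩ := key N
  exact ⟨X, hX, hXs, (sub_eq_zero.1 (eq_zero_of_mem_nilMat h)).symm⟩

theorem adj_nilExp {X : SMat m n N} (hs : IsSupermatrix X) : adj (nilExp X) = nilExp (adj X) := by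
  rw [nilExp, map_sum, nilExp]
  have hp : ∀ p, adj (X ^ p) = adj X ^ p := by
    intro p
    induction p with
    | zero => rw [pow_zero, pow_zero, adj_one]
    | succ p ih =>
      rw [pow_succ', adj_mul hs (Subalgebra.pow_mem (superSubalgebra m n N) hs p), ih, pow_succ]
  exact Finset.sum_congr rfl fun p _ => by rw [map_smul, hp]

theorem realMat_mem_nilMat (A : Matrix (Idx m n) (Idx m n) ℝ) : realMat N A ∈ nilMat m n N 0 :=
  fun j k => by
    rw [pow_zero, Submodule.one_eq_range]
    exact ⟨A j k, rfl⟩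

theorem adj_mem_nilMat {X : SMat m n N} (hX : X ∈ nilMat m n N 1) : adj X ∈ nilMat m n N 1 := by
  have hst : supertranspose X ∈ nilMat m n N 1 := fun j k => by
    rw [supertranspose_apply]
    exact Submodule.smul_mem _ _ (hX k j)
  have := nilMat_mul (nilMat_mul (realMat_mem_nilMat (Matrix.fromBlocks 1 0 0 ((2 : ℝ) • Omega n))) hst)
    (realMat_mem_nilMat (Matrix.fromBlocks 1 0 0 (-(1 / 2 : ℝ) • Omega n)))
  rw [zero_add, add_zero] at this
  exact this

/-- For the logarithm `X` of `E`, the condition `adj E = E⁻¹` reads `nilExp (adj X) = nilExp (-X)`,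
and injectivity gives `adj X = -X`. -/
theorem exists_so0_nilExp_eq {E : SMat m n N} (hE : E - 1 ∈ nilMat m n N 1) (hs : IsSupermatrix E)
    (hadj : adj E * E = 1) : ∃ X ∈ nilpotentPart m n N, nilExp X = E := by
  obtain ⟨X, hX, hXs, rfl⟩ := exists_nilExp_eq hE hs
  refine ⟨X, ⟨⟨hXs, (adj_eq_neg_iff X).2 ?_⟩, fun j k => ?_⟩, rfl⟩
  · obtain ⟨M, hM⟩ := exists_isExpCurve X
    obtain ⟨M', hM'⟩ := exists_isExpCurve (-X)
    have h1 : M' 1 = M (-1) := by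
      have hneg : ∀ t, WeakDeriv (fun t => M (-t)) (-X * M (-t)) t := fun t => by
        have := (hM.deriv (-t)).comp_neg
        rwa [← neg_mul] at this
      have := hM'.unique_curve hneg 1
      rw [this, neg_zero, hM.zero, mul_one]
    refine nilExp_injective (adj_mem_nilMat hX) (Submodule.neg_mem _ hX) ?_
    rw [← hM'.eq_nilExp (Submodule.neg_mem _ hX), h1, ← adj_nilExp hXs]
    rw [← hM.eq_nilExp hX] at hadj ⊢
    exact left_inv_eq_right_inv hadj (hM.mul_neg 1)
  · have := hX j k
    rw [pow_one] at this
    exact this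

end

/-! ### Determinants over the even part of the Grassmann algebra -/

section
variable {N : ℕ}

/-- The even part of the Grassmann algebra, as a subalgebra. -/
def evenLam (N : ℕ) : Subalgebra ℝ (Lam N) where
  carrier := grade (Fin N) 0
  mul_mem' ha hb := by simpa using mul_mem_grade ha hb
  add_mem' ha hb := Submodule.add_mem _ ha hb
  algebraMap_mem' r := algebraMap_mem_grade r

instance : CommRing (evenLam N) :=
  { (inferInstance : Ring (evenLam N)) with
    mul_comm := fun a b => Subtype.ext <| by
      change (a : Lam N) * b = b * a
      rw [mul_of_mem_grade b.2, sgn_zero]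
      rfl }

/-- The inclusion of the even part. -/
abbrev evenVal (N : ℕ) : evenLam N →+* Lam N := (evenLam N).val.toRingHom

theorem evenVal_injective : Function.Injective (evenVal N) := Subtype.val_injective

/-- The body of an even element. -/
def evenBody (N : ℕ) : evenLam N →+* ℝ := (body N : Lam N →+* ℝ).comp (evenVal N)

theorem isNilpotent_even {a : evenLam N} (ha : evenBody N a = 0) : IsNilpotent a := by
  obtain ⟨k, hk⟩ := isNilpotent_of_body_eq_zero ha
  exact ⟨k, evenVal_injective (by rw [map_pow, hk, map_zero])⟩

theorem isUnit_even_iff {a : evenLam N} : IsUnit a ↔ evenBody N a ≠ 0 := by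
  refine ⟨fun h => (h.map (evenBody N)).ne_zero, fun h => ?_⟩
  set c := evenBody N a
  have hc : evenBody N (algebraMap ℝ _ c) = c := AlgHom.commutes (body N) c
  have hn : IsNilpotent (algebraMap ℝ (evenLam N) c - a) :=
    isNilpotent_even (by rw [map_sub, hc, sub_self])
  have hu : IsUnit (algebraMap ℝ (evenLam N) c) := (isUnit_iff_ne_zero.2 h).map _
  have := hn.isUnit_add_left_of_commute hu.neg (Commute.all _ _)
  rw [← IsUnit.neg_iff]
  convert this using 1
  ring

theorem exists_even_lift {ι κ : Type} {M : Matrix ι κ (Lam N)}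
    (hM : ∀ i k, M i k ∈ grade (Fin N) 0) : ∃ A : Matrix ι κ (evenLam N), A.map (evenVal N) = M :=
  ⟨fun i k => ⟨M i k, hM i k⟩, rfl⟩

theorem map_evenVal_injective {ι κ : Type} :
    Function.Injective fun A : Matrix ι κ (evenLam N) => A.map (evenVal N) :=
  Matrix.map_injective evenVal_injective

theorem map_even_mem {ι κ : Type} (A : Matrix ι κ (evenLam N)) (i : ι) (k : κ) :
    A.map (evenVal N) i k ∈ grade (Fin N) 0 := (A i k).2

theorem mul_mem_grade_matrix {ι κ μ : Type} [Fintype κ] {p q : ZMod 2} {U : Matrix ι κ (Lam N)}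
    {V : Matrix κ μ (Lam N)} (hU : ∀ i k, U i k ∈ grade (Fin N) p)
    (hV : ∀ i k, V i k ∈ grade (Fin N) q) (i : ι) (k : μ) : (U * V) i k ∈ grade (Fin N) (p + q) :=
  Submodule.sum_mem _ fun j _ => mul_mem_grade (hU i j) (hV j k)

theorem one_mem_grade_matrix {ι : Type} [DecidableEq ι] (i k : ι) :
    (1 : Matrix ι ι (Lam N)) i k ∈ grade (Fin N) 0 := by
  rw [Matrix.one_apply]
  split_ifs
  · exact (evenLam N).one_mem
  · exact zero_mem _

theorem gdet_map {ι : Type} [Fintype ι] [DecidableEq ι] (A : Matrix ι ι (evenLam N)) :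
    gdet (A.map (evenVal N)) = evenVal N A.det := by
  rw [gdet, Matrix.det_apply, map_sum]
  refine Finset.sum_congr rfl fun σ _ => ?_
  rw [Units.smul_def, map_zsmul, Int.cast_smul_eq_zsmul, ← Finset.prod_map_toList, map_list_prod,
    List.map_map]
  rfl

theorem body_odd {a : Lam N} (ha : a ∈ grade (Fin N) 1) : body N a = 0 := by
  have h : (body N).comp CliffordAlgebra.involute = body N := by
    apply ExteriorAlgebra.hom_ext
    ext v
    simp [body, ExteriorAlgebra.algebraMapInv, ExteriorAlgebra.ι]
  have h1 := congrArg (body N) (CliffordAlgebra.involute_eq_of_mem_odd ha)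
  rw [← AlgHom.comp_apply, h, map_neg] at h1
  linarith

/-- Sylvester's identity for matrices with odd entries. -/
def OddSylvester (N : ℕ) (ι κ : Type) [Fintype ι] [Fintype κ] [DecidableEq ι] [DecidableEq κ] :
    Prop :=
  ∀ (U : Matrix ι κ (Lam N)) (V : Matrix κ ι (Lam N)), (∀ i k, U i k ∈ grade (Fin N) 1) →
    (∀ k i, V k i ∈ grade (Fin N) 1) → ∀ (A : Matrix ι ι (evenLam N)) (B : Matrix κ κ (evenLam N)),
    A.map (evenVal N) = 1 - U * V → B.map (evenVal N) = 1 - V * U → A.det * B.det = 1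

theorem OddSylvester.swap {ι κ : Type} [Fintype ι] [Fintype κ] [DecidableEq ι] [DecidableEq κ]
    (h : OddSylvester N ι κ) : OddSylvester N κ ι := fun U V hU hV A B hA hB => by
  rw [mul_comm]
  exact h V U hV hU B A hB hA

/-- For commuting entries the two determinants would be equal; here `vu = -uv` and `u² = 0` make `1
- uv` and `1 - vu` inverse to each other. -/
theorem oddSylvester_unit : OddSylvester N Unit Unit := by
  intro U V hU hV A B hA hB
  rw [Matrix.det_unique, Matrix.det_unique]
  apply evenVal_injective
  have hA' := congrFun (congrFun hA default) default
  have hB' := congrFun (congrFun hB default) default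
  simp only [Matrix.map_apply, Matrix.sub_apply, Matrix.one_apply_eq, Matrix.mul_apply,
    Finset.univ_unique, Finset.sum_singleton] at hA' hB'
  rw [map_mul, map_one, hA', hB']
  set u := U default default
  set v := V default default
  have huv : v * u = -(u * v) := by
    rw [super_comm (hV _ _) (hU _ _)]
    simp
    rfl
  have huu : u * u = 0 := by
    have := super_comm (hU default default) (hU default default)
    simp only [and_self, if_true, neg_smul, one_smul] at this
    have h2 : (2 : ℝ) • (u * u) = 0 := by
      rw [two_smul]
      nth_rewrite 1 [this]
      exact neg_add_cancel _
    exact (smul_eq_zero.1 h2).resolve_left two_ne_zero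
  have : (1 - u * v) * (1 - v * u) = 1 - v * u - u * v + u * (v * v) * u := by noncomm_ring
  rw [this, huv]
  have h2 : u * (v * v) * u = 0 := by
    rw [mul_assoc, mul_assoc v, huv]
    have : u * (v * -(u * v)) = -(u * (v * u) * v) := by noncomm_ring
    rw [this, huv]
    have : -(u * -(u * v) * v) = u * u * v * v := by noncomm_ring
    rw [this, huu]
    simp
  rw [h2]
  abel

/-- Adds one column `u` to `U₁` and one row `v` to `V₁`. With `P = 1 - U₁V₁` and `R = 1 - V₁U₁`, the
formula `P⁻¹ = 1 + U₁R⁻¹V₁` identifies the Schur complement of `R` in `1 - VU` with `1 - v P⁻¹ u`,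
while `1 - UV = P (1 - P⁻¹ u v)`. So the case of one column applies to `P⁻¹ u` and `v`. -/
theorem OddSylvester.sum_unit {ι κ : Type} [Fintype ι] [Fintype κ] [DecidableEq ι] [DecidableEq κ]
    (h1 : OddSylvester N ι κ) (h2 : OddSylvester N ι Unit) : OddSylvester N ι (κ ⊕ Unit) := by
  intro U V hU hV A B hA hB
  set U₁ : Matrix ι κ (Lam N) := U.toCols₁
  set u : Matrix ι Unit (Lam N) := U.toCols₂
  set V₁ : Matrix κ ι (Lam N) := V.toRows₁
  set v : Matrix Unit ι (Lam N) := V.toRows₂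
  have hUc : U = Matrix.fromCols U₁ u := (Matrix.fromCols_toCols U).symm
  have hVc : V = Matrix.fromRows V₁ v := (Matrix.fromRows_toRows V).symm
  have hU₁ : ∀ i k, U₁ i k ∈ grade (Fin N) 1 := fun i k => hU i (.inl k)
  have hu : ∀ i k, u i k ∈ grade (Fin N) 1 := fun i k => hU i (.inr k)
  have hV₁ : ∀ i k, V₁ i k ∈ grade (Fin N) 1 := fun i k => hV (.inl i) k
  have hv : ∀ i k, v i k ∈ grade (Fin N) 1 := fun i k => hV (.inr i) k
  obtain ⟨P, hP⟩ := exists_even_lift (M := 1 - U₁ * V₁) fun i k =>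
    Submodule.sub_mem _ (one_mem_grade_matrix i k) (mul_mem_grade_matrix hU₁ hV₁ i k)
  obtain ⟨R, hR⟩ := exists_even_lift (M := 1 - V₁ * U₁) fun i k =>
    Submodule.sub_mem _ (one_mem_grade_matrix i k) (mul_mem_grade_matrix hV₁ hU₁ i k)
  have hPR := h1 U₁ V₁ hU₁ hV₁ P R hP hR
  have hPu : IsUnit P.det := .of_mul_eq_one _ hPR
  have hRu : IsUnit R.det := .of_mul_eq_one _ ((mul_comm _ _).trans hPR)
  have hPi : P⁻¹.map (evenVal N) = 1 + U₁ * R⁻¹.map (evenVal N) * V₁ := by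
    have e1 : P⁻¹.map (evenVal N) * P.map (evenVal N) = 1 := by
      rw [← Matrix.map_mul, Matrix.nonsing_inv_mul _ hPu, Matrix.map_one _ (map_zero _) (map_one _)]
    have e2 : R.map (evenVal N) * R⁻¹.map (evenVal N) = 1 := by
      rw [← Matrix.map_mul, Matrix.mul_nonsing_inv _ hRu, Matrix.map_one _ (map_zero _) (map_one _)]
    refine left_inv_eq_right_inv e1 ?_
    rw [hR] at e2
    rw [hP]
    have e3 : (1 - V₁ * U₁) * (R⁻¹.map (evenVal N) * V₁) = V₁ := by
      rw [← Matrix.mul_assoc, e2, Matrix.one_mul]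
    have e4 : (1 - U₁ * V₁) * U₁ = U₁ * (1 - V₁ * U₁) := by
      rw [Matrix.sub_mul, Matrix.mul_sub, Matrix.one_mul, Matrix.mul_one, Matrix.mul_assoc]
    rw [Matrix.mul_add, Matrix.mul_one, Matrix.mul_assoc U₁, ← Matrix.mul_assoc _ U₁, e4,
      Matrix.mul_assoc U₁, e3, sub_add_cancel]
  have hBb : B = Matrix.fromBlocks R B.toBlocks₁₂ B.toBlocks₂₁ B.toBlocks₂₂ := by
    conv_lhs => rw [← Matrix.fromBlocks_toBlocks B]
    congr 1
    apply map_evenVal_injective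
    change _ = R.map (evenVal N)
    rw [hR]
    ext i k
    exact (congrFun (congrFun hB (.inl i)) (.inl k)).trans (by
      simp [hUc, hVc, Matrix.sub_apply, Matrix.one_apply, Matrix.mul_apply])
  have h12 : B.toBlocks₁₂.map (evenVal N) = -(V₁ * u) := by
    ext i k
    exact (congrFun (congrFun hB (.inl i)) (.inr k)).trans (by
      simp [hUc, hVc, Matrix.sub_apply, Matrix.mul_apply])
  have h21 : B.toBlocks₂₁.map (evenVal N) = -(v * U₁) := by
    ext i k
    exact (congrFun (congrFun hB (.inr i)) (.inl k)).trans (by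
      simp [hUc, hVc, Matrix.sub_apply, Matrix.mul_apply])
  have h22 : B.toBlocks₂₂.map (evenVal N) = 1 - v * u := by
    ext i k
    exact (congrFun (congrFun hB (.inr i)) (.inr k)).trans (by
      simp [hUc, hVc, Matrix.sub_apply, Matrix.mul_apply])
  have hdB : B.det = R.det * (B.toBlocks₂₂ - B.toBlocks₂₁ * R⁻¹ * B.toBlocks₁₂).det := by
    have := R.invertibleOfIsUnitDet hRu
    conv_lhs => rw [hBb, Matrix.det_fromBlocks₁₁, Matrix.invOf_eq_nonsing_inv]
  have hdA : A.det = P.det * (P⁻¹ * A).det := by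
    rw [← Matrix.det_mul, ← Matrix.mul_assoc, Matrix.mul_nonsing_inv _ hPu, Matrix.one_mul]
  have hfin := h2 (P⁻¹.map (evenVal N) * u) v (fun i k => by
      simpa using mul_mem_grade_matrix (map_even_mem P⁻¹) hu i k) hv (P⁻¹ * A)
    (B.toBlocks₂₂ - B.toBlocks₂₁ * R⁻¹ * B.toBlocks₁₂) ?_ ?_
  · rw [hdA, hdB, mul_mul_mul_comm, hPR, hfin, one_mul]
  · have e1 : P⁻¹.map (evenVal N) * P.map (evenVal N) = 1 := by
      rw [← Matrix.map_mul, Matrix.nonsing_inv_mul _ hPu, Matrix.map_one _ (map_zero _) (map_one _)]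
    have : A.map (evenVal N) = P.map (evenVal N) - u * v := by
      rw [hA, hP, hUc, hVc, Matrix.fromCols_mul_fromRows, sub_sub]
    rw [Matrix.map_mul, this, Matrix.mul_sub, e1, Matrix.mul_assoc]
  · rw [Matrix.map_sub _ (map_sub _), Matrix.map_mul, Matrix.map_mul, h12, h21, h22, hPi]
    simp only [Matrix.mul_assoc, Matrix.neg_mul, Matrix.mul_neg, neg_neg, Matrix.add_mul,
      Matrix.mul_add, Matrix.one_mul, sub_sub]

theorem OddSylvester.reindex {ι κ μ : Type} [Fintype ι] [Fintype κ] [Fintype μ] [DecidableEq ι]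
    [DecidableEq κ] [DecidableEq μ] (e : κ ≃ μ) (h : OddSylvester N ι κ) : OddSylvester N ι μ := by
  intro U V hU hV A B hA hB
  rw [← Matrix.det_submatrix_equiv_self e B]
  refine h (U.submatrix id e) (V.submatrix e id) (fun i k => hU i _) (fun k i => hV _ i) A _ ?_ ?_
  · rw [Matrix.submatrix_mul_equiv, hA]
    rfl
  · rw [← Matrix.submatrix_map, hB, ← Matrix.submatrix_mul _ _ e id e Function.bijective_id,
      Matrix.submatrix_sub]
    simp

theorem OddSylvester.of_unit {ι : Type} [Fintype ι] [DecidableEq ι] (h : OddSylvester N ι Unit)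
    (k : ℕ) : OddSylvester N ι (Fin k) := by
  induction k with
  | zero =>
    intro U V hU hV A B hA hB
    have : U * V = 0 := by
      ext i k
      simp [Matrix.mul_apply]
    rw [this, sub_zero] at hA
    have hA1 : A = 1 := map_evenVal_injective (hA.trans
      (Matrix.map_one _ (map_zero _) (map_one _)).symm)
    rw [hA1, Matrix.det_one, Matrix.det_isEmpty, one_mul]
  | succ k ih =>
    exact (ih.sum_unit h).reindex
      ((Equiv.sumCongr (Equiv.refl _) (Equiv.equivPUnit (Fin 1)).symm).trans finSumFinEquiv)

/-- One index set is enlarged from the `1 × 1` case, the roles are swapped, and then the other one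
is enlarged. -/
theorem oddSylvester (ι κ : Type) [Fintype ι] [Fintype κ] [DecidableEq ι] [DecidableEq κ] :
    OddSylvester N ι κ :=
  .reindex (Fintype.equivFin κ).symm <| .of_unit
    (.swap <| .reindex (Fintype.equivFin ι).symm <| .of_unit oddSylvester_unit _) _

end

/-! ### The superdeterminant of an orthosymplectic supermatrix -/

section
variable {m n N : ℕ}

theorem mul_eq_one_symm_of_finite {A : Type*} [Ring A] [Algebra ℝ A] [FiniteDimensional ℝ A]
    {a b : A} (h : a * b = 1) : b * a = 1 := by
  have hs : Function.Surjective (LinearMap.mulLeft ℝ a) := fun y =>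
    ⟨b * y, by rw [LinearMap.mulLeft_apply, ← mul_assoc, h, one_mul]⟩
  apply LinearMap.injective_iff_surjective.2 hs
  rw [LinearMap.mulLeft_apply, LinearMap.mulLeft_apply, ← mul_assoc, h, one_mul, mul_one]

theorem realMat_fromBlocks (A : Matrix (Fin m) (Fin m) ℝ)
    (D : Matrix (Fin n × Fin 2) (Fin n × Fin 2) ℝ) :
    realMat N (Matrix.fromBlocks A 0 0 D) =
      Matrix.fromBlocks (A.map (algebraMap ℝ (Lam N))) 0 0 (D.map (algebraMap ℝ (Lam N))) := by
  rw [realMat, Matrix.fromBlocks_map, Matrix.map_zero _ (map_zero _), Matrix.map_zero _ (map_zero _)]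

/-- The body of a supermatrix. -/
def bodyMat (M : SMat m n N) : Matrix (Idx m n) (Idx m n) ℝ := M.map (body N)

/-- The block equations of `adj M * M = 1` and `M * adj M = 1` express `αᵀα` and `ω δ ω' δᵀ` as `1 -
UV` and `1 - VU` with odd `U`, `V`, so `oddSylvester` shows that `r = det α · det δ` has square one.
The Schur complement in the superdeterminant is inverse to `αᵀ`, so the superdeterminant equals `r⁻¹
= r`. -/
theorem sdet_eq {M : SMat m n N} (hM : IsSupermatrix M) (h : adj M * M = 1) :
    sdet M = algebraMap ℝ (Lam N)
      ((bodyMat M).toBlocks₁₁.det * (bodyMat M).toBlocks₂₂.det) := by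
  have h' := mul_eq_one_symm_of_finite h
  set a := M.toBlocks₁₁
  set b := M.toBlocks₁₂
  set c := M.toBlocks₂₁
  set d := M.toBlocks₂₂
  have hMb : M = Matrix.fromBlocks a b c d := (Matrix.fromBlocks_toBlocks M).symm
  have ha : ∀ i k, a i k ∈ grade (Fin N) 0 := fun i k => by
    have := hM (.inl i) (.inl k)
    simp only [parity, Sum.elim_inl, add_zero] at this
    exact this
  have hb : ∀ i k, b i k ∈ grade (Fin N) 1 := fun i k => by
    have := hM (.inl i) (.inr k)
    simp only [parity, Sum.elim_inl, Sum.elim_inr, zero_add] at this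
    exact this
  have hc : ∀ i k, c i k ∈ grade (Fin N) 1 := fun i k => by
    have := hM (.inr i) (.inl k)
    simp only [parity, Sum.elim_inl, Sum.elim_inr, add_zero] at this
    exact this
  have hd : ∀ i k, d i k ∈ grade (Fin N) 0 := fun i k => hM (.inr i) (.inr k)
  set w : Matrix (Fin n × Fin 2) (Fin n × Fin 2) (Lam N) :=
    (-(1 / 2 : ℝ) • Omega n).map (algebraMap ℝ (Lam N))
  set w' : Matrix (Fin n × Fin 2) (Fin n × Fin 2) (Lam N) :=
    ((2 : ℝ) • Omega n).map (algebraMap ℝ (Lam N))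
  have hQ : Qmat m n N = Matrix.fromBlocks 1 0 0 w := by
    rw [Qmat, realMat_fromBlocks, Matrix.map_one _ (map_zero _) (map_one _)]
  have hQ' : Qinv m n N = Matrix.fromBlocks 1 0 0 w' := by
    rw [Qinv, realMat_fromBlocks, Matrix.map_one _ (map_zero _) (map_one _)]
  have hww : w * w' = 1 := by
    rw [← Matrix.map_mul, Matrix.smul_mul, Matrix.mul_smul, Omega_mul_self, smul_smul]
    norm_num
  have hst : supertranspose M = Matrix.fromBlocks a.transpose c.transpose (-b.transpose) d.transpose :=
    rfl
  have E1 := (adj_mul_self_iff M).2 h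
  have E2 : M * Qinv m n N * supertranspose M = Qinv m n N := by
    have := congrArg (· * Qinv m n N) h'
    rw [adj_apply] at this
    simpa only [mul_assoc, Qmat_mul_Qinv, mul_one, one_mul] using this
  rw [hst, hQ, hMb, Matrix.fromBlocks_multiply, Matrix.fromBlocks_multiply,
    Matrix.fromBlocks_inj] at E1
  rw [hst, hQ', hMb, Matrix.fromBlocks_multiply, Matrix.fromBlocks_multiply,
    Matrix.fromBlocks_inj] at E2
  simp only [Matrix.mul_one, Matrix.mul_zero, add_zero, zero_add] at E1 E2
  obtain ⟨E11, E12, -, -⟩ := E1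
  obtain ⟨-, -, -, E22⟩ := E2
  obtain ⟨α, hα⟩ := exists_even_lift ha
  obtain ⟨δ, hδ⟩ := exists_even_lift hd
  set ω : Matrix (Fin n × Fin 2) (Fin n × Fin 2) (evenLam N) :=
    (-(1 / 2 : ℝ) • Omega n).map (algebraMap ℝ (evenLam N))
  set ω' : Matrix (Fin n × Fin 2) (Fin n × Fin 2) (evenLam N) :=
    ((2 : ℝ) • Omega n).map (algebraMap ℝ (evenLam N))
  have hω : ω.map (evenVal N) = w := rfl
  have hω' : ω'.map (evenVal N) = w' := rfl
  have hωω : ω.det * ω'.det = 1 := by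
    rw [← Matrix.det_mul]
    have : ω * ω' = 1 := map_evenVal_injective (by
      change (ω * ω').map (evenVal N) = (1 : Matrix _ _ _).map (evenVal N)
      rw [Matrix.map_mul, hω, hω', hww, Matrix.map_one _ (map_zero _) (map_one _)])
    rw [this, Matrix.det_one]
  have hwc : ∀ i k, (w * c) i k ∈ grade (Fin N) 1 := fun i k => by
    have := mul_mem_grade_matrix (map_even_mem ω) hc i k
    rwa [zero_add] at this
  have hsyl := oddSylvester (N := N) (Fin m) (Fin n × Fin 2) c.transpose (w * c) (fun i k => hc k i) hwc
    (α.transpose * α) (ω * δ * ω' * δ.transpose)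
    (by rw [Matrix.map_mul, Matrix.transpose_map, hα, ← E11, Matrix.mul_assoc, add_sub_cancel_right])
    (by
      rw [Matrix.map_mul, Matrix.map_mul, Matrix.map_mul, Matrix.transpose_map, hδ, hω, hω', ← hww]
      conv_rhs => rw [← E22]
      rw [Matrix.mul_add, Matrix.mul_assoc w c, add_sub_cancel_left, Matrix.mul_assoc,
        Matrix.mul_assoc, Matrix.mul_assoc])
  set r := α.det * δ.det
  have hr : r * r = 1 := by
    simp only [Matrix.det_mul, Matrix.det_transpose] at hsyl
    calc r * r = α.det * α.det * (δ.det * δ.det) * (ω.det * ω'.det) := by rw [hωω]; ring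
      _ = 1 := by rw [← hsyl]; ring
  have hδu : IsUnit δ.det := .of_mul_eq_one (α.det * r) (by rw [← hr]; ring)
  have hdi : d * δ⁻¹.map (evenVal N) = 1 := by
    rw [← hδ, ← Matrix.map_mul, Matrix.mul_nonsing_inv _ hδu, Matrix.map_one _ (map_zero _) (map_one _)]
  have hdi' : δ⁻¹.map (evenVal N) * d = 1 := by
    rw [← hδ, ← Matrix.map_mul, Matrix.nonsing_inv_mul _ hδu, Matrix.map_one _ (map_zero _) (map_one _)]
  have hdinv : Ring.inverse d = δ⁻¹.map (evenVal N) :=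
    Ring.inverse_unit (⟨d, δ⁻¹.map (evenVal N), hdi, hdi'⟩ : (Matrix _ _ (Lam N))ˣ)
  obtain ⟨S, hS⟩ := exists_even_lift (M := a - b * Ring.inverse d * c) fun i k => by
    rw [hdinv]
    refine Submodule.sub_mem _ (ha i k) ?_
    have := mul_mem_grade_matrix (mul_mem_grade_matrix hb (map_even_mem δ⁻¹)) hc i k
    rwa [add_zero, (rfl : (1 : ZMod 2) + 1 = 0)] at this
  have hSα : α.det * S.det = 1 := by
    rw [← Matrix.det_transpose α, ← Matrix.det_mul]
    have : α.transpose * S = 1 := map_evenVal_injective (by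
      change (α.transpose * S).map (evenVal N) = (1 : Matrix _ _ _).map (evenVal N)
      rw [Matrix.map_mul, hS, Matrix.transpose_map, hα, hdinv,
        Matrix.map_one _ (map_zero _) (map_one _), Matrix.mul_sub, ← Matrix.mul_assoc,
        ← Matrix.mul_assoc, eq_neg_of_add_eq_zero_left E12, Matrix.neg_mul, Matrix.neg_mul,
        Matrix.mul_assoc _ d, hdi, Matrix.mul_one, sub_neg_eq_add, E11])
    rw [this, Matrix.det_one]
  have hdd : Ring.inverse (gdet d) = evenVal N (α.det * r) := by
    rw [← hδ, gdet_map]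
    have e : δ.det * (α.det * r) = 1 := by rw [← hr]; ring
    exact Ring.inverse_unit (⟨evenVal N δ.det, evenVal N (α.det * r), by rw [← map_mul, e, map_one],
      by rw [← map_mul, mul_comm, e, map_one]⟩ : (Lam N)ˣ)
  have hs : sdet M = evenVal N r := by
    change gdet (a - b * Ring.inverse d * c) * Ring.inverse (gdet d) = _
    rw [hdd, ← hS, gdet_map, ← map_mul]
    congr 1
    rw [← mul_assoc, mul_comm S.det, hSα, one_mul]
  have hbody : evenBody N r = (bodyMat M).toBlocks₁₁.det * (bodyMat M).toBlocks₂₂.det := by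
    rw [map_mul, RingHom.map_det, RingHom.map_det]
    congr 2
    · change _ = a.map (body N)
      rw [← hα]
      rfl
    · change _ = d.map (body N)
      rw [← hδ]
      rfl
  rw [hs, ← hbody]
  -- An even element with square one is constant: `(r + ε)(r - ε) = 0`, and `r + ε` is a unit
  -- because its body is `2ε ≠ 0`.
  set ε := evenBody N r
  have hε : ε ≠ 0 := isUnit_even_iff.1 (.of_mul_eq_one r hr)
  have hεε : ε * ε = 1 := by rw [← map_mul, hr, map_one]
  have hc : evenBody N (algebraMap ℝ _ ε) = ε := AlgHom.commutes (body N) ε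
  have hu : IsUnit (r + algebraMap ℝ (evenLam N) ε) := isUnit_even_iff.2 (by
    rw [map_add, hc, ← two_mul]
    exact mul_ne_zero two_ne_zero hε)
  have hz : (r + algebraMap ℝ (evenLam N) ε) * (r - algebraMap ℝ (evenLam N) ε) = 0 := by
    have : algebraMap ℝ (evenLam N) ε * algebraMap ℝ (evenLam N) ε = 1 := by
      rw [← map_mul, hεε, map_one]
    calc _ = r * r - algebraMap ℝ (evenLam N) ε * algebraMap ℝ (evenLam N) ε := by ring
      _ = 0 := by rw [hr, this, sub_self]
  have := sub_eq_zero.1 ((hu.mul_right_eq_zero).1 hz)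
  rw [this]
  rfl

/-! ### The body of a supermatrix -/

theorem bodyMat_mul (M M' : SMat m n N) : bodyMat (M * M') = bodyMat M * bodyMat M' := Matrix.map_mul

theorem bodyMat_realMat (A : Matrix (Idx m n) (Idx m n) ℝ) : bodyMat (realMat N A) = A := by
  ext j k
  exact AlgHom.commutes (body N) _

theorem sub_realMat_bodyMat (M : SMat m n N) : M - realMat N (bodyMat M) ∈ nilMat m n N 1 :=
  fun j k => by
    rw [pow_one, mem_nilIdeal, Matrix.sub_apply, map_sub]
    exact sub_eq_zero.2 (AlgHom.commutes (body N) _).symm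

theorem bodyMat_eq_fromBlocks {M : SMat m n N} (hM : IsSupermatrix M) :
    bodyMat M = Matrix.fromBlocks (bodyMat M).toBlocks₁₁ 0 0 (bodyMat M).toBlocks₂₂ := by
  conv_lhs => rw [← Matrix.fromBlocks_toBlocks (bodyMat M)]
  congr 1
  · ext i k
    exact body_odd (by simpa [parity] using hM (.inl i) (.inr k))
  · ext i k
    exact body_odd (by simpa [parity] using hM (.inr i) (.inl k))

theorem isSupermatrix_realMat (A : Matrix (Fin m) (Fin m) ℝ)
    (D : Matrix (Fin n × Fin 2) (Fin n × Fin 2) ℝ) :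
    IsSupermatrix (realMat N (Matrix.fromBlocks A 0 0 D)) := fun j k => by
  rcases j with j | j <;> rcases k with k | k
  · exact algebraMap_mem_grade (A j k)
  · simp [realMat]
  · simp [realMat]
  · exact algebraMap_mem_grade (D j k)

theorem adj_realMat (A : Matrix (Fin m) (Fin m) ℝ) (D : Matrix (Fin n × Fin 2) (Fin n × Fin 2) ℝ) :
    adj (realMat N (Matrix.fromBlocks A 0 0 D)) =
      realMat N (Matrix.fromBlocks A.transpose 0 0 (-(Omega n * D.transpose * Omega n))) := by
  have hst : supertranspose (realMat N (Matrix.fromBlocks A 0 0 D)) =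
      realMat N (Matrix.fromBlocks A.transpose 0 0 D.transpose) := by
    ext j k
    rw [supertranspose_apply]
    rcases j with j | j <;> rcases k with k | k <;> simp [stSign, realMat]
  rw [adj_apply, hst, Qinv, Qmat, ← realMat_mul, ← realMat_mul, Matrix.fromBlocks_multiply,
    Matrix.fromBlocks_multiply]
  simp [smul_smul]

theorem realMat_injective : Function.Injective (realMat N (m := m) (n := n)) :=
  fun A B h => by rw [← bodyMat_realMat (N := N) A, h, bodyMat_realMat]

theorem adj_realMat_mul_self_iff (A : Matrix (Fin m) (Fin m) ℝ)
    (D : Matrix (Fin n × Fin 2) (Fin n × Fin 2) ℝ) :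
    adj (realMat N (Matrix.fromBlocks A 0 0 D)) * realMat N (Matrix.fromBlocks A 0 0 D) = 1 ↔
      A.transpose * A = 1 ∧ D.transpose * Omega n * D = Omega n := by
  rw [adj_realMat, ← realMat_mul, ← realMat_one, realMat_injective.eq_iff,
    Matrix.fromBlocks_multiply, ← Matrix.fromBlocks_one, Matrix.fromBlocks_inj]
  simp only [Matrix.mul_zero, Matrix.zero_mul, add_zero, zero_add, true_and]
  refine and_congr_right fun _ => ?_
  constructor
  · intro h
    have := congrArg (Omega n * ·) h
    simp only [Matrix.mul_one, Matrix.neg_mul, Matrix.mul_neg, ← Matrix.mul_assoc, Omega_mul_self,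
      Matrix.one_mul, neg_neg] at this
    exact this
  · intro h
    rw [Matrix.mul_assoc (Omega n), Matrix.neg_mul, Matrix.mul_assoc (Omega n), h, Omega_mul_self,
      neg_neg]

theorem adj_bodyMat {M : SMat m n N} (hM : IsSupermatrix M) (h : adj M * M = 1) :
    (bodyMat M).toBlocks₁₁.transpose * (bodyMat M).toBlocks₁₁ = 1 ∧
      (bodyMat M).toBlocks₂₂.transpose * Omega n * (bodyMat M).toBlocks₂₂ = Omega n := by
  rw [← adj_realMat_mul_self_iff (N := N), ← bodyMat_eq_fromBlocks hM]
  have hadj : bodyMat (adj M) = bodyMat (adj (realMat N (bodyMat M))) := by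
    have := adj_mem_nilMat (sub_realMat_bodyMat M)
    rw [map_sub] at this
    ext j k
    have := this j k
    rw [pow_one, mem_nilIdeal, Matrix.sub_apply, map_sub] at this
    exact sub_eq_zero.1 this
  obtain ⟨C, hC⟩ : ∃ C, adj (realMat N (bodyMat M)) = realMat N C := by
    rw [bodyMat_eq_fromBlocks hM, adj_realMat]
    exact ⟨_, rfl⟩
  rw [hC, bodyMat_realMat] at hadj
  rw [hC, ← realMat_mul, ← hadj, ← bodyMat_mul, h, ← realMat_one, bodyMat_realMat]

end

/-! ### Rotations -/

section
variable {ι : Type} [Fintype ι] [DecidableEq ι]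

/-- Euler's formula on the image of the projection `P`, where `J` is a complex structure; on the
complement the exponential is the identity. -/
theorem exp_smul_rotation {J P : Matrix ι ι ℝ} (hJ : J * J = -P) (hJP : J * P = J) (t : ℝ) :
    NormedSpace.exp (t • J) = 1 - P + Real.cos t • P + Real.sin t • J := by
  obtain ⟨s, hs⟩ := exists_isExpCurve J
  rw [← hs.eq_exp]
  have h := hs.unique_curve (u := fun t => 1 - P + Real.cos t • P + Real.sin t • J) (fun t => ?_) t
  · simp only [Real.cos_zero, Real.sin_zero, one_smul, zero_smul, add_zero, sub_add_cancel,
      mul_one] at h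
    exact h.symm
  · have h0 : WeakDeriv (fun _ : ℝ => 1 - P) 0 t := by
      simpa using WeakDeriv.smul_const (hasDerivAt_const t (1 : ℝ)) (1 - P)
    have := (h0.add (WeakDeriv.smul_const (Real.hasDerivAt_cos t) P)).add
      (WeakDeriv.smul_const (Real.hasDerivAt_sin t) J)
    refine Eq.subst (motive := fun v => WeakDeriv _ v t) ?_ this
    rw [Matrix.mul_add, Matrix.mul_add, Matrix.mul_sub, Matrix.mul_one, Matrix.mul_smul,
      Matrix.mul_smul, hJ, hJP, sub_self, zero_add, zero_add, smul_neg, neg_smul, add_comm]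

/-- The exponential is the square of the exponential of `X / 2`, and it is invertible. -/
theorem det_exp_pos (X : Matrix ι ι ℝ) : 0 < (NormedSpace.exp X).det := by
  have h : NormedSpace.exp X = NormedSpace.exp ((1 / 2 : ℝ) • X) * NormedSpace.exp ((1 / 2 : ℝ) • X) := by
    rw [← Matrix.exp_add_of_commute _ _ (Commute.refl _), ← add_smul]
    norm_num
  rw [h, Matrix.det_mul]
  refine lt_of_le_of_ne (mul_self_nonneg _) (Ne.symm ?_)
  rw [← Matrix.det_mul, ← h]
  exact ((Matrix.isUnit_iff_isUnit_det _).1 (Matrix.isUnit_exp X)).ne_zero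

end

/-! ### Functional calculus -/

section
open scoped Matrix.Norms.L2Operator
variable {ι : Type} [Fintype ι] [DecidableEq ι]

theorem Matrix.transpose_aeval (u : Matrix ι ι ℂ) (p : Polynomial ℂ) :
    (Polynomial.aeval u p).transpose = Polynomial.aeval u.transpose p := by
  induction p using Polynomial.induction_on' with
  | add p q hp hq => rw [map_add, map_add, Matrix.transpose_add, hp, hq]
  | monomial k c =>
    rw [Polynomial.aeval_monomial, Polynomial.aeval_monomial, Matrix.transpose_mul,
      Matrix.transpose_pow, Matrix.algebraMap_eq_diagonal, Matrix.diagonal_transpose,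
      ← Matrix.algebraMap_eq_diagonal]
    exact (Algebra.commutes c _).symm

theorem continuousOn_spectrum (f : ℂ → ℂ) (u : Matrix ι ι ℂ) : ContinuousOn f (spectrum ℂ u) :=
  (Matrix.finite_spectrum u).continuousOn f

/-- On a finite spectrum every function is a polynomial, and polynomials commute with transposition.
The interpolation uses the spectra of both `u` and `star u`, since the transpose of `u` is `star u`.
-/
theorem cfc_transpose {u : Matrix ι ι ℂ} (hu : IsStarNormal u) (ht : u.transpose = star u)
    (f : ℂ → ℂ) : (cfc f u).transpose = cfc (fun z => f (star z)) u := by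
  have hu' : IsStarNormal (star u) := inferInstance
  set s := ((Matrix.finite_spectrum u).union (Matrix.finite_spectrum (star u))).toFinset
  set p := Lagrange.interpolate s id f
  have hp : ∀ z ∈ s, p.eval z = f z := fun z hz =>
    Lagrange.eval_interpolate_at_node f Function.injective_id.injOn hz
  have h1 : cfc f u = Polynomial.aeval u p := by
    rw [← cfc_polynomial p u]
    exact cfc_congr fun z hz => (hp z (by simp [s, hz])).symm
  have h2 : cfc f (star u) = Polynomial.aeval (star u) p := by
    rw [← cfc_polynomial p (star u)]
    exact cfc_congr fun z hz => (hp z (by simp [s, hz])).symm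
  rw [h1, Matrix.transpose_aeval, ht, ← h2, cfc_comp_star f u ((Set.Finite.image _ (Matrix.finite_spectrum u)).continuousOn f)]

theorem exists_real_of_star_eq {κ : Type} {X : Matrix κ κ ℂ} (h : star X = X.transpose) :
    ∃ A : Matrix κ κ ℝ, A.map Complex.ofReal = X := by
  refine ⟨X.map Complex.re, ?_⟩
  ext j k
  have := congrFun (congrFun h k) j
  rw [Matrix.star_apply, Matrix.transpose_apply] at this
  exact Complex.conj_eq_iff_re.1 this

theorem exp_map_ofReal (A : Matrix ι ι ℝ) :
    (NormedSpace.exp A).map Complex.ofReal = NormedSpace.exp (A.map Complex.ofReal) := by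
  have hc : Continuous (Complex.ofRealHom.mapMatrix : Matrix ι ι ℝ →+* Matrix ι ι ℂ) :=
    continuous_id.matrix_map Complex.continuous_ofReal
  let _ : NormedAlgebra ℚ (Matrix ι ι ℝ) := NormedAlgebra.restrictScalars ℚ ℝ _
  have _ : CompleteSpace (Matrix ι ι ℝ) := FiniteDimensional.complete ℝ _
  exact NormedSpace.map_exp Complex.ofRealHom.mapMatrix hc A

theorem map_ofReal_injective {κ : Type} :
    Function.Injective fun A : Matrix κ κ ℝ => A.map Complex.ofReal :=
  Matrix.map_injective Complex.ofReal_injective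

theorem norm_eq_one_of_mem_spectrum {u : Matrix ι ι ℂ} (hu : star u * u = 1) {z : ℂ}
    (hz : z ∈ spectrum ℂ u) : ‖z‖ = 1 := by
  have : u ∈ unitary (Matrix ι ι ℂ) := ⟨hu, mul_eq_one_comm.1 hu⟩
  exact mem_sphere_zero_iff_norm.1 (spectrum.subset_circle_of_unitary this hz)

theorem exp_I_arg {z : ℂ} (hz : ‖z‖ = 1) : Complex.exp (Complex.I * (z.arg : ℂ)) = z := by
  have := Complex.norm_mul_exp_arg_mul_I z
  rwa [hz, Complex.ofReal_one, one_mul, mul_comm] at this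

theorem exp_cfc {u : Matrix ι ι ℂ} (hu : IsStarNormal u) (f : ℂ → ℂ) :
    NormedSpace.exp (cfc f u) = cfc (fun z => Complex.exp (f z)) u := by
  have hn : IsStarNormal (cfc f u) := cfc_predicate f u
  rw [← CFC.complex_exp_eq_normedSpace_exp (p := IsStarNormal)]
  exact (cfc_comp Complex.exp f u hu Complex.continuous_exp.continuousOn
    (continuousOn_spectrum f u)).symm

/-- Unitary matrices are exponentials of skew-adjoint ones. -/
theorem exists_exp_eq_of_unitary {u : Matrix ι ι ℂ} (hu : star u * u = 1) :
    ∃ X : Matrix ι ι ℂ, star X = -X ∧ NormedSpace.exp X = u := by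
  have hn : IsStarNormal u := ⟨by rw [Commute, SemiconjBy, hu, mul_eq_one_comm.1 hu]⟩
  refine ⟨cfc (fun z => Complex.I * (z.arg : ℂ)) u, ?_, ?_⟩
  · rw [← cfc_star, ← cfc_neg]
    refine cfc_congr fun z _ => ?_
    simp
  · rw [exp_cfc hn]
    refine Eq.trans (cfc_congr fun z hz => ?_) (cfc_id ℂ u)
    exact exp_I_arg (norm_eq_one_of_mem_spectrum hu hz)

/-- The determinant of `1 - 2P` is `(-1)` to the rank of `P`, so positivity forces an even rank. The
columns of `V` are the eigenvectors with eigenvalue `1`, grouped in pairs. -/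
theorem exists_frame {P : Matrix ι ι ℝ} (hP : P.transpose = P) (hPP : P * P = P)
    (hdet : 0 < (1 - (2 : ℝ) • P).det) :
    ∃ (k : ℕ) (V : Matrix ι (Fin k × Fin 2) ℝ), V.transpose * V = 1 ∧ V * V.transpose = P := by
  have hH : P.IsHermitian := hP
  set O : Matrix ι ι ℝ := hH.eigenvectorUnitary.1
  have hO : O.transpose * O = 1 := Unitary.coe_star_mul_self hH.eigenvectorUnitary
  have hO' : O * O.transpose = 1 := Unitary.coe_mul_star_self hH.eigenvectorUnitary
  set v := hH.eigenvalues
  have hPO : P = O * Matrix.diagonal v * O.transpose := by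
    have h := hH.spectral_theorem
    rw [Unitary.conjStarAlgAut_apply] at h
    exact h
  have hPd : Matrix.diagonal v = O.transpose * P * O := by
    rw [hPO]
    simp only [Matrix.mul_assoc]
    rw [hO, Matrix.mul_one, ← Matrix.mul_assoc, hO, Matrix.one_mul]
  have hv : ∀ i, v i = 0 ∨ v i = 1 := fun i => by
    have h : Matrix.diagonal v * Matrix.diagonal v = Matrix.diagonal v := by
      rw [hPd]
      calc _ = O.transpose * (P * (O * O.transpose) * P) * O := by simp only [Matrix.mul_assoc]
        _ = _ := by rw [hO', Matrix.mul_one, hPP]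
    rw [Matrix.diagonal_mul_diagonal] at h
    have h2 : v i * (v i - 1) = 0 := by
      have := congrFun (Matrix.diagonal_injective h) i
      linear_combination this
    rcases mul_eq_zero.1 h2 with h3 | h3
    · exact .inl h3
    · exact .inr (by linarith)
  set s := Finset.univ.filter fun i => v i = 1
  have hcard : Even s.card := by
    have h1 : (1 - (2 : ℝ) • P) = O * Matrix.diagonal (fun i => 1 - 2 * v i) * O.transpose := by
      have : Matrix.diagonal (fun i => 1 - 2 * v i) = 1 - (2 : ℝ) • Matrix.diagonal v := by
        rw [← Matrix.diagonal_one, ← Matrix.diagonal_smul, Matrix.diagonal_sub]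
        rfl
      rw [this, Matrix.mul_sub, Matrix.mul_one, Matrix.sub_mul, hO', Matrix.mul_smul,
        Matrix.smul_mul, ← hPO]
    have h2 : (1 - (2 : ℝ) • P).det = (-1) ^ s.card := by
      rw [h1, Matrix.det_mul, Matrix.det_mul, Matrix.det_diagonal, mul_right_comm, ← Matrix.det_mul,
        hO', Matrix.det_one, one_mul, ← Finset.prod_const, Finset.prod_filter]
      refine Finset.prod_congr rfl fun i _ => ?_
      rcases hv i with h | h <;> rw [h] <;> norm_num
    rw [h2] at hdet
    by_contra h
    rw [(Nat.not_even_iff_odd.1 h).neg_one_pow] at hdet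
    linarith
  obtain ⟨k, hk⟩ := hcard
  have e : Fin k × Fin 2 ≃ s := Fintype.equivOfCardEq (by simp [hk, mul_two])
  set W : Matrix ι (Fin k × Fin 2) ℝ := Matrix.of fun i x => if i = (e x : ι) then 1 else 0
  have hW : W.transpose * W = 1 := by
    ext x y
    simp [W, Matrix.mul_apply, Matrix.one_apply, eq_comm]
  have hW' : W * W.transpose = Matrix.diagonal v := by
    ext i j
    rw [Matrix.mul_apply, ← e.symm.sum_comp]
    simp only [W, Matrix.transpose_apply, Matrix.of_apply, Equiv.apply_symm_apply]
    rw [Finset.sum_coe_sort s (fun y => (if i = y then (1 : ℝ) else 0) * if j = y then 1 else 0),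
      Finset.sum_filter, Matrix.diagonal_apply]
    by_cases hij : i = j
    · subst hij
      rw [if_pos rfl, Finset.sum_eq_single i (fun y _ hy => by simp [Ne.symm hy]) (by simp)]
      rcases hv i with h | h <;> simp [h]
    · rw [if_neg hij]
      refine Finset.sum_eq_zero fun y _ => ?_
      by_cases h1 : i = y
      · subst h1
        simp [Ne.symm hij]
      · simp [h1]
  refine ⟨k, O * W, ?_, ?_⟩
  · rw [Matrix.transpose_mul, Matrix.mul_assoc, ← Matrix.mul_assoc _ O, hO, Matrix.one_mul, hW]
  · rw [Matrix.transpose_mul, ← Matrix.mul_assoc, Matrix.mul_assoc O, hW', ← hPO]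

/-- A real projection of even rank is the negative of the square of an antisymmetric matrix. -/
theorem exists_rotation {P : Matrix ι ι ℝ} (hP : P.transpose = P) (hPP : P * P = P)
    (hdet : 0 < (1 - (2 : ℝ) • P).det) :
    ∃ J : Matrix ι ι ℝ, J.transpose = -J ∧ J * J = -P ∧ J * P = J ∧ P * J = J := by
  obtain ⟨k, V, h1, h2⟩ := exists_frame hP hPP hdet
  refine ⟨V * Omega k * V.transpose, ?_, ?_, ?_, ?_⟩
  · rw [Matrix.transpose_mul, Matrix.transpose_mul, Omega_transpose, Matrix.transpose_transpose,
      Matrix.neg_mul, Matrix.mul_neg, Matrix.mul_assoc]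
  · calc _ = V * (Omega k * (V.transpose * V) * Omega k) * V.transpose := by
          simp only [Matrix.mul_assoc]
      _ = _ := by rw [h1, Matrix.mul_one, Omega_mul_self, Matrix.mul_neg, Matrix.mul_one,
                Matrix.neg_mul, h2]
  · rw [← h2, ← Matrix.mul_assoc, Matrix.mul_assoc (V * Omega k), h1, Matrix.mul_one]
  · rw [← h2, Matrix.mul_assoc, Matrix.mul_assoc V, ← Matrix.mul_assoc V.transpose, h1,
      Matrix.one_mul]

/-- Rotation matrices are exponentials of antisymmetric ones. -/
theorem exists_exp_eq_of_orthogonal {a : Matrix ι ι ℝ} (ha : a.transpose * a = 1) (hdet : a.det = 1) :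
    ∃ A : Matrix ι ι ℝ, A.transpose = -A ∧ NormedSpace.exp A = a := by
  set u : Matrix ι ι ℂ := a.map Complex.ofReal
  have hut : u.transpose = star u := by
    ext j k
    simp [u, Matrix.star_apply]
  have hu : star u * u = 1 := by
    rw [← hut]
    have := congrArg (fun b : Matrix ι ι ℝ => b.map Complex.ofRealHom) ha
    simp only [Matrix.map_mul, Matrix.map_one _ (map_zero _) (map_one _)] at this
    exact this
  have hn : IsStarNormal u := ⟨by rw [Commute, SemiconjBy, hu, mul_eq_one_comm.1 hu]⟩
  -- The principal logarithm is odd under conjugation on the unit circle except at `-1`. There `f`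
  -- is set to zero, and `g` singles out the eigenspace, which is treated separately; this makes
  -- both matrices real.
  set f : ℂ → ℂ := fun z => if z = -1 then 0 else Complex.I * (z.arg : ℂ)
  set g : ℂ → ℂ := fun z => if z = -1 then 1 else 0
  set X := cfc f u
  set Q := cfc g u
  have hstar : ∀ z ∈ spectrum ℂ u, (star z = -1 ↔ z = -1) := fun z _ => by
    rw [star_eq_iff_star_eq, star_neg, star_one, eq_comm]
  have hXs : star X = -X := by
    rw [← cfc_star, ← cfc_neg]
    refine cfc_congr fun z _ => ?_
    simp only [f]
    split_ifs <;> simp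
  have hXt : X.transpose = -X := by
    rw [cfc_transpose hn hut, ← cfc_neg]
    refine cfc_congr fun z hz => ?_
    simp only [f, hstar z hz]
    split_ifs with h
    · simp
    · have hπ : z.arg ≠ Real.pi := fun h' => h (by
        have := exp_I_arg (norm_eq_one_of_mem_spectrum hu hz)
        rw [h', mul_comm, Complex.exp_pi_mul_I] at this
        exact this.symm)
      rw [RCLike.star_def, Complex.arg_conj, if_neg hπ]
      simp
  have hQs : star Q = Q := by
    rw [← cfc_star]
    refine cfc_congr fun z _ => ?_
    simp only [g]
    split_ifs <;> simp
  have hQt : Q.transpose = Q := by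
    rw [cfc_transpose hn hut]
    refine cfc_congr fun z hz => ?_
    simp only [g, hstar z hz]
  have hc := fun f : ℂ → ℂ => continuousOn_spectrum f u
  have hXQ : X * Q = 0 := by
    rw [← cfc_mul f g u (hc _) (hc _), ← cfc_zero ℂ u]
    refine cfc_congr fun z _ => ?_
    simp only [f, g]
    split_ifs <;> simp
  have hQX : Q * X = 0 := by
    rw [← cfc_mul g f u (hc _) (hc _), ← cfc_zero ℂ u]
    refine cfc_congr fun z _ => ?_
    simp only [f, g]
    split_ifs <;> simp
  have hQQ : Q * Q = Q := by
    rw [← cfc_mul g g u (hc _) (hc _)]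
    refine cfc_congr fun z _ => ?_
    simp only [g]
    split_ifs <;> simp
  have huQ : u * Q = -Q := by
    conv_lhs => rw [← cfc_id ℂ u]
    rw [← cfc_mul id g u (hc _) (hc _), ← cfc_neg]
    refine cfc_congr fun z _ => ?_
    simp only [g, id]
    split_ifs with h <;> simp [h]
  have hexp : NormedSpace.exp X = u + (2 : ℂ) • Q := by
    rw [exp_cfc hn]
    conv_rhs => rw [← cfc_id ℂ u]
    rw [← cfc_smul 2 g u (hc _), ← cfc_add u id (fun z => (2 : ℂ) • g z) (hc _) (hc _)]
    refine cfc_congr fun z hz => ?_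
    simp only [f, g, id]
    split_ifs with h
    · rw [h, Complex.exp_zero]
      norm_num
    · rw [exp_I_arg (norm_eq_one_of_mem_spectrum hu hz)]
      simp
  obtain ⟨A, hA⟩ := exists_real_of_star_eq (X := X) (by rw [hXs, hXt])
  obtain ⟨P, hP⟩ := exists_real_of_star_eq (X := Q) (by rw [hQs, hQt])
  have hinj := map_ofReal_injective (κ := ι)
  have hmul : ∀ B C : Matrix ι ι ℝ, (B * C).map Complex.ofReal =
    B.map Complex.ofReal * C.map Complex.ofReal := fun B C => Matrix.map_mul (f := Complex.ofRealHom)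
  have hAt : A.transpose = -A := hinj (by
    change A.transpose.map _ = (-A).map _
    rw [Matrix.transpose_map, hA, hXt, ← hA]
    ext
    simp)
  have hPt : P.transpose = P := hinj (by
    change P.transpose.map _ = P.map _
    rw [Matrix.transpose_map, hP, hQt])
  have hPP : P * P = P := hinj (by
    change (P * P).map _ = P.map _
    rw [hmul, hP, hQQ])
  have hAP : A * P = 0 := hinj (by
    change (A * P).map _ = (0 : Matrix _ _ _).map _
    rw [hmul, hP, hA, hXQ]
    simp)
  have hPA : P * A = 0 := hinj (by
    change (P * A).map _ = (0 : Matrix _ _ _).map _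
    rw [hmul, hP, hA, hQX]
    simp)
  have haP : a * P = -P := hinj (by
    change (a * P).map _ = (-P).map _
    rw [hmul, hP]
    refine huQ.trans ?_
    rw [← hP]
    ext
    simp)
  have hexpA : NormedSpace.exp A = a + (2 : ℝ) • P := hinj (by
    change (NormedSpace.exp A).map _ = _
    rw [exp_map_ofReal, hA, hexp, ← hP]
    ext
    simp [u])
  -- The factor `1 - 2P` corrects `a` on the eigenspace of `-1`. Comparing determinants shows that
  -- this eigenspace has even dimension, so it carries a rotation generator `J`, and the half turn
  -- `exp (π J)` restores the sign.
  have hfac : NormedSpace.exp A = a * (1 - (2 : ℝ) • P) := by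
    rw [hexpA, Matrix.mul_sub, Matrix.mul_smul, haP, Matrix.mul_one, smul_neg, sub_neg_eq_add]
  have hpos := det_exp_pos A
  rw [hfac, Matrix.det_mul, hdet, one_mul] at hpos
  obtain ⟨J, hJt, hJJ, hJP, hPJ⟩ := exists_rotation hPt hPP hpos
  refine ⟨A + Real.pi • J, ?_, ?_⟩
  · rw [Matrix.transpose_add, Matrix.transpose_smul, hAt, hJt, smul_neg, neg_add]
  · have hcomm : Commute A (Real.pi • J) := by
      have h1 : A * J = 0 := by rw [← hPJ, ← Matrix.mul_assoc, hAP, Matrix.zero_mul]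
      have h2 : J * A = 0 := by rw [← hJP, Matrix.mul_assoc, hPA, Matrix.mul_zero]
      rw [Commute, SemiconjBy, Matrix.mul_smul, Matrix.smul_mul, h1, h2]
    rw [Matrix.exp_add_of_commute _ _ hcomm, exp_smul_rotation hJJ hJP, hfac, Real.cos_pi,
      Real.sin_pi, zero_smul, add_zero, neg_smul, one_smul, Matrix.mul_assoc]
    have : (1 - (2 : ℝ) • P) * (1 - P + -P) = 1 := by
      rw [two_smul]
      have e : (1 - (P + P)) * (1 - P + -P) = 1 - (P + P) - (P + P) + (P * P + P * P + P * P + P * P) := by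
        noncomm_ring
      rw [e, hPP]
      abel
    rw [this, Matrix.mul_one]

end

/-! ### The polar decomposition of symplectic matrices -/

section
variable {n : ℕ}

theorem realify_star (Z : Matrix (Fin n) (Fin n) ℂ) : realify n (star Z) = (realify n Z).transpose := by
  ext ⟨j, p⟩ ⟨k, q⟩
  fin_cases p <;> fin_cases q <;>
    simp [realify_apply, Matrix.star_apply]

theorem realify_I : realify n (-Complex.I • 1) = Omega n := by
  ext ⟨j, p⟩ ⟨k, q⟩
  by_cases h : j = k
  · subst h
    fin_cases p <;> fin_cases q <;>
      simp [realify_apply, Omega]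
  · fin_cases p <;> fin_cases q <;>
      simp [realify_apply, Omega, h]

theorem realify_comm_Omega (Z : Matrix (Fin n) (Fin n) ℂ) :
    realify n Z * Omega n = Omega n * realify n Z := by
  rw [← realify_I, ← map_mul, ← map_mul, Matrix.mul_smul, Matrix.smul_mul, Matrix.mul_one,
    Matrix.one_mul]

theorem exists_exp_eq_of_unitary_symplectic {g : Matrix (Fin n × Fin 2) (Fin n × Fin 2) ℝ}
    (hg : g.transpose * g = 1) (hgΩ : g * Omega n = Omega n * g) :
    ∃ D, D.transpose = -D ∧ D * Omega n = Omega n * D ∧ NormedSpace.exp D = g := by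
  have hr := realify_complexify hgΩ
  obtain ⟨X, hX, hXe⟩ := exists_exp_eq_of_unitary (u := complexify g) (realify_injective (by
    rw [map_mul, realify_star, hr, hg, map_one]))
  refine ⟨realify n X, ?_, realify_comm_Omega X, ?_⟩
  · rw [← realify_star, hX, map_neg]
  · rw [← exp_realify, hXe, hr]

theorem Omega_inv : (Omega n)⁻¹ = -Omega n :=
  Matrix.inv_eq_left_inv (by rw [Matrix.neg_mul, Omega_mul_self, neg_neg])

theorem isUnit_Omega : IsUnit (Omega n) :=
  .of_mul_eq_one (-Omega n) (by rw [Matrix.mul_neg, Omega_mul_self, neg_neg])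

theorem exp_neg_mul_Omega {S : Matrix (Fin n × Fin 2) (Fin n × Fin 2) ℝ}
    (hS : S * Omega n = -(Omega n * S)) :
    NormedSpace.exp (-S) * Omega n = Omega n * NormedSpace.exp S := by
  have h : -S = Omega n * S * (Omega n)⁻¹ := by
    rw [Omega_inv, ← neg_neg (Omega n * S), ← hS, Matrix.neg_mul, Matrix.mul_neg, neg_neg,
      Matrix.mul_assoc, Omega_mul_self, Matrix.mul_neg, Matrix.mul_one]
  rw [h, Matrix.exp_conj _ _ isUnit_Omega, Omega_inv, Matrix.mul_assoc, Matrix.neg_mul,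
    Omega_mul_self, neg_neg, Matrix.mul_one]

theorem exp_mul_exp_neg {ι : Type} [Fintype ι] [DecidableEq ι] (S : Matrix ι ι ℝ) :
    NormedSpace.exp S * NormedSpace.exp (-S) = 1 := by
  rw [← Matrix.exp_add_of_commute _ _ (Commute.neg_right (Commute.refl S)), add_neg_cancel,
    NormedSpace.exp_zero]

open scoped Matrix.Norms.L2Operator in
theorem exp_injective_of_symmetric {ι : Type} [Fintype ι] [DecidableEq ι] {S T : Matrix ι ι ℝ}
    (hS : S.transpose = S) (hT : T.transpose = T) (h : NormedSpace.exp S = NormedSpace.exp T) :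
    S = T := by
  rw [← CFC.log_exp S hS, h, CFC.log_exp T hT]

open scoped Matrix.Norms.L2Operator MatrixOrder in
theorem exists_log_of_posDef {ι : Type} [Fintype ι] [DecidableEq ι] {P : Matrix ι ι ℝ}
    (hP : P.PosDef) : ∃ L : Matrix ι ι ℝ, L.transpose = L ∧ NormedSpace.exp L = P :=
  ⟨CFC.log P, IsSelfAdjoint.log (a := P), CFC.exp_log P hP.isStrictlyPositive⟩

theorem mul_Omega_mul_transpose {d : Matrix (Fin n × Fin 2) (Fin n × Fin 2) ℝ}
    (hd : d.transpose * Omega n * d = Omega n) : d * Omega n * d.transpose = Omega n := by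
  have h : -(Omega n * d.transpose * Omega n) * d = 1 := by
    rw [Matrix.neg_mul, Matrix.mul_assoc (Omega n), Matrix.mul_assoc (Omega n), hd, Omega_mul_self,
      neg_neg]
  have h2 := congrArg (· * Omega n) (mul_eq_one_comm.1 h)
  simp only [Matrix.mul_neg, Matrix.neg_mul, Matrix.one_mul, ← Matrix.mul_assoc] at h2
  rwa [Matrix.mul_assoc _ (Omega n) (Omega n), Omega_mul_self, Matrix.mul_neg, Matrix.mul_one,
    neg_neg] at h2

/-- Polar decomposition in the symplectic group. -/
theorem exists_polar {d : Matrix (Fin n × Fin 2) (Fin n × Fin 2) ℝ}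
    (hd : d.transpose * Omega n * d = Omega n) :
    ∃ D S : Matrix (Fin n × Fin 2) (Fin n × Fin 2) ℝ, D.transpose = -D ∧ D * Omega n = Omega n * D ∧
      S.transpose = S ∧ S * Omega n = -(Omega n * S) ∧ d = NormedSpace.exp D * NormedSpace.exp S := by
  have hdu : IsUnit d := by
    refine IsUnit.of_mul_eq_one (-(Omega n * d.transpose * Omega n)) (mul_eq_one_comm.1 ?_)
    rw [Matrix.neg_mul, Matrix.mul_assoc (Omega n), Matrix.mul_assoc (Omega n), hd, Omega_mul_self,
      neg_neg]
  have hP : (d.transpose * d).PosDef :=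
    Matrix.PosDef.conjTranspose_mul_self d (Matrix.mulVec_injective_iff_isUnit.2 hdu)
  have hPΩ : (d.transpose * d) * Omega n * (d.transpose * d) = Omega n := by
    calc _ = d.transpose * (d * Omega n * d.transpose) * d := by simp only [Matrix.mul_assoc]
      _ = _ := by rw [mul_Omega_mul_transpose hd, hd]
  obtain ⟨L, hL, hLe⟩ := exists_log_of_posDef hP
  -- Conjugation by `Ω` inverts `dᵀd`. The exponential is injective on symmetric matrices, so
  -- conjugation by `Ω` changes the sign of the logarithm `L`.
  have hLΩ : L * Omega n = -(Omega n * L) := by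
    have h1 : NormedSpace.exp (Omega n * L * (Omega n)⁻¹) = NormedSpace.exp (-L) := by
      rw [Matrix.exp_conj _ _ isUnit_Omega, hLe]
      have e1 : Omega n * (d.transpose * d) * (Omega n)⁻¹ * (d.transpose * d) = 1 := by
        rw [Omega_inv, Matrix.mul_neg, Matrix.neg_mul, Matrix.mul_assoc, Matrix.mul_assoc,
          ← Matrix.mul_assoc _ (Omega n), hPΩ, Omega_mul_self, neg_neg]
      exact left_inv_eq_right_inv e1 (by rw [← hLe, exp_mul_exp_neg])
    have h2 := exp_injective_of_symmetric (by
      rw [Omega_inv, Matrix.transpose_mul, Matrix.transpose_mul, Matrix.transpose_neg,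
        Omega_transpose, hL]
      simp only [Matrix.mul_neg, neg_neg, Matrix.mul_assoc]) (by rw [Matrix.transpose_neg, hL]) h1
    rw [Omega_inv, Matrix.mul_neg, neg_inj] at h2
    have h3 := congrArg (· * Omega n) h2
    simp only [Matrix.mul_assoc, Omega_mul_self] at h3
    rw [← h3]
    simp
  set S := (1 / 2 : ℝ) • L
  have hS : S.transpose = S := by rw [Matrix.transpose_smul, hL]
  have hSΩ : S * Omega n = -(Omega n * S) := by
    rw [Matrix.smul_mul, Matrix.mul_smul, hLΩ, smul_neg]
  have hSS : NormedSpace.exp S * NormedSpace.exp S = d.transpose * d := by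
    rw [← Matrix.exp_add_of_commute _ _ (Commute.refl S), ← hLe, ← add_smul]
    norm_num
  have hnS : NormedSpace.exp (-S) * NormedSpace.exp S = 1 := mul_eq_one_comm.1 (exp_mul_exp_neg S)
  have hSt : (NormedSpace.exp (-S)).transpose = NormedSpace.exp (-S) := by
    rw [← Matrix.exp_transpose, Matrix.transpose_neg, hS]
  set g := d * NormedSpace.exp (-S)
  have hg : g.transpose * g = 1 := by
    rw [Matrix.transpose_mul, hSt]
    calc _ = NormedSpace.exp (-S) * (d.transpose * d) * NormedSpace.exp (-S) := by
          simp only [g, Matrix.mul_assoc]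
      _ = 1 := by rw [← hSS, ← Matrix.mul_assoc, hnS, Matrix.one_mul, exp_mul_exp_neg]
  have hgΩ : g.transpose * Omega n * g = Omega n := by
    rw [Matrix.transpose_mul, hSt]
    calc _ = NormedSpace.exp (-S) * (d.transpose * Omega n * d) * NormedSpace.exp (-S) := by
          simp only [g, Matrix.mul_assoc]
      _ = _ := by rw [hd, exp_neg_mul_Omega hSΩ, Matrix.mul_assoc, exp_mul_exp_neg, Matrix.mul_one]
  obtain ⟨D, hD, hDΩ, hDe⟩ := exists_exp_eq_of_unitary_symplectic hg (by
    have := congrArg (g * ·) hgΩ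
    simp only [← Matrix.mul_assoc] at this
    rw [mul_eq_one_comm.1 hg, Matrix.one_mul] at this
    exact this.symm)
  exact ⟨D, S, hD, hDΩ, hS, hSΩ, by rw [hDe, Matrix.mul_assoc, hnS, Matrix.mul_one]⟩

/-- The product of `MᵀM`, for `M = exp D · exp S`, is `exp (2S)`, and this determines the symmetric
matrix `S`. -/
theorem polar_unique {ι : Type} [Fintype ι] [DecidableEq ι] {D D' S S' : Matrix ι ι ℝ}
    (hD : D.transpose = -D) (hD' : D'.transpose = -D') (hS : S.transpose = S) (hS' : S'.transpose = S')
    (h : NormedSpace.exp D * NormedSpace.exp S = NormedSpace.exp D' * NormedSpace.exp S') :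
    S = S' ∧ NormedSpace.exp D = NormedSpace.exp D' := by
  have key : ∀ D S : Matrix ι ι ℝ, D.transpose = -D → S.transpose = S →
      (NormedSpace.exp D * NormedSpace.exp S).transpose * (NormedSpace.exp D * NormedSpace.exp S) =
        NormedSpace.exp ((2 : ℝ) • S) := by
    intro D S hD hS
    rw [Matrix.transpose_mul, ← Matrix.exp_transpose, ← Matrix.exp_transpose, hD, hS,
      Matrix.mul_assoc, ← Matrix.mul_assoc _ (NormedSpace.exp D),
      mul_eq_one_comm.1 (exp_mul_exp_neg D), Matrix.one_mul,
      ← Matrix.exp_add_of_commute _ _ (Commute.refl S), two_smul]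
  have hSS : S = S' := by
    have := exp_injective_of_symmetric (by rw [Matrix.transpose_smul, hS])
      (by rw [Matrix.transpose_smul, hS']) ((key D S hD hS).symm.trans
        ((congrArg (fun M => M.transpose * M) h).trans (key D' S' hD' hS')))
    exact smul_right_injective _ (two_ne_zero (α := ℝ)) this
  refine ⟨hSS, ?_⟩
  subst hSS
  have := congrArg (· * NormedSpace.exp (-S)) h
  simpa only [Matrix.mul_assoc, exp_mul_exp_neg, Matrix.mul_one] using this

theorem exp_symplectic {X : Matrix (Fin n × Fin 2) (Fin n × Fin 2) ℝ}
    (hX : X.transpose * Omega n + Omega n * X = 0) :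
    (NormedSpace.exp X).transpose * Omega n * NormedSpace.exp X = Omega n := by
  have h : X.transpose = Omega n * (-X) * (Omega n)⁻¹ := by
    rw [Matrix.mul_neg, ← eq_neg_of_add_eq_zero_left hX, Matrix.mul_assoc,
      Matrix.mul_nonsing_inv _ ((Matrix.isUnit_iff_isUnit_det _).1 isUnit_Omega), Matrix.mul_one]
  rw [← Matrix.exp_transpose, h, Matrix.exp_conj _ _ isUnit_Omega, Matrix.mul_assoc _ _ (Omega n),
    Matrix.nonsing_inv_mul _ ((Matrix.isUnit_iff_isUnit_det _).1 isUnit_Omega), Matrix.mul_one,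
    Matrix.mul_assoc, mul_eq_one_comm.1 (exp_mul_exp_neg X), Matrix.mul_one]

/-- The defining equation gives only `det² = 1`; the polar decomposition into two exponentials makes
the determinant positive. -/
theorem det_symplectic {d : Matrix (Fin n × Fin 2) (Fin n × Fin 2) ℝ}
    (hd : d.transpose * Omega n * d = Omega n) : d.det = 1 := by
  obtain ⟨D, S, -, -, -, -, h⟩ := exists_polar hd
  have hpos : 0 < d.det := by
    rw [h, Matrix.det_mul]
    exact mul_pos (det_exp_pos D) (det_exp_pos S)
  have h1 := congrArg Matrix.det hd
  rw [Matrix.det_mul, Matrix.det_mul, Matrix.det_transpose] at h1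
  have hΩ : (Omega n).det ≠ 0 := ((Matrix.isUnit_iff_isUnit_det _).1 isUnit_Omega).ne_zero
  have h2 : d.det * d.det = 1 := by
    apply mul_right_cancel₀ hΩ
    linarith
  nlinarith

end

/-! ### Full turns -/

section
variable {n : ℕ}

theorem trace_realify (Z : Matrix (Fin n) (Fin n) ℂ) : (realify n Z).trace = 2 * Z.trace.re := by
  rw [Matrix.trace, Fintype.sum_prod_type, Matrix.trace, Complex.re_sum, Finset.mul_sum]
  refine Finset.sum_congr rfl fun j _ => ?_
  simp [Fin.sum_univ_two, Matrix.diag, realify_apply, two_mul]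

/-- `P` is the orthogonal projection on a complex line that is invariant under `D`. -/
structure IsComplexLine (D P : Matrix (Fin n × Fin 2) (Fin n × Fin 2) ℝ) : Prop where
  comm_Omega : P * Omega n = Omega n * P
  symm : P.transpose = P
  idem : P * P = P
  trace : P.trace = 2
  comm : D * P = P * D

namespace IsComplexLine
variable {D P : Matrix (Fin n × Fin 2) (Fin n × Fin 2) ℝ} (hP : IsComplexLine D P)
include hP

theorem add_transpose (hDt : D.transpose = -D) :
    (D + (2 * Real.pi) • (Omega n * P)).transpose = -(D + (2 * Real.pi) • (Omega n * P)) := by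
  rw [Matrix.transpose_add, Matrix.transpose_smul, Matrix.transpose_mul, hP.symm, Omega_transpose,
    hDt, Matrix.mul_neg, hP.comm_Omega, smul_neg, neg_add]

theorem add_comm_Omega (hD : D * Omega n = Omega n * D) :
    (D + (2 * Real.pi) • (Omega n * P)) * Omega n = Omega n * (D + (2 * Real.pi) • (Omega n * P)) := by
  rw [Matrix.add_mul, Matrix.mul_add, hD, Matrix.smul_mul, Matrix.mul_smul, Matrix.mul_assoc,
    hP.comm_Omega]

theorem exp_add (hD : D * Omega n = Omega n * D) :
    NormedSpace.exp (D + (2 * Real.pi) • (Omega n * P)) = NormedSpace.exp D := by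
  have hc : Commute D ((2 * Real.pi) • (Omega n * P)) := by
    refine Commute.smul_right ?_ _
    rw [Commute, SemiconjBy, ← Matrix.mul_assoc, hD, Matrix.mul_assoc, Matrix.mul_assoc, hP.comm]
  rw [Matrix.exp_add_of_commute _ _ hc, exp_smul_rotation (P := P), Real.cos_two_pi, Real.sin_two_pi]
  · simp
  · rw [← Matrix.mul_assoc, Matrix.mul_assoc (Omega n), hP.comm_Omega, ← Matrix.mul_assoc,
      Omega_mul_self, Matrix.neg_mul, Matrix.neg_mul, Matrix.one_mul, hP.idem]
  · rw [Matrix.mul_assoc, hP.idem]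

/-- A full turn in a complex line changes the sign of the operator. -/
theorem flow_eq_neg (hD : D * Omega n = Omega n * D) (hDt : D.transpose = -D)
    {W W' : ℝ → Module.End ℂ (Schw n)} (hW : IsFlow (-(D * Omega n)) W)
    (hW' : IsFlow (-((D + (2 * Real.pi) • (Omega n * P)) * Omega n)) W') : W' 1 = -W 1 := by
  rcases flow_eq_or_eq_neg hD hDt (hP.add_comm_Omega hD) (hP.add_transpose hDt) (hP.exp_add hD).symm
    hW hW' with h | h
  -- Equal signs are excluded by the Gaussian: the full turn raises the trace of the symmetric
  -- matrix by `4π`, which multiplies the eigenvalue by `e^{-πi} = -1`.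
  · exfalso
    have skew : ∀ D : Matrix (Fin n × Fin 2) (Fin n × Fin 2) ℝ, D.transpose = -D →
        (-(D * Omega n) * Omega n).transpose = -(-(D * Omega n) * Omega n) := fun D hD => by
      rw [Matrix.neg_mul, Matrix.mul_assoc, Omega_mul_self, Matrix.mul_neg, Matrix.mul_one, neg_neg, hD]
    have h1 := hW.gauss (skew _ hDt) 1
    have h2 := hW'.gauss (skew _ (hP.add_transpose hDt)) 1
    rw [← h, h1] at h2
    have h3 := congrArg (fun f : Schw n => f 0) h2
    simp only [smul_apply, smul_eq_mul] at h3
    have h4 := mul_right_cancel₀ (gauss_ne_zero 0) h3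
    have htr : (-((D + (2 * Real.pi) • (Omega n * P)) * Omega n)).trace =
        (-(D * Omega n)).trace + 4 * Real.pi := by
      rw [Matrix.add_mul, neg_add, Matrix.trace_add, Matrix.smul_mul, Matrix.mul_assoc, hP.comm_Omega,
        ← Matrix.mul_assoc, Omega_mul_self, Matrix.neg_mul, Matrix.one_mul, smul_neg, neg_neg,
        Matrix.trace_smul, hP.trace, smul_eq_mul]
      ring
    rw [htr] at h4
    have h5 : -(Complex.I / 4) * (((-(D * Omega n)).trace + 4 * Real.pi : ℝ) : ℂ) * ((1 : ℝ) : ℂ) =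
        -(Complex.I / 4) * (((-(D * Omega n)).trace : ℝ) : ℂ) * ((1 : ℝ) : ℂ) - Real.pi * Complex.I := by
      push_cast
      ring
    rw [h5, Complex.exp_sub, Complex.exp_pi_mul_I, div_neg, div_one] at h4
    exact Complex.exp_ne_zero _ (self_eq_neg.1 h4)
  · rw [h, neg_neg]

end IsComplexLine

/-- As a complex matrix `i D` is Hermitian. The projection on one of its eigenvectors commutes with
`D`; such a vector exists because `n ≥ 1`. -/
theorem exists_isComplexLine (hn : 1 ≤ n) {D : Matrix (Fin n × Fin 2) (Fin n × Fin 2) ℝ}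
    (hD : D * Omega n = Omega n * D) (hDt : D.transpose = -D) : ∃ P, IsComplexLine D P := by
  have hr := realify_complexify hD
  have hs : star (complexify D) = -complexify D := realify_injective (by
    rw [realify_star, map_neg, hr, hDt])
  have hH : (Complex.I • complexify D).IsHermitian := by
    change star (Complex.I • complexify D) = _
    rw [star_smul, hs]
    simp
  set O : Matrix (Fin n) (Fin n) ℂ := hH.eigenvectorUnitary.1
  have hO : star O * O = 1 := Unitary.coe_star_mul_self hH.eigenvectorUnitary
  set v : Fin n → ℂ := RCLike.ofReal ∘ hH.eigenvalues
  have hX : Complex.I • complexify D = O * Matrix.diagonal v * star O := by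
    have h := hH.spectral_theorem
    rw [Unitary.conjStarAlgAut_apply] at h
    exact h
  set e : Matrix (Fin n) (Fin n) ℂ := Matrix.diagonal (Pi.single ⟨0, hn⟩ 1)
  have hes : star e = e := by
    rw [Matrix.star_eq_conjTranspose, Matrix.diagonal_conjTranspose]
    congr 1
    ext j
    by_cases h : j = ⟨0, hn⟩
    · subst h; simp
    · simp [h]
  have hee : e * e = e := by
    rw [Matrix.diagonal_mul_diagonal]
    congr 1
    ext j
    by_cases h : j = ⟨0, hn⟩
    · subst h; simp
    · simp [h]
  set p := O * e * star O
  have hps : star p = p := by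
    simp only [p, star_mul, star_star, hes, mul_assoc]
  have hconj : ∀ x y : Matrix (Fin n) (Fin n) ℂ, O * x * star O * (O * y * star O) =
      O * (x * y) * star O := fun x y => by
    calc _ = O * x * (star O * O) * y * star O := by simp only [mul_assoc]
      _ = _ := by rw [hO, mul_one]; simp only [mul_assoc]
  refine ⟨realify n p, realify_comm_Omega p, ?_, ?_, ?_, ?_⟩
  · rw [← realify_star, hps]
  · rw [← map_mul, hconj, hee]
  · rw [trace_realify, Matrix.trace_mul_comm, ← Matrix.mul_assoc, hO, Matrix.one_mul,
      Matrix.trace_diagonal, Finset.sum_pi_single']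
    simp
  · rw [← hr, ← map_mul, ← map_mul]
    congr 1
    have h : (Complex.I • complexify D) * p = p * (Complex.I • complexify D) := by
      rw [hX, hconj, hconj, Matrix.diagonal_mul_diagonal, Matrix.diagonal_mul_diagonal]
      congr 3
      ext j
      exact mul_comm _ _
    rw [Matrix.smul_mul, Matrix.mul_smul] at h
    exact smul_right_injective _ Complex.I_ne_zero h

/-! ### Exponential curves of block matrices -/

variable {m N : ℕ}

/-- Block diagonal real matrices as supermatrices, linear in the blocks. -/
def blockL (m n N : ℕ) : Matrix (Fin m) (Fin m) ℝ × Matrix (Fin n × Fin 2) (Fin n × Fin 2) ℝ →ₗ[ℝ]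
    SMat m n N where
  toFun p := realMat N (Matrix.fromBlocks p.1 0 0 p.2)
  map_add' p q := by
    ext j k
    rcases j with j | j <;> rcases k with k | k <;> simp [realMat]
  map_smul' c p := by
    ext j k
    rcases j with j | j <;> rcases k with k | k <;> simp [realMat, Algebra.algebraMap_eq_smul_one, mul_smul]

theorem IsExpCurve.eq_realMat {A : Matrix (Fin m) (Fin m) ℝ}
    {D : Matrix (Fin n × Fin 2) (Fin n × Fin 2) ℝ} {M : ℝ → SMat m n N}
    (hM : IsExpCurve (realMat N (Matrix.fromBlocks A 0 0 D)) M) :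
    M 1 = realMat N (Matrix.fromBlocks (NormedSpace.exp A) 0 0 (NormedSpace.exp D)) := by
  obtain ⟨a, ha⟩ := exists_isExpCurve A
  obtain ⟨d, hd⟩ := exists_isExpCurve D
  have h := hM.unique_curve (u := fun t => blockL m n N (a t, 0) + blockL m n N (0, d t))
    (fun t => ?_) 1
  · rw [← map_add, ← map_add, Prod.mk_add_mk, Prod.mk_add_mk, add_zero, add_zero, zero_add, zero_add,
      ha.zero, hd.zero, ha.eq_exp, hd.eq_exp, one_smul, one_smul] at h
    have h1 : blockL m n N (1, 1) = 1 := by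
      change realMat N (Matrix.fromBlocks 1 0 0 1) = 1
      rw [Matrix.fromBlocks_one, realMat_one]
    rw [h1, mul_one] at h
    exact h.symm
  · have h1 := ((ha.deriv t).map (blockL m n N ∘ₗ LinearMap.inl ℝ _ _)).add
      ((hd.deriv t).map (blockL m n N ∘ₗ LinearMap.inr ℝ _ _))
    refine Eq.subst (motive := fun v => WeakDeriv _ v t) ?_ h1
    change realMat N (Matrix.fromBlocks (A * a t) 0 0 0) + realMat N (Matrix.fromBlocks 0 0 0 (D * d t)) =
      realMat N (Matrix.fromBlocks A 0 0 D) * (realMat N (Matrix.fromBlocks (a t) 0 0 0) +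
        realMat N (Matrix.fromBlocks 0 0 0 (d t)))
    rw [mul_add, ← realMat_mul, ← realMat_mul, Matrix.fromBlocks_multiply, Matrix.fromBlocks_multiply]
    simp

theorem realMat_mem_so0 {A : Matrix (Fin m) (Fin m) ℝ} {D : Matrix (Fin n × Fin 2) (Fin n × Fin 2) ℝ}
    (hA : A.transpose = -A) (hD : D.transpose * Omega n + Omega n * D = 0) :
    realMat N (Matrix.fromBlocks A 0 0 D) ∈ so0 m n N := by
  refine ⟨isSupermatrix_realMat A D, (adj_eq_neg_iff _).2 ?_⟩
  rw [adj_realMat, hA, Matrix.mul_assoc, eq_neg_of_add_eq_zero_left hD, Matrix.mul_neg,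
    ← Matrix.mul_assoc, Omega_mul_self, neg_neg, Matrix.neg_mul, Matrix.one_mul]
  ext j k
  rcases j with j | j <;> rcases k with k | k <;> simp [realMat]

theorem transpose_neg_mul_Omega {D : Matrix (Fin n × Fin 2) (Fin n × Fin 2) ℝ}
    (hD : D.transpose * Omega n + Omega n * D = 0) : (-(D * Omega n)).transpose = -(D * Omega n) := by
  have h := congrArg (Omega n * · * Omega n) (eq_neg_of_add_eq_zero_left hD)
  simp only [Matrix.mul_assoc, Omega_mul_self, Matrix.mul_neg, Matrix.mul_one, Matrix.neg_mul] at h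
  simp only [← Matrix.mul_assoc, Omega_mul_self, Matrix.neg_mul, Matrix.one_mul] at h
  rw [Matrix.transpose_neg, Matrix.transpose_mul, Omega_transpose, Matrix.neg_mul, neg_neg]
  rw [neg_eq_iff_eq_neg, neg_neg] at h
  exact h

theorem symplectic_of_compact {D : Matrix (Fin n × Fin 2) (Fin n × Fin 2) ℝ} (hDt : D.transpose = -D)
    (hD : D * Omega n = Omega n * D) : D.transpose * Omega n + Omega n * D = 0 := by
  rw [hDt, Matrix.neg_mul, hD, neg_add_cancel]

theorem symplectic_of_symm {D : Matrix (Fin n × Fin 2) (Fin n × Fin 2) ℝ} (hDt : D.transpose = D)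
    (hD : D * Omega n = -(Omega n * D)) : D.transpose * Omega n + Omega n * D = 0 := by
  rw [hDt, hD, neg_add_cancel]

theorem exists_isGen_block {A : Matrix (Fin m) (Fin m) ℝ} {D : Matrix (Fin n × Fin 2) (Fin n × Fin 2) ℝ}
    (hD : D.transpose * Omega n + Omega n * D = 0) :
    ∃ G, IsGen (embed m n _ (bv (realMat N (Matrix.fromBlocks A 0 0 D)))) G := by
  obtain ⟨s, hs⟩ := exists_isExpCurve (biv A)
  obtain ⟨W, hW⟩ := exists_isFlow (transpose_neg_mul_Omega hD)
  exact ⟨_, exists_isGen_real hs hW⟩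

theorem IsGen.cov_so0 {X : SMat m n N} (hX : X ∈ so0 m n N) {G : ℝ → Completed m n N}
    (hG : IsGen (embed m n _ (bv X)) G) {M : ℝ → SMat m n N} (hM : IsExpCurve X M) :
    Cov oscGen (G 1) (M 1) :=
  hG.cov (inf_bv hX).embed hM (hM.isSupermatrix hX.1) 1

end

/-! ### The set `Ξ` -/

section
variable {m n N l : ℕ}

theorem compactPart_subset : compactPart m n N ⊆ so0 m n N := by
  rintro X ⟨A, D, hA, hD, -, rfl⟩
  exact realMat_mem_so0 (eq_neg_of_add_eq_zero_left hA) hD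

theorem symmetricPart_subset : symmetricPart m n N ⊆ so0 m n N := by
  rintro X ⟨D, hD, -, rfl⟩
  exact realMat_mem_so0 (by simp) hD

theorem nilpotentPart_subset : nilpotentPart m n N ⊆ so0 m n N := fun _ h => h.1

theorem mem_nilMat_of_mem_nilpotentPart {X : SMat m n N} (hX : X ∈ nilpotentPart m n N) :
    X ∈ nilMat m n N 1 := fun j k => by
  rw [pow_one]
  exact hX.2 j k

theorem exists_isGen_of_mem {X : SMat m n N}
    (hX : X ∈ compactPart m n N ∪ symmetricPart m n N ∪ nilpotentPart m n N) :
    ∃ G, IsGen (embed m n _ (bv X)) G := by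
  rcases hX with (⟨A, D, -, hD, -, rfl⟩ | ⟨D, hD, -, rfl⟩) | hX
  · exact exists_isGen_block hD
  · exact exists_isGen_block hD
  · exact exists_isGen_nil hX.2

theorem existsUnique_isExp (hl : 0 < l) {B : Lam N ⊗[ℝ] CliffordWeyl m n}
    (hB : B ∈ Xi1 m n N l ∪ Xi2 m n N l ∪ Xi3 m n N l) : ∃! E : Completed m n N, IsExp B E := by
  obtain ⟨X, hX, rfl⟩ : ∃ X ∈ compactPart m n N ∪ symmetricPart m n N ∪ nilpotentPart m n N,
      B = bv X := by
    rcases hB with (hB | hB) | hB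
    · obtain ⟨X, hX, h⟩ := (mem_phiPreimage_iff hl compactPart_subset B).1 hB
      exact ⟨X, .inl (.inl hX), h⟩
    · obtain ⟨X, hX, h⟩ := (mem_phiPreimage_iff hl symmetricPart_subset B).1 hB
      exact ⟨X, .inl (.inr hX), h⟩
    · obtain ⟨X, hX, h⟩ := (mem_phiPreimage_iff hl nilpotentPart_subset B).1 hB
      exact ⟨X, .inr hX, h⟩
  obtain ⟨G, hG⟩ := exists_isGen_of_mem hX
  exact ⟨G 1, (hG.isExp_iff _).2 rfl, fun E hE => (hG.isExp_iff E).1 hE⟩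

theorem Xi_subset_Spin : Xi m n N l ⊆ (Spin m n N : Set (Completed m n N)) := by
  rintro s ⟨s₁, ⟨B₁, h₁, h₁'⟩, s₂, ⟨B₂, h₂, h₂'⟩, s₃, ⟨B₃, h₃, h₃'⟩, rfl⟩
  exact mul_mem (mul_mem (Submonoid.subset_closure ⟨B₁, h₁.1, h₁'⟩)
    (Submonoid.subset_closure ⟨B₂, h₂.1, h₂'⟩)) (Submonoid.subset_closure ⟨B₃, h₃.1, h₃'⟩)

/-- Parameters of an element of `Ξ`. -/
structure XiParam (m n N : ℕ) where
  /-- The generator of the orthogonal factor. -/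
  A : Matrix (Fin m) (Fin m) ℝ
  /-- The generator of the compact symplectic factor. -/
  D : Matrix (Fin n × Fin 2) (Fin n × Fin 2) ℝ
  /-- The generator of the symmetric symplectic factor. -/
  S : Matrix (Fin n × Fin 2) (Fin n × Fin 2) ℝ
  /-- The generator of the nilpotent factor. -/
  X : SMat m n N
  A_skew : A.transpose = -A
  D_skew : D.transpose = -D
  D_comm : D * Omega n = Omega n * D
  S_symm : S.transpose = S
  S_anti : S * Omega n = -(Omega n * S)
  X_mem : X ∈ nilpotentPart m n N

theorem neg_mul_mul {A : Type*} [Ring A] (a b c : A) : -a * b * c = -(a * b * c) := by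
  rw [neg_mul, neg_mul]

theorem tmul_ofEnd_neg (a : Lam N) (c : CliffordAlgebra (negForm m)) (W : Module.End ℂ (Schw n)) :
    a ⊗ₜ[ℝ] (c ⊗ₜ[ℝ] ofEnd (-W)) = -(a ⊗ₜ[ℝ] (c ⊗ₜ[ℝ] ofEnd W)) := by
  have h : ofEnd (-W) = -ofEnd W := rfl
  rw [h, TensorProduct.tmul_neg, TensorProduct.tmul_neg]

namespace XiParam

/-- The matrix covered by the elements with given parameters. -/
def mat (p : XiParam m n N) : SMat m n N :=
  realMat N (Matrix.fromBlocks (NormedSpace.exp p.A) 0 0 (NormedSpace.exp p.D * NormedSpace.exp p.S)) *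
    nilExp p.X

/-- `s` is an element of `Ξ` with parameters `p`. -/
def IsElem (p : XiParam m n N) (s : Completed m n N) : Prop :=
  ∃ (c : ℝ → CliffordAlgebra (negForm m)) (W : ℝ → Module.End ℂ (Schw n)) (G₂ G₃ : ℝ → Completed m n N),
    IsExpCurve (biv p.A) c ∧ IsFlow (-(p.D * Omega n)) W ∧
    IsGen (embed m n _ (bv (realMat N (Matrix.fromBlocks 0 0 0 p.S)))) G₂ ∧
    IsGen (embed m n _ (bv p.X)) G₃ ∧ s = 1 ⊗ₜ (c 1 ⊗ₜ ofEnd (W 1)) * G₂ 1 * G₃ 1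

variable (p : XiParam m n N)

theorem D_symplectic : p.D.transpose * Omega n + Omega n * p.D = 0 :=
  symplectic_of_compact p.D_skew p.D_comm

theorem S_symplectic : p.S.transpose * Omega n + Omega n * p.S = 0 :=
  symplectic_of_symm p.S_symm p.S_anti

theorem exists_isElem : ∃ s, p.IsElem s := by
  obtain ⟨c, hc⟩ := exists_isExpCurve (biv p.A)
  obtain ⟨W, hW⟩ := exists_isFlow (transpose_neg_mul_Omega p.D_symplectic)
  obtain ⟨G₂, h₂⟩ := exists_isGen_block (m := m) (N := N) (A := 0) p.S_symplectic
  obtain ⟨G₃, h₃⟩ := exists_isGen_nil p.X_mem.2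
  exact ⟨_, c, W, G₂, G₃, hc, hW, h₂, h₃, rfl⟩

/-- Since exponentials are unique, the three factors are the values at time `1` of any one-parameter
groups with the given generators. -/
theorem mem_Xi_iff (hl : 0 < l) (s : Completed m n N) :
    s ∈ Xi m n N l ↔ ∃ p : XiParam m n N, p.IsElem s := by
  constructor
  · rintro ⟨s₁, ⟨B₁, h₁, h₁'⟩, s₂, ⟨B₂, h₂, h₂'⟩, s₃, ⟨B₃, h₃, h₃'⟩, rfl⟩
    obtain ⟨X₁, ⟨A, D, hA, hD, hD', rfl⟩, rfl⟩ := (mem_phiPreimage_iff hl compactPart_subset B₁).1 h₁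
    obtain ⟨X₂, ⟨S, hS, hS', rfl⟩, rfl⟩ := (mem_phiPreimage_iff hl symmetricPart_subset B₂).1 h₂
    obtain ⟨X, hX, rfl⟩ := (mem_phiPreimage_iff hl nilpotentPart_subset B₃).1 h₃
    have hDt := eq_neg_of_add_eq_zero_left hD'
    have hDc : D * Omega n = Omega n * D := by
      rw [hDt, Matrix.neg_mul, neg_add_eq_zero] at hD
      exact hD
    have hSc : S * Omega n = -(Omega n * S) := by
      rw [hS'] at hS
      exact eq_neg_of_add_eq_zero_left hS
    let p : XiParam m n N := ⟨A, D, S, X, eq_neg_of_add_eq_zero_left hA, hDt, hDc, hS', hSc, hX⟩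
    obtain ⟨s, c, W, G₂, G₃, hc, hW, hG₂, hG₃, -⟩ := p.exists_isElem
    refine ⟨p, c, W, G₂, G₃, hc, hW, hG₂, hG₃, ?_⟩
    rw [((exists_isGen_real hc hW).isExp_iff s₁).1 h₁', (hG₂.isExp_iff s₂).1 h₂',
      (hG₃.isExp_iff s₃).1 h₃']
  · rintro ⟨p, c, W, G₂, G₃, hc, hW, hG₂, hG₃, rfl⟩
    refine ⟨_, ⟨_, (mem_phiPreimage_iff hl compactPart_subset _).2 ⟨_, ⟨p.A, p.D, ?_, p.D_symplectic,
      ?_, rfl⟩, rfl⟩, ((exists_isGen_real hc hW).isExp_iff _).2 rfl⟩, _,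
      ⟨_, (mem_phiPreimage_iff hl symmetricPart_subset _).2 ⟨_, ⟨p.S, p.S_symplectic, p.S_symm, rfl⟩,
      rfl⟩, (hG₂.isExp_iff _).2 rfl⟩, _, ⟨_, (mem_phiPreimage_iff hl nilpotentPart_subset _).2
      ⟨_, p.X_mem, rfl⟩, (hG₃.isExp_iff _).2 rfl⟩, rfl⟩
    · rw [p.A_skew, neg_add_cancel]
    · rw [p.D_skew, neg_add_cancel]

theorem mat_eq : p.mat = realMat N (Matrix.fromBlocks (NormedSpace.exp p.A) 0 0 (NormedSpace.exp p.D)) *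
    realMat N (Matrix.fromBlocks (NormedSpace.exp 0) 0 0 (NormedSpace.exp p.S)) * nilExp p.X := by
  rw [mat, ← realMat_mul, Matrix.fromBlocks_multiply, NormedSpace.exp_zero]
  simp

variable {p}

theorem IsElem.isUnit {s : Completed m n N} (h : p.IsElem s) : IsUnit s := by
  obtain ⟨c, W, G₂, G₃, hc, hW, h₂, h₃, rfl⟩ := h
  exact ((IsGen.isUnit (exists_isGen_real hc hW) 1).mul (h₂.isUnit 1)).mul (h₃.isUnit 1)

theorem IsElem.isH {s : Completed m n N} (h : p.IsElem s) : IsH l s p.mat := by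
  refine Cov.isH ?_ h.isUnit
  obtain ⟨c, W, G₂, G₃, hc, hW, h₂, h₃, rfl⟩ := h
  obtain ⟨M₁, hM₁⟩ := exists_isExpCurve (realMat N (Matrix.fromBlocks p.A 0 0 p.D))
  obtain ⟨M₂, hM₂⟩ := exists_isExpCurve (realMat N (Matrix.fromBlocks (0 : Matrix (Fin m) _ ℝ) 0 0 p.S))
  obtain ⟨M₃, hM₃⟩ := exists_isExpCurve p.X
  have hX₁ : realMat N (Matrix.fromBlocks p.A 0 0 p.D) ∈ so0 m n N :=
    realMat_mem_so0 p.A_skew p.D_symplectic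
  have hX₂ : realMat N (Matrix.fromBlocks 0 0 0 p.S) ∈ so0 m n N :=
    realMat_mem_so0 (by simp) p.S_symplectic
  rw [mat_eq, ← hM₁.eq_realMat, ← hM₂.eq_realMat,
    ← hM₃.eq_nilExp (mem_nilMat_of_mem_nilpotentPart p.X_mem)]
  exact (((exists_isGen_real hc hW).cov_so0 hX₁ hM₁).mul (h₂.cov_so0 hX₂ hM₂)
    (hM₂.isSupermatrix hX₂.1 1)).mul (h₃.cov_so0 p.X_mem.1 hM₃) (hM₃.isSupermatrix p.X_mem.1.1 1)

theorem bodyMat_mat : bodyMat p.mat =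
    Matrix.fromBlocks (NormedSpace.exp p.A) 0 0 (NormedSpace.exp p.D * NormedSpace.exp p.S) := by
  have h : bodyMat (nilExp p.X) = 1 := by
    ext j k
    have := nilExp_sub_one_mem (mem_nilMat_of_mem_nilpotentPart p.X_mem) j k
    rw [pow_one, mem_nilIdeal, Matrix.sub_apply, map_sub, sub_eq_zero] at this
    refine this.trans ?_
    rw [Matrix.one_apply, Matrix.one_apply]
    split_ifs <;> simp
  rw [mat, bodyMat_mul, h, mul_one, bodyMat_realMat]

theorem exp_skew {ι : Type} [Fintype ι] [DecidableEq ι] {A : Matrix ι ι ℝ} (hA : A.transpose = -A) :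
    (NormedSpace.exp A).transpose * NormedSpace.exp A = 1 := by
  rw [← Matrix.exp_transpose, hA, mul_eq_one_comm.1 (exp_mul_exp_neg A)]

theorem det_exp_skew {ι : Type} [Fintype ι] [DecidableEq ι] {A : Matrix ι ι ℝ}
    (hA : A.transpose = -A) : (NormedSpace.exp A).det = 1 := by
  have h := congrArg Matrix.det (exp_skew hA)
  rw [Matrix.det_mul, Matrix.det_transpose, Matrix.det_one] at h
  nlinarith [det_exp_pos A]

variable (p) in
theorem symplectic : (NormedSpace.exp p.D * NormedSpace.exp p.S).transpose * Omega n *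
    (NormedSpace.exp p.D * NormedSpace.exp p.S) = Omega n := by
  rw [Matrix.transpose_mul]
  calc _ = (NormedSpace.exp p.S).transpose * ((NormedSpace.exp p.D).transpose * Omega n *
        NormedSpace.exp p.D) * NormedSpace.exp p.S := by simp only [Matrix.mul_assoc]
    _ = _ := by rw [exp_symplectic p.D_symplectic, exp_symplectic p.S_symplectic]

theorem isSupermatrix_nilExp : IsSupermatrix (nilExp p.X) :=
  nilExp_mem (S := superSubalgebra m n N) p.X_mem.1.1

theorem adj_nilExp_mul : adj (nilExp p.X) * nilExp p.X = 1 := by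
  obtain ⟨M, hM⟩ := exists_isExpCurve p.X
  rw [← hM.eq_nilExp (mem_nilMat_of_mem_nilpotentPart p.X_mem)]
  exact hM.adj_mul_self p.X_mem.1 1

variable (p) in
theorem mat_mem : p.mat ∈ SO0 m n N := by
  have hs : IsSupermatrix p.mat :=
    Subalgebra.mul_mem (superSubalgebra m n N) (isSupermatrix_realMat _ _) isSupermatrix_nilExp
  have ha : adj p.mat * p.mat = 1 := by
    rw [mat, adj_mul (isSupermatrix_realMat _ _) isSupermatrix_nilExp, mul_assoc,
      ← mul_assoc (adj (realMat N _)),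
      (adj_realMat_mul_self_iff _ _).2 ⟨exp_skew p.A_skew, p.symplectic⟩, one_mul, adj_nilExp_mul]
  refine ⟨hs, (adj_mul_self_iff _).2 ha, ?_⟩
  rw [sdet_eq hs ha, bodyMat_mat, Matrix.toBlocks_fromBlocks₁₁, Matrix.toBlocks_fromBlocks₂₂,
    det_exp_skew p.A_skew, det_symplectic p.symplectic, one_mul, map_one]

/-- Surjectivity of `h`: the body is factored as rotation, compact symplectic and positive
symplectic part, and the nilpotent factor absorbs the rest. -/
theorem exists_mat_eq {M : SMat m n N} (hM : M ∈ SO0 m n N) : ∃ p : XiParam m n N, p.mat = M := by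
  obtain ⟨hs, ha, hdet⟩ := hM
  rw [adj_mul_self_iff] at ha
  rw [sdet_eq hs ha, ← map_one (algebraMap ℝ (Lam N))] at hdet
  obtain ⟨h₁, h₂⟩ := adj_bodyMat hs ha
  set a := (bodyMat M).toBlocks₁₁
  set d := (bodyMat M).toBlocks₂₂
  have hdet' := (algebraMap ℝ (Lam N)).injective hdet
  rw [det_symplectic h₂, mul_one] at hdet'
  obtain ⟨A, hA, hAe⟩ := exists_exp_eq_of_orthogonal h₁ hdet'
  obtain ⟨D, S, hD, hDΩ, hS, hSΩ, hd⟩ := exists_polar h₂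
  -- `M₀` is the body of `M`, and `adj M₀` is its inverse. So `adj M₀ * M` differs from `1` by a
  -- nilpotent matrix and is again orthosymplectic.
  set M₀ := realMat N (Matrix.fromBlocks a 0 0 d)
  have hM₀s : IsSupermatrix M₀ := isSupermatrix_realMat a d
  have hM₀ : adj M₀ * M₀ = 1 := (adj_realMat_mul_self_iff a d).2 ⟨h₁, h₂⟩
  have hM₀' : M₀ * adj M₀ = 1 := mul_eq_one_symm_of_finite hM₀
  have hadj : adj M₀ = realMat N (Matrix.fromBlocks a.transpose 0 0 (-(Omega n * d.transpose * Omega n))) :=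
    adj_realMat a d
  have hadjs : IsSupermatrix (adj M₀) := by
    rw [hadj]
    exact isSupermatrix_realMat _ _
  have hadj2 : adj (adj M₀) = M₀ := by
    have := congrArg adj hM₀
    rw [adj_mul hadjs hM₀s, adj_one] at this
    exact (left_inv_eq_right_inv hM₀' this).symm
  obtain ⟨X, hX, hXe⟩ := exists_so0_nilExp_eq (E := adj M₀ * M) (by
      have h := nilMat_mul (realMat_mem_nilMat (N := N)
        (Matrix.fromBlocks a.transpose 0 0 (-(Omega n * d.transpose * Omega n)))) (sub_realMat_bodyMat M)
      rw [← hadj, zero_add, bodyMat_eq_fromBlocks hs, mul_sub] at h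
      rwa [← hM₀])
    (Subalgebra.mul_mem (superSubalgebra m n N) hadjs hs) (by
      rw [adj_mul hadjs hs, hadj2, mul_assoc, ← mul_assoc M₀, hM₀', one_mul, ha])
  refine ⟨⟨A, D, S, X, hA, hD, hDΩ, hS, hSΩ, hX⟩, ?_⟩
  rw [mat, hXe, hAe, ← hd, ← mul_assoc, hM₀', one_mul]

/-- The body of the matrix determines `exp A` and, by uniqueness of the polar decomposition, `S` and
`exp D`; cancelling it determines `X`. Only the Clifford factor and the compact flow are left
undetermined, each up to a sign. -/
theorem IsElem.eq_or_eq_neg {p q : XiParam m n N} {s t : Completed m n N} (hs : p.IsElem s)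
    (ht : q.IsElem t) (h : p.mat = q.mat) : s = t ∨ s = -t := by
  have hb := congrArg bodyMat h
  rw [bodyMat_mat, bodyMat_mat, Matrix.fromBlocks_inj] at hb
  obtain ⟨hA, -, -, hDS⟩ := hb
  obtain ⟨hS, hD⟩ := polar_unique p.D_skew q.D_skew p.S_symm q.S_symm hDS
  have hX : p.X = q.X := by
    have hu := (adj_realMat_mul_self_iff (N := N) _ _).2 ⟨exp_skew p.A_skew, p.symplectic⟩
    refine nilExp_injective (mem_nilMat_of_mem_nilpotentPart p.X_mem)
      (mem_nilMat_of_mem_nilpotentPart q.X_mem) ?_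
    rw [mat, mat, ← hA, ← hDS] at h
    have := congrArg (adj (realMat N (Matrix.fromBlocks (NormedSpace.exp p.A) 0 0
      (NormedSpace.exp p.D * NormedSpace.exp p.S))) * ·) h
    simpa only [← mul_assoc, hu, one_mul] using this
  obtain ⟨c, W, G₂, G₃, hc, hW, h₂, h₃, rfl⟩ := hs
  obtain ⟨c', W', G₂', G₃', hc', hW', h₂', h₃', rfl⟩ := ht
  rw [← hS] at h₂'
  rw [← hX] at h₃'
  have e₂ : G₂ 1 = G₂' 1 := (h₂'.isExp_iff _).1 ((h₂.isExp_iff _).2 rfl)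
  have e₃ : G₃ 1 = G₃' 1 := (h₃'.isExp_iff _).1 ((h₃.isExp_iff _).2 rfl)
  rw [e₂, e₃]
  rcases spin_eq_or_eq_neg p.A_skew q.A_skew hA hc hc' with e | e <;>
    rcases flow_eq_or_eq_neg p.D_comm p.D_skew q.D_comm q.D_skew hD hW hW' with e' | e' <;>
    rw [e, e']
  · exact .inl rfl
  · rw [tmul_ofEnd_neg, neg_mul_mul]
    exact .inr rfl
  · rw [TensorProduct.neg_tmul, TensorProduct.tmul_neg, neg_mul_mul]
    exact .inr rfl
  · rw [tmul_ofEnd_neg, TensorProduct.neg_tmul, TensorProduct.tmul_neg, neg_neg]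
    exact .inl rfl

/-- Adding a full turn in a complex line invariant under `D` keeps `exp D`, hence the matrix, but
changes the sign of the compact flow. -/
theorem IsElem.neg (hn : 1 ≤ n) {s : Completed m n N} (hs : p.IsElem s) :
    ∃ q : XiParam m n N, q.mat = p.mat ∧ q.IsElem (-s) := by
  obtain ⟨P, hP⟩ := exists_isComplexLine hn p.D_comm p.D_skew
  let q : XiParam m n N := ⟨p.A, p.D + (2 * Real.pi) • (Omega n * P), p.S, p.X, p.A_skew,
    hP.add_transpose p.D_skew, hP.add_comm_Omega p.D_comm, p.S_symm, p.S_anti, p.X_mem⟩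
  obtain ⟨W', hW'⟩ := exists_isFlow (transpose_neg_mul_Omega q.D_symplectic)
  obtain ⟨c, W, G₂, G₃, hc, hW, h₂, h₃, rfl⟩ := hs
  refine ⟨q, ?_, c, W', G₂, G₃, hc, hW', h₂, h₃, ?_⟩
  · simp only [mat, q, hP.exp_add p.D_comm]
  · rw [hP.flow_eq_neg p.D_comm p.D_skew hW hW']
    rw [tmul_ofEnd_neg, neg_mul_mul]

end XiParam

theorem ne_neg_of_isUnit {A : Type*} [Ring A] [Algebra ℝ A] [Nontrivial A] {s : A} (hs : IsUnit s) :
    s ≠ -s := fun h => by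
  have h2 : (2 : ℝ) • s = 0 := by
    rw [two_smul]
    nth_rewrite 1 [h]
    exact neg_add_cancel s
  exact hs.ne_zero ((smul_eq_zero.1 h2).resolve_left two_ne_zero)

/-! ### The exponentials of the harmonic oscillators -/

theorem isComplexLine_coordinate (j : Fin n) :
    IsComplexLine (0 : Matrix (Fin n × Fin 2) (Fin n × Fin 2) ℝ)
      (Matrix.diagonal fun k => if k.1 = j then 1 else 0) where
  comm_Omega := by
    ext ⟨i, p⟩ ⟨k, q⟩
    rw [Matrix.diagonal_mul, Matrix.mul_diagonal]
    simp only [Omega]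
    by_cases h : i = k
    · subst h
      ring
    · simp [h]
  symm := Matrix.diagonal_transpose _
  idem := by
    rw [Matrix.diagonal_mul_diagonal]
    congr 1
    ext k
    split_ifs <;> simp
  trace := by
    rw [Matrix.trace_diagonal, Fintype.sum_prod_type, Finset.sum_eq_single j (fun i _ hi => by
      rw [Fin.sum_univ_two, if_neg hi, add_zero]) (by simp), Fin.sum_univ_two, if_pos rfl]
    norm_num
  comm := by rw [Matrix.zero_mul, Matrix.mul_zero]

/-- For the full turn `D = 2π Ω P` in a coordinate line, the symmetric matrix `-D Ω` is `2π P`, and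
the factor `½` of `bv` leaves `π`. -/
theorem bv_oscillator (j : Fin n) :
    bv (realMat N (Matrix.fromBlocks (0 : Matrix (Fin m) (Fin m) ℝ) 0 0 (0 + (2 * Real.pi) •
      (Omega n * Matrix.diagonal fun k : Fin n × Fin 2 => if k.1 = j then 1 else 0)))) =
      1 ⊗ₜ (Real.pi • (cwGen (.inr (j, 0)) ^ 2 + cwGen (.inr (j, 1)) ^ 2)) := by
  set P : Matrix (Fin n × Fin 2) (Fin n × Fin 2) ℝ :=
    Matrix.diagonal fun k => if k.1 = j then 1 else 0
  have hD : -((0 + (2 * Real.pi) • (Omega n * P)) * Omega n) = (2 * Real.pi) • P := by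
    rw [zero_add, Matrix.smul_mul, Matrix.mul_assoc, (isComplexLine_coordinate j).comm_Omega,
      ← Matrix.mul_assoc, Omega_mul_self, Matrix.neg_mul, Matrix.one_mul, smul_neg, neg_neg]
  generalize (0 : Matrix (Fin n × Fin 2) (Fin n × Fin 2) ℝ) + (2 * Real.pi) • (Omega n * P) = E
    at hD ⊢
  have h1 : ∀ i k : Fin m, realMat N (Matrix.fromBlocks (0 : Matrix (Fin m) (Fin m) ℝ) 0 0 E)
      (.inl i) (.inl k) = 0 := fun _ _ => map_zero (algebraMap ℝ (Lam N))
  have h2 : ∀ (i : Fin n × Fin 2) (k : Fin m), realMat N (Matrix.fromBlocks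
      (0 : Matrix (Fin m) (Fin m) ℝ) 0 0 E) (.inr i) (.inl k) = 0 :=
    fun _ _ => map_zero (algebraMap ℝ (Lam N))
  have h3 : ∀ i k : Fin n × Fin 2, ((1 / 2 : ℝ) • algebraMap ℝ (Lam N) (((2 * Real.pi) • P) i k)) ⊗ₜ[ℝ]
      (cwGen (m := m) (.inr i) * cwGen (.inr k)) = if k = i then (if i.1 = j then
        (1 : Lam N) ⊗ₜ[ℝ] (Real.pi • (cwGen (.inr i) ^ 2)) else 0) else 0 := by
    intro i k
    rw [Algebra.algebraMap_eq_smul_one, smul_smul, ← TensorProduct.smul_tmul', ← TensorProduct.tmul_smul]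
    have hP : ((2 * Real.pi) • P) i k = if k = i then (if i.1 = j then 2 * Real.pi else 0) else 0 := by
      refine (congrArg (fun r : ℝ => (2 * Real.pi) * r) (Matrix.diagonal_apply _ i k)).trans ?_
      simp only [eq_comm (a := k), mul_ite, mul_one, mul_zero]
    rw [hP]
    by_cases h : k = i
    · subst h
      rw [if_pos rfl, if_pos rfl, pow_two]
      split_ifs
      · congr 2
        ring
      · rw [mul_zero, zero_smul, TensorProduct.tmul_zero]
    · rw [if_neg h, if_neg h, mul_zero, zero_smul, TensorProduct.tmul_zero]
  simp only [bv, oddForm_realMat, hD, h1, h2, h3, smul_zero, TensorProduct.zero_tmul,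
    Finset.sum_const_zero, zero_add, Finset.sum_ite_eq', Finset.mem_univ, if_true]
  rw [Fintype.sum_prod_type, Finset.sum_eq_single j (fun i _ hi => by simp [hi]) (by simp),
    Fin.sum_univ_two, if_pos rfl, if_pos rfl, ← TensorProduct.tmul_add, ← smul_add]

/-- The sign change under a full turn, applied to the constant flow of `D = 0`. -/
theorem isExp_oscillator_iff (j : Fin n) (E : Completed m n N) :
    IsExp (1 ⊗ₜ (Real.pi • (cwGen (.inr (j, 0)) ^ 2 + cwGen (.inr (j, 1)) ^ 2))) E ↔ E = -1 := by
  have hP := isComplexLine_coordinate j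
  set D := (0 : Matrix (Fin n × Fin 2) (Fin n × Fin 2) ℝ) + (2 * Real.pi) •
    (Omega n * Matrix.diagonal fun k : Fin n × Fin 2 => if k.1 = j then 1 else 0)
  have h0 : (0 : Matrix (Fin n × Fin 2) (Fin n × Fin 2) ℝ) * Omega n = Omega n * 0 := by simp
  have h0t : (0 : Matrix (Fin n × Fin 2) (Fin n × Fin 2) ℝ).transpose = -0 := by simp
  obtain ⟨c, hc⟩ := exists_isExpCurve (biv (0 : Matrix (Fin m) (Fin m) ℝ))
  obtain ⟨W, hW⟩ := exists_isFlow (transpose_neg_mul_Omega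
    (symplectic_of_compact (hP.add_transpose h0t) (hP.add_comm_Omega h0)))
  have hW0 : IsFlow (-(0 * Omega n)) fun _ => (1 : Module.End ℂ (Schw n)) := by
    rw [Matrix.zero_mul, neg_zero]
    exact isFlow_zero
  have hW1 := hP.flow_eq_neg h0 h0t hW0 hW
  have hc1 : c 1 = 1 := by
    have := hc.unique_curve (u := fun _ => 1) (fun t => by
      simpa [biv] using WeakDeriv.smul_const (hasDerivAt_const t (1 : ℝ))
        (1 : CliffordAlgebra (negForm m))) 1
    rw [mul_one] at this
    exact this.symm
  rw [← bv_oscillator, (exists_isGen_real hc hW).isExp_iff, hc1, hW1]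
  have : (1 : Lam N) ⊗ₜ[ℝ] ((1 : CliffordAlgebra (negForm m)) ⊗ₜ[ℝ] ofEnd (-1 : Module.End ℂ (Schw n))) =
      -1 := by
    rw [tmul_ofEnd_neg]
    rfl
  rw [this]

end

end SuperSpin

end

theorem mainTheorem2 (m n N l : ℕ) (hn : 1 ≤ n) (hl : 1 < l) :
    -- the exponential is well defined on the three subspaces
    (∀ B ∈ SuperSpin.Xi1 m n N l ∪ SuperSpin.Xi2 m n N l ∪ SuperSpin.Xi3 m n N l,
      ∃! E : SuperSpin.Completed m n N, SuperSpin.IsExp B E) ∧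
    -- the set `Ξ` is a subset of the Spin group
    SuperSpin.Xi m n N l ⊆ (SuperSpin.Spin m n N : Set (SuperSpin.Completed m n N)) ∧
    -- `h` is a well-defined map from `Ξ` to `SO₀`
    (∀ s ∈ SuperSpin.Xi m n N l, ∃ M ∈ SuperSpin.SO0 m n N,
      SuperSpin.IsH l s M ∧ ∀ M', SuperSpin.IsH l s M' → M' = M) ∧
    -- every fibre of `h` over `SO₀` consists of exactly two elements `s` and `-s` of `Ξ`
    (∀ M ∈ SuperSpin.SO0 m n N, ∃ s, s ≠ -s ∧
      {s' | s' ∈ SuperSpin.Xi m n N l ∧ SuperSpin.IsH l s' M} = {s, -s}) ∧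
    -- the exponential of `π (e_{2j-1}^2 + e_{2j}^2)` (symplectic generators) is `-1`
    (∀ (j : Fin n) (E : SuperSpin.Completed m n N),
      SuperSpin.IsExp (1 ⊗ₜ (Real.pi • (SuperSpin.cwGen (.inr (j, 0)) ^ 2 +
        SuperSpin.cwGen (.inr (j, 1)) ^ 2))) E ↔ E = -1) := by
  have hl0 : 0 < l := by omega
  refine ⟨fun B hB => SuperSpin.existsUnique_isExp hl0 hB, SuperSpin.Xi_subset_Spin, ?_, ?_,
    SuperSpin.isExp_oscillator_iff⟩
  · intro s hs
    obtain ⟨p, hp⟩ := (SuperSpin.XiParam.mem_Xi_iff hl0 s).1 hs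
    exact ⟨p.mat, p.mat_mem, hp.isH, fun M' hM' => hM'.unique hl0 hp.isH⟩
  · intro M hM
    obtain ⟨p, rfl⟩ := SuperSpin.XiParam.exists_mat_eq hM
    obtain ⟨s, hs⟩ := p.exists_isElem
    refine ⟨s, SuperSpin.ne_neg_of_isUnit hs.isUnit, Set.ext fun t => ⟨?_, ?_⟩⟩
    · rintro ⟨ht, htM⟩
      obtain ⟨q, hq⟩ := (SuperSpin.XiParam.mem_Xi_iff hl0 t).1 ht
      exact hq.eq_or_eq_neg hs (hq.isH.unique hl0 htM)
    · rintro (rfl | rfl)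
      · exact ⟨(SuperSpin.XiParam.mem_Xi_iff hl0 _).2 ⟨p, hs⟩, hs.isH⟩
      · obtain ⟨q, hqp, hq⟩ := hs.neg hn
        refine ⟨(SuperSpin.XiParam.mem_Xi_iff hl0 _).2 ⟨q, hq⟩, ?_⟩
        rw [← hqp]
        exact hq.isH
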